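/- Let $n\ge 2$ and let $M$ be a compact complex manifold of dimension $n$ with smooth boundary $\partial M$ (its charts are homeomorphisms from open subsets of $M$ onto relatively open subsets of closed domains with smooth boundary in $\mathbb C^n$, with transition maps smooth up to the boundary and holomorphic in the interior). Let $\omega=\sqrt{-1}\,\omega_{j\bar k}dz^j\wedge d\bar z^k$ be a smooth Hermitian metric and $\chi$ a smooth real $(1,1)$-form on $M$. For $u\in C^2(M)$ let $\lambda_1,\dots,\lambda_n$ be the eigenvalues of $\chi+\sqrt{-1}\,\partial\bar\partial u$ with respect to $\omega$ and put $$\mathcal M_{n-1}^n(u)=\prod_{1\le i_1<\cdots<i_{n-1}\le n}(\lambda_{i_1}+\cdots+\lambda_{i_{n-1}}).$$ Call $u$ admissible if $\lambda_{i_1}+\cdots+\lambda_{i_{n-1}}>0$ for all $i_1<\cdots<i_{n-1}$ at every point of $M$. Let $\underline u\in C^\infty(M)$ be admissible and let $\varphi=\underline u|_{\partial M}$. Fix a $C^2$ norm $|\cdot|_{C^2}$ on $M$, defined by a finite cover of $M$ by compact subsets of coordinate charts. Then for all real numbers $B\ge 0$ and $m>0$ there is a constant $C$, depending only on $(M,\omega)$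 (and the choice of the $C^2$ norm), $\chi$, $\underline u$, $\varphi$, $B$ and $m$, such that the following holds. Let $\psi\in C^\infty(M)$ satisfy $\psi\ge m$ on $M$, $|\psi^{1/C_n^{n-1}}|_{C^2}\le B$, where $C_n^{n-1}=\binom{n}{n-1}=n$, and $\mathcal M_{n-1}^n(\underline u)\ge\psi$ on $M$. If $u\in C^4(M)$ is an admissible solution of $$\mathcal M_{n-1}^n(u)=\psi\ \text{ in } M,\qquad u=\varphi\ \text{ on }\partial M,$$ then $$\sup_{\partial M}|\sqrt{-1}\,\partial\bar\partial u|\le C K,\qquad K=1+\sup_M|\nabla u|^2,$$ where $|\sqrt{-1}\,\partial\bar\partial u|^2=\omega^{j\bar l}\omega^{m\bar k}u_{j\bar k}u_{m\bar l}$ and $|\nabla u|^2=\omega^{j\bar k}u_ju_{\bar k}$. -/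

import Mathlib

open Complex
open scoped ContDiff ComplexOrder NNReal ENNReal

noncomputable section

namespace HermitianDirichlet

/-- The complex coordinate space with its Euclidean norm. -/
abbrev Cn (n : ℕ) := EuclideanSpace ℂ (Fin n)

/-! ### Wirtinger calculus, one-sided at boundary points -/

/-- `∂f/∂z^j = (∂f/∂x^j - i ∂f/∂y^j) / 2` at `z`, with derivatives taken within the set `T`. -/
def dz {n : ℕ} (T : Set (Cn n)) (j : Fin n) (f : Cn n → ℂ) (z : Cn n) : ℂ :=
  (fderivWithin ℝ f T z (EuclideanSpace.single j 1)
    - I * fderivWithin ℝ f T z (EuclideanSpace.single j I)) / 2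

/-- `∂f/∂z̄^j = (∂f/∂x^j + i ∂f/∂y^j) / 2` at `z`, with derivatives taken within the set `T`. -/
def dzbar {n : ℕ} (T : Set (Cn n)) (j : Fin n) (f : Cn n → ℂ) (z : Cn n) : ℂ :=
  (fderivWithin ℝ f T z (EuclideanSpace.single j 1)
    + I * fderivWithin ℝ f T z (EuclideanSpace.single j I)) / 2

/-- The complex Hessian `(∂²f / ∂z^j ∂z̄^k)_{j,k}` of a real function. -/
def complexHessian {n : ℕ} (T : Set (Cn n)) (f : Cn n → ℝ) (z : Cn n) :
    Matrix (Fin n) (Fin n) ℂ :=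
  Matrix.of fun j k => dz T j (dzbar T k fun w => (f w : ℂ)) z

/-! ### Complex manifolds with boundary -/

/-- `T` is, near each of its points, a closed domain `{ρ ≤ 0}` with smooth boundary
(`dρ ≠ 0` on `{ρ = 0}`). Near an interior point of `T` one may take `ρ = -1`. -/
def IsLocallySmoothDomain {n : ℕ} (T : Set (Cn n)) : Prop :=
  ∀ z ∈ T, ∃ (U : Set (Cn n)) (ρ : Cn n → ℝ), IsOpen U ∧ z ∈ U ∧ ContDiffOn ℝ ∞ ρ U ∧
    (∀ w ∈ U, ρ w = 0 → fderiv ℝ ρ w ≠ 0) ∧ T ∩ U = {w ∈ U | ρ w ≤ 0}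

/-- A complex manifold of dimension `n`, possibly with (smooth) boundary: an atlas of homeomorphisms
from open subsets of `M` onto sets which are locally smooth closed domains of `ℂⁿ`, whose
transition maps are smooth up to the boundary and holomorphic in the interior. -/
structure ComplexManifoldWithBoundary (n : ℕ) (M : Type*) [TopologicalSpace M] where
  atlas : Set (PartialEquiv M (Cn n))
  chartAt : M → PartialEquiv M (Cn n)
  chartAt_mem : ∀ x, chartAt x ∈ atlas
  mem_source : ∀ x, x ∈ (chartAt x).source
  isOpen_source : ∀ e ∈ atlas, IsOpen e.source
  continuousOn : ∀ e ∈ atlas, ContinuousOn e e.source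
  continuousOn_symm : ∀ e ∈ atlas, ContinuousOn e.symm e.target
  smoothDomain : ∀ e ∈ atlas, IsLocallySmoothDomain e.target
  contDiffOn_transition : ∀ e ∈ atlas, ∀ e' ∈ atlas,
    ContDiffOn ℝ ∞ (e' ∘ e.symm) (e.target ∩ e.symm ⁻¹' e'.source)
  holomorphic_transition : ∀ e ∈ atlas, ∀ e' ∈ atlas,
    DifferentiableOn ℂ (e' ∘ e.symm) (interior (e.target ∩ e.symm ⁻¹' e'.source))

variable {n : ℕ} {M : Type*} [TopologicalSpace M]

namespace ComplexManifoldWithBoundary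

variable (X : ComplexManifoldWithBoundary n M)

/-- The boundary `∂M`. -/
def boundary : Set M := {x | X.chartAt x x ∉ interior (X.chartAt x).target}

/-- `f` is of class `C^k` on `M`, up to the boundary. -/
def IsCk (k : WithTop ℕ∞) (f : M → ℝ) : Prop :=
  ∀ e ∈ X.atlas, ContDiffOn ℝ k (f ∘ e.symm) e.target

/-- The holomorphic Jacobian matrix `∂w^i/∂z^j` at `x` of the change from the coordinates `z = e`
to the coordinates `w = e'`. -/
def jacobian (e e' : PartialEquiv M (Cn n)) (x : M) : Matrix (Fin n) (Fin n) ℂ :=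
  Matrix.of fun i j => dz e.target j (fun z => e' (e.symm z) i) (e x)

/-- A smooth real (1,1)-form `h = √-1 h_{j k̄} dz^j ∧ dz̄^k` on `M`, given by its components: in
each chart `e` the Hermitian matrix `coeff e x = (h_{j k̄}(x))_{j,k}`. -/
structure RealForm11 where
  coeff : PartialEquiv M (Cn n) → M → Matrix (Fin n) (Fin n) ℂ
  isHermitian : ∀ e ∈ X.atlas, ∀ x ∈ e.source, (coeff e x).IsHermitian
  smooth : ∀ e ∈ X.atlas, ∀ j k, ContDiffOn ℝ ∞ (fun z => coeff e (e.symm z) j k) e.target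
  transform : ∀ e ∈ X.atlas, ∀ e' ∈ X.atlas, ∀ x ∈ e.source ∩ e'.source,
    coeff e x = (jacobian e e' x).transpose * coeff e' x * (jacobian e e' x).map (starRingEnd ℂ)

/-- A smooth Hermitian metric, given by its positive (1,1)-form. -/
structure HermitianMetric extends RealForm11 X where
  posDef : ∀ e ∈ X.atlas, ∀ x ∈ e.source, (coeff e x).PosDef

/-- A finite cover of `M` by compact subsets of charts, used to fix a `C²` norm. -/
structure ChartCover where
  size : ℕ
  chart : Fin size → PartialEquiv M (Cn n)
  chart_mem : ∀ i, chart i ∈ X.atlas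
  piece : Fin size → Set M
  isCompact_piece : ∀ i, IsCompact (piece i)
  piece_subset : ∀ i, piece i ⊆ (chart i).source
  cover : ∀ x, ∃ i, x ∈ piece i

variable {X}

/-- The `C²` norm of `f` with respect to a finite cover by compact pieces of charts. -/
def ChartCover.c2Norm (𝒦 : X.ChartCover) (f : M → ℝ) : ℝ≥0∞ :=
  ⨆ i, ⨆ x ∈ 𝒦.piece i, ∑ k ∈ Finset.range 3,
    ‖iteratedFDerivWithin ℝ k (f ∘ (𝒦.chart i).symm) (𝒦.chart i).target (𝒦.chart i x)‖ₑ

/-! ### Pointwise quantities, computed in a chart around the point -/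

variable (X) in
/-- The components `u_{j k̄}(x)` of `√-1 ∂∂̄u`. -/
def ddbar (u : M → ℝ) (x : M) : Matrix (Fin n) (Fin n) ℂ :=
  complexHessian (X.chartAt x).target (u ∘ (X.chartAt x).symm) (X.chartAt x x)

/-- The components of the metric at `x`. -/
def HermitianMetric.mat (Ω : X.HermitianMetric) (x : M) : Matrix (Fin n) (Fin n) ℂ :=
  Ω.coeff (X.chartAt x) x

/-- The components of `g = χ + √-1 ∂∂̄u` at `x`. -/
def RealForm11.plusDdbar (χ : X.RealForm11) (u : M → ℝ) (x : M) : Matrix (Fin n) (Fin n) ℂ :=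
  χ.coeff (X.chartAt x) x + X.ddbar u x

/-- The pointwise norm `|√-1 ∂∂̄u|`, with square `Ω^{j l̄} Ω^{m k̄} u_{j k̄} u_{m l̄}`. -/
def HermitianMetric.normDdbar (Ω : X.HermitianMetric) (u : M → ℝ) (x : M) : ℝ :=
  √ (Matrix.trace
    (((Ω.mat x)⁻¹ * X.ddbar u x) * ((Ω.mat x)⁻¹ * X.ddbar u x))).re

/-- The components `∂u/∂z^j` at `x`. -/
def del (X : ComplexManifoldWithBoundary n M) (u : M → ℝ) (x : M) : Fin n → ℂ := fun j =>
  dz (X.chartAt x).target j (fun z => (u ((X.chartAt x).symm z) : ℂ)) (X.chartAt x x)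

/-- The squared gradient norm `|∇u|² = Ω^{j k̄} u_j u_{k̄}`. -/
def HermitianMetric.gradSq (Ω : X.HermitianMetric) (u : M → ℝ) (x : M) : ℝ :=
  (star (X.del u x) ⬝ᵥ ((Ω.mat x)⁻¹).mulVec (X.del u x)).re

/-- The constant `K = 1 + sup_M |∇u|²`. -/
def HermitianMetric.gradConst (Ω : X.HermitianMetric) (u : M → ℝ) : ℝ :=
  1 + ⨆ x, Ω.gradSq u x

end ComplexManifoldWithBoundary

/-! ### The operator -/

/-- The eigenvalues (with multiplicity) of the Hermitian matrix `H` with respect to the positive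
Hermitian matrix `Ω`, that is, of the endomorphism `Ω⁻¹ H`; they are real. -/
def relEigenvalues (Ω H : Matrix (Fin n) (Fin n) ℂ) : Multiset ℝ :=
  (Ω⁻¹ * H).charpoly.roots.map Complex.re

/-- `∏_{i₁ < ⋯ < i_p} (λ_{i₁} + ⋯ + λ_{i_p})`. -/
def prodSums (p : ℕ) (eig : Multiset ℝ) : ℝ :=
  ((eig.powersetCard p).map Multiset.sum).prod

/-- Membership in the cone `𝒫_p`: every sum `λ_{i₁} + ⋯ + λ_{i_p}`, `i₁ < ⋯ < i_p`,
is positive. -/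
def InCone (p : ℕ) (eig : Multiset ℝ) : Prop :=
  ∀ s ∈ eig.powersetCard p, 0 < s.sum

variable {X : ComplexManifoldWithBoundary n M}

/-- The operator `ℳ_p^n(u)`. -/
def maOperator (p : ℕ) (Ω : X.HermitianMetric) (χ : X.RealForm11) (u : M → ℝ) (x : M) : ℝ :=
  prodSums p (relEigenvalues (Ω.mat x) (χ.plusDdbar u x))

/-- `χ + √-1 ∂∂̄u ∈ P_p(M)`. -/
def Admissible (p : ℕ) (Ω : X.HermitianMetric) (χ : X.RealForm11) (u : M → ℝ) : Prop :=
  ∀ x, InCone p (relEigenvalues (Ω.mat x) (χ.plusDdbar u x))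

end HermitianDirichlet

end

/-!
The cone and the operator are those of a determinant: with `g = χ + √-1 ∂∂̄u` and
`W = tr(Ω⁻¹ g) Ω - g`, the relative eigenvalues of `W` are the sums of `n - 1` relative eigenvalues
of `g`, so admissibility says `W > 0` and the equation says `det (Ω⁻¹ W) = ψ`
(`inCone_iff_posDef`, `prodSums_eq_det`). Positive `∂∂̄` increases `W`, `log det` is concave, and the
linearized operator is `tr(G ∂∂̄ ·)` with `G = tr(W⁻¹ Ω) Ω⁻¹ - W⁻¹ > 0`.

Everything is done for the difference `w` of the solution and the subsolution. Since `tr(Ω⁻¹ g) ≥ 0`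
and by concavity, the maximum principle on the components that meet the boundary gives `0 ≤ w ≤ S`
near `∂M` (`EllipticFamily.exists_le`, `exists_sub_le`, `IsSolution.exists_nonneg`), and a barrier
improves this to `0 ≤ w ≤ C d`, where `d = -ρ` for a local defining function `ρ`
(`BoundaryPatch.exists_le_dist`). Hence at boundary points `dw = -η dρ` with `0 ≤ η ≤ C`, and
`∂∂̄w = -η ∂∂̄ρ` on complex tangential directions (`BoundaryPatch.exists_hessian_boundary`).

The tangential part of the form does not degenerate: with `r = ∂ρ`, the value of `W` on the
`Ω`-gradient `Ω⁻¹ r` only involves the tangential part of `g`, and it is bounded below by a positive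
constant (`BoundaryPatch.exists_le_normalForm`). It is an affine function of `η`, and a barrier
excludes slopes `η` near the one where it vanishes, because the determinant of `W` is bounded below
(`BoundaryPatch.exists_normal_barrier`).

The functions `σ = ρ_k̄ w_j - ρ_j w_k̄` vanish on the boundary. The linearized operator maps them to
`O(√K (1 + tr W⁻¹))` up to a term controlled by the gradients of the `σ`
(`BoundaryPatch.isBigO_trace_lin_hess_tangent`): the equation is differentiated once, and `G ∂∂̄w` is
recovered from the gradients of the `σ` and the symmetry of `G g Ω⁻¹`. Adding `K^{-1/2} ∑ |σ|²`
absorbs these gradients, and a barrier built from `w + s (d - N d²)`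
(`BoundaryPatch.exists_mixed_barrier`) yields `|σ| ≤ C √K |z - q|` near boundary points `q`
(`BoundaryPatch.exists_tangent_le`). Thus mixed second derivatives are `O(√K)`, in other words
`∂∂̄w = α r r^* + O(√K)` on the boundary (`BoundaryPatch.exists_hessian_approx`).

Then `W = α (|r|² Ω - r r^*) + O(√K)`. If `α` is large compared with `K`, the lower bound in the
direction `Ω⁻¹ r` and the size of `α` in the complementary directions make `W` uniformly positive,
so that the bound of the determinant bounds the trace, and with it `α`
(`exists_rank_one_coeff_le`). This gives `|∂∂̄w| ≤ C K` near each boundary point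
(`BoundaryPatch.exists_hessian_le`). All constants are uniform over solutions, the quantities
involved do not depend on the chart (`hess_comp`, `relEigenvalues_eq`), and `∂M` is compact
(`exists_forall_normDdbar_le`).
-/

noncomputable section

namespace HermitianDirichlet

open Matrix

/-! ### Hermitian matrices relative to a positive one -/

section LinearAlgebra

variable {n : ℕ}

/-- The matrix `tr(Ω⁻¹ H) Ω - H`, whose eigenvalues relative to `Ω` are the sums of `n - 1`
eigenvalues of `H` relative to `Ω`. -/
def wOp (Ω H : Matrix (Fin n) (Fin n) ℂ) : Matrix (Fin n) (Fin n) ℂ :=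
  (Ω⁻¹ * H).trace • Ω - H

/-- A positive semidefinite matrix is of the form `Bᴴ B`. -/
theorem exists_eq_conjTranspose_mul_self {A : Matrix (Fin n) (Fin n) ℂ} (hA : A.PosSemidef) :
    ∃ B : Matrix (Fin n) (Fin n) ℂ, A = Bᴴ * B := by
  have hsp := hA.1.spectral_theorem
  rw [Unitary.conjStarAlgAut_apply] at hsp
  set V : Matrix (Fin n) (Fin n) ℂ := (hA.1.eigenvectorUnitary : Matrix (Fin n) (Fin n) ℂ)
  refine ⟨diagonal (fun i => (√(hA.1.eigenvalues i) : ℂ)) * Vᴴ, ?_⟩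
  have hd : (diagonal (fun i => (√(hA.1.eigenvalues i) : ℂ)))ᴴ *
      diagonal (fun i => (√(hA.1.eigenvalues i) : ℂ)) =
      diagonal (fun i => (hA.1.eigenvalues i : ℂ)) := by
    rw [diagonal_conjTranspose, diagonal_mul_diagonal]
    congr 1
    funext i
    simp only [Pi.star_apply, RCLike.star_def, conj_ofReal]
    rw [← ofReal_mul, Real.mul_self_sqrt (hA.eigenvalues_nonneg i)]
  rw [conjTranspose_mul, conjTranspose_conjTranspose, Matrix.mul_assoc, ← Matrix.mul_assoc _ᴴ,
    hd, ← Matrix.mul_assoc]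
  exact hsp

/-- Simultaneous diagonalisation of a positive and a Hermitian matrix, `Q` being the inverse of
the change of basis `P`. -/
theorem exists_simul_diag {Ω H : Matrix (Fin n) (Fin n) ℂ} (hΩ : Ω.PosDef) (hH : H.IsHermitian) :
    ∃ (P Q : Matrix (Fin n) (Fin n) ℂ) (l : Fin n → ℝ), P * Q = 1 ∧ Q * P = 1 ∧
      Ω = Qᴴ * Q ∧ H = Qᴴ * diagonal (fun i => (l i : ℂ)) * Q ∧ Ω⁻¹ = P * Pᴴ := by
  obtain ⟨B, hB⟩ := exists_eq_conjTranspose_mul_self hΩ.posSemidef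
  have hdet : IsUnit B.det := by
    have h := hΩ.det_pos.ne'
    rw [hB, det_mul] at h
    exact isUnit_iff_ne_zero.2 (right_ne_zero_of_mul h)
  have hBB : B * B⁻¹ = 1 := mul_nonsing_inv _ hdet
  have hBB' : B⁻¹ * B = 1 := nonsing_inv_mul _ hdet
  have hH' : ((B⁻¹)ᴴ * H * B⁻¹).IsHermitian := isHermitian_conjTranspose_mul_mul _ hH
  obtain ⟨U, ev, hUU, hUU', hsp⟩ : ∃ (U : Matrix (Fin n) (Fin n) ℂ) (ev : Fin n → ℝ),
      U * Uᴴ = 1 ∧ Uᴴ * U = 1 ∧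
      (B⁻¹)ᴴ * H * B⁻¹ = U * diagonal (fun i => (ev i : ℂ)) * Uᴴ := by
    refine ⟨_, hH'.eigenvalues, Unitary.coe_mul_star_self hH'.eigenvectorUnitary,
      Unitary.coe_star_mul_self hH'.eigenvectorUnitary, ?_⟩
    have := hH'.spectral_theorem
    rw [Unitary.conjStarAlgAut_apply] at this
    exact this
  have hPQ : (B⁻¹ * U) * (Uᴴ * B) = 1 := by
    rw [Matrix.mul_assoc, ← Matrix.mul_assoc U, hUU, Matrix.one_mul, hBB']
  have hQP : (Uᴴ * B) * (B⁻¹ * U) = 1 := by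
    rw [Matrix.mul_assoc, ← Matrix.mul_assoc B, hBB, Matrix.one_mul, hUU']
  have hΩ' : Ω = (Uᴴ * B)ᴴ * (Uᴴ * B) := by
    rw [conjTranspose_mul, conjTranspose_conjTranspose, Matrix.mul_assoc, ← Matrix.mul_assoc U, hUU,
      Matrix.one_mul, hB]
  refine ⟨B⁻¹ * U, Uᴴ * B, ev, hPQ, hQP, hΩ', ?_, ?_⟩
  · have h1 : (Bᴴ * (B⁻¹)ᴴ) = 1 := by rw [← conjTranspose_mul, hBB', conjTranspose_one]
    calc H = (Bᴴ * (B⁻¹)ᴴ) * H * (B⁻¹ * B) := by rw [h1, hBB', Matrix.one_mul, Matrix.mul_one]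
      _ = Bᴴ * ((B⁻¹)ᴴ * H * B⁻¹) * B := by simp only [Matrix.mul_assoc]
      _ = _ := by
        rw [hsp, conjTranspose_mul, conjTranspose_conjTranspose]
        simp only [Matrix.mul_assoc]
  · apply inv_eq_left_inv
    have h2 : (B⁻¹ * U)ᴴ * (Uᴴ * B)ᴴ = 1 := by rw [← conjTranspose_mul, hQP, conjTranspose_one]
    rw [hΩ']
    calc _ = (B⁻¹ * U) * ((B⁻¹ * U)ᴴ * (Uᴴ * B)ᴴ) * (Uᴴ * B) := by simp only [Matrix.mul_assoc]
      _ = 1 := by rw [h2, Matrix.mul_one, hPQ]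

theorem erase_univ_injective :
    Function.Injective (fun i : Fin n => (Finset.univ : Finset (Fin n)).erase i) := by
  intro i j hij
  have hi : i ∉ (Finset.univ : Finset (Fin n)).erase j := by
    rw [← show (Finset.univ : Finset (Fin n)).erase i = Finset.univ.erase j from hij]
    simp
  simpa using hi

theorem powersetCard_pred_univ (hn : 1 ≤ n) :
    (Finset.univ : Finset (Fin n)).powersetCard (n - 1) =
      Finset.univ.image fun i => Finset.univ.erase i := by
  ext t
  simp only [Finset.mem_powersetCard, Finset.subset_univ, true_and, Finset.mem_image,
    Finset.mem_univ]
  constructor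
  · intro ht
    have hc : tᶜ.card = 1 := by rw [Finset.card_compl, Fintype.card_fin]; omega
    obtain ⟨i, hi⟩ := Finset.card_eq_one.1 hc
    refine ⟨i, ?_⟩
    rw [← compl_compl t, hi]
    ext j
    simp
  · rintro ⟨i, rfl⟩
    rw [Finset.card_erase_of_mem (Finset.mem_univ i), Finset.card_univ, Fintype.card_fin]

/-- The product over `(n-1)`-element subsets as a product over their complements. -/
theorem prodSums_pred (hn : 1 ≤ n) (l : Fin n → ℝ) :
    prodSums (n - 1) (Finset.univ.val.map l) = ∏ i, (∑ j, l j - l i) := by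
  rw [prodSums, Multiset.powersetCard_map, ← Finset.map_val_val_powersetCard]
  simp only [Multiset.map_map]
  change ∏ t ∈ Finset.powersetCard (n - 1) Finset.univ, ∑ j ∈ t, l j = _
  rw [powersetCard_pred_univ hn, Finset.prod_image (erase_univ_injective.injOn)]
  refine Finset.prod_congr rfl fun i _ => ?_
  rw [← Finset.add_sum_erase _ l (Finset.mem_univ i)]
  ring

theorem inCone_pred (hn : 1 ≤ n) (l : Fin n → ℝ) :
    InCone (n - 1) (Finset.univ.val.map l) ↔ ∀ i, 0 < ∑ j, l j - l i := by
  have h : ∀ i, ∑ j, l j - l i = ∑ j ∈ Finset.univ.erase i, l j := fun i => by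
    rw [← Finset.add_sum_erase _ l (Finset.mem_univ i)]
    ring
  rw [InCone, Multiset.powersetCard_map, ← Finset.map_val_val_powersetCard,
    powersetCard_pred_univ hn]
  simp only [Multiset.map_map, Multiset.mem_map, Finset.mem_val, Finset.mem_image,
    Finset.mem_univ, true_and, forall_exists_index, and_imp]
  constructor
  · intro H i
    rw [h]
    exact H _ _ i rfl rfl
  · rintro H _ _ i rfl rfl
    have := H i
    rw [h] at this
    exact this

/-- The sums of `n - 1` eigenvalues of `H` are the diagonal entries of `wOp Ω H` in a basis
diagonalising `Ω` and `H`. -/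
theorem exists_simul_diag_wOp {Ω H : Matrix (Fin n) (Fin n) ℂ} (hΩ : Ω.PosDef)
    (hH : H.IsHermitian) (hn : 1 ≤ n) :
    ∃ (P Q : Matrix (Fin n) (Fin n) ℂ) (w : Fin n → ℝ), P * Q = 1 ∧ Q * P = 1 ∧
      Ω = Qᴴ * Q ∧ wOp Ω H = Qᴴ * diagonal (fun i => (w i : ℂ)) * Q ∧ Ω⁻¹ = P * Pᴴ ∧
      prodSums (n - 1) (relEigenvalues Ω H) = ∏ i, w i ∧
      (InCone (n - 1) (relEigenvalues Ω H) ↔ ∀ i, 0 < w i) := by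
  obtain ⟨P, Q, l, hPQ, hQP, hΩQ, hHQ, hinv⟩ := exists_simul_diag hΩ hH
  have hsim : Ω⁻¹ * H = P * diagonal (fun i => (l i : ℂ)) * Q := by
    have : Pᴴ * Qᴴ = 1 := by rw [← conjTranspose_mul, hQP, conjTranspose_one]
    rw [hinv, hHQ]
    calc _ = P * (Pᴴ * Qᴴ) * diagonal (fun i => (l i : ℂ)) * Q := by simp only [Matrix.mul_assoc]
      _ = _ := by rw [this, Matrix.mul_one]
  have hroots : relEigenvalues Ω H = Finset.univ.val.map l := by
    rw [relEigenvalues, hsim, Matrix.mul_assoc, charpoly_mul_comm, Matrix.mul_assoc, hQP,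
      Matrix.mul_one, charpoly_diagonal, Polynomial.roots_prod]
    · simp only [Polynomial.roots_X_sub_C, Multiset.bind_singleton, Multiset.map_map]
      exact Multiset.map_congr rfl fun _ _ => by simp
    · exact Finset.prod_ne_zero_iff.2 fun i _ => Polynomial.X_sub_C_ne_zero _
  have htr : (Ω⁻¹ * H).trace = ((∑ j, l j : ℝ) : ℂ) := by
    rw [hsim, Matrix.mul_assoc, trace_mul_comm, Matrix.mul_assoc, hQP, Matrix.mul_one,
      trace_diagonal, ofReal_sum]
  refine ⟨P, Q, fun i => ∑ j, l j - l i, hPQ, hQP, hΩQ, ?_, hinv, ?_, ?_⟩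
  · have hd : diagonal (fun i => ((∑ j, l j - l i : ℝ) : ℂ)) =
        ((∑ j, l j : ℝ) : ℂ) • 1 - diagonal (fun i => (l i : ℂ)) := by
      rw [← diagonal_one, ← diagonal_smul, diagonal_sub]
      congr 1
      funext i
      simp
    rw [wOp, htr, hd, Matrix.mul_sub, Matrix.sub_mul, ← hHQ, Matrix.mul_smul, Matrix.mul_one,
      Matrix.smul_mul, ← hΩQ]
  · rw [hroots, prodSums_pred hn]
  · rw [hroots, inCone_pred hn]

theorem posDef_conj_diagonal_iff {P Q : Matrix (Fin n) (Fin n) ℂ} (hPQ : P * Q = 1)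
    (l : Fin n → ℝ) :
    (Qᴴ * diagonal (fun i => (l i : ℂ)) * Q).PosDef ↔ ∀ i, 0 < l i := by
  have hQ : IsUnit Q := ⟨⟨Q, P, mul_eq_one_comm.1 hPQ, hPQ⟩, rfl⟩
  have := IsUnit.posDef_star_left_conjugate_iff (x := diagonal (fun i => (l i : ℂ))) hQ
  rw [star_eq_conjTranspose] at this
  rw [this, posDef_diagonal_iff]
  simp

theorem inv_mul_conj_diagonal {P Q Ω D : Matrix (Fin n) (Fin n) ℂ}
    (hQP : Q * P = 1) (hΩ : Ω⁻¹ = P * Pᴴ) : Ω⁻¹ * (Qᴴ * D * Q) = P * D * Q := by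
  have : Pᴴ * Qᴴ = 1 := by rw [← conjTranspose_mul, hQP, conjTranspose_one]
  rw [hΩ]
  calc _ = P * (Pᴴ * Qᴴ) * D * Q := by simp only [Matrix.mul_assoc]
    _ = _ := by rw [this, Matrix.mul_one]

theorem det_inv_mul_conj_diagonal {P Q Ω : Matrix (Fin n) (Fin n) ℂ} (hPQ : P * Q = 1)
    (hQP : Q * P = 1) (hΩ : Ω⁻¹ = P * Pᴴ) (l : Fin n → ℝ) :
    (Ω⁻¹ * (Qᴴ * diagonal (fun i => (l i : ℂ)) * Q)).det = ((∏ i, l i : ℝ) : ℂ) := by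
  rw [inv_mul_conj_diagonal hQP hΩ, det_mul, det_mul, det_diagonal, mul_right_comm, ← det_mul, hPQ,
    det_one, one_mul, ofReal_prod]

theorem trace_inv_mul_conj_diagonal {P Q Ω : Matrix (Fin n) (Fin n) ℂ}
    (hQP : Q * P = 1) (hΩ : Ω⁻¹ = P * Pᴴ) (l : Fin n → ℝ) :
    (Ω⁻¹ * (Qᴴ * diagonal (fun i => (l i : ℂ)) * Q)).trace = ((∑ i, l i : ℝ) : ℂ) := by
  rw [inv_mul_conj_diagonal hQP hΩ, Matrix.mul_assoc, trace_mul_comm, Matrix.mul_assoc, hQP,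
    Matrix.mul_one, trace_diagonal, ofReal_sum]

/-- The cone of the problem is the set where `wOp Ω H` is positive. -/
theorem inCone_iff_posDef {Ω H : Matrix (Fin n) (Fin n) ℂ} (hΩ : Ω.PosDef)
    (hH : H.IsHermitian) (hn : 1 ≤ n) :
    InCone (n - 1) (relEigenvalues Ω H) ↔ (wOp Ω H).PosDef := by
  obtain ⟨P, Q, w, hPQ, -, -, hW, -, -, hc⟩ := exists_simul_diag_wOp hΩ hH hn
  rw [hc, hW, posDef_conj_diagonal_iff hPQ]

/-- The operator of the problem is the determinant of `wOp Ω H` relative to `Ω`. -/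
theorem prodSums_eq_det {Ω H : Matrix (Fin n) (Fin n) ℂ} (hΩ : Ω.PosDef)
    (hH : H.IsHermitian) (hn : 1 ≤ n) :
    (prodSums (n - 1) (relEigenvalues Ω H) : ℂ) = (Ω⁻¹ * wOp Ω H).det := by
  obtain ⟨P, Q, w, hPQ, hQP, -, hW, hinv, hp, -⟩ := exists_simul_diag_wOp hΩ hH hn
  rw [hW, det_inv_mul_conj_diagonal hPQ hQP hinv, hp]

theorem isHermitian_wOp {Ω H : Matrix (Fin n) (Fin n) ℂ} (hΩ : Ω.PosDef)
    (hH : H.IsHermitian) : (wOp Ω H).IsHermitian := by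
  have hs : star (Ω⁻¹ * H).trace = (Ω⁻¹ * H).trace := by
    rw [← trace_conjTranspose, conjTranspose_mul, hΩ.1.inv.eq, hH.eq, trace_mul_comm]
  rw [wOp, Matrix.IsHermitian, conjTranspose_sub, conjTranspose_smul, hs, hΩ.1.eq, hH.eq]

/-- Concavity of `log det` on positive matrices. -/
theorem log_det_le {A B : Matrix (Fin n) (Fin n) ℂ} (hA : A.PosDef) (hB : B.PosDef) :
    Real.log B.det.re ≤ Real.log A.det.re + (A⁻¹ * B).trace.re - n := by
  obtain ⟨P, Q, l, hPQ, hQP, -, hBQ, hinv⟩ := exists_simul_diag hA hB.1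
  have hl : ∀ i, 0 < l i := by rwa [hBQ, posDef_conj_diagonal_iff hPQ] at hB
  have hdet : (A⁻¹ * B).det = ((∏ i, l i : ℝ) : ℂ) := by
    rw [hBQ, det_inv_mul_conj_diagonal hPQ hQP hinv]
  have htr : (A⁻¹ * B).trace.re = ∑ i, l i := by
    rw [hBQ, trace_inv_mul_conj_diagonal hQP hinv, ofReal_re]
  have hBdet : B.det = A.det * ((∏ i, l i : ℝ) : ℂ) := by
    rw [← hdet, det_mul, ← mul_assoc, ← det_mul, mul_nonsing_inv _ hA.det_pos.ne'.isUnit, det_one,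
      one_mul]
  have hApos : 0 < A.det.re := (pos_iff.1 hA.det_pos).1
  rw [hBdet, re_mul_ofReal, Real.log_mul hApos.ne' (Finset.prod_pos fun i _ => hl i).ne', htr,
    Real.log_prod fun i _ => (hl i).ne']
  have : ∑ i, Real.log (l i) ≤ ∑ i : Fin n, (l i - 1) :=
    Finset.sum_le_sum fun i _ => Real.log_le_sub_one_of_pos (hl i)
  rw [Finset.sum_sub_distrib, Finset.sum_const, Finset.card_univ, Fintype.card_fin, nsmul_one]
    at this
  linarith

/-- The Hermitian form `x ↦ xᴴ A x`. -/
def quad (A : Matrix (Fin n) (Fin n) ℂ) (x : Fin n → ℂ) : ℝ := (star x ⬝ᵥ A *ᵥ x).re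

theorem quad_nonneg {A : Matrix (Fin n) (Fin n) ℂ} (hA : A.PosSemidef) (x : Fin n → ℂ) :
    0 ≤ quad A x := hA.re_dotProduct_nonneg x

theorem quad_pos {A : Matrix (Fin n) (Fin n) ℂ} (hA : A.PosDef) {x : Fin n → ℂ} (hx : x ≠ 0) :
    0 < quad A x := hA.re_dotProduct_pos hx

theorem quad_add (A B : Matrix (Fin n) (Fin n) ℂ) (x : Fin n → ℂ) :
    quad (A + B) x = quad A x + quad B x := by
  simp [quad, add_mulVec, dotProduct_add]

theorem quad_sub (A B : Matrix (Fin n) (Fin n) ℂ) (x : Fin n → ℂ) :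
    quad (A - B) x = quad A x - quad B x := by
  simp [quad, sub_mulVec, dotProduct_sub]

theorem quad_neg (A : Matrix (Fin n) (Fin n) ℂ) (x : Fin n → ℂ) :
    quad (-A) x = -quad A x := by
  simp [quad, neg_mulVec]

theorem quad_conj (B A : Matrix (Fin n) (Fin n) ℂ) (x : Fin n → ℂ) :
    quad (Bᴴ * A * B) x = quad A (B *ᵥ x) := by
  rw [quad, quad, star_mulVec, ← dotProduct_mulVec, mulVec_mulVec, mulVec_mulVec,
    Matrix.mul_assoc]

theorem quad_smul (a : ℝ) (A : Matrix (Fin n) (Fin n) ℂ) (x : Fin n → ℂ) :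
    quad ((a : ℂ) • A) x = a * quad A x := by
  simp [quad, smul_mulVec]

theorem quad_diagonal (l : Fin n → ℝ) (y : Fin n → ℂ) :
    quad (diagonal fun i => (l i : ℂ)) y = ∑ i, l i * ‖y i‖ ^ 2 := by
  simp only [quad, dotProduct, mulVec_diagonal, Pi.star_apply, RCLike.star_def, re_sum]
  refine Finset.sum_congr rfl fun i _ => ?_
  rw [show (starRingEnd ℂ) (y i) * ((l i : ℂ) * y i) = (l i : ℂ) * ((starRingEnd ℂ) (y i) * y i) by
    ring, conj_mul', ← ofReal_pow, ← ofReal_mul, ofReal_re]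

theorem quad_one (y : Fin n → ℂ) : quad 1 y = ∑ i, ‖y i‖ ^ 2 := by
  have := quad_diagonal (fun _ => 1) y
  simpa using this

theorem quad_vecMulVec (r x : Fin n → ℂ) : quad (vecMulVec r (star r)) x = ‖star r ⬝ᵥ x‖ ^ 2 := by
  rw [quad, vecMulVec_mulVec, dotProduct_smul]
  have : star x ⬝ᵥ r = (starRingEnd ℂ) (star r ⬝ᵥ x) := by
    simp only [dotProduct, Pi.star_apply, RCLike.star_def, map_sum, map_mul, conj_conj]
    exact Finset.sum_congr rfl fun i _ => mul_comm _ _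
  rw [op_smul_eq_smul, smul_eq_mul, this, mul_conj', ← ofReal_pow, ofReal_re]

/-- A bound of the determinant by the smallest value of the form. -/
theorem det_mul_quad_le {Ω W : Matrix (Fin n) (Fin n) ℂ} (hΩ : Ω.PosDef) (hW : W.PosDef)
    (x : Fin n → ℂ) :
    (Ω⁻¹ * W).det.re * quad Ω x ≤ quad W x * (Ω⁻¹ * W).trace.re ^ (n - 1) := by
  obtain ⟨P, Q, w, hPQ, hQP, hΩQ, hWQ, hinv⟩ := exists_simul_diag hΩ hW.1
  have hw : ∀ i, 0 < w i := by rwa [hWQ, posDef_conj_diagonal_iff hPQ] at hW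
  have h1 : quad Ω x = ∑ i, ‖(Q *ᵥ x) i‖ ^ 2 := by
    rw [hΩQ, ← quad_one, ← quad_conj, Matrix.mul_one]
  have h2 : quad W x = ∑ i, w i * ‖(Q *ᵥ x) i‖ ^ 2 := by rw [hWQ, quad_conj, quad_diagonal]
  rw [h1, h2]
  rw [hWQ, det_inv_mul_conj_diagonal hPQ hQP hinv, trace_inv_mul_conj_diagonal hQP hinv,
    ofReal_re, ofReal_re, Finset.mul_sum, Finset.sum_mul]
  refine Finset.sum_le_sum fun i _ => ?_
  have h3 : ∏ j, w j ≤ w i * (∑ j, w j) ^ (n - 1) := by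
    rw [← Finset.mul_prod_erase _ w (Finset.mem_univ i)]
    refine mul_le_mul_of_nonneg_left ?_ (hw i).le
    calc ∏ j ∈ Finset.univ.erase i, w j ≤ ∏ j ∈ Finset.univ.erase i, ∑ k, w k :=
          Finset.prod_le_prod (fun j _ => (hw j).le) fun j _ =>
            Finset.single_le_sum (fun k _ => (hw k).le) (Finset.mem_univ j)
      _ = _ := by
          rw [Finset.prod_const, Finset.card_erase_of_mem (Finset.mem_univ i), Finset.card_univ,
            Fintype.card_fin]
  calc _ ≤ (w i * (∑ j, w j) ^ (n - 1)) * ‖(Q *ᵥ x) i‖ ^ 2 :=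
        mul_le_mul_of_nonneg_right h3 (sq_nonneg _)
    _ = _ := by ring

/-- The coefficients of the linearisation of `H ↦ log det (wOp Ω H)` at a matrix with
`wOp Ω H = W`. -/
def gOp (Ω W : Matrix (Fin n) (Fin n) ℂ) : Matrix (Fin n) (Fin n) ℂ :=
  (W⁻¹ * Ω).trace • Ω⁻¹ - W⁻¹

theorem trace_gOp_mul (Ω W H : Matrix (Fin n) (Fin n) ℂ) :
    (gOp Ω W * H).trace = (W⁻¹ * wOp Ω H).trace := by
  rw [gOp, wOp, Matrix.sub_mul, Matrix.mul_sub, trace_sub, trace_sub, Matrix.smul_mul,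
    Matrix.mul_smul, trace_smul, trace_smul, smul_eq_mul, smul_eq_mul, mul_comm]

/-- A diagonal form of the coefficients `gOp Ω W`. -/
theorem exists_diag_gOp {Ω W : Matrix (Fin n) (Fin n) ℂ} (hΩ : Ω.PosDef) (hW : W.PosDef) :
    ∃ (P : Matrix (Fin n) (Fin n) ℂ) (w : Fin n → ℝ), IsUnit P ∧ (∀ i, 0 < w i) ∧
      Ω⁻¹ = P * Pᴴ ∧ (Ω⁻¹ * W).det.re = ∏ i, w i ∧ (W⁻¹ * Ω).trace = ((∑ i, (w i)⁻¹ : ℝ) : ℂ) ∧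
      gOp Ω W = P * diagonal (fun i => ((∑ j, (w j)⁻¹ - (w i)⁻¹ : ℝ) : ℂ)) * Pᴴ := by
  obtain ⟨P, Q, w, hPQ, hQP, hΩQ, hWQ, hinv⟩ := exists_simul_diag hΩ hW.1
  have hw : ∀ i, 0 < w i := by rwa [hWQ, posDef_conj_diagonal_iff hPQ] at hW
  have hPQ' : Pᴴ * Qᴴ = 1 := by rw [← conjTranspose_mul, hQP, conjTranspose_one]
  have hdd : diagonal (fun i => (((w i)⁻¹ : ℝ) : ℂ)) * diagonal (fun i => (w i : ℂ)) = 1 := by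
    rw [diagonal_mul_diagonal, ← diagonal_one]
    congr 1
    funext i
    rw [← ofReal_mul, inv_mul_cancel₀ (hw i).ne', ofReal_one]
  have hWi : W⁻¹ = P * diagonal (fun i => (((w i)⁻¹ : ℝ) : ℂ)) * Pᴴ := by
    apply inv_eq_left_inv
    rw [hWQ]
    calc _ = P * diagonal (fun i => (((w i)⁻¹ : ℝ) : ℂ)) * (Pᴴ * Qᴴ) *
          diagonal (fun i => (w i : ℂ)) * Q := by simp only [Matrix.mul_assoc]
      _ = P * (diagonal (fun i => (((w i)⁻¹ : ℝ) : ℂ)) * diagonal (fun i => (w i : ℂ))) * Q := by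
          rw [hPQ', Matrix.mul_one, Matrix.mul_assoc P]
      _ = 1 := by rw [hdd, Matrix.mul_one, hPQ]
  have htr : (W⁻¹ * Ω).trace = ((∑ i, (w i)⁻¹ : ℝ) : ℂ) := by
    rw [hWi, hΩQ]
    calc _ = (P * diagonal (fun i => (((w i)⁻¹ : ℝ) : ℂ)) * (Pᴴ * Qᴴ) * Q).trace := by
          simp only [Matrix.mul_assoc]
      _ = _ := by
          rw [hPQ', Matrix.mul_one, Matrix.mul_assoc, trace_mul_comm, Matrix.mul_assoc, hQP,
            Matrix.mul_one, trace_diagonal, ofReal_sum]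
  refine ⟨P, w, ⟨⟨P, Q, hPQ, hQP⟩, rfl⟩, hw, hinv, ?_, htr, ?_⟩
  · rw [hWQ, det_inv_mul_conj_diagonal hPQ hQP hinv, ofReal_re]
  · have hd : diagonal (fun i => ((∑ j, (w j)⁻¹ - (w i)⁻¹ : ℝ) : ℂ)) =
        ((∑ j, (w j)⁻¹ : ℝ) : ℂ) • 1 - diagonal (fun i => (((w i)⁻¹ : ℝ) : ℂ)) := by
      rw [← diagonal_one, ← diagonal_smul, diagonal_sub]
      congr 1
      funext i
      simp
    rw [gOp, htr, hWi, hinv, hd, Matrix.mul_sub, Matrix.sub_mul, Matrix.mul_smul, Matrix.mul_one,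
      Matrix.smul_mul]

theorem posDef_gOp {Ω W : Matrix (Fin n) (Fin n) ℂ} (hΩ : Ω.PosDef) (hW : W.PosDef)
    (hn : 2 ≤ n) : (gOp Ω W).PosDef := by
  obtain ⟨P, w, hP, hw, -, -, -, hG⟩ := exists_diag_gOp hΩ hW
  rw [hG, ← star_eq_conjTranspose, IsUnit.posDef_star_right_conjugate_iff hP, posDef_diagonal_iff]
  intro i
  rw [← Finset.add_sum_erase _ _ (Finset.mem_univ i), add_sub_cancel_left]
  have hne : (Finset.univ.erase i).Nonempty := by
    rw [← Finset.card_pos, Finset.card_erase_of_mem (Finset.mem_univ i), Finset.card_univ,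
      Fintype.card_fin]
    omega
  exact_mod_cast Finset.sum_pos (fun j _ => inv_pos.2 (hw j)) hne

/-- When the trace of `W⁻¹` and the determinant of `W` are bounded, the linearisation is uniformly
elliptic. -/
theorem quad_gOp_ge {Ω W : Matrix (Fin n) (Fin n) ℂ} (hΩ : Ω.PosDef) (hW : W.PosDef)
    (hn : 2 ≤ n) {C D : ℝ} (hC : (W⁻¹ * Ω).trace.re ≤ C) (hD : (Ω⁻¹ * W).det.re ≤ D)
    (x : Fin n → ℂ) : (D * C ^ (n - 1))⁻¹ * quad Ω⁻¹ x ≤ quad (gOp Ω W) x := by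
  obtain ⟨P, w, hP, hw, hinv, hdet, htr, hG⟩ := exists_diag_gOp hΩ hW
  have h1 : quad Ω⁻¹ x = ∑ i, ‖(Pᴴ *ᵥ x) i‖ ^ 2 := by
    rw [hinv, ← quad_one, ← quad_conj, Matrix.mul_one, conjTranspose_conjTranspose]
  have h2 : quad (gOp Ω W) x =
      ∑ i, (∑ j, (w j)⁻¹ - (w i)⁻¹) * ‖(Pᴴ *ᵥ x) i‖ ^ 2 := by
    rw [hG, ← quad_diagonal, ← quad_conj, conjTranspose_conjTranspose]
  rw [htr, ofReal_re] at hC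
  rw [hdet] at hD
  have hCi : ∀ i, (w i)⁻¹ ≤ C := fun i =>
    (Finset.single_le_sum (fun k _ => (inv_pos.2 (hw k)).le) (Finset.mem_univ i)).trans hC
  rw [h1, h2, Finset.mul_sum]
  refine Finset.sum_le_sum fun i _ => mul_le_mul_of_nonneg_right ?_ (sq_nonneg _)
  rw [← Finset.add_sum_erase _ _ (Finset.mem_univ i), add_sub_cancel_left]
  have hne : (Finset.univ.erase i).Nonempty := by
    rw [← Finset.card_pos, Finset.card_erase_of_mem (Finset.mem_univ i), Finset.card_univ,
      Fintype.card_fin]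
    omega
  obtain ⟨j, hj⟩ := hne
  refine le_trans ?_ (Finset.single_le_sum (f := fun k => (w k)⁻¹)
    (fun k _ => (inv_pos.2 (hw k)).le) hj)
  refine inv_anti₀ (hw j) ?_
  have hCpos : 0 < C := (inv_pos.2 (hw j)).trans_le (hCi j)
  have h3 : 1 ≤ (∏ k ∈ Finset.univ.erase j, w k) * C ^ (n - 1) := by
    have : C ^ (n - 1) = ∏ k ∈ Finset.univ.erase j, C := by
      rw [Finset.prod_const, Finset.card_erase_of_mem (Finset.mem_univ j), Finset.card_univ,
        Fintype.card_fin]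
    rw [this, ← Finset.prod_mul_distrib]
    have : ∀ k ∈ Finset.univ.erase j, 1 ≤ w k * C := fun k _ => by
      have := mul_le_mul_of_nonneg_left (hCi k) (hw k).le
      rwa [mul_inv_cancel₀ (hw k).ne'] at this
    calc (1 : ℝ) = ∏ k ∈ Finset.univ.erase j, 1 := Finset.prod_const_one.symm
      _ ≤ _ := Finset.prod_le_prod (fun _ _ => zero_le_one) this
  calc w j = w j * 1 := (mul_one _).symm
    _ ≤ w j * ((∏ k ∈ Finset.univ.erase j, w k) * C ^ (n - 1)) :=
        mul_le_mul_of_nonneg_left h3 (hw j).le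
    _ = (∏ k, w k) * C ^ (n - 1) := by
        rw [← mul_assoc, Finset.mul_prod_erase _ w (Finset.mem_univ j)]
    _ ≤ D * C ^ (n - 1) := mul_le_mul_of_nonneg_right hD (pow_nonneg hCpos.le _)

/-- The Cauchy-Schwarz inequality for a positive semidefinite form. -/
theorem norm_sq_dotProduct_mulVec_le {G : Matrix (Fin n) (Fin n) ℂ} (hG : G.PosSemidef)
    (x y : Fin n → ℂ) : ‖star x ⬝ᵥ G *ᵥ y‖ ^ 2 ≤ quad G x * quad G y := by
  obtain ⟨B, rfl⟩ := exists_eq_conjTranspose_mul_self hG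
  have h : ∀ z, quad (Bᴴ * B) z = ‖WithLp.toLp 2 (B *ᵥ z)‖ ^ 2 := fun z => by
    rw [EuclideanSpace.norm_sq_eq, ← quad_one, ← quad_conj, Matrix.mul_one]
  have h2 : star x ⬝ᵥ (Bᴴ * B) *ᵥ y =
      inner ℂ (WithLp.toLp 2 (B *ᵥ x)) (WithLp.toLp 2 (B *ᵥ y)) := by
    rw [EuclideanSpace.inner_toLp_toLp, ← mulVec_mulVec, dotProduct_mulVec, ← star_mulVec,
      dotProduct_comm]
  rw [h, h, h2, ← mul_pow]
  exact pow_le_pow_left₀ (norm_nonneg _) (norm_inner_le_norm _ _) 2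

theorem quad_single (G : Matrix (Fin n) (Fin n) ℂ) (i : Fin n) :
    quad G (Pi.single i 1) = (G i i).re := by
  simp [quad]

/-- The entries of a positive semidefinite matrix are bounded by its trace. -/
theorem norm_apply_le_trace {G : Matrix (Fin n) (Fin n) ℂ} (hG : G.PosSemidef) (i j : Fin n) :
    ‖G i j‖ ≤ G.trace.re := by
  have hd : ∀ k, 0 ≤ (G k k).re := fun k => by
    rw [← quad_single]; exact quad_nonneg hG _
  have hle : ∀ k, (G k k).re ≤ G.trace.re := fun k => by
    rw [trace, re_sum]
    exact Finset.single_le_sum (f := fun k => (G k k).re) (fun k _ => hd k) (Finset.mem_univ k)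
  have := norm_sq_dotProduct_mulVec_le hG (Pi.single i 1) (Pi.single j 1)
  rw [quad_single, quad_single] at this
  have h2 : star (Pi.single i 1 : Fin n → ℂ) ⬝ᵥ G *ᵥ Pi.single j 1 = G i j := by
    simp
  rw [h2] at this
  have h3 : ‖G i j‖ ^ 2 ≤ G.trace.re ^ 2 := by
    rw [sq G.trace.re]
    exact this.trans (mul_le_mul (hle i) (hle j) (hd j) ((hd i).trans (hle i)))
  exact le_of_sq_le_sq h3 ((hd i).trans (hle i))

theorem norm_mulVec_apply_sq_le {G : Matrix (Fin n) (Fin n) ℂ} (hG : G.PosSemidef)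
    (y : Fin n → ℂ) (i : Fin n) : ‖(G *ᵥ y) i‖ ^ 2 ≤ G.trace.re * quad G y := by
  have := norm_sq_dotProduct_mulVec_le hG (Pi.single i 1) y
  have h2 : star (Pi.single i 1 : Fin n → ℂ) ⬝ᵥ G *ᵥ y = (G *ᵥ y) i := by
    simp
  rw [h2, quad_single] at this
  exact this.trans (mul_le_mul_of_nonneg_right ((re_le_norm _).trans (norm_apply_le_trace hG i i))
    (quad_nonneg hG y))

theorem trace_mul_re_nonneg {A B : Matrix (Fin n) (Fin n) ℂ} (hA : A.PosSemidef)
    (hB : B.PosSemidef) : 0 ≤ (A * B).trace.re := by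
  obtain ⟨C, rfl⟩ := exists_eq_conjTranspose_mul_self hA
  rw [Matrix.mul_assoc, trace_mul_comm]
  exact (nonneg_iff.1 (hB.mul_mul_conjTranspose_same C).trace_nonneg).1

theorem trace_mul_vecMulVec_star (G : Matrix (Fin n) (Fin n) ℂ) (r : Fin n → ℂ) :
    (G * vecMulVec r (star r)).trace.re = quad G r := by
  rw [mul_vecMulVec, trace_vecMulVec, quad, dotProduct_comm]

theorem posSemidef_iff_quad {A : Matrix (Fin n) (Fin n) ℂ} (hA : A.IsHermitian) :
    A.PosSemidef ↔ ∀ x, 0 ≤ quad A x := by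
  refine ⟨fun h x => quad_nonneg h x, fun h => .of_dotProduct_mulVec_nonneg hA fun x => ?_⟩
  exact nonneg_iff.2 ⟨h x, (hA.im_star_dotProduct_mulVec_self x).symm⟩

/-- `wOp Ω` preserves positivity. -/
theorem posSemidef_wOp {Ω H : Matrix (Fin n) (Fin n) ℂ} (hΩ : Ω.PosDef) (hH : H.PosSemidef) :
    (wOp Ω H).PosSemidef := by
  obtain ⟨P, Q, l, hPQ, hQP, hΩQ, hHQ, hinv⟩ := exists_simul_diag hΩ hH.1
  rw [posSemidef_iff_quad (isHermitian_wOp hΩ hH.1)]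
  intro x
  have hl : ∀ i, 0 ≤ l i := fun i => by
    have := quad_nonneg hH (P *ᵥ Pi.single i 1)
    rw [hHQ, quad_conj, mulVec_mulVec, hQP, one_mulVec, quad_single, diagonal_apply_eq,
      ofReal_re] at this
    exact this
  have htr : (Ω⁻¹ * H).trace = ((∑ i, l i : ℝ) : ℂ) := by
    rw [hHQ, trace_inv_mul_conj_diagonal hQP hinv]
  have h1 : quad Ω x = ∑ i, ‖(Q *ᵥ x) i‖ ^ 2 := by
    rw [hΩQ, ← quad_one, ← quad_conj, Matrix.mul_one]
  have h2 : quad H x = ∑ i, l i * ‖(Q *ᵥ x) i‖ ^ 2 := by rw [hHQ, quad_conj, quad_diagonal]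
  rw [wOp, htr, quad_sub, quad_smul, h1, h2, Finset.mul_sum, ← Finset.sum_sub_distrib]
  refine Finset.sum_nonneg fun i _ => ?_
  rw [← sub_mul]
  exact mul_nonneg (sub_nonneg.2 (Finset.single_le_sum (fun k _ => hl k) (Finset.mem_univ i)))
    (sq_nonneg _)

theorem wOp_add (Ω A B : Matrix (Fin n) (Fin n) ℂ) : wOp Ω (A + B) = wOp Ω A + wOp Ω B := by
  rw [wOp, wOp, wOp, Matrix.mul_add, trace_add, add_smul]
  abel

theorem wOp_sub (Ω A B : Matrix (Fin n) (Fin n) ℂ) : wOp Ω (A - B) = wOp Ω A - wOp Ω B := by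
  rw [wOp, wOp, wOp, Matrix.mul_sub, trace_sub, sub_smul]
  abel

end LinearAlgebra

open Set Filter Topology

/-! ### Wirtinger calculus within a set -/

section Wirtinger

variable {n : ℕ} {T : Set (Cn n)} {z : Cn n} {f g : Cn n → ℂ}

theorem dz_congr (h : EqOn f g T) (hz : z ∈ T) (j : Fin n) : dz T j f z = dz T j g z := by
  simp only [dz, fderivWithin_congr' h hz]

theorem dzbar_congr (h : EqOn f g T) (hz : z ∈ T) (j : Fin n) :
    dzbar T j f z = dzbar T j g z := by
  simp only [dzbar, fderivWithin_congr' h hz]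

theorem dz_const (j : Fin n) (c : ℂ) : dz T j (fun _ => c) z = 0 := by simp [dz]

theorem dzbar_const (j : Fin n) (c : ℂ) : dzbar T j (fun _ => c) z = 0 := by simp [dzbar]

theorem dz_add (hT : UniqueDiffWithinAt ℝ T z) (hf : DifferentiableWithinAt ℝ f T z)
    (hg : DifferentiableWithinAt ℝ g T z) (j : Fin n) :
    dz T j (fun w => f w + g w) z = dz T j f z + dz T j g z := by
  simp only [dz, fderivWithin_fun_add hT hf hg, _root_.add_apply]
  ring

theorem dzbar_add (hT : UniqueDiffWithinAt ℝ T z) (hf : DifferentiableWithinAt ℝ f T z)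
    (hg : DifferentiableWithinAt ℝ g T z) (j : Fin n) :
    dzbar T j (fun w => f w + g w) z = dzbar T j f z + dzbar T j g z := by
  simp only [dzbar, fderivWithin_fun_add hT hf hg, _root_.add_apply]
  ring

theorem dz_neg (hT : UniqueDiffWithinAt ℝ T z) (j : Fin n) :
    dz T j (fun w => -f w) z = -dz T j f z := by
  simp only [dz, fderivWithin_fun_neg hT, _root_.neg_apply]
  ring

theorem dzbar_neg (hT : UniqueDiffWithinAt ℝ T z) (j : Fin n) :
    dzbar T j (fun w => -f w) z = -dzbar T j f z := by
  simp only [dzbar, fderivWithin_fun_neg hT, _root_.neg_apply]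
  ring

theorem dz_mul (hT : UniqueDiffWithinAt ℝ T z) (hf : DifferentiableWithinAt ℝ f T z)
    (hg : DifferentiableWithinAt ℝ g T z) (j : Fin n) :
    dz T j (fun w => f w * g w) z = dz T j f z * g z + f z * dz T j g z := by
  simp only [dz, fderivWithin_fun_mul hT hf hg, _root_.add_apply,
    _root_.smul_apply, smul_eq_mul]
  ring

theorem dzbar_mul (hT : UniqueDiffWithinAt ℝ T z) (hf : DifferentiableWithinAt ℝ f T z)
    (hg : DifferentiableWithinAt ℝ g T z) (j : Fin n) :
    dzbar T j (fun w => f w * g w) z = dzbar T j f z * g z + f z * dzbar T j g z := by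
  simp only [dzbar, fderivWithin_fun_mul hT hf hg, _root_.add_apply,
    _root_.smul_apply, smul_eq_mul]
  ring

theorem dz_sum {ι : Type*} (s : Finset ι) {F : ι → Cn n → ℂ} (hT : UniqueDiffWithinAt ℝ T z)
    (hF : ∀ i ∈ s, DifferentiableWithinAt ℝ (F i) T z) (j : Fin n) :
    dz T j (fun w => ∑ i ∈ s, F i w) z = ∑ i ∈ s, dz T j (F i) z := by
  simp only [dz, fderivWithin_fun_sum hT hF, _root_.sum_apply, Finset.mul_sum,
    ← Finset.sum_sub_distrib, Finset.sum_div]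

theorem fderivWithin_conj (hT : UniqueDiffWithinAt ℝ T z)
    (hf : DifferentiableWithinAt ℝ f T z) (v : Cn n) :
    fderivWithin ℝ (fun w => (starRingEnd ℂ) (f w)) T z v =
      (starRingEnd ℂ) (fderivWithin ℝ f T z v) := by
  have h : HasFDerivWithinAt (fun w => (starRingEnd ℂ) (f w))
      ((conjCLE : ℂ →L[ℝ] ℂ).comp (fderivWithin ℝ f T z)) T z :=
    (conjCLE : ℂ →L[ℝ] ℂ).hasFDerivAt.comp_hasFDerivWithinAt z hf.hasFDerivWithinAt
  rw [h.fderivWithin hT]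
  rfl

theorem dz_conj (hT : UniqueDiffWithinAt ℝ T z) (hf : DifferentiableWithinAt ℝ f T z)
    (j : Fin n) :
    dz T j (fun w => (starRingEnd ℂ) (f w)) z = (starRingEnd ℂ) (dzbar T j f z) := by
  simp only [dz, dzbar, fderivWithin_conj hT hf, map_div₀, map_add, map_mul, conj_I]
  rw [show (starRingEnd ℂ) 2 = 2 from conj_ofNat 2]
  ring

theorem dzbar_conj (hT : UniqueDiffWithinAt ℝ T z) (hf : DifferentiableWithinAt ℝ f T z)
    (j : Fin n) :
    dzbar T j (fun w => (starRingEnd ℂ) (f w)) z = (starRingEnd ℂ) (dz T j f z) := by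
  simp only [dz, dzbar, fderivWithin_conj hT hf, map_div₀, map_sub, map_mul, conj_I]
  rw [show (starRingEnd ℂ) 2 = 2 from conj_ofNat 2]
  ring

theorem fderivWithin_ofReal {u : Cn n → ℝ} (hT : UniqueDiffWithinAt ℝ T z)
    (hu : DifferentiableWithinAt ℝ u T z) (v : Cn n) :
    fderivWithin ℝ (fun w => (u w : ℂ)) T z v = (fderivWithin ℝ u T z v : ℂ) := by
  have h : HasFDerivWithinAt (fun w => (u w : ℂ)) (ofRealCLM.comp (fderivWithin ℝ u T z)) T z :=
    ofRealCLM.hasFDerivAt.comp_hasFDerivWithinAt z hu.hasFDerivWithinAt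
  rw [h.fderivWithin hT]
  rfl

theorem dzbar_ofReal {u : Cn n → ℝ} (hT : UniqueDiffWithinAt ℝ T z)
    (hu : DifferentiableWithinAt ℝ u T z) (j : Fin n) :
    dzbar T j (fun w => (u w : ℂ)) z = (starRingEnd ℂ) (dz T j (fun w => (u w : ℂ)) z) := by
  simp only [dz, dzbar, fderivWithin_ofReal hT hu, map_div₀, map_sub, map_mul, conj_I, conj_ofReal]
  rw [show (starRingEnd ℂ) 2 = 2 from conj_ofNat 2]
  ring

theorem contDiffOn_dz {k m : WithTop ℕ∞} (hT : UniqueDiffOn ℝ T) (hf : ContDiffOn ℝ m f T)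
    (hkm : k + 1 ≤ m) (j : Fin n) : ContDiffOn ℝ k (dz T j f) T := by
  have h := hf.fderivWithin hT hkm
  exact ((h.clm_apply contDiffOn_const).sub
    (contDiffOn_const.mul (h.clm_apply contDiffOn_const))).div_const 2

theorem contDiffOn_dzbar {k m : WithTop ℕ∞} (hT : UniqueDiffOn ℝ T) (hf : ContDiffOn ℝ m f T)
    (hkm : k + 1 ≤ m) (j : Fin n) : ContDiffOn ℝ k (dzbar T j f) T := by
  have h := hf.fderivWithin hT hkm
  exact ((h.clm_apply contDiffOn_const).add
    (contDiffOn_const.mul (h.clm_apply contDiffOn_const))).div_const 2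

theorem contDiffOn_ofReal {k : WithTop ℕ∞} {u : Cn n → ℝ} (hu : ContDiffOn ℝ k u T) :
    ContDiffOn ℝ k (fun w => (u w : ℂ)) T :=
  ofRealCLM.contDiff.comp_contDiffOn hu

theorem contDiffOn_conj {k : WithTop ℕ∞} (hf : ContDiffOn ℝ k f T) :
    ContDiffOn ℝ k (fun w => (starRingEnd ℂ) (f w)) T :=
  (conjCLE : ℂ →L[ℝ] ℂ).contDiff.comp_contDiffOn hf

/-- The domains of the calculus: derivatives within `T` are unique, and the interior is dense. -/
structure Regular (T : Set (Cn n)) : Prop where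
  uniqueDiffOn : UniqueDiffOn ℝ T
  subset_closure : T ⊆ closure (interior T)

theorem fderivWithin_fderivWithin_apply (hT : UniqueDiffOn ℝ T) (hf : ContDiffOn ℝ 2 f T)
    (hz : z ∈ T) (v w : Cn n) :
    fderivWithin ℝ (fun y => fderivWithin ℝ f T y v) T z w =
      fderivWithin ℝ (fderivWithin ℝ f T) T z w v := by
  have h : DifferentiableWithinAt ℝ (fderivWithin ℝ f T) T z :=
    (hf.fderivWithin hT (m := 1) (by norm_num)).differentiableOn one_ne_zero z hz
  rw [fderivWithin_clm_apply (hT z hz) h (differentiableWithinAt_const v)]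
  simp

theorem fderivWithin_comm (hT : Regular T) (hf : ContDiffOn ℝ 2 f T)
    (hz : z ∈ T) (v w : Cn n) :
    fderivWithin ℝ (fun y => fderivWithin ℝ f T y v) T z w =
      fderivWithin ℝ (fun y => fderivWithin ℝ f T y w) T z v := by
  rw [fderivWithin_fderivWithin_apply hT.1 hf hz, fderivWithin_fderivWithin_apply hT.1 hf hz]
  exact (hf z hz).isSymmSndFDerivWithinAt (by simp) hT.1 (hT.2 hz) hz _ _

theorem differentiableWithinAt_fderivWithin_apply (hT : UniqueDiffOn ℝ T)
    (hf : ContDiffOn ℝ 2 f T) (hz : z ∈ T) (v : Cn n) :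
    DifferentiableWithinAt ℝ (fun y => fderivWithin ℝ f T y v) T z :=
  ((hf.fderivWithin hT (m := 1) (by norm_num)).clm_apply
    contDiffOn_const).differentiableOn one_ne_zero z hz

theorem fderivWithin_wirtinger (hT : UniqueDiffOn ℝ T) (hf : ContDiffOn ℝ 2 f T) (hz : z ∈ T)
    (c : ℂ) (v w x : Cn n) :
    fderivWithin ℝ (fun y => (fderivWithin ℝ f T y v + c * fderivWithin ℝ f T y w) / 2) T z x =
      (fderivWithin ℝ (fun y => fderivWithin ℝ f T y v) T z x +
        c * fderivWithin ℝ (fun y => fderivWithin ℝ f T y w) T z x) / 2 := by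
  have hv := differentiableWithinAt_fderivWithin_apply hT hf hz v
  have hw := differentiableWithinAt_fderivWithin_apply hT hf hz w
  simp only [div_eq_mul_inv]
  rw [fderivWithin_mul_const (hT z hz) (hv.fun_add (hw.const_mul c)),
    fderivWithin_fun_add (hT z hz) hv (hw.const_mul c), fderivWithin_const_mul (hT z hz) hw]
  simp
  ring

theorem dz_dz_comm (hT : Regular T) (hf : ContDiffOn ℝ 2 f T) (hz : z ∈ T) (j k : Fin n) :
    dz T j (dz T k f) z = dz T k (dz T j f) z := by
  have h : ∀ l, dz T l f = fun y => (fderivWithin ℝ f T y (EuclideanSpace.single l 1) +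
      (-I) * fderivWithin ℝ f T y (EuclideanSpace.single l I)) / 2 := fun l => by
    funext y; simp only [dz]; ring
  rw [h k, h j]
  simp only [dz, fderivWithin_wirtinger hT.1 hf hz]
  rw [fderivWithin_comm hT hf hz (.single k 1) (.single j 1),
    fderivWithin_comm hT hf hz (.single k I) (.single j 1),
    fderivWithin_comm hT hf hz (.single k 1) (.single j I),
    fderivWithin_comm hT hf hz (.single k I) (.single j I)]
  ring

theorem dz_dzbar_comm (hT : Regular T) (hf : ContDiffOn ℝ 2 f T) (hz : z ∈ T) (j k : Fin n) :
    dz T j (dzbar T k f) z = dzbar T k (dz T j f) z := by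
  have h : dz T j f = fun y => (fderivWithin ℝ f T y (EuclideanSpace.single j 1) +
      (-I) * fderivWithin ℝ f T y (EuclideanSpace.single j I)) / 2 := by
    funext y; simp only [dz]; ring
  have h' : dzbar T k f = fun y => (fderivWithin ℝ f T y (EuclideanSpace.single k 1) +
      I * fderivWithin ℝ f T y (EuclideanSpace.single k I)) / 2 := rfl
  rw [h, h']
  simp only [dz, dzbar, fderivWithin_wirtinger hT.1 hf hz]
  rw [fderivWithin_comm hT hf hz (.single k 1) (.single j 1),
    fderivWithin_comm hT hf hz (.single k I) (.single j 1),
    fderivWithin_comm hT hf hz (.single k 1) (.single j I),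
    fderivWithin_comm hT hf hz (.single k I) (.single j I)]
  ring

/-- The real derivative in terms of the Wirtinger derivatives. -/
theorem fderivWithin_apply_eq (v : Cn n) :
    fderivWithin ℝ f T z v =
      ∑ j, (v j * dz T j f z + (starRingEnd ℂ) (v j) * dzbar T j f z) := by
  have hv : v = ∑ j, ((v j).re • EuclideanSpace.single j (1 : ℂ) +
      (v j).im • EuclideanSpace.single j I) := by
    ext i
    have : ∀ j, ((v j).re • EuclideanSpace.single j (1 : ℂ) +
        (v j).im • EuclideanSpace.single j I : Cn n) = EuclideanSpace.single j (v j) := fun j => by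
      ext k
      by_cases h : k = j
      · subst h
        simp [re_add_im]
      · simp [h]
    simp [this]
  conv_lhs => rw [hv]
  rw [map_sum]
  refine Finset.sum_congr rfl fun j _ => ?_
  rw [map_add, map_smul, map_smul]
  simp only [dz, dzbar, real_smul]
  apply Complex.ext <;> simp <;> ring

/-! #### The mixed Hessian -/

/-- The matrix `(∂²f / ∂z^j ∂z̄^k)` of a complex function. -/
def hess (T : Set (Cn n)) (f : Cn n → ℂ) (z : Cn n) : Matrix (Fin n) (Fin n) ℂ :=
  Matrix.of fun j k => dz T j (dzbar T k f) z

/-- The vector `(∂f / ∂z^j)`. -/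
def dzv (T : Set (Cn n)) (f : Cn n → ℂ) (z : Cn n) : Fin n → ℂ := fun j => dz T j f z

/-- The vector `(∂f / ∂z̄^j)`. -/
def dzbv (T : Set (Cn n)) (f : Cn n → ℂ) (z : Cn n) : Fin n → ℂ := fun j => dzbar T j f z

theorem complexHessian_eq (u : Cn n → ℝ) :
    complexHessian T u z = hess T (fun w => (u w : ℂ)) z := rfl

theorem hess_congr (h : EqOn f g T) (hz : z ∈ T) : hess T f z = hess T g z := by
  ext j k
  exact dz_congr (fun w hw => dzbar_congr h hw k) hz j

theorem hess_const (c : ℂ) : hess T (fun _ => c) z = 0 := by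
  ext j k
  have : dzbar T k (fun _ => c) = fun _ => (0 : ℂ) := funext fun w => dzbar_const k c
  simp only [hess, of_apply, this, dz_const, Matrix.zero_apply]

theorem diffAt_of_contDiffOn {k : WithTop ℕ∞} (hf : ContDiffOn ℝ k f T) (hk : k ≠ 0)
    (hz : z ∈ T) : DifferentiableWithinAt ℝ f T z := hf.differentiableOn hk z hz

theorem diffAt_dzbar (hT : UniqueDiffOn ℝ T) (hf : ContDiffOn ℝ 2 f T) (hz : z ∈ T) (k : Fin n) :
    DifferentiableWithinAt ℝ (dzbar T k f) T z :=
  diffAt_of_contDiffOn (contDiffOn_dzbar hT hf (k := 1) (by norm_num) k) one_ne_zero hz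

theorem diffAt_dz (hT : UniqueDiffOn ℝ T) (hf : ContDiffOn ℝ 2 f T) (hz : z ∈ T) (k : Fin n) :
    DifferentiableWithinAt ℝ (dz T k f) T z :=
  diffAt_of_contDiffOn (contDiffOn_dz hT hf (k := 1) (by norm_num) k) one_ne_zero hz

theorem hess_add (hT : UniqueDiffOn ℝ T) (hf : ContDiffOn ℝ 2 f T) (hg : ContDiffOn ℝ 2 g T)
    (hz : z ∈ T) : hess T (fun w => f w + g w) z = hess T f z + hess T g z := by
  ext j k
  have h : EqOn (dzbar T k fun w => f w + g w) (fun w => dzbar T k f w + dzbar T k g w) T :=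
    fun w hw => dzbar_add (hT w hw) (diffAt_of_contDiffOn hf two_ne_zero hw)
      (diffAt_of_contDiffOn hg two_ne_zero hw) k
  simp only [hess, of_apply, Matrix.add_apply]
  rw [dz_congr h hz, dz_add (hT z hz) (diffAt_dzbar hT hf hz k) (diffAt_dzbar hT hg hz k)]

theorem hess_mul (hT : UniqueDiffOn ℝ T) (hf : ContDiffOn ℝ 2 f T) (hg : ContDiffOn ℝ 2 g T)
    (hz : z ∈ T) : hess T (fun w => f w * g w) z =
      g z • hess T f z + f z • hess T g z + vecMulVec (dzv T f z) (dzbv T g z) +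
        vecMulVec (dzv T g z) (dzbv T f z) := by
  ext j k
  have hfd : ∀ {w}, w ∈ T → DifferentiableWithinAt ℝ f T w :=
    fun hw => diffAt_of_contDiffOn hf two_ne_zero hw
  have hgd : ∀ {w}, w ∈ T → DifferentiableWithinAt ℝ g T w :=
    fun hw => diffAt_of_contDiffOn hg two_ne_zero hw
  have h : EqOn (dzbar T k fun w => f w * g w)
      (fun w => dzbar T k f w * g w + f w * dzbar T k g w) T :=
    fun w hw => dzbar_mul (hT w hw) (hfd hw) (hgd hw) k
  simp only [hess, of_apply, Matrix.add_apply, Matrix.smul_apply, vecMulVec_apply, dzv, dzbv,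
    smul_eq_mul]
  rw [dz_congr h hz, dz_add (hT z hz) ((diffAt_dzbar hT hf hz k).fun_mul (hgd hz))
    ((hfd hz).fun_mul (diffAt_dzbar hT hg hz k)), dz_mul (hT z hz) (diffAt_dzbar hT hf hz k) (hgd hz),
    dz_mul (hT z hz) (hfd hz) (diffAt_dzbar hT hg hz k)]
  ring

theorem hess_const_mul (hT : UniqueDiffOn ℝ T) (hf : ContDiffOn ℝ 2 f T) (c : ℂ)
    (hz : z ∈ T) : hess T (fun w => c * f w) z = c • hess T f z := by
  rw [hess_mul hT contDiffOn_const hf hz, hess_const]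
  ext j k
  simp [vecMulVec_apply, dzv, dzbv, dz_const, dzbar_const]

theorem hess_neg (hT : UniqueDiffOn ℝ T) (hf : ContDiffOn ℝ 2 f T)
    (hz : z ∈ T) : hess T (fun w => -f w) z = -hess T f z := by
  have := hess_const_mul hT hf (-1) hz
  simpa using this

theorem hess_sub (hT : UniqueDiffOn ℝ T) (hf : ContDiffOn ℝ 2 f T) (hg : ContDiffOn ℝ 2 g T)
    (hz : z ∈ T) : hess T (fun w => f w - g w) z = hess T f z - hess T g z := by
  have := hess_add hT hf hg.neg hz
  rw [hess_neg hT hg hz] at this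
  simpa [sub_eq_add_neg] using this

theorem hess_sum (hT : UniqueDiffOn ℝ T) {ι : Type*} (s : Finset ι) {F : ι → Cn n → ℂ}
    (hF : ∀ i ∈ s, ContDiffOn ℝ 2 (F i) T) (hz : z ∈ T) :
    hess T (fun w => ∑ i ∈ s, F i w) z = ∑ i ∈ s, hess T (F i) z := by
  classical
  induction s using Finset.induction_on with
  | empty => simpa using hess_const 0
  | insert i s hi ih =>
    simp only [Finset.sum_insert hi]
    rw [hess_add hT (hF i (Finset.mem_insert_self i s))
      (ContDiffOn.sum fun j hj => hF j (Finset.mem_insert_of_mem hj)) hz,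
      ih fun j hj => hF j (Finset.mem_insert_of_mem hj)]

theorem hess_conj (hT : Regular T) (hf : ContDiffOn ℝ 2 f T) (hz : z ∈ T) :
    hess T (fun w => (starRingEnd ℂ) (f w)) z = (hess T f z)ᴴ := by
  ext j k
  have h : EqOn (dzbar T k fun w => (starRingEnd ℂ) (f w))
      (fun w => (starRingEnd ℂ) (dz T k f w)) T :=
    fun w hw => dzbar_conj (hT.1 w hw) (diffAt_of_contDiffOn hf two_ne_zero hw) k
  simp only [hess, of_apply, conjTranspose_apply]
  rw [dz_congr h hz, dz_conj (hT.1 z hz) (diffAt_dz hT.1 hf hz k), dz_dzbar_comm hT hf hz]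
  rfl

theorem isHermitian_hess_ofReal (hT : Regular T) {u : Cn n → ℝ} (hu : ContDiffOn ℝ 2 u T)
    (hz : z ∈ T) : (hess T (fun w => (u w : ℂ)) z).IsHermitian := by
  rw [Matrix.IsHermitian, ← hess_conj hT (contDiffOn_ofReal hu) hz]
  simp only [conj_ofReal]

theorem dzbv_ofReal {u : Cn n → ℝ} (hT : UniqueDiffWithinAt ℝ T z)
    (hu : DifferentiableWithinAt ℝ u T z) :
    dzbv T (fun w => (u w : ℂ)) z = star (dzv T (fun w => (u w : ℂ)) z) := by
  funext j
  exact dzbar_ofReal hT hu j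

end Wirtinger

/-! ### Local maxima and the maximum principle -/

section MaxPrinciple

variable {n : ℕ} {T : Set (Cn n)} {z : Cn n}

theorem deriv_deriv_nonpos_of_isLocalMax {g : ℝ → ℝ} {a : ℝ} (hg : IsLocalMax g a)
    (hc : ContinuousAt g a) : deriv (deriv g) a ≤ 0 := by
  by_contra! h
  have hmin := isLocalMin_of_deriv_deriv_pos h hg.deriv_eq_zero hc
  have hconst : g =ᶠ[𝓝 a] fun _ => g a := by
    filter_upwards [hg, hmin] with x h1 h2 using le_antisymm h1 h2
  have h1 : deriv g =ᶠ[𝓝 a] fun _ => 0 := by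
    filter_upwards [hconst.eventuallyEq_nhds] with x hx
    rw [hx.deriv_eq]
    simp
  rw [h1.deriv_eq] at h
  simp at h

theorem second_derivative_nonpos {u : Cn n → ℝ} (hu : ContDiffOn ℝ 2 u T) (hT : T ∈ 𝓝 z)
    (hmax : IsLocalMax u z) (v : Cn n) :
    fderiv ℝ (fun y => fderiv ℝ u y v) z v ≤ 0 := by
  have hline : ∀ t : ℝ, HasDerivAt (fun t : ℝ => z + t • v) v t := fun t => by
    simpa using ((hasDerivAt_id t).smul_const v).const_add z
  have hcont : ContinuousAt (fun t : ℝ => z + t • v) 0 := (hline 0).continuousAt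
  have h0 : z + (0 : ℝ) • v = z := by simp
  have huz : ContDiffAt ℝ 2 u z := hu.contDiffAt hT
  have hev : ∀ᶠ y in 𝓝 z, DifferentiableAt ℝ u y := by
    filter_upwards [eventually_mem_nhds_iff.2 hT] with y hy
    exact (hu.contDiffAt hy).differentiableAt two_ne_zero
  have hder : deriv (fun t : ℝ => u (z + t • v)) =ᶠ[𝓝 0] fun t => fderiv ℝ u (z + t • v) v := by
    have : ∀ᶠ t in 𝓝 (0 : ℝ), DifferentiableAt ℝ u (z + t • v) := by
      apply hcont.eventually
      simpa using hev
    filter_upwards [this] with t ht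
    exact (ht.hasFDerivAt.comp_hasDerivAt t (hline t)).deriv
  have hmax' : IsLocalMax (fun t : ℝ => u (z + t • v)) 0 := by
    have : ∀ᶠ y in 𝓝 (z + (0 : ℝ) • v), u y ≤ u z := by rwa [h0]
    have h2 := hcont.eventually this
    filter_upwards [h2] with t ht
    simpa using ht
  have hc : ContinuousAt (fun t : ℝ => u (z + t • v)) 0 := by
    apply ContinuousAt.comp (g := u) _ hcont
    rw [h0]
    exact huz.continuousAt
  have hkey := deriv_deriv_nonpos_of_isLocalMax hmax' hc
  rw [hder.deriv_eq] at hkey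
  have hd1 : DifferentiableAt ℝ (fun y => fderiv ℝ u y v) (z + (0 : ℝ) • v) := by
    rw [h0]
    exact ((huz.fderiv_right (m := 1) (by norm_num)).differentiableAt one_ne_zero).clm_apply
      (differentiableAt_const v)
  have := (hd1.hasFDerivAt.comp_hasDerivAt (0 : ℝ) (hline 0)).deriv
  simp only [Function.comp_def] at this
  rw [this, h0] at hkey
  exact hkey

/-- The mixed Hessian as the Laplacian along a complex line. -/
theorem four_mul_hess (hT : Regular T) {f : Cn n → ℂ} (hf : ContDiffOn ℝ 2 f T) (hz : z ∈ T)
    (v : Cn n) :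
    fderivWithin ℝ (fun y => fderivWithin ℝ f T y v) T z v +
      fderivWithin ℝ (fun y => fderivWithin ℝ f T y (I • v)) T z (I • v) =
      4 * ∑ j, ∑ k, v j * (starRingEnd ℂ) (v k) * hess T f z j k := by
  have key : ∀ a : Cn n, fderivWithin ℝ (fun y => fderivWithin ℝ f T y a) T z a =
      ∑ k, ∑ j, (a k * (a j * dz T j (dz T k f) z) +
        (starRingEnd ℂ) (a k) * ((starRingEnd ℂ) (a j) * dzbar T j (dzbar T k f) z)) +
      2 * ∑ j, ∑ k, a j * (starRingEnd ℂ) (a k) * hess T f z j k := by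
    intro a
    have h1 : EqOn (fun y => fderivWithin ℝ f T y a)
        (fun y => ∑ k, (a k * dz T k f y + (starRingEnd ℂ) (a k) * dzbar T k f y)) T :=
      fun y hy => fderivWithin_apply_eq a
    have d1 : ∀ k, DifferentiableWithinAt ℝ (fun y => a k * dz T k f y) T z :=
      fun k => (diffAt_dz hT.1 hf hz k).const_mul _
    have d2 : ∀ k, DifferentiableWithinAt ℝ (fun y => (starRingEnd ℂ) (a k) * dzbar T k f y) T z :=
      fun k => (diffAt_dzbar hT.1 hf hz k).const_mul _
    rw [fderivWithin_congr' h1 hz, fderivWithin_fun_sum (hT.1 z hz) fun k _ => (d1 k).fun_add (d2 k)]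
    simp only [_root_.sum_apply]
    have h2 : ∀ k, fderivWithin ℝ
        (fun y => a k * dz T k f y + (starRingEnd ℂ) (a k) * dzbar T k f y) T z a =
        ∑ j, (a k * (a j * dz T j (dz T k f) z) +
        (starRingEnd ℂ) (a k) * ((starRingEnd ℂ) (a j) * dzbar T j (dzbar T k f) z)) +
        (∑ j, a k * (starRingEnd ℂ) (a j) * hess T f z k j +
         ∑ j, a j * (starRingEnd ℂ) (a k) * hess T f z j k) := by
      intro k
      rw [fderivWithin_fun_add (hT.1 z hz) (d1 k) (d2 k),
        fderivWithin_const_mul (hT.1 z hz) (diffAt_dz hT.1 hf hz k),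
        fderivWithin_const_mul (hT.1 z hz) (diffAt_dzbar hT.1 hf hz k)]
      simp only [_root_.add_apply, _root_.smul_apply, smul_eq_mul]
      rw [fderivWithin_apply_eq a, fderivWithin_apply_eq a, Finset.mul_sum, Finset.mul_sum,
        ← Finset.sum_add_distrib, ← Finset.sum_add_distrib, ← Finset.sum_add_distrib]
      refine Finset.sum_congr rfl fun j _ => ?_
      simp only [hess, of_apply]
      rw [dz_dzbar_comm hT hf hz k j]
      ring
    simp only [h2]
    rw [Finset.sum_add_distrib, Finset.sum_add_distrib,
      Finset.sum_comm (f := fun k j => a j * (starRingEnd ℂ) (a k) * hess T f z j k), two_mul]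
  rw [key, key]
  have e1 : ∀ k j, ((I • v) k * ((I • v) j * dz T j (dz T k f) z) +
        (starRingEnd ℂ) ((I • v) k) * ((starRingEnd ℂ) ((I • v) j) * dzbar T j (dzbar T k f) z)) =
      -(v k * (v j * dz T j (dz T k f) z) +
        (starRingEnd ℂ) (v k) * ((starRingEnd ℂ) (v j) * dzbar T j (dzbar T k f) z)) := by
    intro k j
    simp only [PiLp.smul_apply, smul_eq_mul, map_mul, conj_I]
    linear_combination (v k * v j * dz T j (dz T k f) z + (starRingEnd ℂ) (v k) *
      (starRingEnd ℂ) (v j) * dzbar T j (dzbar T k f) z) * I_mul_I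
  have e2 : ∀ j k, (I • v) j * (starRingEnd ℂ) ((I • v) k) * hess T f z j k =
      v j * (starRingEnd ℂ) (v k) * hess T f z j k := by
    intro j k
    simp only [PiLp.smul_apply, smul_eq_mul, map_mul, conj_I]
    linear_combination -(v j * (starRingEnd ℂ) (v k) * hess T f z j k) * I_mul_I
  simp only [e1, e2, Finset.sum_neg_distrib]
  ring

/-- At an interior local maximum the mixed Hessian is negative semidefinite. -/
theorem quad_complexHessian_nonpos (hT : Regular T) {u : Cn n → ℝ} (hu : ContDiffOn ℝ 2 u T)
    (hz : T ∈ 𝓝 z) (hmax : IsLocalMax u z) (x : Fin n → ℂ) :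
    quad (complexHessian T u z) x ≤ 0 := by
  set v : Cn n := WithLp.toLp 2 (star x) with hv
  have hq : star x ⬝ᵥ complexHessian T u z *ᵥ x =
      ∑ j, ∑ k, v j * (starRingEnd ℂ) (v k) * hess T (fun w => (u w : ℂ)) z j k := by
    simp only [dotProduct, mulVec, Finset.mul_sum, complexHessian_eq]
    refine Finset.sum_congr rfl fun j _ => Finset.sum_congr rfl fun k _ => ?_
    simp only [hv, Pi.star_apply, RCLike.star_def, conj_conj]
    ring
  have h4 := four_mul_hess hT (contDiffOn_ofReal hu) (mem_of_mem_nhds hz) v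
  rw [← hq] at h4
  have hD : ∀ a : Cn n,
      fderivWithin ℝ (fun y => fderivWithin ℝ (fun w => (u w : ℂ)) T y a) T z a =
      ((fderiv ℝ (fun y => fderiv ℝ u y a) z a : ℝ) : ℂ) := by
    intro a
    have huz : ContDiffAt ℝ 2 u z := hu.contDiffAt hz
    have hd1 : DifferentiableAt ℝ (fun y => fderiv ℝ u y a) z :=
      ((huz.fderiv_right (m := 1) (by norm_num)).differentiableAt one_ne_zero).clm_apply
        (differentiableAt_const a)
    rw [← fderivWithin_of_mem_nhds hz,
      ← fderivWithin_ofReal (hT.1 z (mem_of_mem_nhds hz)) hd1.differentiableWithinAt,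
      fderivWithin_of_mem_nhds hz, fderivWithin_of_mem_nhds hz]
    have : (fun y => fderivWithin ℝ (fun w => (u w : ℂ)) T y a) =ᶠ[𝓝 z]
        fun y => ((fderiv ℝ u y a : ℝ) : ℂ) := by
      filter_upwards [eventually_mem_nhds_iff.2 hz] with y hy
      rw [fderivWithin_ofReal (hT.1 y (mem_of_mem_nhds hy))
        (hu.differentiableOn two_ne_zero y (mem_of_mem_nhds hy)), fderivWithin_of_mem_nhds hy]
    rw [this.fderiv_eq]
  rw [hD, hD] at h4
  have h5 := congrArg Complex.re h4
  simp only [add_re, ofReal_re, mul_re] at h5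
  have e4 : (4 : ℂ).re = 4 := rfl
  have e4' : (4 : ℂ).im = 0 := rfl
  rw [e4, e4'] at h5
  have s1 := second_derivative_nonpos hu hz hmax v
  have s2 := second_derivative_nonpos hu hz hmax (I • v)
  rw [quad]
  linarith

/-- The elementary maximum principle: a function on a compact set which is nonpositive outside
an open part and has no positive local maximum there is nonpositive. -/
theorem nonpos_of_no_interior_max {K O : Set (Cn n)} (hK : IsCompact K) (hO : IsOpen O)
    (hOK : O ⊆ K) {f : Cn n → ℝ} (hf : ContinuousOn f K) (hbd : ∀ y ∈ K, y ∉ O → f y ≤ 0)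
    (hint : ∀ y ∈ O, 0 < f y → IsLocalMax f y → False) : ∀ y ∈ K, f y ≤ 0 := by
  intro y hy
  by_contra! hpos
  obtain ⟨y₀, hy₀, hm⟩ := hK.exists_isMaxOn ⟨y, hy⟩ hf
  have hpos₀ : 0 < f y₀ := hpos.trans_le (hm hy)
  have hyO : y₀ ∈ O := by
    by_contra h
    exact absurd (hbd y₀ hy₀ h) (not_le.2 hpos₀)
  exact hint y₀ hyO hpos₀ (hm.isLocalMax (Filter.mem_of_superset (hO.mem_nhds hyO) hOK))

/-- The second-order part of an elliptic operator is nonpositive at an interior maximum. -/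
theorem trace_mul_complexHessian_nonpos (hT : Regular T) {u : Cn n → ℝ}
    (hu : ContDiffOn ℝ 2 u T) (hz : T ∈ 𝓝 z) (hmax : IsLocalMax u z)
    {G : Matrix (Fin n) (Fin n) ℂ} (hG : G.PosSemidef) :
    (G * complexHessian T u z).trace.re ≤ 0 := by
  have hH : (-complexHessian T u z).PosSemidef := by
    have hherm : (-complexHessian T u z).IsHermitian :=
      (isHermitian_hess_ofReal hT hu (mem_of_mem_nhds hz)).neg
    rw [posSemidef_iff_quad hherm]
    intro x
    rw [quad_neg]
    linarith [quad_complexHessian_nonpos hT hu hz hmax x]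
  have := trace_mul_re_nonneg hG hH
  rw [Matrix.mul_neg, trace_neg, neg_re] at this
  linarith

end MaxPrinciple

/-! ### Smooth domains -/

section Domain

variable {n : ℕ} {T U : Set (Cn n)} {ρ : Cn n → ℝ} {z q : Cn n}

/-- `T` is the part `{ρ ≤ 0}` of the open set `U`, and `ρ` is a smooth defining function. -/
structure IsDefining (U : Set (Cn n)) (ρ : Cn n → ℝ) (T : Set (Cn n)) : Prop where
  isOpen : IsOpen U
  smooth : ContDiffOn ℝ ∞ ρ U
  regular : ∀ w ∈ U, ρ w = 0 → fderiv ℝ ρ w ≠ 0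
  eq : T = {w ∈ U | ρ w ≤ 0}

namespace IsDefining

theorem subset (h : IsDefining U ρ T) : T ⊆ U := by
  rw [h.eq]; exact fun _ hw => hw.1

theorem mem_iff (h : IsDefining U ρ T) (hz : z ∈ U) : z ∈ T ↔ ρ z ≤ 0 := by
  rw [h.eq]; exact ⟨fun hw => hw.2, fun hw => ⟨hz, hw⟩⟩

theorem nonpos (h : IsDefining U ρ T) (hz : z ∈ T) : ρ z ≤ 0 := (h.mem_iff (h.subset hz)).1 hz

theorem contDiffAt (h : IsDefining U ρ T) (hz : z ∈ U) : ContDiffAt ℝ ∞ ρ z :=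
  h.smooth.contDiffAt (h.isOpen.mem_nhds hz)

theorem hasFDerivAt (h : IsDefining U ρ T) (hz : z ∈ U) : HasFDerivAt ρ (fderiv ℝ ρ z) z :=
  ((h.contDiffAt hz).differentiableAt (by simp)).hasFDerivAt

theorem mono (h : IsDefining U ρ T) {V : Set (Cn n)} (hV : IsOpen V) :
    IsDefining (U ∩ V) ρ (T ∩ V) where
  isOpen := h.isOpen.inter hV
  smooth := h.smooth.mono inter_subset_left
  regular w hw := h.regular w hw.1
  eq := by
    rw [h.eq]; ext w; simp only [mem_inter_iff, mem_ofPred_eq]; tauto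

theorem mem_nhds_of_neg (h : IsDefining U ρ T) (hz : z ∈ U) (hρ : ρ z < 0) : T ∈ 𝓝 z := by
  filter_upwards [h.isOpen.mem_nhds hz,
    (h.contDiffAt hz).continuousAt.eventually_lt continuousAt_const hρ] with w hw hw'
  exact (h.mem_iff hw).2 hw'.le

theorem eventually_neg (h : IsDefining U ρ T) (hz : z ∈ U) (hρ : ρ z = 0) {v : Cn n}
    (hv : fderiv ℝ ρ z v < 0) : ∀ᶠ t in 𝓝[>] (0 : ℝ), z + t • v ∈ U ∧ ρ (z + t • v) < 0 := by
  have hline : HasDerivAt (fun t : ℝ => z + t • v) v 0 := by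
    simpa using ((hasDerivAt_id (0 : ℝ)).smul_const v).const_add z
  have h0 : z + (0 : ℝ) • v = z := by simp
  have hU : ∀ᶠ t in 𝓝[>] (0 : ℝ), z + t • v ∈ U := by
    apply (hline.continuousAt.mono_left nhdsWithin_le_nhds).eventually
    simpa using h.isOpen.mem_nhds hz
  have hd : HasDerivAt (fun t : ℝ => ρ (z + t • v)) (fderiv ℝ ρ z v) 0 := by
    have : HasFDerivAt ρ (fderiv ℝ ρ z) (z + (0 : ℝ) • v) := by rw [h0]; exact h.hasFDerivAt hz
    exact this.comp_hasDerivAt (0 : ℝ) hline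
  have hs := hd.tendsto_slope_zero_right
  simp only [zero_add, zero_smul, add_zero, hρ, sub_zero] at hs
  filter_upwards [hU, hs.eventually_lt_const hv, self_mem_nhdsWithin] with t h1 h2 h3
  refine ⟨h1, ?_⟩
  have h3' : (0 : ℝ) < t := h3
  have : t⁻¹ * ρ (z + t • v) < 0 := h2
  by_contra! hc
  exact absurd this (not_lt.2 (mul_nonneg (inv_nonneg.2 h3'.le) hc))

theorem exists_fderiv_eq (h : IsDefining U ρ T) (hz : z ∈ U) (hρ : ρ z = 0) (a : ℝ) :
    ∃ v, fderiv ℝ ρ z v = a := by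
  obtain ⟨v, hv⟩ : ∃ v, fderiv ℝ ρ z v ≠ 0 := by
    by_contra! hc
    exact h.regular z hz hρ (ContinuousLinearMap.ext hc)
  exact ⟨(a / fderiv ℝ ρ z v) • v, by rw [map_smul, smul_eq_mul, div_mul_cancel₀ _ hv]⟩

theorem mem_nhds_iff (h : IsDefining U ρ T) (hz : z ∈ U) : T ∈ 𝓝 z ↔ ρ z < 0 := by
  refine ⟨fun hT => ?_, h.mem_nhds_of_neg hz⟩
  have hzT := mem_of_mem_nhds hT
  refine lt_of_le_of_ne (h.nonpos hzT) fun h0 => ?_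
  obtain ⟨v, hv⟩ := h.exists_fderiv_eq hz h0 1
  have hmax : IsLocalMax ρ z := by
    filter_upwards [hT] with w hw
    rw [h0]
    exact h.nonpos hw
  rw [hmax.fderiv_eq_zero] at hv
  simp at hv

theorem mem_interior_iff (h : IsDefining U ρ T) (hz : z ∈ U) : z ∈ interior T ↔ ρ z < 0 := by
  rw [mem_interior_iff_mem_nhds, h.mem_nhds_iff hz]

theorem mem_closure_interior (h : IsDefining U ρ T) (hz : z ∈ T) : z ∈ closure (interior T) := by
  rcases (h.nonpos hz).lt_or_eq with h0 | h0
  · exact subset_closure ((h.mem_interior_iff (h.subset hz)).2 h0)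
  · obtain ⟨v, hv⟩ := h.exists_fderiv_eq (h.subset hz) h0 (-1)
    have hev := h.eventually_neg (h.subset hz) h0 (v := v) (by rw [hv]; norm_num)
    have hc : Tendsto (fun t : ℝ => z + t • v) (𝓝[>] 0) (𝓝 z) := by
      have : ContinuousAt (fun t : ℝ => z + t • v) 0 := by fun_prop
      simpa using! this.tendsto.mono_left nhdsWithin_le_nhds
    exact mem_closure_of_tendsto hc (hev.mono fun t ht => (h.mem_interior_iff ht.1).2 ht.2)

theorem uniqueDiffWithinAt (h : IsDefining U ρ T) (hz : z ∈ T) : UniqueDiffWithinAt ℝ T z := by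
  rcases (h.nonpos hz).lt_or_eq with h0 | h0
  · exact uniqueDiffWithinAt_of_mem_nhds (h.mem_nhds_of_neg (h.subset hz) h0)
  refine ⟨?_, subset_closure hz⟩
  have hsub : {v | fderiv ℝ ρ z v < 0} ⊆ tangentConeAt ℝ T z := by
    intro v hv
    have ht : Tendsto (fun t : ℝ => t) (𝓝[>] 0) (𝓝[≠] 0) :=
      tendsto_id.mono_right (nhdsWithin_mono _ fun t ht => ne_of_gt ht)
    refine mem_tangentConeAt_of_add_smul_mem ht ?_
    filter_upwards [h.eventually_neg (h.subset hz) h0 hv] with t ht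
    exact (h.mem_iff ht.1).2 ht.2.le
  have htop : Submodule.span ℝ (tangentConeAt ℝ T z) = ⊤ := by
    apply Submodule.eq_top_of_nonempty_interior'
    obtain ⟨v, hv⟩ := h.exists_fderiv_eq (h.subset hz) h0 (-1)
    have hopen : IsOpen {v | fderiv ℝ ρ z v < 0} :=
      isOpen_lt (fderiv ℝ ρ z).continuous continuous_const
    refine ⟨v, interior_mono (hsub.trans Submodule.subset_span) ?_⟩
    rw [hopen.interior_eq]
    simp [hv]
  rw [htop]
  exact dense_univ

theorem isRegular (h : IsDefining U ρ T) : Regular T :=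
  ⟨fun _ hz => h.uniqueDiffWithinAt hz, fun _ hz => h.mem_closure_interior hz⟩

theorem hasLimit_slope (h : IsDefining U ρ T) (hq : q ∈ T) (h0 : ρ q = 0) {F : Type*}
    [NormedAddCommGroup F] [NormedSpace ℝ F] {f : Cn n → F}
    (hf : DifferentiableWithinAt ℝ f T q) {v : Cn n} (hv : fderiv ℝ ρ q v < 0) :
    Tendsto (fun t : ℝ => t⁻¹ • (f (q + t • v) - f q)) (𝓝[>] 0)
      (𝓝 (fderivWithin ℝ f T q v)) := by
  refine hf.hasFDerivWithinAt.lim ?_ ?_ ?_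
  · have : ContinuousAt (fun t : ℝ => t • v) 0 := by fun_prop
    simpa using! this.tendsto.mono_left nhdsWithin_le_nhds
  · filter_upwards [h.eventually_neg (h.subset hq) h0 hv] with t ht
    exact (h.mem_iff ht.1).2 ht.2.le
  · refine tendsto_nhds_of_eventually_eq ?_
    filter_upwards [self_mem_nhdsWithin] with t ht
    rw [smul_smul, inv_mul_cancel₀ (ne_of_gt ht), one_smul]

theorem tendsto_ray (h : IsDefining U ρ T) (hq : q ∈ T) (h0 : ρ q = 0) {v : Cn n}
    (hv : fderiv ℝ ρ q v < 0) : Tendsto (fun t : ℝ => q + t • v) (𝓝[>] 0) (𝓝[T] q) := by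
  have hc : Tendsto (fun t : ℝ => q + t • v) (𝓝[>] 0) (𝓝 q) := by
    have : ContinuousAt (fun t : ℝ => q + t • v) 0 := by fun_prop
    simpa using! this.tendsto.mono_left nhdsWithin_le_nhds
  refine tendsto_nhdsWithin_iff.2 ⟨hc, ?_⟩
  filter_upwards [h.eventually_neg (h.subset hq) h0 hv] with t ht
  exact (h.mem_iff ht.1).2 ht.2.le

/-- A property of derivatives which is closed and even holds in all directions as soon as it holds
in the directions pointing into the domain. -/
theorem le_of_forall_inward (h : IsDefining U ρ T) (hq : q ∈ T) (h0 : ρ q = 0) {A B : Cn n → ℝ}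
    (hA : Continuous A) (hB : Continuous B) (hAe : ∀ v, A (-v) = A v) (hBe : ∀ v, B (-v) = B v)
    (hAB : ∀ v, fderiv ℝ ρ q v < 0 → A v ≤ B v) (v : Cn n) : A v ≤ B v := by
  have key : ∀ v, fderiv ℝ ρ q v ≤ 0 → A v ≤ B v := by
    intro v hv
    obtain ⟨a, ha⟩ := h.exists_fderiv_eq (h.subset hq) h0 (-1)
    have hc : Tendsto (fun t : ℝ => v + t • a) (𝓝[>] 0) (𝓝 v) := by
      have : ContinuousAt (fun t : ℝ => v + t • a) 0 := by fun_prop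
      simpa using! this.tendsto.mono_left nhdsWithin_le_nhds
    refine le_of_tendsto_of_tendsto ((hA.tendsto v).comp hc) ((hB.tendsto v).comp hc) ?_
    filter_upwards [self_mem_nhdsWithin] with t ht
    refine hAB _ ?_
    rw [map_add, map_smul, ha, smul_eq_mul]
    have : (0 : ℝ) < t := ht
    linarith
  rcases le_total (fderiv ℝ ρ q v) 0 with h1 | h1
  · exact key v h1
  · rw [← hAe, ← hBe]
    exact key (-v) (by rw [map_neg]; linarith)

/-- At a boundary zero of `f`, a linear bound of `f` bounds all first derivatives. -/
theorem norm_fderivWithin_le (h : IsDefining U ρ T) (hq : q ∈ T) (h0 : ρ q = 0) {F : Type*}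
    [NormedAddCommGroup F] [NormedSpace ℝ F] {f : Cn n → F}
    (hf : DifferentiableWithinAt ℝ f T q) (hfq : f q = 0) {C : ℝ}
    (hC : ∀ᶠ y in 𝓝[T] q, ‖f y‖ ≤ C * ‖y - q‖) (v : Cn n) :
    ‖fderivWithin ℝ f T q v‖ ≤ C * ‖v‖ := by
  refine h.le_of_forall_inward hq h0 (A := fun v => ‖fderivWithin ℝ f T q v‖)
    (B := fun v => C * ‖v‖) (by fun_prop) (by fun_prop) (by simp) (by simp) (fun v hv => ?_) v
  refine le_of_tendsto (h.hasLimit_slope hq h0 hf hv).norm ?_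
  filter_upwards [(h.tendsto_ray hq h0 hv).eventually hC, self_mem_nhdsWithin] with t ht ht'
  have ht0 : (0 : ℝ) < t := ht'
  rw [hfq, sub_zero, norm_smul, norm_inv, Real.norm_of_nonneg ht0.le]
  rw [add_sub_cancel_left, norm_smul, Real.norm_of_nonneg ht0.le] at ht
  calc t⁻¹ * ‖f (q + t • v)‖ ≤ t⁻¹ * (C * (t * ‖v‖)) :=
        mul_le_mul_of_nonneg_left ht (inv_nonneg.2 ht0.le)
    _ = C * ‖v‖ := by field_simp

/-- A function bounded by a multiple of the defining function has its differential proportional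
to that of the defining function. -/
theorem exists_fderivWithin_eq_smul (h : IsDefining U ρ T) (hq : q ∈ T) (h0 : ρ q = 0) {F : Type*}
    [NormedAddCommGroup F] [NormedSpace ℝ F] {f : Cn n → F}
    (hf : DifferentiableWithinAt ℝ f T q) (hfq : f q = 0) {C : ℝ}
    (hC : ∀ᶠ y in 𝓝[T] q, ‖f y‖ ≤ C * (-ρ y)) :
    ∃ c : F, ‖c‖ ≤ C ∧ ∀ v, fderivWithin ℝ f T q v = (fderiv ℝ ρ q v) • c := by
  have hρd : fderivWithin ℝ ρ T q = fderiv ℝ ρ q :=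
    (h.hasFDerivAt (h.subset hq)).hasFDerivWithinAt.fderivWithin (h.uniqueDiffWithinAt hq)
  have key : ∀ v, ‖fderivWithin ℝ f T q v‖ ≤ C * |fderiv ℝ ρ q v| := by
    refine h.le_of_forall_inward hq h0 (A := fun v => ‖fderivWithin ℝ f T q v‖)
      (B := fun v => C * |fderiv ℝ ρ q v|) (by fun_prop) (by fun_prop) (by simp) (by simp)
      (fun v hv => ?_)
    have l1 := (h.hasLimit_slope hq h0 hf hv).norm
    have l2 := (h.hasLimit_slope hq h0
      (h.hasFDerivAt (h.subset hq)).differentiableAt.differentiableWithinAt hv).neg.const_mul C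
    rw [hρd, ← abs_of_neg hv] at l2
    refine le_of_tendsto_of_tendsto l1 l2 ?_
    filter_upwards [(h.tendsto_ray hq h0 hv).eventually hC, self_mem_nhdsWithin] with t ht ht'
    have ht0 : (0 : ℝ) < t := ht'
    rw [hfq, sub_zero, norm_smul, norm_inv, Real.norm_of_nonneg ht0.le, h0, sub_zero, smul_eq_mul]
    calc t⁻¹ * ‖f (q + t • v)‖ ≤ t⁻¹ * (C * (-ρ (q + t • v))) :=
          mul_le_mul_of_nonneg_left ht (inv_nonneg.2 ht0.le)
      _ = _ := by ring
  obtain ⟨a, ha⟩ := h.exists_fderiv_eq (h.subset hq) h0 1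
  refine ⟨fderivWithin ℝ f T q a, by simpa [ha] using key a, fun v => ?_⟩
  have := key (v - fderiv ℝ ρ q v • a)
  rw [map_sub, map_sub, map_smul, map_smul, ha, smul_eq_mul, mul_one, sub_self, abs_zero,
    mul_zero] at this
  exact sub_eq_zero.1 (norm_le_zero_iff.1 this)

/-- Points of the domain near a boundary point are joined to the boundary by short segments within
the domain. -/
theorem exists_segment (h : IsDefining U ρ T) {p : Cn n} (hp : p ∈ U) (hp0 : ρ p = 0) :
    ∃ C : ℝ, 0 ≤ C ∧ ∀ ε > 0, ∃ δ > 0, ∀ z ∈ T, dist z p < δ →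
      ∃ q ∈ T, ρ q = 0 ∧ dist q p < ε ∧ ‖z - q‖ ≤ C * (-ρ z) ∧ segment ℝ z q ⊆ T := by
  obtain ⟨a, ha⟩ := h.exists_fderiv_eq hp hp0 1
  have hev : ∀ᶠ z in 𝓝 p, z ∈ U ∧ 1 / 2 < fderiv ℝ ρ z a := by
    have : ContinuousAt (fun z => fderiv ℝ ρ z a) p :=
      (((h.contDiffAt hp).fderiv_right (m := 1) (by decide)).continuousAt).clm_apply
        continuousAt_const
    exact (h.isOpen.eventually_mem hp).and (this.eventually_const_lt (by norm_num [ha]))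
  obtain ⟨r, hr, hball⟩ := Metric.eventually_nhds_iff.1 hev
  refine ⟨2 * ‖a‖, by positivity, fun ε hε => ?_⟩
  set r' := min r ε with hr'
  have hr'0 : 0 < r' := lt_min hr hε
  have hcont : ∀ᶠ z in 𝓝 p, 2 * ‖a‖ * (-ρ z) < r' / 2 := by
    have hc : ContinuousAt (fun z => 2 * ‖a‖ * (-ρ z)) p :=
      continuousAt_const.mul (h.contDiffAt hp).continuousAt.neg
    exact hc.eventually_lt_const (by simpa [hp0] using hr'0)
  obtain ⟨δ, hδ, hδb⟩ := Metric.eventually_nhds_iff.1 hcont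
  refine ⟨min δ (r' / 2), lt_min hδ (by positivity), fun z hz hzp => ?_⟩
  have hz1 := hδb (hzp.trans_le (min_le_left _ _))
  have hz2 : dist z p < r' / 2 := hzp.trans_le (min_le_right _ _)
  set L := 2 * (-ρ z) with hL
  have hL0 : 0 ≤ L := by have := h.nonpos hz; linarith
  have hin : ∀ s ∈ Icc 0 L, dist (z + s • a) p < r' := by
    intro s hs
    calc dist (z + s • a) p ≤ dist (z + s • a) z + dist z p := dist_triangle _ _ _
      _ = s * ‖a‖ + dist z p := by
          rw [dist_eq_norm, add_sub_cancel_left, norm_smul, Real.norm_of_nonneg hs.1]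
      _ ≤ L * ‖a‖ + dist z p := by gcongr; exact hs.2
      _ < r' := by rw [hL]; nlinarith
  have hline : ∀ t : ℝ, HasDerivAt (fun t : ℝ => z + t • a) a t := fun t => by
    simpa using ((hasDerivAt_id t).smul_const a).const_add z
  have hder : ∀ s ∈ Icc 0 L, HasDerivAt (fun s : ℝ => ρ (z + s • a))
      (fderiv ℝ ρ (z + s • a) a) s := fun s hs =>
    (h.hasFDerivAt (hball ((hin s hs).trans_le (min_le_left _ _))).1).comp_hasDerivAt s (hline s)
  have hcontL : ContinuousOn (fun s : ℝ => ρ (z + s • a)) (Icc 0 L) :=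
    fun s hs => (hder s hs).continuousAt.continuousWithinAt
  have hmono := (convex_Icc 0 L).mul_sub_le_image_sub_of_le_deriv hcontL
    (fun s hs => (hder s (interior_subset hs)).differentiableAt.differentiableWithinAt)
    (C := 1 / 2) (fun s hs => by
      rw [(hder s (interior_subset hs)).deriv]
      exact (hball ((hin s (interior_subset hs)).trans_le (min_le_left _ _))).2.le)
  have hend : 0 ≤ ρ (z + L • a) := by
    have := hmono 0 ⟨le_rfl, hL0⟩ L ⟨hL0, le_rfl⟩ hL0
    simp only [zero_smul, add_zero] at this
    linarith
  obtain ⟨s, hs, hs0⟩ := intermediate_value_Icc hL0 hcontL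
    (show (0 : ℝ) ∈ Icc _ _ from ⟨by simpa using h.nonpos hz, hend⟩)
  have hs0' : ρ (z + s • a) = 0 := hs0
  have hsegT : ∀ s' ∈ Icc 0 s, z + s' • a ∈ T := by
    intro s' hs'
    have hs'L : s' ∈ Icc 0 L := ⟨hs'.1, hs'.2.trans hs.2⟩
    refine (h.mem_iff (hball ((hin s' hs'L).trans_le (min_le_left _ _))).1).2 ?_
    have := hmono s' hs'L s hs hs'.2
    simp only [hs0'] at this
    linarith [hs'.2]
  refine ⟨z + s • a, hsegT s ⟨hs.1, le_rfl⟩, hs0', (hin s hs).trans_le (min_le_right _ _), ?_, ?_⟩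
  · rw [sub_add_cancel_left, norm_neg, norm_smul, Real.norm_of_nonneg hs.1]
    calc s * ‖a‖ ≤ L * ‖a‖ := by gcongr; exact hs.2
      _ = _ := by rw [hL]; ring
  · rw [segment_eq_image']
    rintro _ ⟨θ, hθ, rfl⟩
    simp only [add_sub_cancel_left, smul_smul]
    exact hsegT _ ⟨mul_nonneg hθ.1 hs.1, mul_le_of_le_one_left hs.1 hθ.2⟩

end IsDefining

theorem IsLocallySmoothDomain.exists_isDefining (hT : IsLocallySmoothDomain T) (hz : z ∈ T) :
    ∃ (U : Set (Cn n)) (ρ : Cn n → ℝ), z ∈ U ∧ IsDefining U ρ (T ∩ U) := by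
  obtain ⟨U, ρ, hU, hzU, hs, hr, he⟩ := hT z hz
  exact ⟨U, ρ, hzU, hU, hs, hr, he⟩

theorem IsLocallySmoothDomain.isRegular (hT : IsLocallySmoothDomain T) : Regular T := by
  refine ⟨fun z hz => ?_, fun z hz => ?_⟩
  · obtain ⟨U, ρ, hzU, h⟩ := hT.exists_isDefining hz
    exact (uniqueDiffWithinAt_inter (h.isOpen.mem_nhds hzU)).1 (h.uniqueDiffWithinAt ⟨hz, hzU⟩)
  · obtain ⟨U, ρ, hzU, h⟩ := hT.exists_isDefining hz
    exact closure_mono (interior_mono inter_subset_left) (h.mem_closure_interior ⟨hz, hzU⟩)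

theorem Regular.inter (hT : Regular T) {V : Set (Cn n)} (hV : IsOpen V) : Regular (T ∩ V) := by
  refine ⟨hT.1.inter hV, fun z hz => ?_⟩
  rw [interior_inter, hV.interior_eq, inter_comm]
  exact hV.inter_closure ⟨hz.2, hT.2 hz.1⟩

end Domain

/-! ### Barriers for uniformly elliptic operators -/

section Barrier

variable {n : ℕ} {T U : Set (Cn n)} {ρ : Cn n → ℝ} {z p q : Cn n}

theorem exists_eventually_bound {X ι F : Type*} [TopologicalSpace X] [Finite ι]
    [NormedAddCommGroup F] {S : Set X} {x : X} {f : ι → X → F}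
    (hf : ∀ i, ContinuousWithinAt (f i) S x) :
    ∃ C : ℝ, 0 < C ∧ ∀ᶠ y in 𝓝[S] x, ∀ i, ‖f i y‖ ≤ C := by
  have := Fintype.ofFinite ι
  refine ⟨∑ i, ‖f i x‖ + 1, by positivity, eventually_all.2 fun i => ?_⟩
  have h : ‖f i x‖ < ∑ i, ‖f i x‖ + 1 :=
    (Finset.single_le_sum (f := fun i => ‖f i x‖) (fun _ _ => norm_nonneg _)
      (Finset.mem_univ i)).trans_lt (lt_add_one _)
  filter_upwards [(hf i).norm.eventually_lt_const h] with y hy using hy.le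

theorem dz_coord (hT : UniqueDiffWithinAt ℝ T z) (j k : Fin n) (c : ℂ) :
    dz T j (fun w => w k - c) z = if k = j then 1 else 0 := by
  have h : HasFDerivWithinAt (fun w : Cn n => w k - c)
      ((EuclideanSpace.proj k : Cn n →L[ℂ] ℂ).restrictScalars ℝ) T z :=
    (((EuclideanSpace.proj k : Cn n →L[ℂ] ℂ).restrictScalars ℝ).hasFDerivAt.sub_const
      c).hasFDerivWithinAt
  rw [dz, h.fderivWithin hT]
  simp only [ContinuousLinearMap.coe_restrictScalars', PiLp.proj_apply, PiLp.single_apply]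
  split_ifs
  · rw [I_mul_I]; norm_num
  · simp

theorem dzbar_coord (hT : UniqueDiffWithinAt ℝ T z) (j k : Fin n) (c : ℂ) :
    dzbar T j (fun w => w k - c) z = 0 := by
  have h : HasFDerivWithinAt (fun w : Cn n => w k - c)
      ((EuclideanSpace.proj k : Cn n →L[ℂ] ℂ).restrictScalars ℝ) T z :=
    (((EuclideanSpace.proj k : Cn n →L[ℂ] ℂ).restrictScalars ℝ).hasFDerivAt.sub_const
      c).hasFDerivWithinAt
  rw [dzbar, h.fderivWithin hT]
  simp only [ContinuousLinearMap.coe_restrictScalars', PiLp.proj_apply, PiLp.single_apply]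
  split_ifs
  · rw [I_mul_I]; norm_num
  · simp

theorem contDiff_coord (k : Fin n) (c : ℂ) : ContDiff ℝ ∞ fun w : Cn n => w k - c :=
  (((EuclideanSpace.proj k : Cn n →L[ℂ] ℂ).restrictScalars ℝ).contDiff).sub contDiff_const

theorem ofReal_normSq_sub (w q : Cn n) : ((‖w - q‖ ^ 2 : ℝ) : ℂ) =
    ∑ k, (w k - q k) * (starRingEnd ℂ) (w k - q k) := by
  rw [EuclideanSpace.norm_sq_eq, ofReal_sum]
  refine Finset.sum_congr rfl fun k _ => ?_
  rw [mul_conj', ofReal_pow, PiLp.sub_apply]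

theorem contDiff_normSq (q : Cn n) {k : WithTop ℕ∞} : ContDiff ℝ k fun w : Cn n => ‖w - q‖ ^ 2 :=
  (contDiff_id.sub contDiff_const).norm_sq ℝ

theorem dz_normSq (hT : UniqueDiffOn ℝ T) (hz : z ∈ T) (q : Cn n) (j : Fin n) :
    dz T j (fun w => ((‖w - q‖ ^ 2 : ℝ) : ℂ)) z = (starRingEnd ℂ) (z j - q j) := by
  have hd : ∀ k, DifferentiableWithinAt ℝ (fun w : Cn n => w k - q k) T z := fun k =>
    ((contDiff_coord k (q k)).differentiable (by simp)).differentiableAt.differentiableWithinAt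
  have hd' : ∀ k, DifferentiableWithinAt ℝ (fun w : Cn n => (starRingEnd ℂ) (w k - q k)) T z :=
    fun k => (contDiffOn_conj (contDiff_coord k (q k)).contDiffOn).differentiableOn (by simp) z hz
  simp only [ofReal_normSq_sub]
  rw [dz_sum _ (hT z hz) fun k _ => (hd k).fun_mul (hd' k)]
  simp only [dz_mul (hT z hz) (hd _) (hd' _), dz_conj (hT z hz) (hd _), dz_coord (hT z hz),
    dzbar_coord (hT z hz)]
  simp

theorem dzbar_normSq (hT : UniqueDiffOn ℝ T) (hz : z ∈ T) (q : Cn n) (j : Fin n) :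
    dzbar T j (fun w => ((‖w - q‖ ^ 2 : ℝ) : ℂ)) z = z j - q j := by
  rw [dzbar_ofReal (hT z hz) ((contDiff_normSq q (k := 1)).differentiable one_ne_zero
    |>.differentiableAt.differentiableWithinAt),
    dz_normSq hT hz, conj_conj]

theorem hess_normSq (hT : UniqueDiffOn ℝ T) (hz : z ∈ T) (q : Cn n) :
    hess T (fun w => ((‖w - q‖ ^ 2 : ℝ) : ℂ)) z = 1 := by
  ext j k
  simp only [hess, of_apply]
  rw [dz_congr (g := fun w => w k - q k) (fun w hw => dzbar_normSq hT hw q k) hz,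
    dz_coord (hT z hz), one_apply]
  simp only [eq_comm]

/-- Ellipticity of a coefficient matrix with explicit constants. -/
structure Elliptic (l L : ℝ) (G : Matrix (Fin n) (Fin n) ℂ) : Prop where
  posSemidef : G.PosSemidef
  lower : ∀ x, l * ∑ i, ‖x i‖ ^ 2 ≤ quad G x
  upper : ∀ i j, ‖G i j‖ ≤ L

theorem norm_trace_mul_le {G H : Matrix (Fin n) (Fin n) ℂ} {a b : ℝ} (hG : ∀ i j, ‖G i j‖ ≤ a)
    (hH : ∀ i j, ‖H i j‖ ≤ b) : ‖(G * H).trace‖ ≤ n * n * (a * b) := by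
  rw [trace]
  refine (norm_sum_le _ _).trans ?_
  have : ∀ i, ‖(G * H).diag i‖ ≤ n * (a * b) := fun i => by
    rw [diag_apply, mul_apply]
    refine (norm_sum_le _ _).trans ((Finset.sum_le_sum fun j _ => ?_).trans_eq
      (b := ∑ _j : Fin n, a * b) (by simp))
    rw [norm_mul]
    exact mul_le_mul (hG i j) (hH j i) (norm_nonneg _) ((norm_nonneg _).trans (hG i j))
  refine (Finset.sum_le_sum fun i _ => this i).trans_eq ?_
  simp [mul_assoc]

theorem abs_trace_mul_le {G H : Matrix (Fin n) (Fin n) ℂ} {a b : ℝ} (hG : ∀ i j, ‖G i j‖ ≤ a)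
    (hH : ∀ i j, ‖H i j‖ ≤ b) : |(G * H).trace.re| ≤ n * n * (a * b) :=
  (abs_re_le_norm _).trans (norm_trace_mul_le hG hH)

/-- The mixed Hessian of the barrier `d - N d²`, `d = -ρ`. -/
theorem complexHessian_neg_sub_sq (hT : UniqueDiffOn ℝ T) (hρ : ContDiffOn ℝ 2 ρ T) (hz : z ∈ T)
    (N : ℝ) : complexHessian T (fun w => -ρ w - N * ρ w ^ 2) z =
      -((1 + 2 * N * ρ z : ℝ) : ℂ) • complexHessian T ρ z -
      ((2 * N : ℝ) : ℂ) • vecMulVec (dzv T (fun w => (ρ w : ℂ)) z)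
        (star (dzv T (fun w => (ρ w : ℂ)) z)) := by
  have hc := contDiffOn_ofReal hρ
  have hcc : ContDiffOn ℝ 2 (fun w => (ρ w : ℂ) * (ρ w : ℂ)) T := hc.mul hc
  have he : (fun w => ((-ρ w - N * ρ w ^ 2 : ℝ) : ℂ)) =
      fun w => -(ρ w : ℂ) - (N : ℂ) * ((ρ w : ℂ) * (ρ w : ℂ)) := by
    funext w; push_cast; ring
  rw [complexHessian_eq, complexHessian_eq, he, hess_sub hT hc.neg (contDiffOn_const.mul hcc) hz,
    hess_neg hT hc hz, hess_const_mul hT hcc _ hz, hess_mul hT hc hc hz,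
    dzbv_ofReal (hT z hz) (hρ.differentiableOn two_ne_zero z hz)]
  ext i j
  simp only [Matrix.sub_apply, Matrix.neg_apply, Matrix.smul_apply, Matrix.add_apply, smul_eq_mul]
  push_cast
  ring

theorem isCompact_inter_closedBall (h : IsDefining U ρ T) {R : ℝ}
    (hR : Metric.closedBall q R ⊆ U) : IsCompact (T ∩ Metric.closedBall q R) := by
  have : T ∩ Metric.closedBall q R = Metric.closedBall q R ∩ ρ ⁻¹' Iic 0 := by
    ext w
    simp only [mem_inter_iff, mem_preimage, mem_Iic]
    refine ⟨fun hw => ⟨hw.2, h.nonpos hw.1⟩, fun hw => ⟨(h.mem_iff (hR hw.1)).2 hw.2, hw.1⟩⟩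
  rw [this]
  exact (isCompact_closedBall q R).of_isClosed_subset
    ((h.smooth.continuousOn.mono hR).preimage_isClosed_of_isClosed Metric.isClosed_closedBall
      isClosed_Iic) inter_subset_left

theorem dzv_ne_zero (h : IsDefining U ρ T) (hp : p ∈ T) (h0 : ρ p = 0) :
    dzv T (fun w => (ρ w : ℂ)) p ≠ 0 := by
  intro hz
  have hd : DifferentiableWithinAt ℝ ρ T p :=
    (h.hasFDerivAt (h.subset hp)).differentiableAt.differentiableWithinAt
  apply h.regular p (h.subset hp) h0
  ext v
  have h1 : ((fderivWithin ℝ ρ T p v : ℝ) : ℂ) = 0 := by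
    rw [← fderivWithin_ofReal (h.uniqueDiffWithinAt hp) hd, fderivWithin_apply_eq]
    refine Finset.sum_eq_zero fun j _ => ?_
    have : dz T j (fun w => (ρ w : ℂ)) p = 0 := congrFun hz j
    rw [dzbar_ofReal (h.uniqueDiffWithinAt hp) hd, this]
    simp
  rw [(h.hasFDerivAt (h.subset hp)).hasFDerivWithinAt.fderivWithin (h.uniqueDiffWithinAt hp)] at h1
  simpa using h1

theorem IsDefining.contDiffOn (h : IsDefining U ρ T) {k : WithTop ℕ∞} (hk : k ≤ (∞ : WithTop ℕ∞)) :
    ContDiffOn ℝ k ρ T := (h.smooth.mono h.subset).of_le hk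

/-- Uniform control of the defining function near a boundary point. -/
theorem exists_defining_bounds (h : IsDefining U ρ T) (hp : p ∈ T) (h0 : ρ p = 0) :
    ∃ C c : ℝ, 0 < C ∧ 0 < c ∧ ∃ R > 0, Metric.closedBall p R ⊆ U ∧
      (∀ y ∈ T, dist y p ≤ R → (∀ i j, ‖complexHessian T ρ y i j‖ ≤ C) ∧
        c ≤ ∑ i, ‖dz T i (fun w => (ρ w : ℂ)) y‖ ^ 2) ∧
      ∀ y ∈ Metric.closedBall p R, ∀ y' ∈ Metric.closedBall p R, |ρ y - ρ y'| ≤ C * ‖y - y'‖ := by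
  have hreg := h.isRegular
  have hc : ContDiffOn ℝ ∞ (fun w => (ρ w : ℂ)) T := contDiffOn_ofReal (h.contDiffOn le_rfl)
  have hdz : ∀ i, ContDiffOn ℝ ∞ (dz T i (fun w => (ρ w : ℂ))) T :=
    fun i => contDiffOn_dz hreg.1 hc le_rfl i
  obtain ⟨C₁, hC₁, hb₁⟩ := exists_eventually_bound (S := T) (x := p)
    (f := fun (ij : Fin n × Fin n) y => complexHessian T ρ y ij.1 ij.2) fun ij =>
      (contDiffOn_dz (k := ∞) hreg.1 (contDiffOn_dzbar (k := ∞) hreg.1 hc le_rfl ij.2) le_rfl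
        ij.1).continuousOn p hp
  obtain ⟨k, hk⟩ : ∃ k, dz T k (fun w => (ρ w : ℂ)) p ≠ 0 := by
    by_contra! hcon
    exact dzv_ne_zero h hp h0 (funext hcon)
  have hpos : 0 < ∑ i, ‖dz T i (fun w => (ρ w : ℂ)) p‖ ^ 2 :=
    Finset.sum_pos' (fun i _ => by positivity) ⟨k, Finset.mem_univ k, by positivity⟩
  have hb₂ : ∀ᶠ y in 𝓝[T] p, (∑ i, ‖dz T i (fun w => (ρ w : ℂ)) p‖ ^ 2) / 2 <
      ∑ i, ‖dz T i (fun w => (ρ w : ℂ)) y‖ ^ 2 := by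
    have : ContinuousWithinAt (fun y => ∑ i, ‖dz T i (fun w => (ρ w : ℂ)) y‖ ^ 2) T p :=
      tendsto_finsetSum _ fun i _ => (((hdz i).continuousOn p hp).norm.pow 2)
    exact this.eventually_const_lt (half_lt_self hpos)
  obtain ⟨K, V, hV, hlip⟩ :=
    ((h.contDiffAt (h.subset hp)).of_le (m := 1) (by decide)).exists_lipschitzOnWith
  obtain ⟨R, hR, hball⟩ := Metric.mem_nhdsWithin_iff.1 (hb₁.and hb₂)
  obtain ⟨R', hR', hball'⟩ := Metric.mem_nhds_iff.1
    (inter_mem hV (h.isOpen.mem_nhds (h.subset hp)))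
  refine ⟨C₁ + K, _, by positivity, half_pos hpos, min R R' / 2, half_pos (lt_min hR hR'),
    ?_, ?_, ?_⟩
  · refine (Metric.closedBall_subset_ball ?_).trans (hball'.trans inter_subset_right)
    linarith [min_le_right R R', lt_min hR hR']
  · intro y hy hyp
    have := hball ⟨Metric.mem_ball.2 (hyp.trans_lt (by linarith [min_le_left R R', lt_min hR hR'])),
      hy⟩
    exact ⟨fun i j => (this.1 (i, j)).trans (by simp), this.2.le⟩
  · have hsub : Metric.closedBall p (min R R' / 2) ⊆ V :=
      (Metric.closedBall_subset_ball (by linarith [min_le_right R R', lt_min hR hR'])).trans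
        (hball'.trans inter_subset_left)
    intro y hy y' hy'
    have := hlip.dist_le_mul y (hsub hy) y' (hsub hy')
    rw [Real.dist_eq, dist_eq_norm] at this
    exact this.trans (mul_le_mul_of_nonneg_right (by linarith) (norm_nonneg _))

theorem complexHessian_add_real (hT : UniqueDiffOn ℝ T) {u v : Cn n → ℝ} (hu : ContDiffOn ℝ 2 u T)
    (hv : ContDiffOn ℝ 2 v T) (hz : z ∈ T) :
    complexHessian T (fun w => u w + v w) z = complexHessian T u z + complexHessian T v z := by
  rw [complexHessian_eq, complexHessian_eq, complexHessian_eq,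
    ← hess_add hT (contDiffOn_ofReal hu) (contDiffOn_ofReal hv) hz]
  simp only [ofReal_add]

theorem complexHessian_sub_real (hT : UniqueDiffOn ℝ T) {u v : Cn n → ℝ} (hu : ContDiffOn ℝ 2 u T)
    (hv : ContDiffOn ℝ 2 v T) (hz : z ∈ T) :
    complexHessian T (fun w => u w - v w) z = complexHessian T u z - complexHessian T v z := by
  rw [complexHessian_eq, complexHessian_eq, complexHessian_eq,
    ← hess_sub hT (contDiffOn_ofReal hu) (contDiffOn_ofReal hv) hz]
  simp only [ofReal_sub]

theorem complexHessian_const_mul (hT : UniqueDiffOn ℝ T) {u : Cn n → ℝ}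
    (hu : ContDiffOn ℝ 2 u T) (c : ℝ) (hz : z ∈ T) :
    complexHessian T (fun w => c * u w) z = (c : ℂ) • complexHessian T u z := by
  rw [complexHessian_eq, complexHessian_eq, ← hess_const_mul hT (contDiffOn_ofReal hu) _ hz]
  simp only [ofReal_mul]

theorem complexHessian_const (c : ℝ) : complexHessian T (fun _ => c) z = 0 := hess_const _

theorem boundary_barrier_arith {κ N r τ θ s m : ℝ} (hτ : |τ| ≤ κ) (hN : 0 ≤ N) (hr : r ≤ 0)
    (hNr : N * -r ≤ 1 / 4) (hθ : 2 * κ + 1 ≤ 2 * N * θ) (hs : s ≤ m) (hm : 0 ≤ m) :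
    s + (1 + m) * (-(1 + 2 * N * r) * τ - 2 * N * θ) ≤ -1 := by
  obtain ⟨h1, h2⟩ := abs_le.1 hτ
  have u1 : 0 ≤ 1 + 2 * N * r := by linarith
  have u2 : 1 + 2 * N * r ≤ 1 := by nlinarith
  have u3 : -(1 + 2 * N * r) * τ ≤ 1 * κ := by
    nlinarith [mul_le_mul_of_nonneg_left h1 u1, mul_le_mul_of_nonneg_right u2 (by linarith : 0 ≤ κ)]
  have u4 := mul_le_mul_of_nonneg_left
    (by linarith : -(1 + 2 * N * r) * τ - 2 * N * θ ≤ -1) (by linarith : 0 ≤ 1 + m)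
  linarith

set_option maxHeartbeats 400000 in
/-- A barrier at boundary points near `p`: it vanishes at `q`, is at least `1` at distance `R`
from `q`, and is a strict supersolution for all operators with given ellipticity constants. -/
theorem exists_boundary_barrier (h : IsDefining U ρ T) (hp : p ∈ T) (h0 : ρ p = 0) {l : ℝ}
    (hl : 0 < l) (L : ℝ) {R₂ : ℝ} (hR₂ : 0 < R₂) :
    ∃ C R : ℝ, 0 < C ∧ 0 < R ∧ 2 * R ≤ R₂ ∧ Metric.closedBall p (2 * R) ⊆ U ∧
      ∀ q ∈ T, ρ q = 0 → dist q p ≤ R → ∃ b : Cn n → ℝ, ContDiffOn ℝ 2 b T ∧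
        ∀ y ∈ T, dist y q ≤ R → 0 ≤ b y ∧ b y ≤ C * ‖y - q‖ ∧ (dist y q = R → 1 ≤ b y) ∧
          ∀ G, Elliptic l L G → (G * complexHessian T b y).trace.re ≤ -1 := by
  obtain ⟨C₁, c, hC₁, hc, R₀, hR₀, hU, hbd, hlip⟩ := exists_defining_bounds h hp h0
  set R₁ := min R₀ R₂ with hR₁d
  have hR₁ : 0 < R₁ := lt_min hR₀ hR₂
  have hR₁₀ : R₁ ≤ R₀ := min_le_left _ _
  have hR₁₂ : R₁ ≤ R₂ := min_le_right _ _
  clear_value R₁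
  set κ := (n : ℝ) * n * (|L| * C₁) with hκ
  have hκ0 : 0 ≤ κ := by positivity
  -- The barrier is `|z - q|² / R² + A (d - N d²)` with `d = -ρ`. The term `-N d²` dominates the
  -- bounded Hessian of `ρ`, and `R` is so small that `N d ≤ 1/4` on the half ball.
  set N := (2 * κ + 1) / (2 * l * c) with hN
  have hN0 : 0 < N := by positivity
  set R := min (R₁ / 2) (1 / (4 * N * C₁)) with hR
  have hR0 : 0 < R := lt_min (by positivity) (by positivity)
  have hRR : 2 * R ≤ R₁ := by linarith [min_le_left (R₁ / 2) (1 / (4 * N * C₁))]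
  have hRN : C₁ * R ≤ 1 / (4 * N) := by
    have := mul_le_mul_of_nonneg_left (min_le_right (R₁ / 2) (1 / (4 * N * C₁))) hC₁.le
    calc C₁ * R ≤ C₁ * (1 / (4 * N * C₁)) := this
      _ = 1 / (4 * N) := by field_simp
  set A := 1 + n * |L| / R ^ 2 with hA
  have hA0 : 0 < A := by positivity
  refine ⟨1 / R + A * C₁, R, by positivity, hR0,
    hRR.trans hR₁₂, (Metric.closedBall_subset_closedBall (hRR.trans hR₁₀)).trans hU,
    fun q hq hq0 hqp => ?_⟩
  have hreg := h.isRegular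
  have hρ2 : ContDiffOn ℝ 2 ρ T := h.contDiffOn (by decide)
  have hs1 : ContDiffOn ℝ 2 (fun w => (1 / R ^ 2) * ‖w - q‖ ^ 2) T :=
    contDiffOn_const.mul (contDiff_normSq q).contDiffOn
  have hs2 : ContDiffOn ℝ 2 (fun w => -ρ w - N * ρ w ^ 2) T :=
    hρ2.neg.sub (contDiffOn_const.mul (hρ2.pow 2))
  refine ⟨fun w => (1 / R ^ 2) * ‖w - q‖ ^ 2 + A * (-ρ w - N * ρ w ^ 2),
    hs1.add (contDiffOn_const.mul hs2), fun y hy hyq => ?_⟩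
  have hyp : dist y p ≤ 2 * R := by linarith [dist_triangle y q p]
  have hyR : ‖y - q‖ ≤ R := by rwa [← dist_eq_norm]
  have hρy : ρ y ≤ 0 := h.nonpos hy
  have hρy' : -ρ y ≤ C₁ * ‖y - q‖ := by
    have := hlip y (Metric.mem_closedBall.2 (hyp.trans (hRR.trans hR₁₀))) q
      (Metric.mem_closedBall.2 (hqp.trans (by linarith)))
    rw [hq0, sub_zero, abs_of_nonpos hρy] at this
    exact this
  have hρN : N * (-ρ y) ≤ 1 / 4 := by
    have h1 : -ρ y ≤ 1 / (4 * N) :=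
      hρy'.trans ((mul_le_mul_of_nonneg_left hyR hC₁.le).trans hRN)
    calc N * (-ρ y) ≤ N * (1 / (4 * N)) := mul_le_mul_of_nonneg_left h1 hN0.le
      _ = 1 / 4 := by field_simp
  have hnn : 0 ≤ -ρ y - N * ρ y ^ 2 := by nlinarith
  refine ⟨by positivity, ?_, fun hyd => ?_, fun G hG => ?_⟩
  · have e1 : (1 / R ^ 2) * ‖y - q‖ ^ 2 ≤ 1 / R * ‖y - q‖ := by
      rw [div_mul_eq_mul_div, div_mul_eq_mul_div, one_mul, one_mul,
        div_le_div_iff₀ (by positivity) hR0]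
      nlinarith [mul_le_mul_of_nonneg_left hyR (mul_nonneg (norm_nonneg (y - q)) hR0.le)]
    have e2 : A * (-ρ y - N * ρ y ^ 2) ≤ A * (C₁ * ‖y - q‖) := by
      refine mul_le_mul_of_nonneg_left ?_ hA0.le
      nlinarith [sq_nonneg (ρ y)]
    nlinarith
  · rw [dist_eq_norm] at hyd
    change 1 ≤ 1 / R ^ 2 * ‖y - q‖ ^ 2 + A * (-ρ y - N * ρ y ^ 2)
    rw [hyd]
    have : 1 / R ^ 2 * R ^ 2 = 1 := by field_simp
    rw [this]
    nlinarith [mul_nonneg hA0.le hnn]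
  · have hH : complexHessian T
        (fun w => (1 / R ^ 2) * ‖w - q‖ ^ 2 + A * (-ρ w - N * ρ w ^ 2)) y =
        ((1 / R ^ 2 : ℝ) : ℂ) • (1 : Matrix (Fin n) (Fin n) ℂ) +
        (A : ℂ) • (-((1 + 2 * N * ρ y : ℝ) : ℂ) • complexHessian T ρ y -
        ((2 * N : ℝ) : ℂ) • vecMulVec (dzv T (fun w => (ρ w : ℂ)) y)
          (star (dzv T (fun w => (ρ w : ℂ)) y))) := by
      rw [complexHessian_add_real hreg.1 hs1 (contDiffOn_const.mul hs2) hy,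
        complexHessian_const_mul hreg.1 (contDiff_normSq q).contDiffOn _ hy,
        complexHessian_const_mul hreg.1 hs2 _ hy, complexHessian_neg_sub_sq hreg.1 hρ2 hy,
        complexHessian_eq, hess_normSq hreg.1 hy]
    rw [hH]
    simp only [Matrix.mul_add, Matrix.mul_sub, Matrix.mul_smul, Matrix.mul_one, trace_add,
      trace_sub, trace_smul, add_re, sub_re, smul_eq_mul, re_ofReal_mul, ← ofReal_neg,
      trace_mul_vecMulVec_star]
    have t1 : G.trace.re ≤ n * |L| := by
      rw [trace, re_sum]
      calc ∑ i, (G.diag i).re ≤ ∑ _i : Fin n, |L| := Finset.sum_le_sum fun i _ =>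
            (re_le_norm _).trans ((hG.upper i i).trans (le_abs_self L))
        _ = n * |L| := by simp
    have t2 := abs_trace_mul_le (fun i j => (hG.upper i j).trans (le_abs_self L))
      (hbd y hy (hyp.trans (hRR.trans hR₁₀))).1
    have t3 : l * c ≤ quad G (dzv T (fun w => (ρ w : ℂ)) y) :=
      (mul_le_mul_of_nonneg_left (hbd y hy (hyp.trans (hRR.trans hR₁₀))).2 hl.le).trans (hG.lower _)
    rw [← hκ] at t2
    have t6 : 2 * κ + 1 ≤ 2 * N * quad G (dzv T (fun w => (ρ w : ℂ)) y) := by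
      calc 2 * κ + 1 = 2 * N * (l * c) := by rw [hN]; field_simp
        _ ≤ _ := mul_le_mul_of_nonneg_left t3 (by positivity)
    have t7 : 1 / R ^ 2 * G.trace.re ≤ n * |L| / R ^ 2 := by
      rw [div_mul_eq_mul_div, one_mul]
      gcongr
    have t8 : 0 ≤ n * |L| / R ^ 2 := by positivity
    clear_value κ N R
    exact boundary_barrier_arith t2 hN0.le hρy hρN t6 t7 t8

/-- Growth of subsolutions at the boundary. -/
theorem le_mul_boundary_barrier (h : IsDefining U ρ T) {R : ℝ} (hR : Metric.closedBall q R ⊆ U)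
    {l L : ℝ} {b f : Cn n → ℝ} (hb : ContDiffOn ℝ 2 b T)
    (hbar : ∀ y ∈ T, dist y q ≤ R → 0 ≤ b y ∧ (dist y q = R → 1 ≤ b y) ∧
      ∀ G, Elliptic l L G → (G * complexHessian T b y).trace.re ≤ -1)
    (hf : ContDiffOn ℝ 2 f T) {S β : ℝ} (hS : 0 ≤ S) (hβ : 0 < β)
    (hfS : ∀ y ∈ T, dist y q ≤ R → f y ≤ S)
    (hf0 : ∀ y ∈ T, dist y q ≤ R → ρ y = 0 → f y ≤ 0)
    (hsub : ∀ y ∈ T, dist y q < R → ρ y < 0 → ∃ G, Elliptic l L G ∧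
      -β ≤ (G * complexHessian T f y).trace.re) :
    ∀ y ∈ T, dist y q ≤ R → f y ≤ (S + 2 * β) * b y := by
  set O := {y ∈ U | ρ y < 0} ∩ Metric.ball q R with hO
  have hOopen : IsOpen O :=
    (h.smooth.continuousOn.isOpen_inter_preimage h.isOpen isOpen_Iio).inter Metric.isOpen_ball
  have hreg := h.isRegular
  have hOT : O ⊆ T ∩ Metric.closedBall q R := fun y hy =>
    ⟨(h.mem_iff hy.1.1).2 hy.1.2.le, Metric.ball_subset_closedBall hy.2⟩
  have hg : ContDiffOn ℝ 2 (fun y => f y - (S + 2 * β) * b y) T := hf.sub (contDiffOn_const.mul hb)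
  have key := nonpos_of_no_interior_max (isCompact_inter_closedBall h hR) hOopen hOT
    (f := fun y => f y - (S + 2 * β) * b y) (hg.continuousOn.mono inter_subset_left) ?_ ?_
  · intro y hy hyq
    linarith [key y ⟨hy, hyq⟩]
  · rintro y ⟨hyT, hyR⟩ hyO
    obtain ⟨b0, b1, -⟩ := hbar y hyT hyR
    rcases (h.nonpos hyT).lt_or_eq with h1 | h1
    · have hyd : dist y q = R := by
        by_contra hne
        exact hyO ⟨⟨h.subset hyT, h1⟩, lt_of_le_of_ne hyR hne⟩
      have := hfS y hyT hyR
      have := b1 hyd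
      nlinarith
    · have := hf0 y hyT hyR h1
      nlinarith [mul_nonneg (by linarith : 0 ≤ S + 2 * β) b0]
  · intro y hyO _ hmax
    have hyT := (hOT hyO).1
    obtain ⟨G, hG, hGf⟩ := hsub y hyT hyO.2 hyO.1.2
    have h1 := trace_mul_complexHessian_nonpos hreg hg
      (h.mem_nhds_of_neg hyO.1.1 hyO.1.2) hmax hG.posSemidef
    rw [complexHessian_sub_real hreg.1 hf (contDiffOn_const.mul hb) hyT,
      complexHessian_const_mul hreg.1 hb _ hyT, Matrix.mul_sub, Matrix.mul_smul, trace_sub,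
      trace_smul, sub_re, smul_eq_mul, re_ofReal_mul] at h1
    have h2 := (hbar y hyT (hOT hyO).2).2.2 G hG
    nlinarith

theorem dz_exp (hT : UniqueDiffWithinAt ℝ T z) {f : Cn n → ℂ}
    (hf : DifferentiableWithinAt ℝ f T z) (j : Fin n) :
    dz T j (fun w => cexp (f w)) z = cexp (f z) * dz T j f z := by
  have h : HasFDerivWithinAt (fun w => cexp (f w)) (cexp (f z) • fderivWithin ℝ f T z) T z :=
    hf.hasFDerivWithinAt.cexp
  simp only [dz, h.fderivWithin hT, _root_.smul_apply, smul_eq_mul]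
  ring

theorem dzbar_exp (hT : UniqueDiffWithinAt ℝ T z) {f : Cn n → ℂ}
    (hf : DifferentiableWithinAt ℝ f T z) (j : Fin n) :
    dzbar T j (fun w => cexp (f w)) z = cexp (f z) * dzbar T j f z := by
  have h : HasFDerivWithinAt (fun w => cexp (f w)) (cexp (f z) • fderivWithin ℝ f T z) T z :=
    hf.hasFDerivWithinAt.cexp
  simp only [dzbar, h.fderivWithin hT, _root_.smul_apply, smul_eq_mul]
  ring

theorem hess_exp (hT : UniqueDiffOn ℝ T) {f : Cn n → ℂ} (hf : ContDiffOn ℝ 2 f T) (hz : z ∈ T) :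
    hess T (fun w => cexp (f w)) z =
      cexp (f z) • (hess T f z + vecMulVec (dzv T f z) (dzbv T f z)) := by
  have hfd : ∀ {w}, w ∈ T → DifferentiableWithinAt ℝ f T w :=
    fun hw => diffAt_of_contDiffOn hf two_ne_zero hw
  ext j k
  simp only [hess, of_apply, Matrix.smul_apply, Matrix.add_apply, vecMulVec_apply, dzv, dzbv,
    smul_eq_mul]
  rw [dz_congr (fun w hw => dzbar_exp (hT w hw) (hfd hw) k) hz,
    dz_mul (hT z hz) (hfd hz).cexp (diffAt_dzbar hT hf hz k), dz_exp (hT z hz) (hfd hz)]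
  ring

/-- The Hopf barrier `exp(-α |z - y|²)`. -/
theorem trace_mul_complexHessian_hopf (hT : UniqueDiffOn ℝ T) (hz : z ∈ T) (y : Cn n) (α : ℝ)
    (G : Matrix (Fin n) (Fin n) ℂ) :
    (G * complexHessian T (fun w => Real.exp (-α * ‖w - y‖ ^ 2)) z).trace.re =
      Real.exp (-α * ‖z - y‖ ^ 2) * (-α * G.trace.re + α ^ 2 * quad G (star (z - y).ofLp)) := by
  have hs : ContDiffOn ℝ 2 (fun w => ((‖w - y‖ ^ 2 : ℝ) : ℂ)) T :=
    contDiffOn_ofReal (contDiff_normSq y).contDiffOn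
  have he : (fun w => ((Real.exp (-α * ‖w - y‖ ^ 2) : ℝ) : ℂ)) =
      fun w => cexp ((-α : ℝ) * ((‖w - y‖ ^ 2 : ℝ) : ℂ)) := by
    funext w; push_cast; ring
  have h1 : dzv T (fun w => ((-α : ℝ) : ℂ) * ((‖w - y‖ ^ 2 : ℝ) : ℂ)) z =
      ((-α : ℝ) : ℂ) • star (z - y).ofLp := by
    funext j
    simp only [dzv]
    rw [dz_mul (hT z hz) (differentiableWithinAt_const _) (hs.differentiableOn two_ne_zero z hz),
      dz_const, dz_normSq hT hz]
    simp
  have h2 : dzbv T (fun w => ((-α : ℝ) : ℂ) * ((‖w - y‖ ^ 2 : ℝ) : ℂ)) z =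
      ((-α : ℝ) : ℂ) • star (star (z - y).ofLp) := by
    funext j
    simp only [dzbv]
    rw [dzbar_mul (hT z hz) (differentiableWithinAt_const _) (hs.differentiableOn two_ne_zero z hz),
      dzbar_const, dzbar_normSq hT hz]
    simp
  have h3 : cexp (((-α : ℝ) : ℂ) * ((‖z - y‖ ^ 2 : ℝ) : ℂ)) =
      ((Real.exp (-α * ‖z - y‖ ^ 2) : ℝ) : ℂ) := by push_cast; ring
  rw [complexHessian_eq, he, hess_exp hT (contDiffOn_const.mul hs) hz,
    hess_const_mul hT hs _ hz, hess_normSq hT hz, h1, h2, h3, vecMulVec_smul, smul_vecMulVec]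
  simp only [Matrix.mul_smul, Matrix.mul_add, Matrix.mul_one, trace_smul, trace_add, smul_eq_mul,
    re_ofReal_mul, add_re, trace_mul_vecMulVec_star]
  ring

theorem hopf_barrier_arith {α E k g m θ q e : ℝ} (hα : 0 < α) (hE : 0 < E) (hk : 0 < k)
    (hg : g ≤ m) (hm : α * θ = m + 1) (hq : θ ≤ q) (he : E ≤ e) :
    k * (E * α) ≤ k * (e * (-α * g + α ^ 2 * q)) := by
  have h1 : α * (m + 1) ≤ α ^ 2 * q := by
    rw [← hm]
    calc α * (α * θ) = α ^ 2 * θ := by ring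
      _ ≤ α ^ 2 * q := mul_le_mul_of_nonneg_left hq (sq_nonneg α)
  have h2 : α ≤ -α * g + α ^ 2 * q := by nlinarith [mul_le_mul_of_nonneg_left hg hα.le]
  exact mul_le_mul_of_nonneg_left (mul_le_mul he h2 hα.le (hE.le.trans he)) hk.le

/-- Growth of subsolutions inside: an improvement of an upper bound on a small ball propagates to
a ball of fixed size, by comparison with `exp (-α |x - y|²)` on the annulus between them. -/
theorem exists_growth_inside (hreg : Regular T) {y : Cn n} {R ε : ℝ} (hε : 0 < ε) (hεR : ε < R)
    (hR : Metric.closedBall y (2 * R) ⊆ interior T) {l L : ℝ} (hl : 0 < l) {c C : ℝ}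
    (hc : 0 < c) (hc1 : c ≤ 1) (hC : 0 ≤ C) :
    ∃ c' C' : ℝ, 0 < c' ∧ c' ≤ 1 ∧ 0 ≤ C' ∧ ∀ (f : Cn n → ℝ) (S β : ℝ), 0 ≤ S → 0 < β →
      ContDiffOn ℝ 2 f T → (∀ x ∈ Metric.closedBall y (2 * R), f x ≤ S) →
      (∀ x ∈ Metric.closedBall y ε, f x ≤ (1 - c) * S + C * β) →
      (∀ x ∈ Metric.ball y (2 * R), ∃ G, Elliptic l L G ∧
        -β ≤ (G * complexHessian T f x).trace.re) →
      ∀ x ∈ Metric.closedBall y (3 / 2 * R), f x ≤ (1 - c') * S + C' * β := by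
  have hR0 : 0 < R := hε.trans hεR
  set α := (n * |L| + 1) / (l * ε ^ 2) with hα
  have hα0 : 0 < α := by positivity
  set E := Real.exp (-α * (2 * R) ^ 2) with hE
  have hE0 : 0 < E := Real.exp_pos _
  set h₁ := E * α with hh₁
  have hh₁0 : 0 < h₁ := by positivity
  set h₀ := Real.exp (-α * (3 / 2 * R) ^ 2) - E with hh₀
  have hh₀0 : 0 < h₀ := by
    rw [hh₀, sub_pos, hE, Real.exp_lt_exp]
    nlinarith [mul_pos hα0 (pow_pos hR0 2)]
  have hh₀1 : h₀ ≤ 1 := by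
    have : Real.exp (-α * (3 / 2 * R) ^ 2) ≤ 1 := Real.exp_le_one_iff.2 (by nlinarith [sq_nonneg R])
    linarith
  refine ⟨c * h₀, C + 2 / h₁, by positivity, mul_le_one₀ hc1 hh₀0.le hh₀1, by positivity, ?_⟩
  intro f S β hS hβ hf hfS hfε hsub
  -- The coefficient of the exponential balances the improvement `c S` on the small ball and the
  -- right hand side `β` of the inequality.
  set k := c * S + 2 * β / h₁ with hk
  have hk0 : 0 < k := by positivity
  set hb : Cn n → ℝ := fun x => Real.exp (-α * ‖x - y‖ ^ 2) with hhb
  have hbC : ContDiff ℝ 2 hb := (contDiff_const.mul (contDiff_normSq y)).exp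
  have hTi : Metric.closedBall y (2 * R) ⊆ T := hR.trans interior_subset
  set O := Metric.ball y (2 * R) \ Metric.closedBall y ε with hO
  have hOopen : IsOpen O := Metric.isOpen_ball.sdiff Metric.isClosed_closedBall
  have hOK : O ⊆ Metric.closedBall y (2 * R) := fun x hx => Metric.ball_subset_closedBall hx.1
  have hg1 : ContDiffOn ℝ 2 (fun x => f x + k * hb x) T :=
    hf.add (contDiffOn_const.mul hbC.contDiffOn)
  have hg : ContDiffOn ℝ 2 (fun x => f x + k * hb x - (S + k * E + (C + 2 / h₁) * β)) T :=
    hg1.sub contDiffOn_const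
  have key := nonpos_of_no_interior_max (isCompact_closedBall y (2 * R)) hOopen hOK
    (f := fun x => f x + k * hb x - (S + k * E + (C + 2 / h₁) * β))
    (hg.continuousOn.mono hTi) ?_ ?_
  · intro x hx
    have hx' : ‖x - y‖ ≤ 3 / 2 * R := by rw [← dist_eq_norm]; exact hx
    have h1 := key x (Metric.closedBall_subset_closedBall (by linarith) hx)
    have h2 : h₀ + E ≤ hb x := by
      rw [hh₀, sub_add_cancel]
      refine Real.exp_le_exp.2 ?_
      have := pow_le_pow_left₀ (norm_nonneg _) hx' 2
      nlinarith
    have h3 : c * S * h₀ ≤ k * h₀ := mul_le_mul_of_nonneg_right (by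
      have : 0 < 2 * β / h₁ := by positivity
      linarith) hh₀0.le
    nlinarith [mul_le_mul_of_nonneg_left h2 hk0.le]
  · intro x hx hxO
    have hb1 : hb x ≤ 1 := Real.exp_le_one_iff.2 (by nlinarith [sq_nonneg ‖x - y‖])
    by_cases hxε : x ∈ Metric.closedBall y ε
    · have h1 := hfε x hxε
      have h2 : k * hb x ≤ k * 1 := mul_le_mul_of_nonneg_left hb1 hk0.le
      have h3 : 0 < k * E := by positivity
      have h4 : k = c * S + 2 / h₁ * β := by rw [hk]; ring
      nlinarith
    · have hx2 : ‖x - y‖ = 2 * R := by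
        rw [← dist_eq_norm]
        by_contra hne
        exact hxO ⟨lt_of_le_of_ne hx hne, hxε⟩
      have h1 := hfS x hx
      have h2 : hb x = E := by rw [hhb, hE]; simp only [hx2]
      have h3 : 0 ≤ (C + 2 / h₁) * β := by positivity
      rw [h2]
      linarith
  · intro x hxO _ hmax
    have hxT : x ∈ T := hTi (hOK hxO)
    obtain ⟨G, hG, hGf⟩ := hsub x hxO.1
    have h1 := trace_mul_complexHessian_nonpos hreg hg
      (mem_interior_iff_mem_nhds.1 (hR (hOK hxO))) hmax hG.posSemidef
    rw [complexHessian_sub_real hreg.1 hg1 contDiffOn_const hxT, complexHessian_const, sub_zero,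
      complexHessian_add_real hreg.1 hf (contDiffOn_const.mul hbC.contDiffOn) hxT,
      complexHessian_const_mul hreg.1 hbC.contDiffOn _ hxT, Matrix.mul_add, Matrix.mul_smul,
      trace_add, trace_smul, add_re, smul_eq_mul, re_ofReal_mul,
      trace_mul_complexHessian_hopf hreg.1 hxT] at h1
    have hx2 : ‖x - y‖ ≤ 2 * R := by rw [← dist_eq_norm]; exact (hOK hxO)
    have hxε : ε ≤ ‖x - y‖ := by
      rw [← dist_eq_norm]; exact (not_le.1 hxO.2).le
    have t1 : G.trace.re ≤ n * |L| := by
      rw [trace, re_sum]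
      calc ∑ i, (G.diag i).re ≤ ∑ _i : Fin n, |L| := Finset.sum_le_sum fun i _ =>
            (re_le_norm _).trans ((hG.upper i i).trans (le_abs_self L))
        _ = n * |L| := by simp
    have t2 : l * ε ^ 2 ≤ quad G (star (x - y).ofLp) := by
      refine le_trans ?_ (hG.lower _)
      refine mul_le_mul_of_nonneg_left ?_ hl.le
      have : ∑ i, ‖(star (x - y).ofLp) i‖ ^ 2 = ‖x - y‖ ^ 2 := by
        rw [EuclideanSpace.norm_sq_eq]
        simp [← map_sub]
      rw [this]
      exact pow_le_pow_left₀ hε.le hxε 2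
    have t3 : E ≤ Real.exp (-α * ‖x - y‖ ^ 2) := by
      refine Real.exp_le_exp.2 ?_
      have := pow_le_pow_left₀ (norm_nonneg _) hx2 2
      nlinarith
    have e1 : α * (l * ε ^ 2) = n * |L| + 1 := by rw [hα]; field_simp
    have t6 : 2 * β ≤ k * h₁ := by
      have : k * h₁ = c * S * h₁ + 2 * β := by rw [hk]; field_simp
      rw [this]
      have : 0 ≤ c * S * h₁ := by positivity
      linarith
    have := hopf_barrier_arith hα0 hE0 hk0 t1 e1 t2 t3
    linarith

end Barrier

/-! ### Uniform bounds and the normal form of a Hessian at the boundary -/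

section NormalForm

variable {n : ℕ} {T : Set (Cn n)} {z p : Cn n}

theorem trace_inv_mul_wOp {Ω : Matrix (Fin n) (Fin n) ℂ} (hΩ : Ω.PosDef)
    (H : Matrix (Fin n) (Fin n) ℂ) :
    (Ω⁻¹ * wOp Ω H).trace = ((n : ℂ) - 1) * (Ω⁻¹ * H).trace := by
  have h : Ω⁻¹ * Ω = 1 := Matrix.nonsing_inv_mul _ ((Matrix.isUnit_iff_isUnit_det _).1 hΩ.isUnit)
  rw [wOp, Matrix.mul_sub, Matrix.mul_smul, h, trace_sub, trace_smul, trace_one]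
  simp only [smul_eq_mul, Fintype.card_fin]
  ring

theorem abs_quad_le {A : Matrix (Fin n) (Fin n) ℂ} {a : ℝ} (hA : ∀ i j, ‖A i j‖ ≤ a)
    (x : Fin n → ℂ) : |quad A x| ≤ n * a * ∑ i, ‖x i‖ ^ 2 := by
  have h1 : ‖star x ⬝ᵥ A *ᵥ x‖ ≤ ∑ i, ∑ j, a * ((‖x i‖ ^ 2 + ‖x j‖ ^ 2) / 2) := by
    refine (norm_sum_le _ _).trans (Finset.sum_le_sum fun i _ => ?_)
    rw [norm_mul, mulVec, dotProduct]
    refine (mul_le_mul_of_nonneg_left (norm_sum_le _ _) (norm_nonneg _)).trans ?_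
    rw [Finset.mul_sum]
    refine Finset.sum_le_sum fun j _ => ?_
    rw [norm_mul, Pi.star_apply, norm_star]
    have ha : 0 ≤ a := (norm_nonneg _).trans (hA i j)
    have h2 : ‖x i‖ * ‖x j‖ ≤ (‖x i‖ ^ 2 + ‖x j‖ ^ 2) / 2 := by
      nlinarith [sq_nonneg (‖x i‖ - ‖x j‖)]
    calc ‖x i‖ * (‖A i j‖ * ‖x j‖) = ‖A i j‖ * (‖x i‖ * ‖x j‖) := by ring
      _ ≤ a * _ := mul_le_mul (hA i j) h2 (by positivity) ha
  refine (abs_re_le_norm _).trans (h1.trans_eq ?_)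
  simp only [← Finset.mul_sum, ← Finset.sum_div, Finset.sum_add_distrib, Finset.sum_const,
    Finset.card_univ, Fintype.card_fin, nsmul_eq_mul]
  ring

theorem continuous_quad (A : Matrix (Fin n) (Fin n) ℂ) : Continuous (quad A) :=
  continuous_re.comp (continuous_star.dotProduct (continuous_const.matrix_mulVec continuous_id))

theorem exists_quad_ge {A : Matrix (Fin n) (Fin n) ℂ} (hA : A.PosDef) :
    ∃ l : ℝ, 0 < l ∧ ∀ x, l * ∑ i, ‖x i‖ ^ 2 ≤ quad A x := by
  have hhom : ∀ (t : ℝ) (x : Fin n → ℂ), quad A ((t : ℂ) • x) = t ^ 2 * quad A x := by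
    intro t x
    rw [quad, quad, mulVec_smul, star_smul, smul_dotProduct, dotProduct_smul, smul_eq_mul,
      smul_eq_mul, ← mul_assoc]
    simp only [RCLike.star_def, conj_ofReal, ← ofReal_mul, re_ofReal_mul]
    ring
  set D : Set (Fin n → ℂ) := {x | ∑ i, ‖x i‖ ^ 2 = 1} with hD
  have hcont : Continuous fun x : Fin n → ℂ => ∑ i, ‖x i‖ ^ 2 := by fun_prop
  have hDc : IsCompact D := by
    refine Metric.isCompact_of_isClosed_isBounded (isClosed_eq hcont continuous_const)
      ((Metric.isBounded_closedBall (x := (0 : Fin n → ℂ)) (r := 1)).subset fun x hx => ?_)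
    rw [mem_closedBall_zero_iff, pi_norm_le_iff_of_nonneg zero_le_one]
    intro i
    have : ‖x i‖ ^ 2 ≤ 1 := (Finset.single_le_sum (f := fun i => ‖x i‖ ^ 2)
      (fun _ _ => by positivity) (Finset.mem_univ i)).trans_eq hx
    exact (sq_le_one_iff₀ (norm_nonneg _)).1 this
  obtain ⟨l, hl, hle⟩ : ∃ l : ℝ, 0 < l ∧ ∀ x ∈ D, l ≤ quad A x := by
    rcases D.eq_empty_or_nonempty with he | hne
    · exact ⟨1, one_pos, fun x hx => by rw [he] at hx; exact hx.elim⟩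
    · obtain ⟨x₀, hx₀, hmin⟩ := hDc.exists_isMinOn hne (continuous_quad A).continuousOn
      refine ⟨quad A x₀, quad_pos hA ?_, fun x hx => hmin hx⟩
      rintro rfl
      simp [hD] at hx₀
  refine ⟨l, hl, fun x => ?_⟩
  rcases eq_or_ne x 0 with rfl | hx
  · simp [quad]
  have hs : 0 < ∑ i, ‖x i‖ ^ 2 := by
    obtain ⟨i, hi⟩ := Function.ne_iff.1 hx
    exact Finset.sum_pos' (fun _ _ => by positivity)
      ⟨i, Finset.mem_univ i, pow_pos (norm_pos_iff.2 hi) 2⟩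
  set t : ℝ := (√(∑ i, ‖x i‖ ^ 2))⁻¹ with ht
  have ht2 : t ^ 2 * ∑ i, ‖x i‖ ^ 2 = 1 := by
    rw [ht, inv_pow, Real.sq_sqrt hs.le, inv_mul_cancel₀ hs.ne']
  have hmem : ((t : ℂ) • x) ∈ D := by
    rw [hD, mem_ofPred_eq, ← ht2, Finset.mul_sum]
    refine Finset.sum_congr rfl fun i _ => ?_
    rw [Pi.smul_apply, smul_eq_mul, norm_mul, mul_pow, norm_real, Real.norm_eq_abs, sq_abs]
  have h1 := hle _ hmem
  rw [hhom] at h1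
  have h2 := mul_le_mul_of_nonneg_right h1 hs.le
  calc _ ≤ _ := h2
    _ = (t ^ 2 * ∑ i, ‖x i‖ ^ 2) * quad A x := by ring
    _ = quad A x := by rw [ht2, one_mul]

/-- A continuous family of positive definite matrices is locally uniformly elliptic. -/
theorem exists_elliptic {X : Type*} [TopologicalSpace X] {T : Set X} {p : X}
    {G : X → Matrix (Fin n) (Fin n) ℂ} (hp : p ∈ T)
    (hG : ∀ z ∈ T, (G z).PosDef) (hc : ∀ i j, ContinuousWithinAt (fun z => G z i j) T p) :
    ∃ l L : ℝ, 0 < l ∧ 0 < L ∧ ∀ᶠ z in 𝓝[T] p, Elliptic l L (G z) := by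
  obtain ⟨l, hl, hlow⟩ := exists_quad_ge (hG p hp)
  obtain ⟨L, hL, hup⟩ := exists_eventually_bound (S := T) (x := p)
    (f := fun (ij : Fin n × Fin n) z => G z ij.1 ij.2) fun ij => hc ij.1 ij.2
  have hclose : ∀ᶠ z in 𝓝[T] p, ∀ ij : Fin n × Fin n,
      ‖(G p - G z) ij.1 ij.2‖ ≤ l / (2 * (n + 1)) := by
    refine eventually_all.2 fun ij => ?_
    have h1 : ContinuousWithinAt (fun z => ‖(G p - G z) ij.1 ij.2‖) T p :=
      (continuousWithinAt_const.sub (hc ij.1 ij.2)).norm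
    have h2 : ‖(G p - G p) ij.1 ij.2‖ < l / (2 * (n + 1)) := by simp; positivity
    filter_upwards [h1.eventually_lt_const h2] with z hz using hz.le
  refine ⟨l / 2, L, by positivity, hL, ?_⟩
  filter_upwards [hup, hclose, self_mem_nhdsWithin] with z h1 h2 hz
  refine ⟨(hG z hz).posSemidef, fun x => ?_, fun i j => h1 (i, j)⟩
  have h3 := (abs_le.1 (abs_quad_le (fun i j => h2 (i, j)) x)).2
  rw [quad_sub] at h3
  have h4 := hlow x
  have h5 : (n : ℝ) * (l / (2 * (n + 1))) ≤ l / 2 := by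
    rw [mul_div_assoc', div_le_div_iff₀ (by positivity) two_pos]
    nlinarith
  nlinarith [mul_le_mul_of_nonneg_right h5 (Finset.sum_nonneg fun i _ => sq_nonneg ‖x i‖ :
    0 ≤ ∑ i, ‖x i‖ ^ 2)]

theorem contDiffOn_det {k : WithTop ℕ∞} {A : Cn n → Matrix (Fin n) (Fin n) ℂ}
    (hA : ∀ i j, ContDiffOn ℝ k (fun z => A z i j) T) :
    ContDiffOn ℝ k (fun z => (A z).det) T := by
  simp only [det_apply']
  exact ContDiffOn.sum fun σ _ => contDiffOn_const.mul (contDiffOn_prod fun i _ => hA _ _)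

theorem contDiffOn_inv_apply {k : WithTop ℕ∞} {A : Cn n → Matrix (Fin n) (Fin n) ℂ}
    (hA : ∀ i j, ContDiffOn ℝ k (fun z => A z i j) T) (hdet : ∀ z ∈ T, (A z).det ≠ 0)
    (i j : Fin n) : ContDiffOn ℝ k (fun z => (A z)⁻¹ i j) T := by
  have h : ContDiffOn ℝ k (fun z => (A z).det⁻¹ * (A z).adjugate i j) T := by
    refine ((contDiffOn_det hA).inv hdet).mul ?_
    simp only [adjugate_apply]
    refine contDiffOn_det fun a b => ?_
    by_cases hab : a = j
    · subst hab; simpa using contDiffOn_const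
    · simpa [updateRow_apply, hab] using hA a b
  refine h.congr fun z _ => ?_
  rw [Matrix.inv_def, Ring.inverse_eq_inv', Matrix.smul_apply, smul_eq_mul]

theorem contDiffOn_mul_apply {k : WithTop ℕ∞} {A B : Cn n → Matrix (Fin n) (Fin n) ℂ}
    (hA : ∀ i j, ContDiffOn ℝ k (fun z => A z i j) T)
    (hB : ∀ i j, ContDiffOn ℝ k (fun z => B z i j) T) (i j : Fin n) :
    ContDiffOn ℝ k (fun z => (A z * B z) i j) T := by
  simp only [mul_apply]
  exact ContDiffOn.sum fun l _ => (hA _ _).mul (hB _ _)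

theorem contDiffOn_trace {k : WithTop ℕ∞} {A : Cn n → Matrix (Fin n) (Fin n) ℂ}
    (hA : ∀ i j, ContDiffOn ℝ k (fun z => A z i j) T) :
    ContDiffOn ℝ k (fun z => (A z).trace) T := by
  simp only [trace, diag]
  exact ContDiffOn.sum fun l _ => hA _ _

theorem contDiffOn_mulVec_apply {k : WithTop ℕ∞} {A : Cn n → Matrix (Fin n) (Fin n) ℂ}
    {x : Cn n → Fin n → ℂ} (hA : ∀ i j, ContDiffOn ℝ k (fun z => A z i j) T)
    (hx : ∀ i, ContDiffOn ℝ k (fun z => x z i) T) (i : Fin n) :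
    ContDiffOn ℝ k (fun z => (A z *ᵥ x z) i) T := by
  simp only [mulVec, dotProduct]
  exact ContDiffOn.sum fun l _ => (hA _ _).mul (hx _)

theorem contDiffOn_re {k : WithTop ℕ∞} {f : Cn n → ℂ} (hf : ContDiffOn ℝ k f T) :
    ContDiffOn ℝ k (fun z => (f z).re) T := reCLM.contDiff.comp_contDiffOn hf

theorem contDiffOn_quad {k : WithTop ℕ∞} {A : Cn n → Matrix (Fin n) (Fin n) ℂ}
    {x : Cn n → Fin n → ℂ} (hA : ∀ i j, ContDiffOn ℝ k (fun z => A z i j) T)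
    (hx : ∀ i, ContDiffOn ℝ k (fun z => x z i) T) :
    ContDiffOn ℝ k (fun z => quad (A z) (x z)) T := by
  refine contDiffOn_re ?_
  simp only [dotProduct]
  exact ContDiffOn.sum fun l _ => (contDiffOn_conj (hx l)).mul (contDiffOn_mulVec_apply hA hx l)

theorem contDiffOn_wOp {k : WithTop ℕ∞} {A B : Cn n → Matrix (Fin n) (Fin n) ℂ}
    (hA : ∀ i j, ContDiffOn ℝ k (fun z => A z i j) T) (hdet : ∀ z ∈ T, (A z).det ≠ 0)
    (hB : ∀ i j, ContDiffOn ℝ k (fun z => B z i j) T) (i j : Fin n) :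
    ContDiffOn ℝ k (fun z => wOp (A z) (B z) i j) T := by
  simp only [wOp, Matrix.sub_apply, Matrix.smul_apply, smul_eq_mul]
  exact ((contDiffOn_trace (contDiffOn_mul_apply (contDiffOn_inv_apply hA hdet) hB)).mul
    (hA i j)).sub (hB i j)

/-- The value of the form `wOp Ω H` on the `Ω`-gradient `Ω⁻¹ r`. At a boundary point with conormal
`r` it only involves the tangential part of `H`. -/
def normalForm (Ω : Matrix (Fin n) (Fin n) ℂ) (r : Fin n → ℂ) (H : Matrix (Fin n) (Fin n) ℂ) : ℝ :=
  quad (wOp Ω H) (Ω⁻¹ *ᵥ r)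

theorem wOp_smul (Ω : Matrix (Fin n) (Fin n) ℂ) (a : ℂ) (H : Matrix (Fin n) (Fin n) ℂ) :
    wOp Ω (a • H) = a • wOp Ω H := by
  simp only [wOp, Matrix.mul_smul, trace_smul, smul_sub, smul_smul, smul_eq_mul]

theorem normalForm_add (Ω : Matrix (Fin n) (Fin n) ℂ) (r : Fin n → ℂ)
    (H H' : Matrix (Fin n) (Fin n) ℂ) :
    normalForm Ω r (H + H') = normalForm Ω r H + normalForm Ω r H' := by
  rw [normalForm, wOp_add, quad_add]; rfl

theorem normalForm_smul (Ω : Matrix (Fin n) (Fin n) ℂ) (r : Fin n → ℂ) (a : ℝ)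
    (H : Matrix (Fin n) (Fin n) ℂ) :
    normalForm Ω r ((a : ℂ) • H) = a * normalForm Ω r H := by
  rw [normalForm, wOp_smul, quad_smul]; rfl

theorem normalForm_vecMulVec {Ω : Matrix (Fin n) (Fin n) ℂ} (hΩ : Ω.PosDef) (r a b : Fin n → ℂ) :
    normalForm Ω r (vecMulVec a (star r) + vecMulVec r b) = 0 := by
  have hu : Ω * Ω⁻¹ = 1 := Matrix.mul_nonsing_inv _ ((Matrix.isUnit_iff_isUnit_det _).1 hΩ.isUnit)
  set x := Ω⁻¹ *ᵥ r with hx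
  have h1 : Ω *ᵥ x = r := by rw [hx, mulVec_mulVec, hu, one_mulVec]
  have h2 : star x = star r ᵥ* Ω⁻¹ := by
    rw [hx, star_mulVec, hΩ.1.inv.eq]
  have h3 : (Ω⁻¹ * vecMulVec a (star r)).trace = star x ⬝ᵥ a := by
    rw [mul_vecMulVec, trace_vecMulVec, dotProduct_comm, h2, dotProduct_mulVec]
  have h4 : (Ω⁻¹ * vecMulVec r b).trace = b ⬝ᵥ x := by
    rw [mul_vecMulVec, trace_vecMulVec, dotProduct_comm]
  have h5 : star r ⬝ᵥ x = star x ⬝ᵥ r := by rw [h2, hx, dotProduct_mulVec]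
  rw [normalForm, ← hx, quad, wOp, Matrix.mul_add, trace_add, h3, h4, sub_mulVec, smul_mulVec,
    h1, add_mulVec, vecMulVec_mulVec, vecMulVec_mulVec, dotProduct_sub, dotProduct_smul,
    dotProduct_add, h5, op_smul_eq_smul, op_smul_eq_smul, dotProduct_smul, dotProduct_smul]
  simp only [smul_eq_mul]
  rw [show (star x ⬝ᵥ a + b ⬝ᵥ x) * (star x ⬝ᵥ r) - ((star x ⬝ᵥ r) * (star x ⬝ᵥ a) +
    (b ⬝ᵥ x) * (star x ⬝ᵥ r)) = 0 by ring, zero_re]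

theorem dz_inter {V : Set (Cn n)} (hV : IsOpen V) (hz : z ∈ V) (j : Fin n) (f : Cn n → ℂ) :
    dz (T ∩ V) j f z = dz T j f z := by
  simp only [dz, fderivWithin_inter (hV.mem_nhds hz)]

theorem dzbar_inter {V : Set (Cn n)} (hV : IsOpen V) (hz : z ∈ V) (j : Fin n) (f : Cn n → ℂ) :
    dzbar (T ∩ V) j f z = dzbar T j f z := by
  simp only [dzbar, fderivWithin_inter (hV.mem_nhds hz)]

theorem hess_inter {V : Set (Cn n)} (hV : IsOpen V) (hzT : z ∈ T) (hz : z ∈ V) (f : Cn n → ℂ) :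
    hess (T ∩ V) f z = hess T f z := by
  ext j k
  simp only [hess, of_apply]
  rw [dz_congr (g := dzbar T k f) (fun w hw => dzbar_inter hV hw.2 k f) (mem_inter hzT hz),
    dz_inter hV hz]

end NormalForm

/-! ### The local problem at a boundary point, and first derivatives at the boundary -/

section Patch

variable {n : ℕ} {T U : Set (Cn n)} {ρ : Cn n → ℝ} {z p q : Cn n}

/-- A function vanishing on the boundary is bounded by the defining function. -/
theorem IsDefining.exists_norm_le_of_vanish (h : IsDefining U ρ T) (hq : q ∈ T) (h0 : ρ q = 0)
    {f : Cn n → ℂ} (hf : ContDiffOn ℝ 1 f T)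
    (hv : ∀ᶠ z in 𝓝[T] q, ρ z = 0 → f z = 0) :
    ∃ C : ℝ, ∀ᶠ z in 𝓝[T] q, ‖f z‖ ≤ C * (-ρ z) := by
  have hT := h.isRegular.1
  have hc : ContinuousWithinAt (fun z => fderivWithin ℝ f T z) T q :=
    hf.continuousOn_fderivWithin hT le_rfl q hq
  obtain ⟨B, hB, hb⟩ := exists_eventually_bound (ι := Unit) fun _ => hc
  obtain ⟨δ₁, hδ₁, hball⟩ := Metric.mem_nhdsWithin_iff.1 (hb.and hv)
  obtain ⟨C, hC, hseg⟩ := h.exists_segment (h.subset hq) h0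
  obtain ⟨δ, hδ, hs⟩ := hseg δ₁ hδ₁
  refine ⟨B * C, ?_⟩
  have hnear : ∀ᶠ z in 𝓝[T] q, dist z q < min δ δ₁ :=
    mem_nhdsWithin_of_mem_nhds (Metric.ball_mem_nhds q (lt_min hδ hδ₁))
  filter_upwards [hnear, self_mem_nhdsWithin] with z hz hzT
  obtain ⟨q', hq', hq'0, hq'd, hle, hsub⟩ := hs z hzT (hz.trans_le (min_le_left _ _))
  have hsegball : segment ℝ z q' ⊆ Metric.ball q δ₁ :=
    (convex_ball q δ₁).segment_subset (Metric.mem_ball.2 (hz.trans_le (min_le_right _ _)))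
      (Metric.mem_ball.2 hq'd)
  have h1 := (convex_segment z q').norm_image_sub_le_of_norm_hasFDerivWithin_le (𝕜 := ℝ) (f := f)
    (f' := fun y => fderivWithin ℝ f T y) (C := B)
    (fun y hy => ((hf.differentiableOn one_ne_zero y (hsub hy)).hasFDerivWithinAt).mono hsub)
    (fun y hy => (hball ⟨hsegball hy, hsub hy⟩).1 ()) (right_mem_segment ℝ z q')
    (left_mem_segment ℝ z q')
  rw [(hball ⟨Metric.mem_ball.2 hq'd, hq'⟩).2 hq'0, sub_zero] at h1
  calc ‖f z‖ ≤ B * ‖z - q'‖ := h1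
    _ ≤ B * (C * (-ρ z)) := mul_le_mul_of_nonneg_left hle hB.le
    _ = B * C * (-ρ z) := by ring

/-- The functions `f_k̄ g_j - f_j g_k̄`. When `f` is a defining function and `g` vanishes on the
boundary, they are tangential derivatives of `g` and vanish on the boundary. -/
def tang (T : Set (Cn n)) (f g : Cn n → ℂ) (j k : Fin n) (z : Cn n) : ℂ :=
  dzbar T k f z * dz T j g z - dz T j f z * dzbar T k g z

theorem contDiffOn_tang {f g : Cn n → ℂ} {k m : WithTop ℕ∞} (hT : UniqueDiffOn ℝ T)
    (hf : ContDiffOn ℝ m f T) (hg : ContDiffOn ℝ m g T) (hk : k + 1 ≤ m) (i j : Fin n) :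
    ContDiffOn ℝ k (tang T f g i j) T :=
  ((contDiffOn_dzbar hT hf hk _).mul (contDiffOn_dz hT hg hk _)).sub
    ((contDiffOn_dz hT hf hk _).mul (contDiffOn_dzbar hT hg hk _))

theorem dz_sub (hT : UniqueDiffWithinAt ℝ T z) {f g : Cn n → ℂ}
    (hf : DifferentiableWithinAt ℝ f T z) (hg : DifferentiableWithinAt ℝ g T z) (j : Fin n) :
    dz T j (fun w => f w - g w) z = dz T j f z - dz T j g z := by
  simp only [sub_eq_add_neg]
  rw [dz_add hT hf hg.fun_neg, dz_neg hT]

theorem dzbar_sub (hT : UniqueDiffWithinAt ℝ T z) {f g : Cn n → ℂ}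
    (hf : DifferentiableWithinAt ℝ f T z) (hg : DifferentiableWithinAt ℝ g T z) (j : Fin n) :
    dzbar T j (fun w => f w - g w) z = dzbar T j f z - dzbar T j g z := by
  simp only [sub_eq_add_neg]
  rw [dzbar_add hT hf hg.fun_neg, dzbar_neg hT]

theorem dzbar_tang (hT : Regular T) {f g : Cn n → ℂ} (hf : ContDiffOn ℝ 2 f T)
    (hg : ContDiffOn ℝ 2 g T) (hz : z ∈ T) (j k l : Fin n) :
    dzbar T l (tang T f g j k) z =
      (dzbar T l (dzbar T k f) z * dz T j g z + dzbar T k f z * hess T g z j l) -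
      (hess T f z j l * dzbar T k g z + dz T j f z * dzbar T l (dzbar T k g) z) := by
  have h1 := diffAt_dz hT.1 hf hz
  have h2 := diffAt_dz hT.1 hg hz
  have h3 := diffAt_dzbar hT.1 hf hz
  have h4 := diffAt_dzbar hT.1 hg hz
  unfold tang
  rw [dzbar_sub (hT.1 z hz) ((h3 k).fun_mul (h2 j)) ((h1 j).fun_mul (h4 k)),
    dzbar_mul (hT.1 z hz) (h3 k) (h2 j), dzbar_mul (hT.1 z hz) (h1 j) (h4 k),
    ← dz_dzbar_comm hT hf hz j l, ← dz_dzbar_comm hT hg hz j l]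
  rfl

theorem dz_tang (hT : Regular T) {f g : Cn n → ℂ} (hf : ContDiffOn ℝ 2 f T)
    (hg : ContDiffOn ℝ 2 g T) (hz : z ∈ T) (j k l : Fin n) :
    dz T l (tang T f g j k) z =
      (hess T f z l k * dz T j g z + dzbar T k f z * dz T l (dz T j g) z) -
      (dz T l (dz T j f) z * dzbar T k g z + dz T j f z * hess T g z l k) := by
  have h1 := diffAt_dz hT.1 hf hz
  have h2 := diffAt_dz hT.1 hg hz
  have h3 := diffAt_dzbar hT.1 hf hz
  have h4 := diffAt_dzbar hT.1 hg hz
  unfold tang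
  rw [dz_sub (hT.1 z hz) ((h3 k).fun_mul (h2 j)) ((h1 j).fun_mul (h4 k)),
    dz_mul (hT.1 z hz) (h3 k) (h2 j), dz_mul (hT.1 z hz) (h1 j) (h4 k)]
  rfl

/-- A function which is controlled by the defining function near a boundary point has its
differential there proportional to that of the defining function; the sign of the factor is that
of the function. -/
theorem IsDefining.exists_normal_derivative (h : IsDefining U ρ T) (hq : q ∈ T) (h0 : ρ q = 0)
    {w : Cn n → ℝ} (hw : DifferentiableWithinAt ℝ w T q) (hwq : w q = 0) {C : ℝ}
    (hC : ∀ᶠ z in 𝓝[T] q, 0 ≤ w z ∧ w z ≤ C * (-ρ z)) :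
    ∃ η : ℝ, 0 ≤ η ∧ η ≤ C ∧ ∀ v, fderivWithin ℝ w T q v = -η * fderiv ℝ ρ q v := by
  obtain ⟨c, hc, hcv⟩ := h.exists_fderivWithin_eq_smul hq h0 hw hwq (C := C) (by
    filter_upwards [hC] with z hz
    rw [Real.norm_eq_abs, abs_of_nonneg hz.1]
    exact hz.2)
  refine ⟨-c, ?_, (neg_le_abs c).trans hc, fun v => by rw [hcv v, smul_eq_mul]; ring⟩
  obtain ⟨v, hv⟩ := h.exists_fderiv_eq (h.subset hq) h0 (-1)
  have hv' : fderiv ℝ ρ q v < 0 := by rw [hv]; norm_num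
  have hlim := h.hasLimit_slope hq h0 hw hv'
  rw [hcv v, hv, neg_one_smul, hwq] at hlim
  refine ge_of_tendsto hlim ?_
  filter_upwards [(h.tendsto_ray hq h0 hv').eventually hC, self_mem_nhdsWithin] with t ht ht0
  rw [sub_zero, smul_eq_mul]
  exact mul_nonneg (inv_nonneg.2 (mem_Ioi.1 ht0).le) ht.1

theorem IsDefining.dz_eq_of_fderivWithin (h : IsDefining U ρ T) (hq : q ∈ T)
    {w : Cn n → ℝ} (hw : DifferentiableWithinAt ℝ w T q) {η : ℝ}
    (hη : ∀ v, fderivWithin ℝ w T q v = -η * fderiv ℝ ρ q v) (j : Fin n) :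
    dz T j (fun y => (w y : ℂ)) q = -η * dz T j (fun y => (ρ y : ℂ)) q := by
  have hu := h.uniqueDiffWithinAt hq
  have hρ := (h.hasFDerivAt (h.subset hq))
  simp only [dz, fderivWithin_ofReal hu hw,
    fderivWithin_ofReal hu hρ.differentiableAt.differentiableWithinAt, hη,
    hρ.hasFDerivWithinAt.fderivWithin hu]
  push_cast
  ring

/-- The data of the Dirichlet problem near the point `p` of a boundary chart: the domain `T = {ρ ≤ 0}`,
the metric `Ω` and the form `ref = χ + √-1 ∂∂̄usub` of the subsolution. The remaining fields are
the constants of the estimates for the difference `w` of a solution and the subsolution on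
`T ∩ closedBall p radius`: `sup` bounds `w`, the determinant lies between `inf` and `detSup`, `dlog`
bounds the derivatives of its logarithm, and `grad * √K` those of `w`. -/
structure BoundaryPatch (n : ℕ) where
  U : Set (Cn n)
  T : Set (Cn n)
  ρ : Cn n → ℝ
  p : Cn n
  two_le : 2 ≤ n
  defining : IsDefining U ρ T
  mem : p ∈ T
  zero : ρ p = 0
  Ω : Cn n → Matrix (Fin n) (Fin n) ℂ
  ref : Cn n → Matrix (Fin n) (Fin n) ℂ
  smooth_metric : ∀ i j, ContDiffOn ℝ ∞ (fun z => Ω z i j) T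
  smooth_ref : ∀ i j, ContDiffOn ℝ ∞ (fun z => ref z i j) T
  posDef : ∀ z ∈ T, (Ω z).PosDef
  isHermitian_ref : ∀ z ∈ T, (ref z).IsHermitian
  posDef_ref : ∀ z ∈ T, (wOp (Ω z) (ref z)).PosDef
  radius : ℝ
  radius_pos : 0 < radius
  sup : ℝ
  inf : ℝ
  inf_pos : 0 < inf
  detSup : ℝ
  dlog : ℝ
  grad : ℝ

namespace BoundaryPatch

variable (P : BoundaryPatch n) {w : Cn n → ℝ} {K : ℝ}

/-- The conormal `∂ρ`. -/
def conormal (z : Cn n) : Fin n → ℂ := dzv P.T (fun y => (P.ρ y : ℂ)) z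

/-- The form `g = χ + √-1 ∂∂̄u`. -/
def form (w : Cn n → ℝ) (z : Cn n) : Matrix (Fin n) (Fin n) ℂ :=
  P.ref z + complexHessian P.T w z

/-- The form `W = (tr g) Ω - g`; the equation prescribes its determinant. -/
def W (w : Cn n → ℝ) (z : Cn n) : Matrix (Fin n) (Fin n) ℂ := wOp (P.Ω z) (P.form w z)

/-- The logarithm of the operator. -/
def logDet (w : Cn n → ℝ) (z : Cn n) : ℝ := Real.log ((P.Ω z)⁻¹ * P.W w z).det.re

/-- `w` is the difference of an admissible solution and the subsolution, and `K` controls the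
square of its gradient. -/
structure Solution (w : Cn n → ℝ) (K : ℝ) : Prop where
  smooth : ContDiffOn ℝ 4 w P.T
  vanish : ∀ z ∈ P.T, dist z P.p ≤ P.radius → P.ρ z = 0 → w z = 0
  nonneg : ∀ z ∈ P.T, dist z P.p ≤ P.radius → 0 ≤ w z
  le_sup : ∀ z ∈ P.T, dist z P.p ≤ P.radius → w z ≤ P.sup
  posDef : ∀ z ∈ P.T, dist z P.p ≤ P.radius → (P.W w z).PosDef
  inf_le : ∀ z ∈ P.T, dist z P.p ≤ P.radius → P.inf ≤ ((P.Ω z)⁻¹ * P.W w z).det.re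
  le_detSup : ∀ z ∈ P.T, dist z P.p ≤ P.radius → ((P.Ω z)⁻¹ * P.W w z).det.re ≤ P.detSup
  smooth_logDet : ContDiffOn ℝ 1 (P.logDet w) P.T
  dlog_le : ∀ z ∈ P.T, dist z P.p ≤ P.radius →
    ∀ j, ‖dz P.T j (fun y => (P.logDet w y : ℂ)) z‖ ≤ P.dlog
  grad_le : ∀ z ∈ P.T, dist z P.p ≤ P.radius →
    ∀ j, ‖dz P.T j (fun y => (w y : ℂ)) z‖ ≤ P.grad * √K
  one_le : 1 ≤ K

variable {P}

theorem reg (P : BoundaryPatch n) : Regular P.T := P.defining.isRegular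

theorem eventually_dist_le {R : ℝ} (hR : 0 < R) : ∀ᶠ z in 𝓝[P.T] P.p, dist z P.p ≤ R :=
  mem_nhdsWithin_of_mem_nhds (Metric.closedBall_mem_nhds _ hR)

theorem eventually_radius : ∀ᶠ z in 𝓝[P.T] P.p, dist z P.p ≤ P.radius :=
  eventually_dist_le P.radius_pos

theorem det_metric_ne (hz : z ∈ P.T) : (P.Ω z).det ≠ 0 := (P.posDef z hz).det_pos.ne'

theorem metric_mul_inv (hz : z ∈ P.T) : P.Ω z * (P.Ω z)⁻¹ = 1 :=
  Matrix.mul_nonsing_inv _ (isUnit_iff_ne_zero.2 (det_metric_ne hz))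

theorem smooth_inv (i j : Fin n) : ContDiffOn ℝ ∞ (fun z => (P.Ω z)⁻¹ i j) P.T :=
  contDiffOn_inv_apply P.smooth_metric (fun _ hz => det_metric_ne hz) i j

theorem smooth_rho : ContDiffOn ℝ ∞ P.ρ P.T := P.defining.contDiffOn le_rfl

theorem smooth_rhoC : ContDiffOn ℝ ∞ (fun y => (P.ρ y : ℂ)) P.T := contDiffOn_ofReal P.smooth_rho

theorem smooth_conormal (i : Fin n) : ContDiffOn ℝ ∞ (fun z => P.conormal z i) P.T :=
  contDiffOn_dz P.reg.1 P.smooth_rhoC le_rfl i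

theorem contDiffOn_complexHessian {u : Cn n → ℝ} {k m : WithTop ℕ∞} (hT : UniqueDiffOn ℝ T)
    (hu : ContDiffOn ℝ m u T) (hk : k + 1 + 1 ≤ m) (i j : Fin n) :
    ContDiffOn ℝ k (fun z => complexHessian T u z i j) T :=
  contDiffOn_dz hT (contDiffOn_dzbar hT (contDiffOn_ofReal hu) hk j) le_rfl i

theorem smooth_hessian_rho (i j : Fin n) :
    ContDiffOn ℝ ∞ (fun z => complexHessian P.T P.ρ z i j) P.T :=
  contDiffOn_complexHessian P.reg.1 P.smooth_rho le_rfl i j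

theorem smooth_normalForm {H : Cn n → Matrix (Fin n) (Fin n) ℂ} {k : WithTop ℕ∞}
    (hk : k ≤ (∞ : WithTop ℕ∞)) (hH : ∀ i j, ContDiffOn ℝ k (fun z => H z i j) P.T) :
    ContDiffOn ℝ k (fun z => normalForm (P.Ω z) (P.conormal z) (H z)) P.T :=
  contDiffOn_quad (contDiffOn_wOp (fun i j => (P.smooth_metric i j).of_le hk)
    (fun _ hz => det_metric_ne hz) hH)
    (contDiffOn_mulVec_apply (fun i j => (P.smooth_inv i j).of_le hk)
      fun i => (P.smooth_conormal i).of_le hk)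

theorem quad_metric_inv_mulVec (hz : z ∈ P.T) (r : Fin n → ℂ) :
    quad (P.Ω z) ((P.Ω z)⁻¹ *ᵥ r) = quad (P.Ω z)⁻¹ r := by
  rw [← quad_conj, (P.posDef z hz).1.inv.eq, Matrix.mul_assoc, metric_mul_inv hz, Matrix.mul_one]

theorem conormal_ne_zero (P : BoundaryPatch n) : P.conormal P.p ≠ 0 :=
  dzv_ne_zero P.defining P.mem P.zero

theorem two_le_four : (2 : WithTop ℕ∞) ≤ 4 := by norm_num

theorem Solution.smooth_two (h : P.Solution w K) : ContDiffOn ℝ 2 w P.T :=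
  h.smooth.of_le two_le_four

theorem Solution.diffAt (h : P.Solution w K) (hz : z ∈ P.T) :
    DifferentiableWithinAt ℝ w P.T z := h.smooth.differentiableOn (by norm_num) z hz

theorem Solution.trace_form_nonneg (h : P.Solution w K) (hz : z ∈ P.T)
    (hd : dist z P.p ≤ P.radius) : 0 ≤ ((P.Ω z)⁻¹ * P.form w z).trace.re := by
  have h1 := trace_mul_re_nonneg (P.posDef z hz).inv.posSemidef (h.posDef z hz hd).posSemidef
  rw [W, trace_inv_mul_wOp (P.posDef z hz), show ((n : ℂ) - 1) = ((n - 1 : ℝ) : ℂ) by push_cast; rfl,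
    re_ofReal_mul] at h1
  have hn : (2 : ℝ) ≤ n := by exact_mod_cast P.two_le
  exact (mul_nonneg_iff_of_pos_left (by linarith)).1 h1

/-- A solution is bounded by a multiple of the distance to the boundary: it satisfies
`tr(Ω⁻¹ ∂∂̄w) ≥ -C`, since `tr(Ω⁻¹ g) ≥ 0`. -/
theorem exists_le_dist (P : BoundaryPatch n) : ∃ C : ℝ, 0 < C ∧ ∀ᶠ z in 𝓝[P.T] P.p,
    ∀ w K, P.Solution w K → 0 ≤ w z ∧ w z ≤ C * (-P.ρ z) := by
  obtain ⟨l, L, hl, -, hell⟩ := exists_elliptic (G := fun z => (P.Ω z)⁻¹) P.mem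
    (fun z hz => (P.posDef z hz).inv) fun i j => (P.smooth_inv i j).continuousOn P.p P.mem
  obtain ⟨β, hβ, hb⟩ := exists_eventually_bound (ι := Unit) (S := P.T) (x := P.p)
    (f := fun _ z => ((P.Ω z)⁻¹ * P.ref z).trace) fun _ =>
      (contDiffOn_trace (k := ∞) (contDiffOn_mul_apply P.smooth_inv P.smooth_ref)).continuousOn
        P.p P.mem
  obtain ⟨R₂, hR₂, hball⟩ := Metric.mem_nhdsWithin_iff.1 ((hell.and hb).and eventually_radius)
  obtain ⟨Cb, R, hCb, hR, hRR, hRU, hbar⟩ :=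
    exists_boundary_barrier P.defining P.mem P.zero hl L (half_pos hR₂)
  obtain ⟨Cs, hCs, hseg⟩ := P.defining.exists_segment (P.defining.subset P.mem) P.zero
  obtain ⟨δ, hδ, hs⟩ := hseg (R / 2) (by positivity)
  refine ⟨(|P.sup| + 2 * β) * (Cb * Cs) + 1, by positivity, ?_⟩
  filter_upwards [self_mem_nhdsWithin, eventually_dist_le (half_pos hδ),
    eventually_dist_le (half_pos hR), eventually_radius] with z hzT hzδ hzR hzr w K hw
  refine ⟨hw.nonneg z hzT hzr, ?_⟩
  obtain ⟨q, hqT, hq0, hqd, hle, -⟩ := hs z hzT (hzδ.trans_lt (by linarith))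
  obtain ⟨b, hbC, hbb⟩ := hbar q hqT hq0 (by linarith)
  have hin : ∀ y ∈ P.T, dist y q ≤ R → y ∈ Metric.ball P.p R₂ ∩ P.T := fun y hy hyq =>
    ⟨Metric.mem_ball.2 (by linarith [dist_triangle y q P.p]), hy⟩
  have hzq : dist z q ≤ R := by linarith [dist_triangle z P.p q, dist_comm q P.p]
  have key := le_mul_boundary_barrier P.defining (q := q) (R := R) (S := |P.sup|) (β := β)
    ((Metric.closedBall_subset_closedBall' (by linarith)).trans hRU) hbC
    (fun y hy hyq => ⟨(hbb y hy hyq).1, (hbb y hy hyq).2.2⟩) hw.smooth_two (abs_nonneg _) hβ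
    (fun y hy hyq => (hw.le_sup y hy (hball (hin y hy hyq)).2).trans (le_abs_self _))
    (fun y hy hyq h0 => (hw.vanish y hy (hball (hin y hy hyq)).2 h0).le)
    (fun y hy hyq _ => ⟨_, (hball (hin y hy hyq.le)).1.1, ?_⟩) z hzT hzq
  · have h1 := (hbb z hzT hzq).2.1
    have h2 : 0 ≤ |P.sup| + 2 * β := by positivity
    have h3 : 0 ≤ -P.ρ z := neg_nonneg.2 (P.defining.nonpos hzT)
    have h4 : b z ≤ Cb * (Cs * (-P.ρ z)) := h1.trans (mul_le_mul_of_nonneg_left hle hCb.le)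
    nlinarith [mul_le_mul_of_nonneg_left h4 h2]
  · have h1 := hw.trace_form_nonneg hy (hball (hin y hy hyq.le)).2
    have h2 := (hball (hin y hy hyq.le)).1.2 ()
    rw [form, Matrix.mul_add, trace_add, add_re] at h1
    linarith [(re_le_norm _).trans h2]

/-- At boundary points the differential of a solution is a bounded nonpositive multiple of the
conormal, and the tangential part of its complex Hessian is the same multiple of that of `ρ`. -/
theorem exists_hessian_boundary (P : BoundaryPatch n) : ∃ C : ℝ, 0 < C ∧ ∀ᶠ q in 𝓝[P.T] P.p,
    P.ρ q = 0 → ∀ w K, P.Solution w K → ∃ η : ℝ, 0 ≤ η ∧ η ≤ C ∧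
      (∀ v, fderivWithin ℝ w P.T q v = -η * fderiv ℝ P.ρ q v) ∧
      (∀ i j, ∀ᶠ z in 𝓝[P.T] q, P.ρ z = 0 →
        tang P.T (fun y => (P.ρ y : ℂ)) (fun y => (w y : ℂ)) i j z = 0) ∧
      ∃ a b, complexHessian P.T w q = ((-η : ℝ) : ℂ) • complexHessian P.T P.ρ q +
        (vecMulVec a (star (P.conormal q)) + vecMulVec (P.conormal q) b) := by
  obtain ⟨C, hC, hle⟩ := P.exists_le_dist
  refine ⟨C, hC, ?_⟩
  have hlt : ∀ᶠ z in 𝓝[P.T] P.p, dist z P.p ≤ P.radius := eventually_radius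
  filter_upwards [eventually_eventually_nhdsWithin.2 (eventually_eventually_nhdsWithin.2
    (hle.and hlt)), self_mem_nhdsWithin] with q hq hqT h0 w K hw
  have hnd : ∀ᶠ z in 𝓝[P.T] q, z ∈ P.T → P.ρ z = 0 → ∃ η : ℝ, 0 ≤ η ∧ η ≤ C ∧
      ∀ v, fderivWithin ℝ w P.T z v = -η * fderiv ℝ P.ρ z v := by
    filter_upwards [hq] with z hz hzT hz0
    exact P.defining.exists_normal_derivative hzT hz0 (hw.diffAt hzT)
      (hw.vanish z hzT (hz.self_of_nhdsWithin hzT).2 hz0) (hz.mono fun y hy => hy.1 w K hw)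
  obtain ⟨η, hη0, hηC, hη⟩ := hnd.self_of_nhdsWithin hqT hqT h0
  have hu : ∀ {z}, z ∈ P.T → UniqueDiffWithinAt ℝ P.T z := fun hz => P.reg.1 _ hz
  have hρd : ∀ {z}, z ∈ P.T → DifferentiableWithinAt ℝ P.ρ P.T z := fun hz =>
    P.smooth_rho.differentiableOn (by simp) _ hz
  have hdzb : ∀ {z}, z ∈ P.T → ∀ {η : ℝ}, (∀ v, fderivWithin ℝ w P.T z v =
      -η * fderiv ℝ P.ρ z v) → ∀ k, dzbar P.T k (fun y => (w y : ℂ)) z =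
        -η * dzbar P.T k (fun y => (P.ρ y : ℂ)) z := by
    intro z hz η hη k
    rw [dzbar_ofReal (hu hz) (hw.diffAt hz), P.defining.dz_eq_of_fderivWithin hz (hw.diffAt hz) hη,
      dzbar_ofReal (hu hz) (hρd hz)]
    simp
  have hvan : ∀ i j, ∀ᶠ z in 𝓝[P.T] q, P.ρ z = 0 →
      tang P.T (fun y => (P.ρ y : ℂ)) (fun y => (w y : ℂ)) i j z = 0 := by
    intro i j
    filter_upwards [hnd, self_mem_nhdsWithin] with z hz hzT hz0
    obtain ⟨η', -, -, hη'⟩ := hz hzT hz0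
    rw [tang, hdzb hzT hη', P.defining.dz_eq_of_fderivWithin hzT (hw.diffAt hzT) hη']
    ring
  refine ⟨η, hη0, hηC, hη, hvan, ?_⟩
  obtain ⟨k, hk⟩ : ∃ k, P.conormal q k ≠ 0 := by
    by_contra! hcon
    exact dzv_ne_zero P.defining hqT h0 (funext hcon)
  have hρ2 : ContDiffOn ℝ 2 (fun y => (P.ρ y : ℂ)) P.T := P.smooth_rhoC.of_le (by decide)
  have hw2 : ContDiffOn ℝ 2 (fun y => (w y : ℂ)) P.T := contDiffOn_ofReal hw.smooth_two
  have hσ : ∀ j, ∃ c : ℂ, ∀ l, dzbar P.T l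
      (tang P.T (fun y => (P.ρ y : ℂ)) (fun y => (w y : ℂ)) j k) q =
        c * star (P.conormal q) l := by
    intro j
    have hσC := contDiffOn_tang (k := 1) P.reg.1 hρ2 hw2 (by norm_num) j k
    obtain ⟨C', hC'⟩ := P.defining.exists_norm_le_of_vanish hqT h0 hσC (hvan j k)
    obtain ⟨c, -, hc⟩ := P.defining.exists_fderivWithin_eq_smul hqT h0
      (hσC.differentiableOn one_ne_zero q hqT) ((hvan j k).self_of_nhdsWithin hqT h0) hC'
    refine ⟨c, fun l => ?_⟩
    have h1 : star (P.conormal q) l = dzbar P.T l (fun y => (P.ρ y : ℂ)) q := by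
      rw [dzbar_ofReal (hu hqT) (hρd hqT)]; rfl
    have h2 := fun v => fderivWithin_ofReal (hu hqT) (hρd hqT) v
    rw [h1]
    simp only [dzbar, hc, h2, (P.defining.hasFDerivAt
      (P.defining.subset hqT)).hasFDerivWithinAt.fderivWithin (hu hqT), real_smul]
    ring
  choose c hc using hσ
  have hk' : star (P.conormal q) k ≠ 0 := by simpa using hk
  have hdb : ∀ l, dzbar P.T l (fun y => (P.ρ y : ℂ)) q = star (P.conormal q) l := fun l => by
    rw [dzbar_ofReal (hu hqT) (hρd hqT)]; rfl
  refine ⟨fun j => c j / star (P.conormal q) k, fun l =>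
    (dzbar P.T l (dzbar P.T k (fun y => (w y : ℂ))) q +
      η * dzbar P.T l (dzbar P.T k (fun y => (P.ρ y : ℂ))) q) / star (P.conormal q) k, ?_⟩
  ext j l
  have h1 := hc j l
  rw [dzbar_tang P.reg hρ2 hw2 hqT, hdzb hqT hη, P.defining.dz_eq_of_fderivWithin hqT
    (hw.diffAt hqT) hη, hdb] at h1
  rw [complexHessian_eq, complexHessian_eq]
  simp only [Matrix.add_apply, Matrix.smul_apply, vecMulVec_apply, smul_eq_mul]
  have h3 : dz P.T j (fun y => (P.ρ y : ℂ)) q = P.conormal q j := rfl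
  rw [h3] at h1
  push_cast
  field_simp
  linear_combination h1

theorem normalForm_form_boundary (hz : z ∈ P.T) {η : ℝ} {a b : Fin n → ℂ}
    (h : complexHessian P.T w z = ((-η : ℝ) : ℂ) • complexHessian P.T P.ρ z +
      (vecMulVec a (star (P.conormal z)) + vecMulVec (P.conormal z) b)) :
    normalForm (P.Ω z) (P.conormal z) (P.form w z) =
      normalForm (P.Ω z) (P.conormal z) (P.ref z) -
      η * normalForm (P.Ω z) (P.conormal z) (complexHessian P.T P.ρ z) := by
  rw [form, h, normalForm_add, normalForm_add, normalForm_vecMulVec (P.posDef z hz),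
    normalForm_smul]
  ring

end BoundaryPatch

end Patch

/-! ### Lower bound for the tangential part of the form at the boundary -/

section NormalBarrier

variable {n : ℕ} {T U : Set (Cn n)} {ρ : Cn n → ℝ} {z p q : Cn n}

theorem complexHessian_barrier (hT : UniqueDiffOn ℝ T) {φ : Cn n → ℝ} (hφ : ContDiffOn ℝ 2 φ T)
    (hρ : ContDiffOn ℝ 2 ρ T) (hz : z ∈ T) (M : ℝ) :
    complexHessian T (fun y => -ρ y * φ y + M * ρ y ^ 2) z =
      ((-ρ z : ℝ) : ℂ) • complexHessian T φ z +
      ((-(φ z - 2 * M * ρ z) : ℝ) : ℂ) • complexHessian T ρ z +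
      (vecMulVec ((M : ℂ) • dzv T (fun y => (ρ y : ℂ)) z - dzv T (fun y => (φ y : ℂ)) z)
          (star (dzv T (fun y => (ρ y : ℂ)) z)) +
        vecMulVec (dzv T (fun y => (ρ y : ℂ)) z)
          (star ((M : ℂ) • dzv T (fun y => (ρ y : ℂ)) z - dzv T (fun y => (φ y : ℂ)) z))) := by
  have hc := contDiffOn_ofReal hρ
  have hp := contDiffOn_ofReal hφ
  have he : (fun w => ((-ρ w * φ w + M * ρ w ^ 2 : ℝ) : ℂ)) =
      fun w => (M : ℂ) * ((ρ w : ℂ) * (ρ w : ℂ)) - (ρ w : ℂ) * (φ w : ℂ) := by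
    funext w; push_cast; ring
  rw [complexHessian_eq, complexHessian_eq, complexHessian_eq, he,
    hess_sub hT (contDiffOn_const.mul (hc.mul hc)) (hc.mul hp) hz,
    hess_const_mul hT (hc.mul hc) _ hz, hess_mul hT hc hc hz, hess_mul hT hc hp hz,
    dzbv_ofReal (hT z hz) (hρ.differentiableOn two_ne_zero z hz),
    dzbv_ofReal (hT z hz) (hφ.differentiableOn two_ne_zero z hz)]
  ext i j
  simp only [Matrix.sub_apply, Matrix.smul_apply, Matrix.add_apply, smul_eq_mul, vecMulVec_apply,
    Pi.star_apply, Pi.sub_apply, Pi.smul_apply, star_sub, star_mul', RCLike.star_def, conj_ofReal]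
  push_cast
  ring

/-- Comparison of the forms `W` at a point where the difference of two functions has a
local maximum. -/
theorem compare_at_max (hreg : Regular T) (hz : T ∈ 𝓝 z) {w h : Cn n → ℝ}
    (hw : ContDiffOn ℝ 2 w T) (hh : ContDiffOn ℝ 2 h T)
    (hmax : IsLocalMax (fun y => w y - h y) z) {Ω g : Matrix (Fin n) (Fin n) ℂ} (hΩ : Ω.PosDef)
    (x : Fin n → ℂ) :
    quad (wOp Ω (g + complexHessian T w z)) x ≤ quad (wOp Ω (g + complexHessian T h z)) x ∧
    (Ω⁻¹ * wOp Ω (g + complexHessian T w z)).trace.re ≤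
      (Ω⁻¹ * wOp Ω (g + complexHessian T h z)).trace.re := by
  have hzT := mem_of_mem_nhds hz
  have hneg := quad_complexHessian_nonpos hreg (hw.sub hh) hz hmax
  have hsub := complexHessian_sub_real hreg.1 hw hh hzT
  have hherm : (complexHessian T h z - complexHessian T w z).IsHermitian :=
    (isHermitian_hess_ofReal hreg hh hzT).sub (isHermitian_hess_ofReal hreg hw hzT)
  have hpsd : (complexHessian T h z - complexHessian T w z).PosSemidef := by
    refine (posSemidef_iff_quad hherm).2 fun y => ?_
    have := hneg y
    change quad (complexHessian T (fun y => w y - h y) z) y ≤ 0 at this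
    rw [hsub, quad_sub] at this
    rw [quad_sub]
    linarith
  have hW := posSemidef_wOp hΩ hpsd
  have he : wOp Ω (g + complexHessian T h z) = wOp Ω (g + complexHessian T w z) +
      wOp Ω (complexHessian T h z - complexHessian T w z) := by
    rw [← wOp_add]; congr 1; abel
  have htr := trace_mul_re_nonneg hΩ.inv.posSemidef hW
  rw [he, quad_add, Matrix.mul_add, trace_add, add_re]
  exact ⟨by linarith [quad_nonneg hW x], by linarith⟩

theorem norm_barrier_le {g H R : Matrix (Fin n) (Fin n) ℂ} {a r : Fin n → ℂ} {s t b C D E F : ℝ}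
    (hg : ∀ i j, ‖g i j‖ ≤ C) (hH : ∀ i j, ‖H i j‖ ≤ D) (hR : ∀ i j, ‖R i j‖ ≤ C)
    (ha : ∀ i, ‖a i‖ ≤ E) (hr : ∀ i, ‖r i‖ ≤ C) (hs : |s| ≤ C) (ht : |t| ≤ F)
    (hb : b = C + (C * D + F * C + (E * C + C * E))) (i j : Fin n) :
    ‖(g + ((s : ℂ) • H + (t : ℂ) • R + (vecMulVec a (star r) + vecMulVec r (star a)))) i j‖ ≤ b := by
  simp only [Matrix.add_apply, Matrix.smul_apply, vecMulVec_apply, Pi.star_apply, smul_eq_mul]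
  have hC := (norm_nonneg _).trans (hr i)
  have h1 : ‖(s : ℂ) * H i j‖ ≤ C * D := by
    rw [norm_mul, norm_real]
    exact mul_le_mul hs (hH i j) (norm_nonneg _) hC
  have h2 : ‖(t : ℂ) * R i j‖ ≤ F * C := by
    rw [norm_mul, norm_real]
    exact mul_le_mul ht (hR i j) (norm_nonneg _) ((abs_nonneg _).trans ht)
  have h3 : ‖a i * star (r j)‖ ≤ E * C := by
    rw [norm_mul, norm_star]
    exact mul_le_mul (ha i) (hr j) (norm_nonneg _) ((norm_nonneg _).trans (ha i))
  have h4 : ‖r i * star (a j)‖ ≤ C * E := by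
    rw [norm_mul, norm_star]
    exact mul_le_mul (hr i) (ha j) (norm_nonneg _) hC
  rw [hb]
  exact (norm_add_le _ _).trans (add_le_add (hg i j) ((norm_add_le _ _).trans (add_le_add
    ((norm_add_le _ _).trans (add_le_add h1 h2)) ((norm_add_le _ _).trans (add_le_add h3 h4)))))

namespace BoundaryPatch

variable {P : BoundaryPatch n} {w : Cn n → ℝ} {K : ℝ}

/-- The normal form of the reference form. -/
def refNormal (P : BoundaryPatch n) (z : Cn n) : ℝ :=
  normalForm (P.Ω z) (P.conormal z) (P.ref z)

/-- The normal form of the Hessian of the defining function. -/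
def rhoNormal (P : BoundaryPatch n) (z : Cn n) : ℝ :=
  normalForm (P.Ω z) (P.conormal z) (complexHessian P.T P.ρ z)

theorem smooth_refNormal : ContDiffOn ℝ ∞ P.refNormal P.T :=
  P.smooth_normalForm le_rfl P.smooth_ref

theorem smooth_rhoNormal : ContDiffOn ℝ ∞ P.rhoNormal P.T :=
  P.smooth_normalForm le_rfl P.smooth_hessian_rho

theorem refNormal_pos (P : BoundaryPatch n) : 0 < P.refNormal P.p := by
  refine quad_pos (P.posDef_ref _ P.mem) fun h => P.conormal_ne_zero ?_
  rw [← one_mulVec (P.conormal P.p), ← metric_mul_inv P.mem, ← mulVec_mulVec, h, mulVec_zero]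

theorem eventually_const_lt {f : Cn n → ℝ} (hf : ContDiffOn ℝ ∞ f P.T) {a : ℝ} (ha : a < f P.p) :
    ∀ᶠ z in 𝓝[P.T] P.p, a < f z :=
  (hf.continuousOn P.p P.mem).eventually_const_lt ha

theorem eventually_lt_const {f : Cn n → ℝ} (hf : ContDiffOn ℝ ∞ f P.T) {a : ℝ} (ha : f P.p < a) :
    ∀ᶠ z in 𝓝[P.T] P.p, f z < a :=
  (hf.continuousOn P.p P.mem).eventually_lt_const ha

theorem exists_bound {ι : Type*} [Finite ι] {f : ι → Cn n → ℂ} {V : Set (Cn n)}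
    (hV : IsOpen V) (hp : P.p ∈ V) (hf : ∀ i, ContDiffOn ℝ ∞ (f i) (P.T ∩ V)) :
    ∃ C : ℝ, 0 < C ∧ ∀ᶠ y in 𝓝[P.T] P.p, ∀ i, ‖f i y‖ ≤ C := by
  have h := exists_eventually_bound (S := P.T ∩ V) (x := P.p) (f := f) fun i =>
    (hf i).continuousOn P.p ⟨P.mem, hp⟩
  rwa [inter_comm, nhdsWithin_inter_of_mem (mem_nhdsWithin_of_mem_nhds (hV.mem_nhds hp))] at h

set_option maxHeartbeats 4000000 in
/-- An upper barrier for solutions when the normal form of the Hessian of `ρ` is positive at `p`.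
At boundary points `normalForm g = refNormal - η rhoNormal`, where `η` is the inner normal slope of
`w`, so that the quotient `refNormal / rhoNormal` is the slope at which `g` would degenerate. The
barrier has the smaller slope `refNormal / rhoNormal - θ` at `q`. If it were touched from below by
`w` at an interior point, the form `W` of the barrier would dominate that of the solution there,
but for small `θ` its normal form is too small for the lower bound of the determinant. -/
theorem exists_normal_barrier (P : BoundaryPatch n) (hκ : 0 < P.rhoNormal P.p) :
    ∃ θ A M : ℝ, 0 < θ ∧ ∀ᶠ q in 𝓝[P.T] P.p, P.ρ q = 0 → ∀ w K, P.Solution w K →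
      ∀ᶠ z in 𝓝[P.T] q, w z ≤
        -P.ρ z * (P.refNormal z / P.rhoNormal z + (A * ‖z - q‖ ^ 2 - θ)) + M * P.ρ z ^ 2 := by
  obtain ⟨C', hC', hle⟩ := P.exists_le_dist
  obtain ⟨κ₀, hκ₀⟩ : ∃ x : ℝ, x = P.rhoNormal P.p / 2 := ⟨_, rfl⟩
  have hκ₀0 : 0 < κ₀ := by rw [hκ₀]; exact half_pos hκ
  obtain ⟨s₀, hs₀⟩ : ∃ x : ℝ, x = P.refNormal P.p / 2 := ⟨_, rfl⟩
  have hs₀0 : 0 < s₀ := by rw [hs₀]; exact half_pos P.refNormal_pos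
  -- On `T ∩ V` the quotient of the two normal forms is smooth.
  obtain ⟨V, hV, hpV, hVκ⟩ : ∃ V : Set (Cn n), IsOpen V ∧ P.p ∈ V ∧
      ∀ z ∈ P.T ∩ V, κ₀ < P.rhoNormal z := by
    have := eventually_const_lt P.smooth_rhoNormal (half_lt_self hκ)
    rw [← hκ₀] at this
    obtain ⟨V, hV, hp, hsub⟩ := mem_nhdsWithin.1 this
    exact ⟨V, hV, hp, fun z hz => hsub ⟨hz.2, hz.1⟩⟩
  have hdef := P.defining.mono hV
  set T' := P.T ∩ V with hT'
  have hreg : Regular T' := hdef.isRegular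
  set φ₀ : Cn n → ℝ := fun z => P.refNormal z / P.rhoNormal z with hφ₀
  have hφ₀C : ContDiffOn ℝ ∞ φ₀ T' := (P.smooth_refNormal.mono inter_subset_left).div
    (P.smooth_rhoNormal.mono inter_subset_left) fun z hz => (hκ₀0.trans (hVκ z hz)).ne'
  have hφH : ∀ i j, ContDiffOn ℝ ∞ (fun z => complexHessian T' φ₀ z i j) T' :=
    contDiffOn_complexHessian hreg.1 hφ₀C le_rfl
  have hφN : ContDiffOn ℝ ∞ (fun z => normalForm (P.Ω z) (P.conormal z) (complexHessian T' φ₀ z))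
      T' :=
    contDiffOn_quad (contDiffOn_wOp (fun i j => (P.smooth_metric i j).mono inter_subset_left)
      (fun _ hz => det_metric_ne hz.1) hφH) (contDiffOn_mulVec_apply
        (fun i j => (P.smooth_inv i j).mono inter_subset_left)
        fun i => (P.smooth_conormal i).mono inter_subset_left)
  have h1N : ContDiffOn ℝ ∞ (fun z => normalForm (P.Ω z) (P.conormal z) 1) P.T :=
    P.smooth_normalForm le_rfl fun _ _ => contDiffOn_const
  have hmT : ∀ {f : Cn n → ℂ}, ContDiffOn ℝ ∞ f P.T → ContDiffOn ℝ ∞ f (P.T ∩ V) :=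
    fun hf => hf.mono inter_subset_left
  -- Bounds for the coefficients near `p`.
  obtain ⟨C₁, hC₁, hb₁⟩ := exists_bound (P := P) hV hpV
    (f := fun (i : Fin n × Fin n) z => P.ref z i.1 i.2) fun i => hmT (P.smooth_ref _ _)
  obtain ⟨C₂, hC₂, hb₂⟩ := exists_bound (P := P) hV hpV
    (f := fun (i : Fin n × Fin n) z => complexHessian T' φ₀ z i.1 i.2) fun i => hφH _ _
  obtain ⟨C₃, hC₃, hb₃⟩ := exists_bound (P := P) hV hpV
    (f := fun (i : Fin n × Fin n) z => complexHessian P.T P.ρ z i.1 i.2)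
    fun i => hmT (P.smooth_hessian_rho _ _)
  obtain ⟨C₄, hC₄, hb₄⟩ := exists_bound (P := P) hV hpV
    (f := fun (i : Fin n) z => P.conormal z i) fun i => hmT (P.smooth_conormal _)
  obtain ⟨C₅, hC₅, hb₅⟩ := exists_bound (P := P) hV hpV
    (f := fun (i : Fin n) z => dz T' i (fun y => (φ₀ y : ℂ)) z)
    fun i => contDiffOn_dz hreg.1 (contDiffOn_ofReal hφ₀C) le_rfl i
  obtain ⟨C₆, hC₆, hb₆⟩ := exists_bound (P := P) hV hpV
    (f := fun (i : Fin n × Fin n) z => (P.Ω z)⁻¹ i.1 i.2) fun i => hmT (P.smooth_inv _ _)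
  obtain ⟨C₇, hC₇, hb₇⟩ := exists_bound (P := P) hV hpV
    (f := fun (i : Fin 5) z => ![((P.ρ z : ℝ) : ℂ), ((φ₀ z : ℝ) : ℂ), ((P.rhoNormal z : ℝ) : ℂ),
      ((normalForm (P.Ω z) (P.conormal z) (complexHessian T' φ₀ z) : ℝ) : ℂ),
      ((normalForm (P.Ω z) (P.conormal z) 1 : ℝ) : ℂ)] i) (by
        intro i
        fin_cases i
        · exact hmT P.smooth_rhoC
        · exact contDiffOn_ofReal hφ₀C
        · exact hmT (contDiffOn_ofReal P.smooth_rhoNormal)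
        · exact contDiffOn_ofReal hφN
        · exact hmT (contDiffOn_ofReal h1N))
  obtain ⟨C, hC⟩ : ∃ x : ℝ, x = C₁ + C₂ + C₃ + C₄ + C₅ + C₆ + C₇ := ⟨_, rfl⟩
  have hC0 : 0 < C := by rw [hC]; positivity
  -- A lower bound for the length of the conormal.
  obtain ⟨c₃, hc₃⟩ : ∃ x : ℝ, x = quad (P.Ω P.p)⁻¹ (P.conormal P.p) / 2 := ⟨_, rfl⟩
  have hc₃0 : 0 < c₃ := by
    rw [hc₃]
    exact half_pos (quad_pos (P.posDef _ P.mem).inv P.conormal_ne_zero)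
  have hlen : ∀ᶠ z in 𝓝[P.T] P.p, c₃ < quad (P.Ω z)⁻¹ (P.conormal z) := by
    rw [hc₃]
    exact eventually_const_lt (contDiffOn_quad P.smooth_inv P.smooth_conormal) (half_lt_self
      (quad_pos (P.posDef _ P.mem).inv P.conormal_ne_zero))
  have hsev : ∀ᶠ z in 𝓝[P.T] P.p, s₀ < P.refNormal z := by
    rw [hs₀]
    exact eventually_const_lt P.smooth_refNormal (half_lt_self P.refNormal_pos)
  have hVU : V ∩ P.U ∈ 𝓝 P.p :=
    inter_mem (hV.mem_nhds hpV) (P.defining.isOpen.mem_nhds (P.defining.subset P.mem))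
  obtain ⟨R₀, hR₀, hball₀⟩ := Metric.mem_nhds_iff.1 hVU
  obtain ⟨R₁, hR₁, hball⟩ := Metric.mem_nhdsWithin_iff.1
    (((((((((hle.and hb₁).and hb₂).and hb₃).and hb₄).and hb₅).and hb₆).and hb₇).and
      (hlen.and hsev)).and eventually_radius)
  obtain ⟨R, hR⟩ : ∃ x : ℝ, x = min (min R₀ R₁ / 3) 1 := ⟨_, rfl⟩
  have hR0 : 0 < R := by
    rw [hR]
    exact lt_min (by have := lt_min hR₀ hR₁; positivity) one_pos
  have hRle : 3 * R ≤ min R₀ R₁ := by rw [hR]; linarith [min_le_left (min R₀ R₁ / 3) 1]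
  have hR1 : R ≤ 1 := hR ▸ min_le_right _ _
  -- The choice of `A`, `M` and `d₀` makes the barrier exceed `C' d ≥ w` on the sphere of radius `R`
  -- around `q` and on the level set `d = -ρ = d₀`, and `M` absorbs the Hessians of the quotient and
  -- of `A |z - q|²` in the normal direction.
  obtain ⟨A, hA⟩ : ∃ x : ℝ, x = C' / R ^ 2 := ⟨_, rfl⟩
  have hA0 : 0 < A := by rw [hA]; positivity
  obtain ⟨M, hM⟩ : ∃ x : ℝ, x = C * (1 + A) / (2 * κ₀) := ⟨_, rfl⟩
  have hM0 : 0 < M := by rw [hM]; positivity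
  obtain ⟨d₀, hd₀⟩ : ∃ x : ℝ, x = C' / M := ⟨_, rfl⟩
  have hd₀0 : 0 < d₀ := by rw [hd₀]; positivity
  obtain ⟨F, hF⟩ : ∃ x : ℝ, x = C + A + 1 + 2 * M * C := ⟨_, rfl⟩
  obtain ⟨E, hE⟩ : ∃ x : ℝ, x = M * C + (C + A) := ⟨_, rfl⟩
  obtain ⟨b, hb⟩ : ∃ x : ℝ, x = C + (C * (C + A) + F * C + (E * C + C * E)) := ⟨_, rfl⟩
  have hF0 : 0 < F := by rw [hF]; positivity
  have hE0 : 0 < E := by rw [hE]; positivity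
  have hb0 : 0 < b := by rw [hb]; positivity
  obtain ⟨Λ, hΛ⟩ : ∃ x : ℝ, x = (n : ℝ) * (n * n * (C * b)) := ⟨_, rfl⟩
  have hn2 : (2 : ℝ) ≤ n := by exact_mod_cast P.two_le
  have hΛ0 : 0 < Λ := by rw [hΛ]; positivity
  -- `θ ≤ s₀ / C` keeps the slope of the barrier nonnegative; the last bound contradicts the lower
  -- bound `inf` of the determinant, `Λ` being a bound of the relative trace of `W`.
  obtain ⟨θ, hθ⟩ : ∃ x : ℝ, x = min (min 1 (s₀ / C)) (P.inf * c₃ / (2 * C * Λ ^ (n - 1))) := ⟨_, rfl⟩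
  have hθ0 : 0 < θ := by
    have := P.inf_pos
    rw [hθ]
    exact lt_min (lt_min one_pos (by positivity)) (by positivity)
  have hθ1 : θ ≤ 1 := hθ ▸ (min_le_left _ _).trans (min_le_left _ _)
  have hθs : θ ≤ s₀ / C := hθ ▸ (min_le_left _ _).trans (min_le_right _ _)
  have hθm : θ ≤ P.inf * c₃ / (2 * C * Λ ^ (n - 1)) := hθ ▸ min_le_right _ _
  refine ⟨θ, A, M, hθ0, ?_⟩
  filter_upwards [self_mem_nhdsWithin, eventually_dist_le hR0] with q hqT hqR hq0 w K hw
  -- Everything holds on the ball of radius `R` around `q`.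
  have hin : ∀ y, dist y q ≤ R → y ∈ Metric.ball P.p R₀ ∧ y ∈ Metric.ball P.p R₁ := by
    intro y hy
    have h1 : dist y P.p < min R₀ R₁ := by linarith [dist_triangle y q P.p]
    exact ⟨h1.trans_le (min_le_left _ _), h1.trans_le (min_le_right _ _)⟩
  have hV' : ∀ y, dist y q ≤ R → y ∈ V := fun y hy => (hball₀ (hin y hy).1).1
  have hsubU : Metric.closedBall q R ⊆ P.U := fun y hy => (hball₀ (hin y hy).1).2
  have hall := fun y (hy : y ∈ P.T) (hyq : dist y q ≤ R) => hball ⟨(hin y hyq).2, hy⟩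
  set φ : Cn n → ℝ := fun z => φ₀ z + (A * ‖z - q‖ ^ 2 - θ) with hφ
  have hψC : ContDiffOn ℝ 2 (fun z => A * ‖z - q‖ ^ 2 - θ) T' :=
    (contDiffOn_const.mul (contDiff_normSq q).contDiffOn).sub contDiffOn_const
  have hφC : ContDiffOn ℝ 2 φ T' := (hφ₀C.of_le (by decide)).add hψC
  have hρC : ContDiffOn ℝ 2 P.ρ T' := (P.smooth_rho.mono inter_subset_left).of_le (by decide)
  set h : Cn n → ℝ := fun z => -P.ρ z * φ z + M * P.ρ z ^ 2 with hh
  have hhC : ContDiffOn ℝ 2 h T' := (hρC.neg.mul hφC).add (contDiffOn_const.mul (hρC.pow 2))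
  have hwC : ContDiffOn ℝ 2 w T' := hw.smooth_two.mono inter_subset_left
  set D := (P.T ∩ Metric.closedBall q R) ∩ {z | -d₀ ≤ P.ρ z} with hD
  have hDT' : D ⊆ T' := fun y hy => ⟨hy.1.1, hV' y hy.1.2⟩
  have hDc : IsCompact D := by
    have h1 := isCompact_inter_closedBall P.defining hsubU
    exact h1.of_isClosed_subset ((P.smooth_rho.continuousOn.mono
      inter_subset_left).preimage_isClosed_of_isClosed h1.isClosed isClosed_Ici) inter_subset_left
  set O := {y ∈ P.U | P.ρ y ∈ Ioo (-d₀) 0} ∩ Metric.ball q R with hO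
  have hOo : IsOpen O := (P.defining.smooth.continuousOn.isOpen_inter_preimage
    P.defining.isOpen isOpen_Ioo).inter Metric.isOpen_ball
  have hOD : O ⊆ D := fun y hy => ⟨⟨(P.defining.mem_iff hy.1.1).2 hy.1.2.2.le,
    Metric.ball_subset_closedBall hy.2⟩, hy.1.2.1.le⟩
  have hbounds : ∀ y ∈ P.T, dist y q ≤ R → |P.ρ y| ≤ C ∧ |φ₀ y| ≤ C ∧ |P.rhoNormal y| ≤ C ∧
      |normalForm (P.Ω y) (P.conormal y) (complexHessian T' φ₀ y)| ≤ C ∧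
      |normalForm (P.Ω y) (P.conormal y) 1| ≤ C := by
    intro y hy hyq
    have h7 := (hall y hy hyq).1.1.2
    have hC7 : C₇ ≤ C := by rw [hC]; linarith
    refine ⟨?_, ?_, ?_, ?_, ?_⟩
    · simpa using (h7 0).trans hC7
    · simpa using (h7 1).trans hC7
    · simpa using (h7 2).trans hC7
    · simpa using (h7 3).trans hC7
    · simpa using (h7 4).trans hC7
  have hφ₀θ : ∀ y ∈ P.T, dist y q ≤ R → θ ≤ φ₀ y := by
    intro y hy hyq
    have h1 := (hall y hy hyq).1.2.2
    have h2 := hVκ y ⟨hy, hV' y hyq⟩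
    have h3 := (abs_le.1 (hbounds y hy hyq).2.2.1).2
    exact hθs.trans (div_le_div₀ (hs₀0.trans h1).le h1.le (hκ₀0.trans h2) h3)
  have key := nonpos_of_no_interior_max hDc hOo hOD (f := fun y => w y - h y)
    ((hwC.sub hhC).continuousOn.mono hDT') ?_ ?_
  · have hρev : ∀ᶠ z in 𝓝[P.T] q, -d₀ < P.ρ z :=
      (P.smooth_rho.continuousOn q hqT).eventually_const_lt (by rw [hq0]; linarith)
    filter_upwards [hρev, self_mem_nhdsWithin,
      mem_nhdsWithin_of_mem_nhds (Metric.closedBall_mem_nhds q hR0)] with z hz hzT hzR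
    have := key z ⟨⟨hzT, hzR⟩, hz.le⟩
    simp only [hh, hφ, hφ₀] at this
    linarith
  · rintro y ⟨⟨hyT, hyR⟩, hyd⟩ hyO
    have hyR' : dist y q ≤ R := hyR
    have hρy := P.defining.nonpos hyT
    have hwy := ((hall y hyT hyR).1.1.1.1.1.1.1.1.1 w K hw).2
    have hθy := hφ₀θ y hyT hyR
    have hφy : 0 ≤ φ y := by
      have : 0 ≤ A * ‖y - q‖ ^ 2 := by positivity
      simp only [hφ]; linarith
    rcases hρy.eq_or_lt with h0 | hneg
    · have h1 : h y = 0 := by simp [hh, h0]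
      rw [h0] at hwy
      simp only [h1]
      linarith
    · by_cases hyR2 : dist y q = R
      · have h1 : C' ≤ φ y := by
          have : A * ‖y - q‖ ^ 2 = C' := by
            rw [← dist_eq_norm, hyR2, hA]; field_simp
          simp only [hφ, this]; linarith
        have h2 : 0 ≤ M * P.ρ y ^ 2 := by positivity
        have h3 : C' * (-P.ρ y) ≤ φ y * (-P.ρ y) :=
          mul_le_mul_of_nonneg_right h1 (by linarith)
        simp only [hh]
        linarith
      · have hd : P.ρ y = -d₀ := by
          by_contra hne
          exact hyO ⟨⟨P.defining.subset hyT, lt_of_le_of_ne hyd (Ne.symm hne), hneg⟩,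
            lt_of_le_of_ne hyR' hyR2⟩
        have h1 : M * P.ρ y ^ 2 = C' * (-P.ρ y) := by
          rw [hd, hd₀]; field_simp
        have h2 : 0 ≤ -P.ρ y * φ y := mul_nonneg (by linarith) hφy
        simp only [hh]
        linarith
  · intro y hyO _ hmax
    have hyD := hOD hyO
    have hyT := hyD.1.1
    have hyR : dist y q ≤ R := hyD.1.2
    have hyT' := hDT' hyD
    have hρneg : P.ρ y < 0 := hyO.1.2.2
    have hnhds : T' ∈ 𝓝 y := inter_mem (P.defining.mem_nhds_of_neg hyO.1.1 hρneg)
      (hV.mem_nhds hyT'.2)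
    obtain ⟨⟨⟨⟨⟨⟨⟨⟨⟨-, b1⟩, b2⟩, b3⟩, b4⟩, b5⟩, b6⟩, -⟩, hlen', -⟩, hrad⟩ := hall y hyT hyR
    obtain ⟨bρ, bφ, bκ, bN, b1N⟩ := hbounds y hyT hyR
    have hΩ := P.posDef y hyT
    have hcmp := compare_at_max hreg hnhds hwC hhC hmax hΩ (g := P.ref y)
      ((P.Ω y)⁻¹ *ᵥ P.conormal y)
    have hHw : complexHessian T' w y = complexHessian P.T w y := by
      rw [complexHessian_eq, complexHessian_eq, hT', hess_inter hV hyT hyT'.2]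
    have hHρ : complexHessian T' P.ρ y = complexHessian P.T P.ρ y := by
      rw [complexHessian_eq, complexHessian_eq, hT', hess_inter hV hyT hyT'.2]
    have hdρ : dzv T' (fun y => (P.ρ y : ℂ)) y = P.conormal y := by
      funext i; exact dz_inter hV hyT'.2 i _
    have hHφ : complexHessian T' φ y = complexHessian T' φ₀ y + (A : ℂ) • 1 := by
      rw [hφ, complexHessian_add_real hreg.1 (hφ₀C.of_le (by decide)) hψC hyT',
        complexHessian_sub_real hreg.1 (contDiffOn_const.mul (contDiff_normSq q).contDiffOn)
          contDiffOn_const hyT', complexHessian_const, sub_zero,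
        complexHessian_const_mul hreg.1 (contDiff_normSq q).contDiffOn _ hyT',
        complexHessian_eq (fun w => ‖w - q‖ ^ 2), hess_normSq hreg.1 hyT']
    have hyq1 : ‖y - q‖ ≤ 1 := by rw [← dist_eq_norm]; exact hyR.trans hR1
    have hyqi : ∀ i, ‖y i - q i‖ ≤ 1 := fun i => by
      rw [← PiLp.sub_apply]; exact (PiLp.norm_apply_le _ i).trans hyq1
    have hdφ : ∀ i, dz T' i (fun y => (φ y : ℂ)) y =
        dz T' i (fun y => (φ₀ y : ℂ)) y + A * (starRingEnd ℂ) (y i - q i) := by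
      intro i
      have hu := hreg.1 y hyT'
      have d1 : DifferentiableWithinAt ℝ (fun y => (φ₀ y : ℂ)) T' y :=
        (contDiffOn_ofReal hφ₀C).differentiableOn (by simp) y hyT'
      have d2 : DifferentiableWithinAt ℝ (fun z => ((‖z - q‖ ^ 2 : ℝ) : ℂ)) T' y :=
        (contDiffOn_ofReal (contDiff_normSq q (k := 1)).contDiffOn).differentiableOn
          one_ne_zero y hyT'
      have he : (fun y => (φ y : ℂ)) = fun y => (φ₀ y : ℂ) +
          ((A : ℂ) * ((‖y - q‖ ^ 2 : ℝ) : ℂ) + (-θ : ℂ)) := by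
        funext y; simp only [hφ]; push_cast; ring
      rw [he, dz_add hu d1 (((differentiableWithinAt_const _).fun_mul d2).fun_add
        (differentiableWithinAt_const _)), dz_add hu ((differentiableWithinAt_const _).fun_mul d2)
        (differentiableWithinAt_const _), dz_mul hu (differentiableWithinAt_const _) d2, dz_const,
        dz_const, dz_normSq hreg.1 hyT']
      ring
    have hφyle : |φ y| ≤ C + A + 1 := by
      have h1 : A * ‖y - q‖ ^ 2 ≤ A * 1 :=
        mul_le_mul_of_nonneg_left (pow_le_one₀ (norm_nonneg _) hyq1) hA0.le
      have h2 : 0 ≤ A * ‖y - q‖ ^ 2 := by positivity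
      obtain ⟨h3, h4⟩ := abs_le.1 bφ
      simp only [hφ]
      exact abs_le.2 ⟨by linarith, by linarith⟩
    rw [hHw, hh, complexHessian_barrier hreg.1 hφC hρC hyT', hHρ, hdρ, hHφ] at hcmp
    -- The normal form of the barrier is small at `y`.
    have hκy := hVκ y hyT'
    have hnf : normalForm (P.Ω y) (P.conormal y) (P.ref y + (((-P.ρ y : ℝ) : ℂ) •
        (complexHessian T' φ₀ y + (A : ℂ) • 1) + ((-(φ y - 2 * M * P.ρ y) : ℝ) : ℂ) •
          complexHessian P.T P.ρ y + (vecMulVec ((M : ℂ) • P.conormal y -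
          dzv T' (fun y => (φ y : ℂ)) y) (star (P.conormal y)) + vecMulVec (P.conormal y)
          (star ((M : ℂ) • P.conormal y - dzv T' (fun y => (φ y : ℂ)) y))))) ≤ θ * C := by
      rw [normalForm_add, normalForm_add, normalForm_add, normalForm_vecMulVec hΩ, normalForm_smul,
        normalForm_smul, normalForm_add, normalForm_smul]
      have e1 : φ y * P.rhoNormal y = P.refNormal y + (A * ‖y - q‖ ^ 2 - θ) * P.rhoNormal y := by
        simp only [hφ, hφ₀]
        rw [add_mul, div_mul_cancel₀ _ (hκ₀0.trans hκy).ne']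
      have e2 : 0 ≤ A * ‖y - q‖ ^ 2 * P.rhoNormal y := by
        have := hκ₀0.trans hκy
        positivity
      have e3 : C * (1 + A) ≤ 2 * M * P.rhoNormal y := by
        calc C * (1 + A) = 2 * M * κ₀ := by rw [hM]; field_simp
          _ ≤ _ := mul_le_mul_of_nonneg_left hκy.le (by positivity)
      have e4 := (abs_le.1 bN).2
      have e5 := mul_le_mul_of_nonneg_left (abs_le.1 b1N).2 hA0.le
      have e6 := mul_le_mul_of_nonneg_left (abs_le.1 bκ).2 hθ0.le
      have e7 : -P.ρ y * (normalForm (P.Ω y) (P.conormal y) (complexHessian T' φ₀ y) +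
          A * normalForm (P.Ω y) (P.conormal y) 1 - 2 * M * P.rhoNormal y) ≤ 0 :=
        mul_nonpos_of_nonneg_of_nonpos (by linarith) (by linarith)
      have e8 : normalForm (P.Ω y) (P.conormal y) (P.ref y) = P.refNormal y := rfl
      have e9 : normalForm (P.Ω y) (P.conormal y) (complexHessian P.T P.ρ y) = P.rhoNormal y := rfl
      rw [e8, e9]
      linarith
    -- Its trace is bounded.
    have htr := abs_trace_mul_le (G := (P.Ω y)⁻¹) (a := C) (b := b)
      (H := P.ref y + (((-P.ρ y : ℝ) : ℂ) •
        (complexHessian T' φ₀ y + (A : ℂ) • 1) + ((-(φ y - 2 * M * P.ρ y) : ℝ) : ℂ) •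
          complexHessian P.T P.ρ y + (vecMulVec ((M : ℂ) • P.conormal y -
          dzv T' (fun y => (φ y : ℂ)) y) (star (P.conormal y)) + vecMulVec (P.conormal y)
          (star ((M : ℂ) • P.conormal y - dzv T' (fun y => (φ y : ℂ)) y)))))
      (fun i j => (b6 (i, j)).trans (by linarith)) (norm_barrier_le (D := C + A) (E := E) (F := F)
        (fun i j => (b1 (i, j)).trans (by linarith)) (fun i j => ?_)
        (fun i j => (b3 (i, j)).trans (by linarith)) (fun i => ?_)
        (fun i => (b4 i).trans (by linarith)) (by rwa [abs_neg]) ?_ hb)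
    rotate_left
    · rw [Matrix.add_apply, Matrix.smul_apply, smul_eq_mul]
      refine (norm_add_le _ _).trans (add_le_add ((b2 (i, j)).trans (by linarith)) ?_)
      rw [norm_mul, norm_real, Real.norm_eq_abs, abs_of_pos hA0]
      refine mul_le_of_le_one_right hA0.le ?_
      rw [one_apply]; split_ifs <;> simp
    · rw [Pi.sub_apply, Pi.smul_apply, smul_eq_mul, hE]
      refine (norm_sub_le _ _).trans (add_le_add ?_ ?_)
      · rw [norm_mul, norm_real, Real.norm_eq_abs, abs_of_pos hM0]
        exact mul_le_mul_of_nonneg_left ((b4 i).trans (by linarith)) hM0.le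
      · change ‖dz T' i (fun y => (φ y : ℂ)) y‖ ≤ _
        rw [hdφ i]
        refine (norm_add_le _ _).trans (add_le_add ((b5 i).trans (by linarith)) ?_)
        rw [norm_mul, norm_real, Real.norm_eq_abs, abs_of_pos hA0, RCLike.norm_conj]
        exact mul_le_of_le_one_right hA0.le (hyqi i)
    · rw [abs_neg, hF]
      refine (abs_sub _ _).trans (add_le_add hφyle ?_)
      rw [abs_mul, abs_of_pos (by positivity : 0 < 2 * M)]
      exact mul_le_mul_of_nonneg_left bρ (by positivity)
    have hWpos := hw.posDef y hyT hrad
    have hdet := det_mul_quad_le hΩ hWpos ((P.Ω y)⁻¹ *ᵥ P.conormal y)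
    rw [quad_metric_inv_mulVec hyT] at hdet
    have hinf := hw.inf_le y hyT hrad
    have htrW : ((P.Ω y)⁻¹ * P.W w y).trace.re ≤ Λ := by
      refine hcmp.2.trans ?_
      rw [trace_inv_mul_wOp hΩ, show ((n : ℂ) - 1) = ((n - 1 : ℝ) : ℂ) by push_cast; rfl,
        re_ofReal_mul]
      have := (abs_le.1 htr).2
      have h0 : 0 ≤ (n : ℝ) * n * (C * b) := by positivity
      calc _ ≤ ((n : ℝ) - 1) * (n * n * (C * b)) :=
            mul_le_mul_of_nonneg_left this (by linarith)
        _ ≤ Λ := by rw [hΛ]; exact mul_le_mul_of_nonneg_right (by linarith) h0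
    have htrW0 : 0 ≤ ((P.Ω y)⁻¹ * P.W w y).trace.re :=
      trace_mul_re_nonneg hΩ.inv.posSemidef hWpos.posSemidef
    have hq1 : quad (P.W w y) ((P.Ω y)⁻¹ *ᵥ P.conormal y) ≤ θ * C := hcmp.1.trans hnf
    have hfin : P.inf * c₃ ≤ θ * C * Λ ^ (n - 1) :=
      calc P.inf * c₃ ≤ ((P.Ω y)⁻¹ * P.W w y).det.re * quad (P.Ω y)⁻¹ (P.conormal y) :=
            mul_le_mul hinf hlen'.le hc₃0.le (P.inf_pos.le.trans hinf)
        _ ≤ _ := hdet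
        _ ≤ θ * C * Λ ^ (n - 1) := mul_le_mul hq1 (pow_le_pow_left₀ htrW0 htrW _)
            (pow_nonneg htrW0 _) (by positivity)
    have hθm' : θ * C * Λ ^ (n - 1) ≤ P.inf * c₃ / 2 := by
      calc θ * C * Λ ^ (n - 1) = θ * (C * Λ ^ (n - 1)) := by ring
        _ ≤ P.inf * c₃ / (2 * C * Λ ^ (n - 1)) * (C * Λ ^ (n - 1)) :=
            mul_le_mul_of_nonneg_right hθm (by positivity)
        _ = P.inf * c₃ / 2 := by field_simp
    have := mul_pos P.inf_pos hc₃0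
    linarith

/-- The tangential part of the form has a positive lower bound at the boundary. It equals
`refNormal - η rhoNormal` with `0 ≤ η ≤ C`, so only the case `rhoNormal > 0` needs the barrier. -/
theorem exists_le_normalForm (P : BoundaryPatch n) : ∃ c : ℝ, 0 < c ∧ ∀ᶠ q in 𝓝[P.T] P.p,
    P.ρ q = 0 → ∀ w K, P.Solution w K →
      c ≤ normalForm (P.Ω q) (P.conormal q) (P.form w q) := by
  obtain ⟨C, hC, hb⟩ := P.exists_hessian_boundary
  have hs := P.refNormal_pos
  have hsev := eventually_const_lt P.smooth_refNormal (half_lt_self hs)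
  rcases le_or_gt (P.rhoNormal P.p) 0 with hκ | hκ
  · have hκev : ∀ᶠ z in 𝓝[P.T] P.p, P.rhoNormal z < P.refNormal P.p / (4 * C) :=
      eventually_lt_const P.smooth_rhoNormal (hκ.trans_lt (by positivity))
    refine ⟨P.refNormal P.p / 4, by positivity, ?_⟩
    filter_upwards [hb, hsev, hκev, self_mem_nhdsWithin] with q hq h1 h2 hqT h0 w K hw
    obtain ⟨η, hη0, hηC, -, -, a, b, hab⟩ := hq h0 w K hw
    rw [normalForm_form_boundary hqT hab]
    have h3 : η * P.rhoNormal q ≤ P.refNormal P.p / 4 := by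
      rcases le_or_gt (P.rhoNormal q) 0 with h4 | h4
      · exact (mul_nonpos_of_nonneg_of_nonpos hη0 h4).trans (by positivity)
      · calc η * P.rhoNormal q ≤ C * (P.refNormal P.p / (4 * C)) :=
              mul_le_mul hηC h2.le h4.le hC.le
          _ = P.refNormal P.p / 4 := by field_simp
    change _ ≤ P.refNormal q - η * P.rhoNormal q
    linarith
  · obtain ⟨θ, A, M, hθ, hbar⟩ := P.exists_normal_barrier hκ
    have hκev := eventually_const_lt P.smooth_rhoNormal (half_lt_self hκ)
    refine ⟨θ * (P.rhoNormal P.p / 2), by positivity, ?_⟩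
    filter_upwards [hb, hbar, hκev, self_mem_nhdsWithin,
      eventually_radius] with q hq hq' h1 hqT hrad h0 w K hw
    obtain ⟨η, hη0, hηC, hη, -, a, b, hab⟩ := hq h0 w K hw
    rw [normalForm_form_boundary hqT hab]
    change _ ≤ P.refNormal q - η * P.rhoNormal q
    have hκq : 0 < P.rhoNormal q := (half_pos hκ).trans h1
    -- Compare the slopes of `w` and of the barrier along an inward ray.
    have hslope : η ≤ P.refNormal q / P.rhoNormal q + (A * ‖q - q‖ ^ 2 - θ) := by
      obtain ⟨v, hv⟩ := P.defining.exists_fderiv_eq (P.defining.subset hqT) h0 (-1)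
      have hv' : fderiv ℝ P.ρ q v < 0 := by rw [hv]; norm_num
      have hwq := hw.vanish q hqT hrad h0
      have l1 := P.defining.hasLimit_slope hqT h0 (hw.diffAt hqT) hv'
      have l2 := P.defining.hasLimit_slope hqT h0
        (P.smooth_rho.differentiableOn (by simp) q hqT) hv'
      have hray := P.defining.tendsto_ray hqT h0 hv'
      rw [hη v, hv, hwq] at l1
      rw [(P.defining.hasFDerivAt (P.defining.subset hqT)).hasFDerivWithinAt.fderivWithin
        (P.reg.1 q hqT), hv, h0] at l2
      have c1 : ContinuousWithinAt
          (fun z => P.refNormal z / P.rhoNormal z + (A * ‖z - q‖ ^ 2 - θ)) P.T q :=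
        ((P.smooth_refNormal.continuousOn q hqT).div (P.smooth_rhoNormal.continuousOn q hqT)
          hκq.ne').add (((contDiff_normSq q (k := 0)).continuous.continuousWithinAt.const_mul
            A).sub continuousWithinAt_const)
      have c2 : ContinuousWithinAt P.ρ P.T q := P.smooth_rho.continuousOn q hqT
      have l3 := ((l2.neg).mul (c1.tendsto.comp hray)).add
        ((l2.const_mul M).mul (c2.tendsto.comp hray))
      rw [h0] at l3
      have := le_of_tendsto_of_tendsto l1 l3 ?_
      · simpa using this
      filter_upwards [hray.eventually (hq' h0 w K hw), self_mem_nhdsWithin] with t ht ht0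
      have ht0' : 0 < t⁻¹ := inv_pos.2 ht0
      simp only [Function.comp_apply, smul_eq_mul, sub_zero]
      calc t⁻¹ * w (q + t • v) ≤ t⁻¹ * _ := mul_le_mul_of_nonneg_left ht ht0'.le
        _ = _ := by ring
    rw [sub_self, norm_zero] at hslope
    have h2 : η * P.rhoNormal q ≤ (P.refNormal q / P.rhoNormal q - θ) * P.rhoNormal q :=
      mul_le_mul_of_nonneg_right (by linarith) hκq.le
    rw [sub_mul, div_mul_cancel₀ _ hκq.ne'] at h2
    have h3 : θ * (P.rhoNormal P.p / 2) ≤ θ * P.rhoNormal q :=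
      mul_le_mul_of_nonneg_left h1.le hθ.le
    linarith

end BoundaryPatch

end NormalBarrier

/-! ### The differentiated equation -/

section Differentiated

open Asymptotics

variable {n : ℕ} {T : Set (Cn n)} {z p q : Cn n}

theorem ofReal_re_trace_mul {A B : Matrix (Fin n) (Fin n) ℂ} (hA : A.IsHermitian)
    (hB : B.IsHermitian) : (((A * B).trace.re : ℝ) : ℂ) = (A * B).trace := by
  refine conj_eq_iff_re.1 ?_
  rw [← RCLike.star_def, ← trace_conjTranspose, conjTranspose_mul, hA.eq, hB.eq, trace_mul_comm]

theorem norm_trace_mul_conjTranspose {G : Matrix (Fin n) (Fin n) ℂ} (hG : G.IsHermitian)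
    (A : Matrix (Fin n) (Fin n) ℂ) : ‖(G * Aᴴ).trace‖ = ‖(G * A).trace‖ := by
  rw [← norm_star, ← trace_conjTranspose, conjTranspose_mul, conjTranspose_conjTranspose, hG.eq,
    trace_mul_comm]

/-- The entrywise derivative `∂_j` of a matrix valued function. -/
def dzMat (T : Set (Cn n)) (j : Fin n) (A : Cn n → Matrix (Fin n) (Fin n) ℂ) (z : Cn n) :
    Matrix (Fin n) (Fin n) ℂ := Matrix.of fun a b => dz T j (fun y => A y a b) z

/-- Entrywise differentiability within `T`. -/
def DiffMat (T : Set (Cn n)) (A : Cn n → Matrix (Fin n) (Fin n) ℂ) (z : Cn n) : Prop :=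
  ∀ a b, DifferentiableWithinAt ℝ (fun y => A y a b) T z

variable {A B : Cn n → Matrix (Fin n) (Fin n) ℂ}

theorem DiffMat.mul (hA : DiffMat T A z) (hB : DiffMat T B z) : DiffMat T (fun y => A y * B y) z := by
  intro a b
  simp only [mul_apply]
  exact DifferentiableWithinAt.fun_sum fun c _ => (hA a c).fun_mul (hB c b)

theorem DiffMat.const (C : Matrix (Fin n) (Fin n) ℂ) : DiffMat T (fun _ => C) z :=
  fun _ _ => differentiableWithinAt_const _

theorem dzMat_const (C : Matrix (Fin n) (Fin n) ℂ) (j : Fin n) :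
    dzMat T j (fun _ => C) z = 0 := by
  ext a b; simp [dzMat, dz_const]

theorem dzMat_mul (hT : UniqueDiffWithinAt ℝ T z) (hA : DiffMat T A z) (hB : DiffMat T B z)
    (j : Fin n) : dzMat T j (fun y => A y * B y) z = dzMat T j A z * B z + A z * dzMat T j B z := by
  ext a b
  simp only [dzMat, of_apply, mul_apply, Matrix.add_apply]
  rw [dz_sum _ hT fun c _ => (hA a c).fun_mul (hB c b), ← Finset.sum_add_distrib]
  exact Finset.sum_congr rfl fun c _ => dz_mul hT (hA a c) (hB c b) j

theorem dz_trace (hT : UniqueDiffWithinAt ℝ T z) (hA : DiffMat T A z) (j : Fin n) :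
    dz T j (fun y => (A y).trace) z = (dzMat T j A z).trace := by
  simp only [trace, diag]
  rw [dz_sum _ hT fun c _ => hA c c]
  rfl

theorem DiffMat.trace (hA : DiffMat T A z) :
    DifferentiableWithinAt ℝ (fun y => (A y).trace) T z := by
  simp only [Matrix.trace, diag]
  exact DifferentiableWithinAt.fun_sum fun c _ => hA c c

theorem dzMat_inv (hT : UniqueDiffWithinAt ℝ T z) (hz : z ∈ T) (hA : DiffMat T A z)
    (hAi : DiffMat T (fun y => (A y)⁻¹) z) (hdet : ∀ y ∈ T, (A y).det ≠ 0) (j : Fin n) :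
    dzMat T j (fun y => (A y)⁻¹) z = -((A z)⁻¹ * dzMat T j A z * (A z)⁻¹) := by
  have h1 := dzMat_mul hT hA hAi j
  have h2 : dzMat T j (fun y => A y * (A y)⁻¹) z = 0 := by
    rw [← dzMat_const (T := T) (z := z) 1 j]
    ext a b
    refine dz_congr (fun y hy => ?_) hz j
    change (A y * (A y)⁻¹) a b = (1 : Matrix (Fin n) (Fin n) ℂ) a b
    rw [Matrix.mul_nonsing_inv _ (isUnit_iff_ne_zero.2 (hdet y hy))]
  rw [h2] at h1
  have h3 := congrArg ((A z)⁻¹ * ·) h1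
  simp only [Matrix.mul_zero, Matrix.mul_add, ← Matrix.mul_assoc,
    Matrix.nonsing_inv_mul _ (isUnit_iff_ne_zero.2 (hdet z hz)), Matrix.one_mul] at h3
  exact eq_neg_of_add_eq_zero_right h3.symm

theorem DiffMat.wOp {Ω g : Cn n → Matrix (Fin n) (Fin n) ℂ} (hΩ : DiffMat T Ω z)
    (hΩi : DiffMat T (fun y => (Ω y)⁻¹) z) (hg : DiffMat T g z) :
    DiffMat T (fun y => wOp (Ω y) (g y)) z := by
  intro a b
  simp only [HermitianDirichlet.wOp, Matrix.sub_apply, Matrix.smul_apply, smul_eq_mul]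
  exact ((hΩi.mul hg).trace.fun_mul (hΩ a b)).fun_sub (hg a b)

theorem dzMat_wOp (hT : UniqueDiffWithinAt ℝ T z) (hz : z ∈ T)
    {Ω g : Cn n → Matrix (Fin n) (Fin n) ℂ}
    (hΩ : DiffMat T Ω z) (hΩi : DiffMat T (fun y => (Ω y)⁻¹) z) (hg : DiffMat T g z)
    (hdet : ∀ y ∈ T, (Ω y).det ≠ 0) (j : Fin n) :
    dzMat T j (fun y => wOp (Ω y) (g y)) z =
      (-((Ω z)⁻¹ * dzMat T j Ω z * (Ω z)⁻¹ * g z).trace + ((Ω z)⁻¹ * dzMat T j g z).trace) • Ω z +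
        ((Ω z)⁻¹ * g z).trace • dzMat T j Ω z - dzMat T j g z := by
  have h1 := dz_trace hT (hΩi.mul hg) j
  rw [dzMat_mul hT hΩi hg, dzMat_inv hT hz hΩ hΩi hdet, trace_add, Matrix.neg_mul, trace_neg] at h1
  ext a b
  have h2 := dz_sub hT ((hΩi.mul hg).trace.fun_mul (hΩ a b)) (hg a b) j
  rw [dz_mul hT (hΩi.mul hg).trace (hΩ a b), h1] at h2
  simp only [Matrix.sub_apply, Matrix.add_apply, Matrix.smul_apply, smul_eq_mul]
  exact h2

theorem gOp_mul_mul_inv {Ω g W : Matrix (Fin n) (Fin n) ℂ} (hΩ : Ω.det ≠ 0)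
    (hW : W.det ≠ 0) (hWg : W = wOp Ω g) : gOp Ω W * g * Ω⁻¹ =
      (W⁻¹ * Ω).trace • (Ω⁻¹ * g * Ω⁻¹) - ((Ω⁻¹ * g).trace • W⁻¹ - Ω⁻¹) := by
  have u1 : Ω * Ω⁻¹ = 1 := Matrix.mul_nonsing_inv _ (isUnit_iff_ne_zero.2 hΩ)
  have u2 : W⁻¹ * W = 1 := Matrix.nonsing_inv_mul _ (isUnit_iff_ne_zero.2 hW)
  have hg : g = (Ω⁻¹ * g).trace • Ω - W := by rw [hWg, wOp]; abel
  have e1 : W⁻¹ * g = (Ω⁻¹ * g).trace • (W⁻¹ * Ω) - 1 := by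
    conv_lhs => rw [hg]
    rw [Matrix.mul_sub, u2, Matrix.mul_smul]
  rw [gOp, Matrix.sub_mul, e1, Matrix.sub_mul, Matrix.sub_mul, Matrix.smul_mul, Matrix.smul_mul,
    Matrix.smul_mul, Matrix.mul_assoc W⁻¹, u1, Matrix.mul_one, Matrix.one_mul]

/-- Algebraic form of the derivative of `log det (Ω⁻¹ W)`. -/
theorem trace_gOp_mul_eq {Ω g W D g' : Matrix (Fin n) (Fin n) ℂ} (hΩ : Ω.det ≠ 0)
    (hW : W.det ≠ 0) (hWg : W = wOp Ω g) {t : ℂ}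
    (h : t = (W⁻¹ * ((-(Ω⁻¹ * D * Ω⁻¹ * g).trace + (Ω⁻¹ * g').trace) • Ω +
      (Ω⁻¹ * g).trace • D - g')).trace + (Ω * -(Ω⁻¹ * D * Ω⁻¹)).trace) :
    (gOp Ω W * g').trace = t + (D * (gOp Ω W * g * Ω⁻¹)).trace := by
  have u1 : Ω * Ω⁻¹ = 1 := Matrix.mul_nonsing_inv _ (isUnit_iff_ne_zero.2 hΩ)
  have e2 := gOp_mul_mul_inv hΩ hW hWg
  have e3 : (Ω⁻¹ * D * Ω⁻¹ * g).trace = (D * (Ω⁻¹ * g * Ω⁻¹)).trace := by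
    rw [Matrix.mul_assoc, Matrix.mul_assoc, trace_mul_comm, Matrix.mul_assoc]
  have e4 : (Ω * -(Ω⁻¹ * D * Ω⁻¹)).trace = -(D * Ω⁻¹).trace := by
    rw [Matrix.mul_neg, trace_neg, Matrix.mul_assoc, ← Matrix.mul_assoc, u1, Matrix.one_mul]
  rw [h, e2, e4, e3, gOp, Matrix.sub_mul, trace_sub, Matrix.smul_mul, trace_smul]
  simp only [Matrix.mul_sub, Matrix.mul_add, trace_sub, trace_add, Matrix.mul_smul, trace_smul,
    smul_eq_mul]
  rw [trace_mul_comm D W⁻¹]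
  ring

theorem isHermitian_gOp_mul_mul_inv {Ω g W : Matrix (Fin n) (Fin n) ℂ} (hΩ : Ω.PosDef)
    (hg : g.IsHermitian) (hW : W.PosDef) (hWg : W = wOp Ω g) :
    (gOp Ω W * g * Ω⁻¹).IsHermitian := by
  have hs : ∀ {c : ℝ} {A : Matrix (Fin n) (Fin n) ℂ}, A.IsHermitian →
      ((c : ℂ) • A).IsHermitian := fun {c A} hA => by
    rw [IsHermitian, conjTranspose_smul, hA.eq, RCLike.star_def, conj_ofReal]
  rw [gOp_mul_mul_inv hΩ.det_pos.ne' hW.det_pos.ne' hWg, ← ofReal_re_trace_mul hW.1.inv hΩ.1,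
    ← ofReal_re_trace_mul hΩ.1.inv hg]
  refine (hs ?_).sub ((hs hW.1.inv).sub hΩ.1.inv)
  have := isHermitian_conjTranspose_mul_mul (A := g) Ω⁻¹ hg
  rwa [hΩ.1.inv.eq] at this

theorem trace_gOp_le {Ω W : Matrix (Fin n) (Fin n) ℂ} (hΩ : Ω.PosDef) (hW : W.PosDef) :
    (gOp Ω W).trace.re ≤ (W⁻¹ * Ω).trace.re * Ω⁻¹.trace.re := by
  rw [gOp, trace_sub, trace_smul, ← ofReal_re_trace_mul hW.1.inv hΩ.1, smul_eq_mul, sub_re,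
    re_ofReal_mul, ofReal_re]
  have : 0 ≤ W⁻¹.trace.re := by
    have := trace_mul_re_nonneg hW.inv.posSemidef (Matrix.PosDef.one (n := Fin n)).posSemidef
    rwa [Matrix.mul_one] at this
  linarith

theorem log_det_mul {A B : Matrix (Fin n) (Fin n) ℂ} (hA : A.PosDef) (hB : B.PosDef) :
    Real.log (A * B).det.re = Real.log A.det.re + Real.log B.det.re := by
  have h1 := pos_iff.1 hA.det_pos
  have h2 := pos_iff.1 hB.det_pos
  rw [det_mul, mul_re, ← h1.2, ← h2.2, mul_zero, sub_zero, Real.log_mul h1.1.ne' h2.1.ne']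

theorem dz_eq_zero_of_isLocalMax {u : Cn n → ℝ} (hz : T ∈ 𝓝 z) (h : IsLocalMax u z)
    (hu : DifferentiableWithinAt ℝ u T z) (j : Fin n) : dz T j (fun y => (u y : ℂ)) z = 0 := by
  have hun : UniqueDiffWithinAt ℝ T z := uniqueDiffWithinAt_of_mem_nhds hz
  have h0 : fderivWithin ℝ u T z = 0 := by rw [fderivWithin_of_mem_nhds hz, h.fderiv_eq_zero]
  simp [dz, fderivWithin_ofReal hun hu, h0]

namespace BoundaryPatch

variable {P : BoundaryPatch n} {w : Cn n → ℝ} {K : ℝ}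

theorem isHermitian_form (hw : ContDiffOn ℝ 2 w P.T) (hz : z ∈ P.T) :
    (P.form w z).IsHermitian :=
  (P.isHermitian_ref z hz).add (isHermitian_hess_ofReal P.reg hw hz)

theorem isHermitian_W (hw : ContDiffOn ℝ 2 w P.T) (hz : z ∈ P.T) : (P.W w z).IsHermitian :=
  isHermitian_wOp (P.posDef z hz) (isHermitian_form hw hz)

/-- The coefficients of the linearized operator. -/
def lin (P : BoundaryPatch n) (w : Cn n → ℝ) (z : Cn n) : Matrix (Fin n) (Fin n) ℂ :=
  gOp (P.Ω z) (P.W w z)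

/-- The first derivatives of the equation. The concavity of `log det` replaces the computation of
the derivative of a determinant: `log det W` touches its tangent from below. -/
theorem Solution.trace_lin_mul (h : P.Solution w K) (hz : z ∈ P.T) (hneg : P.ρ z < 0)
    (hd : dist z P.p < P.radius) (j : Fin n) :
    (P.lin w z * dzMat P.T j (complexHessian P.T w) z).trace =
      dz P.T j (fun y => (P.logDet w y : ℂ)) z +
        (dzMat P.T j P.Ω z * (P.lin w z * P.form w z * (P.Ω z)⁻¹)).trace -
        (P.lin w z * dzMat P.T j P.ref z).trace := by
  have hnhds := P.defining.mem_nhds_of_neg (P.defining.subset hz) hneg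
  have hu := P.reg.1 z hz
  have hΩ : DiffMat P.T P.Ω z := fun a b => (P.smooth_metric a b).differentiableOn (by simp) z hz
  have hΩi : DiffMat P.T (fun y => (P.Ω y)⁻¹) z :=
    fun a b => (P.smooth_inv a b).differentiableOn (by simp) z hz
  have hH : DiffMat P.T (complexHessian P.T w) z := fun a b =>
    (contDiffOn_complexHessian (k := 1) P.reg.1 h.smooth (by norm_num) a b).differentiableOn
      one_ne_zero z hz
  have href : DiffMat P.T P.ref z := fun a b =>
    (P.smooth_ref a b).differentiableOn (by simp) z hz
  have hg : DiffMat P.T (P.form w) z := fun a b => (href a b).fun_add (hH a b)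
  have hW : DiffMat P.T (P.W w) z := hΩ.wOp hΩi hg
  have hdet : ∀ y ∈ P.T, (P.Ω y).det ≠ 0 := fun y hy => det_metric_ne hy
  have hW0 := h.posDef z hz hd.le
  have hΩ0 := P.posDef z hz
  have hgj : dzMat P.T j (P.form w) z =
      dzMat P.T j P.ref z + dzMat P.T j (complexHessian P.T w) z := by
    ext a b; exact dz_add hu (href a b) (hH a b) j
  -- The difference of `log det` and its tangent has a maximum at `z`.
  have hmax : IsLocalMax (fun y => P.logDet w y - ((P.W w z)⁻¹ * P.W w y).trace.re -
      (P.Ω z * (P.Ω y)⁻¹).trace.re) z := by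
    filter_upwards [hnhds, Metric.ball_mem_nhds z (sub_pos.2 hd)] with y hy hyd
    have hyd' : dist y P.p ≤ P.radius := by
      have := Metric.mem_ball.1 hyd
      linarith [dist_triangle y z P.p]
    have hWy := h.posDef y hy hyd'
    have hΩy := P.posDef y hy
    have e1 := log_det_le hW0 hWy
    have e2 := log_det_le hΩ0.inv hΩy.inv
    rw [Matrix.nonsing_inv_nonsing_inv _ (isUnit_iff_ne_zero.2 (hdet z hz))] at e2
    have e3 : ((P.W w z)⁻¹ * P.W w z).trace.re = n := by
      rw [Matrix.nonsing_inv_mul _ (isUnit_iff_ne_zero.2 hW0.det_pos.ne')]; simp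
    have e4 : (P.Ω z * (P.Ω z)⁻¹).trace.re = n := by rw [metric_mul_inv hz]; simp
    simp only [logDet]
    rw [log_det_mul hΩy.inv hWy, log_det_mul hΩ0.inv hW0, e3, e4]
    linarith
  have hrealW : ∀ y ∈ P.T, ((((P.W w z)⁻¹ * P.W w y).trace.re : ℝ) : ℂ) =
      ((P.W w z)⁻¹ * P.W w y).trace := fun y hy =>
    ofReal_re_trace_mul hW0.1.inv (isHermitian_W h.smooth_two hy)
  have hrealΩ : ∀ y ∈ P.T, (((P.Ω z * (P.Ω y)⁻¹).trace.re : ℝ) : ℂ) =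
      (P.Ω z * (P.Ω y)⁻¹).trace := fun y hy => ofReal_re_trace_mul hΩ0.1 (P.posDef y hy).1.inv
  have d1 : DifferentiableWithinAt ℝ (fun y => ((P.W w z)⁻¹ * P.W w y).trace) P.T z :=
    ((DiffMat.const _).mul hW).trace
  have d2 : DifferentiableWithinAt ℝ (fun y => (P.Ω z * (P.Ω y)⁻¹).trace) P.T z :=
    ((DiffMat.const _).mul hΩi).trace
  have d0 : DifferentiableWithinAt ℝ (P.logDet w) P.T z :=
    h.smooth_logDet.differentiableOn one_ne_zero z hz
  have d0' : DifferentiableWithinAt ℝ (fun y => (P.logDet w y : ℂ)) P.T z :=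
    (contDiffOn_ofReal h.smooth_logDet).differentiableOn one_ne_zero z hz
  have hre : ∀ {f : Cn n → ℂ}, DifferentiableWithinAt ℝ f P.T z →
      DifferentiableWithinAt ℝ (fun y => (f y).re) P.T z := fun hf =>
    reCLM.differentiableAt.comp_differentiableWithinAt z hf
  have h0 := dz_eq_zero_of_isLocalMax hnhds hmax ((d0.fun_sub (hre d1)).fun_sub (hre d2)) j
  rw [dz_congr (g := fun y => ((P.logDet w y : ℂ) - ((P.W w z)⁻¹ * P.W w y).trace) -
    (P.Ω z * (P.Ω y)⁻¹).trace) (fun y hy => by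
      simp only [ofReal_sub]; rw [hrealW y hy, hrealΩ y hy]) hz,
    dz_sub hu (d0'.fun_sub d1) d2, dz_sub hu d0' d1, dz_trace hu ((DiffMat.const _).mul hW),
    dz_trace hu ((DiffMat.const _).mul hΩi), dzMat_mul hu (DiffMat.const _) hW,
    dzMat_mul hu (DiffMat.const _) hΩi, dzMat_const, dzMat_const, Matrix.zero_mul, zero_add,
    Matrix.zero_mul, zero_add, dzMat_inv hu hz hΩ hΩi hdet] at h0
  have hWj : dzMat P.T j (P.W w) z = _ := dzMat_wOp hu hz hΩ hΩi hg hdet j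
  rw [hWj] at h0
  have key := trace_gOp_mul_eq (W := P.W w z) (hdet z hz) hW0.det_pos.ne' rfl
    (t := dz P.T j (fun y => (P.logDet w y : ℂ)) z) (by linear_combination h0)
  rw [hgj, Matrix.mul_add, trace_add] at key
  rw [lin]
  linear_combination key

end BoundaryPatch

end Differentiated

/-! ### Uniform control of the linearized operator on tangential derivatives -/

section Tangential

open Asymptotics

variable {n : ℕ} {z p q : Cn n}

/-- All entries of a family of matrices are `O(a)`. -/
def MatO {ι : Type*} (l : Filter ι) (A : ι → Matrix (Fin n) (Fin n) ℂ) (a : ι → ℝ) : Prop :=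
  ∀ i j, (fun t => A t i j) =O[l] a

/-- All entries of a family of vectors are `O(a)`. -/
def VecO {ι : Type*} (l : Filter ι) (x : ι → Fin n → ℂ) (a : ι → ℝ) : Prop :=
  ∀ i, (fun t => x t i) =O[l] a

section Calculus

variable {ι : Type*} {l : Filter ι} {A B : ι → Matrix (Fin n) (Fin n) ℂ} {x y : ι → Fin n → ℂ}
  {a b c : ι → ℝ} {f g : ι → ℂ}

theorem isBigO_one_mul (hf : f =O[l] fun _ => (1 : ℝ)) (hg : g =O[l] a) :
    (fun t => f t * g t) =O[l] a := by simpa using hf.mul hg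

theorem isBigO_mul_one (hf : f =O[l] a) (hg : g =O[l] fun _ => (1 : ℝ)) :
    (fun t => f t * g t) =O[l] a := by simpa using hf.mul hg

theorem isBigO_star (hf : f =O[l] a) : (fun t => star (f t)) =O[l] a :=
  (hf.norm_left.congr_left fun _ => (norm_star _).symm).of_norm_left

theorem MatO.mulVec (hA : MatO l A a) (hx : VecO l x b) :
    VecO l (fun t => A t *ᵥ x t) fun t => a t * b t := fun i => by
  simp only [Matrix.mulVec, dotProduct]
  exact IsBigO.fun_sum fun j _ => (hA i j).mul (hx j)

theorem MatO.mul (hA : MatO l A a) (hB : MatO l B b) :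
    MatO l (fun t => A t * B t) fun t => a t * b t := fun i j => by
  simp only [mul_apply]
  exact IsBigO.fun_sum fun k _ => (hA i k).mul (hB k j)

theorem MatO.one_mul (hA : MatO l A fun _ => 1) (hB : MatO l B b) :
    MatO l (fun t => A t * B t) b := by simpa using hA.mul hB

theorem MatO.mul_one (hA : MatO l A a) (hB : MatO l B fun _ => 1) :
    MatO l (fun t => A t * B t) a := by simpa using hA.mul hB

theorem MatO.one_mulVec (hA : MatO l A fun _ => 1) (hx : VecO l x b) :
    VecO l (fun t => A t *ᵥ x t) b := by simpa using hA.mulVec hx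

theorem MatO.mulVec_one (hA : MatO l A a) (hx : VecO l x fun _ => 1) :
    VecO l (fun t => A t *ᵥ x t) a := by simpa using hA.mulVec hx

theorem MatO.trace (hA : MatO l A a) : (fun t => (A t).trace) =O[l] a :=
  IsBigO.fun_sum (s := Finset.univ) (A := fun i t => A t i i) fun i _ => hA i i

theorem MatO.conjTranspose (hA : MatO l A a) : MatO l (fun t => (A t)ᴴ) a :=
  fun i j => isBigO_star (hA j i)

theorem VecO.star (hx : VecO l x a) : VecO l (fun t => star (x t)) a := fun i => isBigO_star (hx i)

theorem VecO.dot_one (hx : VecO l x a) (hy : VecO l y fun _ => 1) :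
    (fun t => x t ⬝ᵥ y t) =O[l] a :=
  IsBigO.fun_sum fun i _ => isBigO_mul_one (hx i) (hy i)

theorem VecO.one_dot (hx : VecO l x fun _ => 1) (hy : VecO l y a) :
    (fun t => x t ⬝ᵥ y t) =O[l] a :=
  IsBigO.fun_sum fun i _ => isBigO_one_mul (hx i) (hy i)

theorem MatO.trans (hA : MatO l A a) (h : a =O[l] b) : MatO l A b := fun i j => (hA i j).trans h

theorem VecO.trans (hx : VecO l x a) (h : a =O[l] b) : VecO l x b := fun i => (hx i).trans h

/-- A family of matrices `E` with trace `n`, such that `E R` is Hermitian, is `O(Y)` as soon as it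
is of the form `τ r^*` up to `O(Y)`: applying `E R = (E R)^*` to `r` expresses `τ` by `tr(τ r^*)`,
which is `n` up to `O(Y)`. -/
theorem isBigO_of_rank_one {E R : ι → Matrix (Fin n) (Fin n) ℂ} {τ r : ι → Fin n → ℂ} {Y : ι → ℝ}
    (h1 : (fun _ => (1 : ℝ)) =O[l] Y) (hR : MatO l R fun _ => 1) (hr : VecO l r fun _ => 1)
    (hs : (fun t => (star (r t) ⬝ᵥ R t *ᵥ r t)⁻¹) =O[l] fun _ => (1 : ℝ))
    (hs0 : ∀ᶠ t in l, star (r t) ⬝ᵥ R t *ᵥ r t ≠ 0) (hRh : ∀ᶠ t in l, (R t).IsHermitian)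
    (hER : ∀ᶠ t in l, (E t * R t).IsHermitian) (htr : ∀ᶠ t in l, (E t).trace = n)
    (hE : MatO l (fun t => E t - vecMulVec (τ t) (star (r t))) Y) : MatO l E Y := by
  set e : ι → Matrix (Fin n) (Fin n) ℂ := fun t => E t - vecMulVec (τ t) (star (r t)) with he
  have hEe : ∀ t, E t = e t + vecMulVec (τ t) (star (r t)) := fun t => by simp [he]
  have hγ : (fun t => star (τ t) ⬝ᵥ r t) =O[l] Y := by
    have h2 : (fun t => star ((n : ℂ) - (e t).trace)) =O[l] Y :=
      isBigO_star (((isBigO_const_const (n : ℂ) one_ne_zero l).trans h1).sub hE.trace)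
    refine h2.congr' ?_ (EventuallyEq.refl _ _)
    filter_upwards [htr] with t ht
    rw [← ht, hEe t, trace_add, trace_vecMulVec, add_sub_cancel_left]
    simp only [dotProduct, star_sum, star_mul', Pi.star_apply, star_star]
  have hτ : VecO l τ Y := by
    intro b
    have h2 : (fun t => (star (r t) ⬝ᵥ R t *ᵥ r t)⁻¹ * ((star (τ t) ⬝ᵥ r t) * (R t *ᵥ r t) b +
        (R t *ᵥ ((e t)ᴴ *ᵥ r t)) b - (e t *ᵥ (R t *ᵥ r t)) b)) =O[l] Y :=
      isBigO_one_mul hs (((isBigO_mul_one hγ (hR.one_mulVec hr b)).add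
        (hR.one_mulVec (hE.conjTranspose.mulVec_one hr) b)).sub
        (hE.mulVec_one (hR.one_mulVec hr) b))
    refine h2.congr' ?_ (EventuallyEq.refl _ _)
    filter_upwards [hs0, hER, hRh] with t ht hH hRt
    have e1 : (E t * R t) *ᵥ r t = (star (r t) ⬝ᵥ R t *ᵥ r t) • τ t + e t *ᵥ (R t *ᵥ r t) := by
      rw [← mulVec_mulVec, hEe t, add_mulVec, vecMulVec_mulVec, op_smul_eq_smul, add_comm]
    have e2 : (E t * R t) *ᵥ r t = (star (τ t) ⬝ᵥ r t) • (R t *ᵥ r t) +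
        R t *ᵥ ((e t)ᴴ *ᵥ r t) := by
      rw [← hH.eq, conjTranspose_mul, hRt.eq, ← mulVec_mulVec, hEe t, conjTranspose_add,
        conjTranspose_vecMulVec, star_star, add_mulVec, mulVec_add, vecMulVec_mulVec,
        op_smul_eq_smul, mulVec_smul, add_comm]
    have e3 := congrFun (e1.symm.trans e2) b
    simp only [Pi.add_apply, Pi.smul_apply, smul_eq_mul] at e3
    rw [inv_mul_eq_iff_eq_mul₀ ht]
    linear_combination -e3
  intro i j
  refine ((hE i j).add (isBigO_mul_one (hτ i) (isBigO_star (hr j)))).congr_left fun t => ?_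
  simp [he, vecMulVec_apply]

end Calculus

namespace BoundaryPatch

variable {P : BoundaryPatch n} {w : Cn n → ℝ} {K : ℝ}

/-- Configurations: a solution, the constant `K`, and a point. -/
abbrev Config (n : ℕ) := (Cn n → ℝ) × ℝ × Cn n

/-- Uniformity over all solutions, at points of `S` close to the centre of the patch. -/
def near (P : BoundaryPatch n) (S : Set (Cn n)) : Filter (Config n) :=
  𝓟 {t | P.Solution t.1 t.2.1} ⊓ comap (fun t => t.2.2) (𝓝[S] P.p)

theorem eventually_near {S : Set (Cn n)} {Q : Config n → Prop} :
    (∀ᶠ t in P.near S, Q t) ↔ ∀ᶠ z in 𝓝[S] P.p, ∀ w K, P.Solution w K → Q (w, K, z) := by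
  rw [near, inf_comm, eventually_inf_principal, eventually_comap]
  constructor
  · intro h
    filter_upwards [h] with z hz w K hw using hz (w, K, z) rfl hw
  · intro h
    filter_upwards [h] with z hz t ht hw
    have := hz t.1 t.2.1 hw
    rwa [← ht] at this

theorem tendsto_near {S : Set (Cn n)} : Tendsto (fun t : Config n => t.2.2) (P.near S) (𝓝[S] P.p) :=
  tendsto_comap.mono_left inf_le_right

/-- The interior points of the patch. -/
def inside (P : BoundaryPatch n) : Set (Cn n) := {z ∈ P.T | P.ρ z < 0}

theorem eventually_inside : ∀ᶠ t in P.near P.inside,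
    P.Solution t.1 t.2.1 ∧ t.2.2 ∈ P.T ∧ P.ρ t.2.2 < 0 ∧ dist t.2.2 P.p < P.radius := by
  refine eventually_near.2 ?_
  filter_upwards [self_mem_nhdsWithin,
    mem_nhdsWithin_of_mem_nhds (Metric.ball_mem_nhds P.p P.radius_pos)] with z hz hd w K hw
  exact ⟨hw, hz.1, hz.2, hd⟩

theorem tendsto_inside : Tendsto (fun t : Config n => t.2.2) (P.near P.inside) (𝓝[P.T] P.p) :=
  tendsto_near.mono_right (nhdsWithin_mono _ fun _ h => h.1)

theorem isBigO_coeff {f : Cn n → ℂ} (hf : ContDiffOn ℝ ∞ f P.T) :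
    (fun t : Config n => f t.2.2) =O[P.near P.inside] fun _ => (1 : ℝ) :=
  ((hf.continuousOn P.p P.mem).tendsto.comp tendsto_inside).isBigO_one ℝ

theorem isBigO_coeff_inv {f : Cn n → ℂ} (hf : ContDiffOn ℝ ∞ f P.T) (h0 : f P.p ≠ 0) :
    (fun t : Config n => (f t.2.2)⁻¹) =O[P.near P.inside] fun _ => (1 : ℝ) :=
  (((hf.continuousOn P.p P.mem).tendsto.comp tendsto_inside).inv₀ h0).isBigO_one ℝ

theorem eventually_coeff_ne {f : Cn n → ℂ} (hf : ContDiffOn ℝ ∞ f P.T) (h0 : f P.p ≠ 0) :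
    ∀ᶠ t : Config n in P.near P.inside, f t.2.2 ≠ 0 :=
  ((hf.continuousOn P.p P.mem).tendsto.comp tendsto_inside).eventually_ne h0

/-- The trace of the inverse of `W`, which measures the size of the linearized operator. -/
def invTrace (P : BoundaryPatch n) (t : Config n) : ℝ :=
  ((P.W t.1 t.2.2)⁻¹ * P.Ω t.2.2).trace.re

/-- The tangential derivatives of `w` along the level sets of `ρ`. -/
def tangent (P : BoundaryPatch n) (w : Cn n → ℝ) (j k : Fin n) (z : Cn n) : ℂ :=
  tang P.T (fun y => (P.ρ y : ℂ)) (fun y => (w y : ℂ)) j k z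

/-- The square of the gradient of the tangential derivatives, measured by the linearized operator. -/
def energy (P : BoundaryPatch n) (t : Config n) : ℝ :=
  ∑ j, ∑ k, quad (P.lin t.1 t.2.2) (dzv P.T (P.tangent t.1 j k) t.2.2)

/-- The quantity `√K (1 + tr W⁻¹) + (tr W⁻¹ · energy)^{1/2}` controlling the errors in the mixed
estimate; the second term is absorbed by the energy itself. -/
def err (P : BoundaryPatch n) (t : Config n) : ℝ :=
  √t.2.1 * (1 + P.invTrace t) + √(P.invTrace t * P.energy t)

theorem Solution.posDef_lin (h : P.Solution w K) (hz : z ∈ P.T) (hd : dist z P.p ≤ P.radius) :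
    (P.lin w z).PosDef := posDef_gOp (P.posDef z hz) (h.posDef z hz hd) P.two_le

theorem Solution.invTrace_nonneg (h : P.Solution w K) (hz : z ∈ P.T)
    (hd : dist z P.p ≤ P.radius) : 0 ≤ P.invTrace (w, K, z) :=
  trace_mul_re_nonneg (h.posDef z hz hd).inv.posSemidef (P.posDef z hz).posSemidef

theorem Solution.energy_nonneg (h : P.Solution w K) (hz : z ∈ P.T)
    (hd : dist z P.p ≤ P.radius) : 0 ≤ P.energy (w, K, z) :=
  Finset.sum_nonneg fun _ _ => Finset.sum_nonneg fun _ _ =>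
    quad_nonneg (h.posDef_lin hz hd).posSemidef _

theorem Solution.le_energy (h : P.Solution w K) (hz : z ∈ P.T)
    (hd : dist z P.p ≤ P.radius) (j k : Fin n) :
    quad (P.lin w z) (dzv P.T (P.tangent w j k) z) ≤ P.energy (w, K, z) := by
  have h0 : ∀ j k, 0 ≤ quad (P.lin w z) (dzv P.T (P.tangent w j k) z) := fun j k =>
    quad_nonneg (h.posDef_lin hz hd).posSemidef _
  exact (Finset.single_le_sum (f := fun k => quad (P.lin w z) (dzv P.T (P.tangent w j k) z))
    (fun k _ => h0 j k) (Finset.mem_univ k)).trans (Finset.single_le_sum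
      (f := fun j => ∑ k, quad (P.lin w z) (dzv P.T (P.tangent w j k) z))
      (fun j _ => Finset.sum_nonneg fun k _ => h0 j k) (Finset.mem_univ j))

theorem one_le_sqrt (h : P.Solution w K) : 1 ≤ √K := Real.one_le_sqrt.2 h.one_le

theorem isBigO_err_of_le {f : Config n → ℝ} (hf : ∀ᶠ t in P.near P.inside,
    ∀ s T e : ℝ, s = √t.2.1 → T = P.invTrace t → e = √(P.invTrace t * P.energy t) → 1 ≤ s →
      0 ≤ T → 0 ≤ e → |f t| ≤ s * (1 + T) + e) : f =O[P.near P.inside] P.err := by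
  refine IsBigO.of_bound 1 ?_
  filter_upwards [hf, eventually_inside] with t ht ⟨hs, hz, _, hd⟩
  rw [Real.norm_eq_abs, Real.norm_eq_abs, _root_.one_mul]
  exact (ht _ _ _ rfl rfl rfl (one_le_sqrt hs) (hs.invTrace_nonneg hz hd.le)
    (Real.sqrt_nonneg _)).trans (le_abs_self _)

theorem one_isBigO_err : (fun _ => (1 : ℝ)) =O[P.near P.inside] P.err :=
  isBigO_err_of_le (.of_forall fun t s T e _ _ _ hs hT he => by rw [abs_one]; nlinarith)

theorem invTrace_isBigO_err : P.invTrace =O[P.near P.inside] P.err :=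
  isBigO_err_of_le (.of_forall fun t s T e _ hT' _ hs hT he => by
    rw [← hT', abs_of_nonneg (by linarith)]; nlinarith)

theorem invTrace_mul_sqrt_isBigO_err :
    (fun t : Config n => P.invTrace t * √t.2.1) =O[P.near P.inside] P.err :=
  isBigO_err_of_le (.of_forall fun t s T e hs' hT' _ hs hT he => by
    rw [← hT', ← hs', abs_of_nonneg (by positivity)]; nlinarith)

theorem sqrt_energy_isBigO_err :
    (fun t => √(P.invTrace t * P.energy t)) =O[P.near P.inside] P.err :=
  isBigO_err_of_le (.of_forall fun t s T e _ _ he' hs hT he => by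
    rw [← he', abs_of_nonneg (by linarith)]; nlinarith)

theorem isBigO_grad (j : Fin n) :
    (fun t : Config n => dz P.T j (fun y => (t.1 y : ℂ)) t.2.2) =O[P.near P.inside]
      fun t => √t.2.1 := by
  refine IsBigO.of_bound P.grad ?_
  filter_upwards [eventually_inside] with t ⟨hs, hz, _, hd⟩
  rw [Real.norm_eq_abs, abs_of_nonneg (Real.sqrt_nonneg _)]
  exact hs.grad_le _ hz hd.le j

theorem isBigO_grad_bar (j : Fin n) :
    (fun t : Config n => dzbar P.T j (fun y => (t.1 y : ℂ)) t.2.2) =O[P.near P.inside]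
      fun t => √t.2.1 := by
  refine (isBigO_star (isBigO_grad j)).congr' ?_ (EventuallyEq.refl _ _)
  filter_upwards [eventually_inside] with t ⟨hs, hz, _, hd⟩
  rw [dzbar_ofReal (P.reg.1 _ hz) (hs.diffAt hz)]; rfl

theorem matO_inv : MatO (P.near P.inside) (fun t => (P.Ω t.2.2)⁻¹) fun _ => 1 :=
  fun i j => isBigO_coeff (P.smooth_inv i j)

theorem matO_lin : MatO (P.near P.inside) (fun t => P.lin t.1 t.2.2) P.invTrace := by
  intro i j
  have h1 := (matO_inv (P := P)).trace
  obtain ⟨C, hC, hb⟩ := h1.exists_pos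
  refine IsBigO.of_bound C ?_
  filter_upwards [hb.bound, eventually_inside] with t ht ⟨hs, hz, _, hd⟩
  have h2 := hs.invTrace_nonneg hz hd.le
  rw [norm_one, _root_.mul_one] at ht
  rw [Real.norm_eq_abs, abs_of_nonneg h2, mul_comm]
  exact (norm_apply_le_trace (hs.posDef_lin hz hd.le).posSemidef i j).trans
    ((trace_gOp_le (P.posDef _ hz) (hs.posDef _ hz hd.le)).trans
      (mul_le_mul_of_nonneg_left ((re_le_norm _).trans ht) h2))

theorem lin_mulVec_dz_tangent (j k : Fin n) : VecO (P.near P.inside)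
    (fun t => P.lin t.1 t.2.2 *ᵥ dzv P.T (P.tangent t.1 j k) t.2.2) P.err := by
  intro i
  obtain ⟨C, hC, hb⟩ := (matO_lin (P := P)).trace.exists_pos
  refine IsBigO.trans (IsBigO.of_bound (√C) ?_) sqrt_energy_isBigO_err
  filter_upwards [hb.bound, eventually_inside] with t ht ⟨hs, hz, _, hd⟩
  have h2 := hs.invTrace_nonneg hz hd.le
  have h3 := norm_mulVec_apply_sq_le (hs.posDef_lin hz hd.le).posSemidef
    (dzv P.T (P.tangent t.1 j k) t.2.2) i
  have h4 := hs.le_energy hz hd.le j k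
  rw [Real.norm_eq_abs, abs_of_nonneg h2] at ht
  rw [Real.norm_eq_abs, abs_of_nonneg (Real.sqrt_nonneg _), ← Real.sqrt_mul hC.le]
  refine Real.le_sqrt_of_sq_le (h3.trans ?_)
  have h5 : 0 ≤ quad (P.lin t.1 t.2.2) (dzv P.T (P.tangent t.1 j k) t.2.2) :=
    quad_nonneg (hs.posDef_lin hz hd.le).posSemidef _
  rw [← mul_assoc]
  exact mul_le_mul ((re_le_norm _).trans ht) h4 h5 (by positivity)

theorem smooth_dz_rho (j : Fin n) :
    ContDiffOn ℝ ∞ (dz P.T j fun y => (P.ρ y : ℂ)) P.T :=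
  contDiffOn_dz P.reg.1 P.smooth_rhoC le_rfl j

theorem smooth_dzbar_rho (j : Fin n) :
    ContDiffOn ℝ ∞ (dzbar P.T j fun y => (P.ρ y : ℂ)) P.T :=
  contDiffOn_dzbar P.reg.1 P.smooth_rhoC le_rfl j

theorem dzbar_rho (hz : z ∈ P.T) (j : Fin n) :
    dzbar P.T j (fun y => (P.ρ y : ℂ)) z = star (P.conormal z j) := by
  rw [dzbar_ofReal (P.reg.1 z hz) (P.smooth_rho.differentiableOn (by simp) z hz)]; rfl

theorem smooth_hess_rho (j k : Fin n) :
    ContDiffOn ℝ ∞ (fun z => hess P.T (fun y => (P.ρ y : ℂ)) z j k) P.T :=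
  P.smooth_hessian_rho j k

theorem smooth_dz_dz_rho (j k : Fin n) :
    ContDiffOn ℝ ∞ (dz P.T j (dz P.T k fun y => (P.ρ y : ℂ))) P.T :=
  contDiffOn_dz P.reg.1 (smooth_dz_rho k) le_rfl j

set_option maxHeartbeats 1000000 in
/-- The product `G g` is controlled. Derivatives of the tangential derivatives contain the
tangential part of `∂∂̄w`, so `G g` is `τ r^*` up to controlled errors; moreover `G g Ω⁻¹` is
Hermitian and `tr(G g) = n`. -/
theorem matO_lin_mul_form :
    MatO (P.near P.inside) (fun t => P.lin t.1 t.2.2 * P.form t.1 t.2.2) P.err := by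
  obtain ⟨κ, hκ⟩ : ∃ κ, P.conormal P.p κ ≠ 0 := by
    by_contra! hcon
    exact P.conormal_ne_zero (funext hcon)
  have hr : ∀ i, (fun t : Config n => P.conormal t.2.2 i) =O[P.near P.inside] fun _ => (1 : ℝ) :=
    fun i => isBigO_coeff (P.smooth_conormal i)
  have hrb : ∀ i, (fun t : Config n => star (P.conormal t.2.2 i)) =O[P.near P.inside]
      fun _ => (1 : ℝ) := fun i => isBigO_star (hr i)
  have hri := isBigO_coeff_inv (P.smooth_conormal κ) hκ
  have hrne := eventually_coeff_ne (P.smooth_conormal κ) hκ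
  have hquad : ContDiffOn ℝ ∞
      (fun z => star (P.conormal z) ⬝ᵥ (P.Ω z)⁻¹ *ᵥ P.conormal z) P.T := by
    simp only [dotProduct]
    exact ContDiffOn.sum fun i _ => (contDiffOn_conj (P.smooth_conormal i)).mul
      (contDiffOn_mulVec_apply P.smooth_inv P.smooth_conormal i)
  have hquad0 : star (P.conormal P.p) ⬝ᵥ (P.Ω P.p)⁻¹ *ᵥ P.conormal P.p ≠ 0 := by
    intro h0
    have := quad_pos (P.posDef _ P.mem).inv P.conormal_ne_zero
    rw [quad, h0] at this
    simp at this
  -- The matrix `m` collects the terms with first derivatives of `w` in the derivatives of the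
  -- tangential derivatives.
  set c : Config n → ℂ := fun t => (P.conormal t.2.2 κ)⁻¹ * star (P.conormal t.2.2 κ)⁻¹ with hc
  have hcO : c =O[P.near P.inside] fun _ => (1 : ℝ) := isBigO_one_mul hri (isBigO_star hri)
  set m : Config n → Matrix (Fin n) (Fin n) ℂ := fun t => Matrix.of fun a k =>
    (star (P.conormal t.2.2 κ) * hess P.T (fun y => (P.ρ y : ℂ)) t.2.2 a k -
      star (P.conormal t.2.2 k) * hess P.T (fun y => (P.ρ y : ℂ)) t.2.2 a κ) *
      dz P.T κ (fun y => (t.1 y : ℂ)) t.2.2 -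
    dz P.T a (dz P.T κ fun y => (P.ρ y : ℂ)) t.2.2 *
      (star (P.conormal t.2.2 κ) * dzbar P.T k (fun y => (t.1 y : ℂ)) t.2.2 -
        star (P.conormal t.2.2 k) * dzbar P.T κ (fun y => (t.1 y : ℂ)) t.2.2) with hm
  have hmO : MatO (P.near P.inside) m fun t => √t.2.1 := fun a k =>
    (isBigO_one_mul ((isBigO_one_mul (hrb κ) (isBigO_coeff (smooth_hess_rho a k))).sub
      (isBigO_one_mul (hrb k) (isBigO_coeff (smooth_hess_rho a κ)))) (isBigO_grad κ)).sub
    (isBigO_one_mul (isBigO_coeff (smooth_dz_dz_rho a κ))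
      ((isBigO_one_mul (hrb κ) (isBigO_grad_bar k)).sub
        (isBigO_one_mul (hrb k) (isBigO_grad_bar κ))))
  have hGm := (matO_lin.mul hmO).trans invTrace_mul_sqrt_isBigO_err
  have hGref : MatO (P.near P.inside) (fun t => P.lin t.1 t.2.2 * P.ref t.2.2) P.err :=
    (matO_lin.mul_one fun i j => isBigO_coeff (P.smooth_ref i j)).trans invTrace_isBigO_err
  have hrV : VecO (P.near P.inside) (fun t => P.conormal t.2.2) fun _ => 1 := hr
  refine isBigO_of_rank_one (l := P.near P.inside) (E := fun t => P.lin t.1 t.2.2 * P.form t.1 t.2.2)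
    (R := fun t => (P.Ω t.2.2)⁻¹) (r := fun t => P.conormal t.2.2)
    (τ := fun t b => (P.lin t.1 t.2.2 * complexHessian P.T t.1 t.2.2) b κ *
      star (P.conormal t.2.2 κ)⁻¹) one_isBigO_err matO_inv hrV
    (isBigO_coeff_inv hquad hquad0) (eventually_coeff_ne hquad hquad0) ?_ ?_ ?_ ?_
  · filter_upwards [eventually_inside] with t ⟨hs, hz, _, hd⟩ using (P.posDef _ hz).1.inv
  · filter_upwards [eventually_inside] with t ⟨hs, hz, _, hd⟩
    exact isHermitian_gOp_mul_mul_inv (P.posDef _ hz) (isHermitian_form hs.smooth_two hz)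
      (hs.posDef _ hz hd.le) rfl
  · filter_upwards [eventually_inside] with t ⟨hs, hz, _, hd⟩
    rw [lin, trace_gOp_mul]
    change ((P.W t.1 t.2.2)⁻¹ * P.W t.1 t.2.2).trace = n
    rw [Matrix.nonsing_inv_mul _ (isUnit_iff_ne_zero.2 (hs.posDef _ hz hd.le).det_pos.ne')]
    simp
  · intro b k
    have hO : (fun t => (P.lin t.1 t.2.2 * P.ref t.2.2) b k + c t *
        ((P.lin t.1 t.2.2 * m t) b k -
          (star (P.conormal t.2.2 κ) *
            (P.lin t.1 t.2.2 *ᵥ dzv P.T (P.tangent t.1 κ k) t.2.2) b -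
          star (P.conormal t.2.2 k) *
            (P.lin t.1 t.2.2 *ᵥ dzv P.T (P.tangent t.1 κ κ) t.2.2) b))) =O[P.near P.inside]
        P.err :=
      (hGref b k).add (isBigO_one_mul hcO ((hGm b k).sub
        ((isBigO_one_mul (hrb κ) (lin_mulVec_dz_tangent κ k b)).sub
          (isBigO_one_mul (hrb k) (lin_mulVec_dz_tangent κ κ b)))))
    refine hO.congr' ?_ (EventuallyEq.refl _ _)
    filter_upwards [eventually_inside, hrne] with t ⟨hs, hz, _, hd⟩ hne
    have hne' : star (P.conormal t.2.2 κ) ≠ 0 := by simpa using hne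
    have hρ2 : ContDiffOn ℝ 2 (fun y => (P.ρ y : ℂ)) P.T := P.smooth_rhoC.of_le (by decide)
    have hw2 : ContDiffOn ℝ 2 (fun y => (t.1 y : ℂ)) P.T := contDiffOn_ofReal hs.smooth_two
    have hdt : ∀ k a, dzv P.T (P.tangent t.1 κ k) t.2.2 a = _ := fun k a =>
      dz_tang P.reg hρ2 hw2 hz κ k a
    have hma : ∀ a, m t a k - (star (P.conormal t.2.2 κ) * dzv P.T (P.tangent t.1 κ k) t.2.2 a -
        star (P.conormal t.2.2 k) * dzv P.T (P.tangent t.1 κ κ) t.2.2 a) =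
        P.conormal t.2.2 κ * (star (P.conormal t.2.2 κ) * complexHessian P.T t.1 t.2.2 a k -
          star (P.conormal t.2.2 k) * complexHessian P.T t.1 t.2.2 a κ) := by
      intro a
      rw [hdt, hdt, hm, complexHessian_eq]
      simp only [of_apply, dzbar_rho hz]
      change _ = dz P.T κ (fun y => (P.ρ y : ℂ)) t.2.2 * _
      ring
    simp only [Matrix.sub_apply, vecMulVec_apply, form, Matrix.mul_add, Matrix.add_apply,
      Pi.star_apply]
    rw [add_sub_assoc]
    congr 1
    have hsum : (P.lin t.1 t.2.2 * m t) b k -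
          (star (P.conormal t.2.2 κ) *
            (P.lin t.1 t.2.2 *ᵥ dzv P.T (P.tangent t.1 κ k) t.2.2) b -
          star (P.conormal t.2.2 k) *
            (P.lin t.1 t.2.2 *ᵥ dzv P.T (P.tangent t.1 κ κ) t.2.2) b) =
        P.conormal t.2.2 κ * (star (P.conormal t.2.2 κ) *
            (P.lin t.1 t.2.2 * complexHessian P.T t.1 t.2.2) b k -
          star (P.conormal t.2.2 k) *
            (P.lin t.1 t.2.2 * complexHessian P.T t.1 t.2.2) b κ) := by
      simp only [mul_apply, mulVec, dotProduct, Finset.mul_sum, ← Finset.sum_sub_distrib]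
      refine Finset.sum_congr rfl fun a _ => ?_
      linear_combination (P.lin t.1 t.2.2 b a) * hma a
    rw [hsum, hc]
    simp only [star_inv₀]
    field_simp

/-- Hence `G ∂∂̄w` is controlled. -/
theorem matO_lin_mul_hessian :
    MatO (P.near P.inside) (fun t => P.lin t.1 t.2.2 * complexHessian P.T t.1 t.2.2) P.err := by
  intro i j
  have h := (matO_lin_mul_form (P := P) i j).sub
    (((matO_lin.mul_one fun i j => isBigO_coeff (P.smooth_ref i j)).trans
      invTrace_isBigO_err) i j)
  refine h.congr_left fun t => ?_
  simp only [form, Matrix.mul_add, Matrix.add_apply, add_sub_cancel_left]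

theorem vecO_lin_mulVec_dz_dz (j : Fin n) : VecO (P.near P.inside)
    (fun t => P.lin t.1 t.2.2 *ᵥ dzv P.T (dz P.T j fun y => (t.1 y : ℂ)) t.2.2) P.err := by
  obtain ⟨κ, hκ⟩ : ∃ κ, P.conormal P.p κ ≠ 0 := by
    by_contra! hcon
    exact P.conormal_ne_zero (funext hcon)
  have hri := isBigO_star (isBigO_coeff_inv (P.smooth_conormal κ) hκ)
  have hrne := eventually_coeff_ne (P.smooth_conormal κ) hκ
  set m : Config n → Fin n → ℂ := fun t a =>
    dz P.T a (dz P.T j fun y => (P.ρ y : ℂ)) t.2.2 * dzbar P.T κ (fun y => (t.1 y : ℂ)) t.2.2 -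
      hess P.T (fun y => (P.ρ y : ℂ)) t.2.2 a κ * dz P.T j (fun y => (t.1 y : ℂ)) t.2.2 with hm
  have hmO : VecO (P.near P.inside) m fun t => √t.2.1 := fun a =>
    (isBigO_one_mul (isBigO_coeff (smooth_dz_dz_rho a j)) (isBigO_grad_bar κ)).sub
      (isBigO_one_mul (isBigO_coeff (smooth_hess_rho a κ)) (isBigO_grad j))
  have hGm := (matO_lin.mulVec hmO).trans invTrace_mul_sqrt_isBigO_err
  intro b
  have hO := isBigO_one_mul hri (((lin_mulVec_dz_tangent (P := P) j κ b).add (isBigO_one_mul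
    (isBigO_coeff (P.smooth_conormal j)) (matO_lin_mul_hessian b κ))).add (hGm b))
  refine hO.congr' ?_ (EventuallyEq.refl _ _)
  filter_upwards [eventually_inside, hrne] with t ⟨hs, hz, _, hd⟩ hne
  have hne' : star (P.conormal t.2.2 κ) ≠ 0 := by simpa using hne
  have hρ2 : ContDiffOn ℝ 2 (fun y => (P.ρ y : ℂ)) P.T := P.smooth_rhoC.of_le (by decide)
  have hw2 : ContDiffOn ℝ 2 (fun y => (t.1 y : ℂ)) P.T := contDiffOn_ofReal hs.smooth_two
  have hma : ∀ a, dzv P.T (P.tangent t.1 j κ) t.2.2 a +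
      P.conormal t.2.2 j * complexHessian P.T t.1 t.2.2 a κ + m t a =
      star (P.conormal t.2.2 κ) * dzv P.T (dz P.T j fun y => (t.1 y : ℂ)) t.2.2 a := by
    intro a
    rw [show dzv P.T (P.tangent t.1 j κ) t.2.2 a = _ from dz_tang P.reg hρ2 hw2 hz j κ a, hm,
      complexHessian_eq, dzbar_rho hz]
    change _ + dz P.T j (fun y => (P.ρ y : ℂ)) t.2.2 * _ + _ =
      _ * dz P.T a (dz P.T j fun y => (t.1 y : ℂ)) t.2.2
    ring
  have hsum : (P.lin t.1 t.2.2 *ᵥ dzv P.T (P.tangent t.1 j κ) t.2.2) b +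
      P.conormal t.2.2 j * (P.lin t.1 t.2.2 * complexHessian P.T t.1 t.2.2) b κ +
      (P.lin t.1 t.2.2 *ᵥ m t) b = star (P.conormal t.2.2 κ) *
        (P.lin t.1 t.2.2 *ᵥ dzv P.T (dz P.T j fun y => (t.1 y : ℂ)) t.2.2) b := by
    simp only [mul_apply, mulVec, dotProduct, Finset.mul_sum, ← Finset.sum_add_distrib]
    refine Finset.sum_congr rfl fun a _ => ?_
    linear_combination (P.lin t.1 t.2.2 b a) * hma a
  rw [hsum, star_inv₀, inv_mul_cancel_left₀ hne']

/-- The linearized operator applied to first derivatives of `w`. -/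
theorem isBigO_trace_lin_hess_dz (j : Fin n) :
    (fun t : Config n => (P.lin t.1 t.2.2 *
      hess P.T (dz P.T j fun y => (t.1 y : ℂ)) t.2.2).trace) =O[P.near P.inside] P.err := by
  have h1 : (fun t : Config n => dz P.T j (fun y => (P.logDet t.1 y : ℂ)) t.2.2)
      =O[P.near P.inside] P.err := by
    refine IsBigO.trans (IsBigO.of_bound P.dlog ?_) (one_isBigO_err (P := P))
    filter_upwards [eventually_inside] with t ⟨hs, hz, _, hd⟩
    rw [norm_one, _root_.mul_one]
    exact hs.dlog_le _ hz hd.le j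
  have h2 : MatO (P.near P.inside) (fun t => dzMat P.T j P.Ω t.2.2) fun _ => 1 := fun a b =>
    isBigO_coeff (contDiffOn_dz P.reg.1 (P.smooth_metric a b) le_rfl j)
  have h3 : MatO (P.near P.inside) (fun t => dzMat P.T j P.ref t.2.2) fun _ => 1 := fun a b =>
    isBigO_coeff (contDiffOn_dz P.reg.1 (P.smooth_ref a b) le_rfl j)
  have h4 := (h1.add (h2.one_mul (matO_lin_mul_form.mul_one matO_inv)).trace).sub
    ((matO_lin.mul_one h3).trace.trans invTrace_isBigO_err)
  refine h4.congr' ?_ (EventuallyEq.refl _ _)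
  filter_upwards [eventually_inside] with t ⟨hs, hz, hneg, hd⟩
  rw [← hs.trace_lin_mul hz hneg hd j]
  congr 2
  have hw3 : ContDiffOn ℝ 3 (fun y => (t.1 y : ℂ)) P.T :=
    contDiffOn_ofReal (hs.smooth.of_le (by norm_num))
  ext a b
  simp only [dzMat, of_apply, hess]
  rw [dz_congr (g := dz P.T j (dzbar P.T b fun y => (t.1 y : ℂ)))
    (fun y hy => (dz_dzbar_comm P.reg (hw3.of_le (by norm_num)) hy j b).symm) hz a,
    dz_dz_comm P.reg (contDiffOn_dzbar P.reg.1 hw3 (by norm_num) b) hz a j]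
  rfl

end BoundaryPatch

end Tangential

/-! ### Mixed second derivatives at the boundary -/

section Mixed

open Asymptotics

variable {n : ℕ} {T : Set (Cn n)} {z p q : Cn n}

theorem trace_mul_vecMulVec (G : Matrix (Fin n) (Fin n) ℂ) (x y : Fin n → ℂ) :
    (G * vecMulVec x y).trace = y ⬝ᵥ G *ᵥ x := by
  rw [mul_vecMulVec, trace_vecMulVec, dotProduct_comm]

theorem trace_mul_hess_mul (hT : UniqueDiffOn ℝ T) {f g : Cn n → ℂ} (hf : ContDiffOn ℝ 2 f T)
    (hg : ContDiffOn ℝ 2 g T) (hz : z ∈ T) (G : Matrix (Fin n) (Fin n) ℂ) :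
    (G * hess T (fun w => f w * g w) z).trace =
      g z * (G * hess T f z).trace + f z * (G * hess T g z).trace +
        dzbv T g z ⬝ᵥ G *ᵥ dzv T f z + dzbv T f z ⬝ᵥ G *ᵥ dzv T g z := by
  rw [hess_mul hT hf hg hz]
  simp only [Matrix.mul_add, trace_add, Matrix.mul_smul, trace_smul, smul_eq_mul,
    trace_mul_vecMulVec]

theorem trace_mul_hess_normSq_ge (hT : Regular T) {f : Cn n → ℂ} (hf : ContDiffOn ℝ 2 f T)
    (hz : z ∈ T) {G : Matrix (Fin n) (Fin n) ℂ} (hG : G.PosSemidef) :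
    quad G (dzv T f z) - 2 * (‖f z‖ * ‖(G * hess T f z).trace‖) ≤
      (G * hess T (fun w => f w * (starRingEnd ℂ) (f w)) z).trace.re := by
  have hfc := contDiffOn_conj hf
  have hu := hT.1 z hz
  have hd := diffAt_of_contDiffOn hf two_ne_zero hz
  have h1 : dzbv T (fun w => (starRingEnd ℂ) (f w)) z = star (dzv T f z) :=
    funext fun j => dzbar_conj hu hd j
  have h2 : dzbv T f z = star (dzv T (fun w => (starRingEnd ℂ) (f w)) z) := funext fun j => by
    simp only [dzbv, dzv, Pi.star_apply]
    rw [dz_conj hu hd j, RCLike.star_def, conj_conj]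
  rw [trace_mul_hess_mul hT.1 hf hfc hz, hess_conj hT hf hz, h1, h2]
  simp only [add_re]
  have h3 : -(‖f z‖ * ‖(G * hess T f z).trace‖) ≤
      ((starRingEnd ℂ) (f z) * (G * hess T f z).trace).re := by
    have := (abs_le.1 (abs_re_le_norm ((starRingEnd ℂ) (f z) * (G * hess T f z).trace))).1
    rwa [norm_mul, RCLike.norm_conj] at this
  have h4 : -(‖f z‖ * ‖(G * hess T f z).trace‖) ≤ (f z * (G * (hess T f z)ᴴ).trace).re := by
    have := (abs_le.1 (abs_re_le_norm (f z * (G * (hess T f z)ᴴ).trace))).1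
    rwa [norm_mul, norm_trace_mul_conjTranspose hG.1] at this
  have h5 := quad_nonneg hG (dzv T (fun w => (starRingEnd ℂ) (f w)) z)
  simp only [quad] at h5 ⊢
  linarith

theorem norm_dzbar_le {f : Cn n → ℂ} {C : ℝ} (h : ∀ v, ‖fderivWithin ℝ f T z v‖ ≤ C * ‖v‖)
    (j : Fin n) : ‖dzbar T j f z‖ ≤ C := by
  have h1 := h (EuclideanSpace.single j 1)
  have h2 := h (EuclideanSpace.single j I)
  rw [PiLp.norm_single, norm_one, mul_one] at h1
  rw [PiLp.norm_single, norm_I, mul_one] at h2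
  rw [dzbar, norm_div, Complex.norm_ofNat, div_le_iff₀ two_pos]
  refine (norm_add_le _ _).trans ?_
  rw [norm_mul, norm_I, one_mul]
  linarith

/-- The choice of constants in the barrier for mixed derivatives. -/
theorem mixed_barrier_arith {κ 𝒯 E X L c A B ε g v S : ℝ} (hκ : 1 ≤ κ) (h𝒯 : 0 ≤ 𝒯) (hE : 0 ≤ E)
    (hX : X ^ 2 = 𝒯 * E)
    (hL : L ≤ c * (κ * (1 + 𝒯) + X)) (hg : B * κ * g ≤ S * κ * 𝒯) (hS : 0 ≤ S)
    (hv : v ≤ -ε * (1 + 𝒯)) (hA0 : 0 ≤ A) (hA : A * ε = c + S + c ^ 2 + 1) :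
    0 < -L - A * κ * v - B * κ * g + κ⁻¹ * E := by
  have hκ0 : 0 < κ := one_pos.trans_le hκ
  have h1 : c * X ≤ κ⁻¹ * E + c ^ 2 * κ * 𝒯 := by
    have ha : 0 ≤ κ⁻¹ * E := by positivity
    have hb : 0 ≤ c ^ 2 * κ * 𝒯 := by positivity
    have hab : (c * X) ^ 2 = κ⁻¹ * E * (c ^ 2 * κ * 𝒯) := by
      rw [mul_pow, hX]; field_simp
    refine abs_le_of_sq_le_sq' ?_ (add_nonneg ha hb) |>.2
    rw [hab]
    nlinarith
  have h2 : A * κ * v ≤ -(c + S + c ^ 2 + 1) * κ * (1 + 𝒯) := by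
    calc A * κ * v ≤ A * κ * (-ε * (1 + 𝒯)) := mul_le_mul_of_nonneg_left hv (by positivity)
      _ = -(A * ε) * κ * (1 + 𝒯) := by ring
      _ = _ := by rw [hA]
  have h3 : 0 ≤ κ * 𝒯 := by positivity
  nlinarith [mul_nonneg hS hκ0.le, mul_nonneg (sq_nonneg c) hκ0.le]

theorem mixed_barrier_conclusion {κ τ E Z L c c' A B G ε g S x₁ x₂ x₃ : ℝ} (hκ : 1 ≤ κ)
    (hτ : 0 ≤ τ) (hE : 0 ≤ E) (hZ : Z ^ 2 = τ * E) (h2 : -(L * (κ * (1 + τ) + Z)) ≤ x₂)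
    (h3 : κ⁻¹ * E - c' * (κ * (1 + τ) + Z) ≤ κ⁻¹ * x₃) (hg : g ≤ G * τ) (hB : 0 ≤ B)
    (hS : S = B * G) (hS0 : 0 ≤ S) (h1 : x₁ ≤ -ε * (1 + τ)) (hA0 : 0 ≤ A)
    (hA : A * ε = c + S + c ^ 2 + 1) (hc : c = L + c')
    (h : x₂ - A * κ * x₁ - B * κ * g + κ⁻¹ * x₃ ≤ 0) : False := by
  have hgB : B * κ * g ≤ S * κ * τ := by
    have := mul_le_mul_of_nonneg_left hg (mul_nonneg hB (zero_le_one.trans hκ))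
    rw [hS]
    linarith
  have := mixed_barrier_arith (L := c * (κ * (1 + τ) + Z)) hκ hτ hE hZ le_rfl hgB hS0 h1 hA0 hA
  rw [hc] at this
  nlinarith

namespace BoundaryPatch

variable {P : BoundaryPatch n} {w : Cn n → ℝ} {K : ℝ}

/-- The linearized operator applied to tangential derivatives: third derivatives of `w` are removed by
the differentiated equation, second derivatives only occur in products with `G`. -/
theorem isBigO_trace_lin_hess_tangent (j k : Fin n) :
    (fun t : Config n => (P.lin t.1 t.2.2 * hess P.T (P.tangent t.1 j k) t.2.2).trace)
      =O[P.near P.inside] P.err := by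
  have hsm : ∀ {f : Cn n → ℂ}, ContDiffOn ℝ ∞ f P.T →
      MatO (P.near P.inside) (fun t => hess P.T f t.2.2) (fun _ => 1) ∧
      VecO (P.near P.inside) (fun t => dzv P.T f t.2.2) (fun _ => 1) ∧
      VecO (P.near P.inside) (fun t => dzbv P.T f t.2.2) (fun _ => 1) := fun hf =>
    ⟨fun a b => isBigO_coeff (contDiffOn_dz P.reg.1 (contDiffOn_dzbar (k := ∞) P.reg.1 hf le_rfl b)
      le_rfl a), fun a => isBigO_coeff (contDiffOn_dz P.reg.1 hf le_rfl a),
      fun a => isBigO_coeff (contDiffOn_dzbar P.reg.1 hf le_rfl a)⟩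
  obtain ⟨a1, a2, a3⟩ := hsm (smooth_dzbar_rho (P := P) k)
  obtain ⟨b1, b2, b3⟩ := hsm (smooth_dz_rho (P := P) j)
  have hTK : (fun t : Config n => √t.2.1 * P.invTrace t) =O[P.near P.inside] P.err :=
    invTrace_mul_sqrt_isBigO_err.congr_left fun _ => mul_comm _ _
  have hGH := matO_lin_mul_hessian (P := P)
  have s1 := ((isBigO_grad (P := P) j).mul (matO_lin.mul_one a1).trace).trans hTK
  have s2 := isBigO_one_mul (isBigO_coeff (smooth_dzbar_rho (P := P) k))
    (isBigO_trace_lin_hess_dz (P := P) j)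
  have s3 := hGH.conjTranspose.mulVec_one a2 j
  have s4 := a3.one_dot (vecO_lin_mulVec_dz_dz (P := P) j)
  have s5 := ((isBigO_grad_bar (P := P) k).mul (matO_lin.mul_one b1).trace).trans hTK
  have s6 := isBigO_one_mul (isBigO_coeff (smooth_dz_rho (P := P) j))
    (isBigO_star (isBigO_trace_lin_hess_dz (P := P) k))
  have s7 := (vecO_lin_mulVec_dz_dz (P := P) k).star.dot_one b2
  have s8 := b3.one_dot (fun b => hGH b k : VecO (P.near P.inside) (fun t b =>
    (P.lin t.1 t.2.2 * complexHessian P.T t.1 t.2.2) b k) P.err)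
  refine ((((s1.add s2).add s3).add s4).sub (((s5.add s6).add s7).add s8)).congr' ?_
    (EventuallyEq.refl _ _)
  filter_upwards [eventually_inside] with t ⟨hs, hz, _, hd⟩
  have hT := P.reg
  have hu := hT.1 _ hz
  have hGh := (hs.posDef_lin hz hd.le).1
  have hw3 : ContDiffOn ℝ 3 (fun y => (t.1 y : ℂ)) P.T :=
    contDiffOn_ofReal (hs.smooth.of_le (by norm_num))
  have hw2 : ContDiffOn ℝ 2 (fun y => (t.1 y : ℂ)) P.T := hw3.of_le (by norm_num)
  have c1 : ContDiffOn ℝ 2 (dzbar P.T k fun y => (P.ρ y : ℂ)) P.T :=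
    (smooth_dzbar_rho k).of_le (by decide)
  have c2 : ContDiffOn ℝ 2 (dz P.T j fun y => (P.ρ y : ℂ)) P.T :=
    (smooth_dz_rho j).of_le (by decide)
  have c3 : ∀ j, ContDiffOn ℝ 2 (dz P.T j fun y => (t.1 y : ℂ)) P.T := fun j =>
    contDiffOn_dz hT.1 hw3 (by norm_num) j
  have c4 : ContDiffOn ℝ 2 (dzbar P.T k fun y => (t.1 y : ℂ)) P.T :=
    contDiffOn_dzbar hT.1 hw3 (by norm_num) k
  have hbar : EqOn (dzbar P.T k fun y => (t.1 y : ℂ))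
      (fun y => (starRingEnd ℂ) (dz P.T k (fun y => (t.1 y : ℂ)) y)) P.T := fun y hy =>
    dzbar_ofReal (hT.1 y hy) (hs.diffAt hy) k
  have e1 : hess P.T (dzbar P.T k fun y => (t.1 y : ℂ)) t.2.2 =
      (hess P.T (dz P.T k fun y => (t.1 y : ℂ)) t.2.2)ᴴ := by
    rw [hess_congr hbar hz, hess_conj hT (c3 k) hz]
  have e2 : dzbv P.T (dz P.T j fun y => (t.1 y : ℂ)) t.2.2 =
      fun b => complexHessian P.T t.1 t.2.2 j b := funext fun b =>
    (dz_dzbar_comm hT hw2 hz j b).symm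
  have e3 : dzbv P.T (dzbar P.T k fun y => (t.1 y : ℂ)) t.2.2 =
      star (dzv P.T (dz P.T k fun y => (t.1 y : ℂ)) t.2.2) := funext fun b => by
    simp only [dzbv]
    rw [dzbar_congr hbar hz, dzbar_conj hu (diffAt_dz hT.1 hw2 hz k)]; rfl
  have e4 : dzv P.T (dzbar P.T k fun y => (t.1 y : ℂ)) t.2.2 =
      fun a => complexHessian P.T t.1 t.2.2 a k := rfl
  have hfun : P.tangent t.1 j k = fun y =>
      dzbar P.T k (fun y => (P.ρ y : ℂ)) y * dz P.T j (fun y => (t.1 y : ℂ)) y -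
      dz P.T j (fun y => (P.ρ y : ℂ)) y * dzbar P.T k (fun y => (t.1 y : ℂ)) y := rfl
  have hHh : (complexHessian P.T t.1 t.2.2).IsHermitian :=
    isHermitian_hess_ofReal hT hs.smooth_two hz
  have f1 : ((P.lin t.1 t.2.2 * complexHessian P.T t.1 t.2.2)ᴴ *ᵥ
      dzv P.T (dzbar P.T k fun y => (P.ρ y : ℂ)) t.2.2) j =
      (fun b => complexHessian P.T t.1 t.2.2 j b) ⬝ᵥ (P.lin t.1 t.2.2 *ᵥ
        dzv P.T (dzbar P.T k fun y => (P.ρ y : ℂ)) t.2.2) := by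
    rw [conjTranspose_mul, hGh.eq, hHh.eq, ← mulVec_mulVec]
    rfl
  have f2 : (P.lin t.1 t.2.2 * (hess P.T (dz P.T k fun y => (t.1 y : ℂ)) t.2.2)ᴴ).trace =
      star (P.lin t.1 t.2.2 * hess P.T (dz P.T k fun y => (t.1 y : ℂ)) t.2.2).trace := by
    rw [← trace_conjTranspose, conjTranspose_mul, hGh.eq, trace_mul_comm]
  have f3 : star (dzv P.T (dz P.T k fun y => (t.1 y : ℂ)) t.2.2) ⬝ᵥ (P.lin t.1 t.2.2 *ᵥ
      dzv P.T (dz P.T j fun y => (P.ρ y : ℂ)) t.2.2) =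
      star (P.lin t.1 t.2.2 *ᵥ dzv P.T (dz P.T k fun y => (t.1 y : ℂ)) t.2.2) ⬝ᵥ
        dzv P.T (dz P.T j fun y => (P.ρ y : ℂ)) t.2.2 := by
    rw [star_mulVec, hGh.eq, dotProduct_mulVec]
  rw [hfun, hess_sub hT.1 (c1.mul (c3 j)) (c2.mul c4) hz, Matrix.mul_sub, trace_sub,
    trace_mul_hess_mul hT.1 c1 (c3 j) hz, trace_mul_hess_mul hT.1 c2 c4 hz, e1, e2, e3, e4, f1, f2,
    f3]
  rfl

/-- The main barrier: `v = w + s (d - N d²)`, `d = -ρ`, is a strict supersolution. Since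
`tr(G g) = n`, and `tr(G ref) ≥ ε₁ tr W⁻¹` by admissibility of the subsolution, `w` is one where
`tr W⁻¹` is large. Where it is small the linearized operator is uniformly elliptic, as the
determinant is bounded, and the term `-N d²` gives the sign. -/
theorem exists_mixed_barrier (P : BoundaryPatch n) : ∃ s N ε C : ℝ, 0 < ε ∧ 0 < C ∧
    (∀ᶠ z in 𝓝[P.T] P.p, ∀ w K, P.Solution w K →
      0 ≤ w z + s * (-P.ρ z - N * P.ρ z ^ 2) ∧
        w z + s * (-P.ρ z - N * P.ρ z ^ 2) ≤ C * (-P.ρ z)) ∧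
    ∀ᶠ t in P.near P.inside, (P.lin t.1 t.2.2 * complexHessian P.T
      (fun y => t.1 y + s * (-P.ρ y - N * P.ρ y ^ 2)) t.2.2).trace.re ≤
        -ε * (1 + P.invTrace t) := by
  obtain ⟨Cd, hCd, hle⟩ := P.exists_le_dist
  obtain ⟨l, L', hl, _, hell⟩ := exists_elliptic (G := fun z => wOp (P.Ω z) (P.ref z)) P.mem
    P.posDef_ref fun i j => (contDiffOn_wOp P.smooth_metric (fun _ hz => det_metric_ne hz)
      P.smooth_ref i j).continuousOn P.p P.mem
  obtain ⟨l', L, _, hL, hell'⟩ := exists_elliptic (G := P.Ω) P.mem P.posDef fun i j =>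
    (P.smooth_metric i j).continuousOn P.p P.mem
  obtain ⟨C, hC, hO⟩ := ((matO_lin (P := P)).mul_one
    (fun i j => isBigO_coeff (P.smooth_hessian_rho i j) :
      MatO (P.near P.inside) (fun t => complexHessian P.T P.ρ t.2.2) fun _ => 1)).trace.exists_pos
  have hn : (0 : ℝ) < n := by exact_mod_cast (by have := P.two_le; omega : 0 < n)
  obtain ⟨ε₁, hε₁⟩ : ∃ x : ℝ, x = l / (n * L) := ⟨_, rfl⟩
  have hε₁0 : 0 < ε₁ := by rw [hε₁]; positivity
  obtain ⟨s, hs⟩ : ∃ x : ℝ, x = ε₁ / (2 * C) := ⟨_, rfl⟩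
  have hs0 : 0 < s := by rw [hs]; positivity
  obtain ⟨T₀, hT₀⟩ : ∃ x : ℝ, x = 4 * (n + 1) / ε₁ := ⟨_, rfl⟩
  have hT₀0 : 0 < T₀ := by rw [hT₀]; positivity
  obtain ⟨c₃, hc₃⟩ : ∃ x : ℝ, x = quad (P.Ω P.p)⁻¹ (P.conormal P.p) / 2 := ⟨_, rfl⟩
  have hquad := quad_pos (P.posDef _ P.mem).inv P.conormal_ne_zero
  have hc₃0 : 0 < c₃ := by rw [hc₃]; exact half_pos hquad
  have hlen : ∀ᶠ z in 𝓝[P.T] P.p, c₃ < quad (P.Ω z)⁻¹ (P.conormal z) := by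
    rw [hc₃]
    exact eventually_const_lt (contDiffOn_quad P.smooth_inv P.smooth_conormal)
      (half_lt_self hquad)
  obtain ⟨e₀, he₀⟩ : ∃ x : ℝ, x = (max P.detSup 1 * T₀ ^ (n - 1))⁻¹ * c₃ := ⟨_, rfl⟩
  have he₀0 : 0 < e₀ := by
    have : (0 : ℝ) < max P.detSup 1 := lt_max_of_lt_right one_pos
    rw [he₀]; positivity
  obtain ⟨N, hN⟩ : ∃ x : ℝ, x = (n + 1) / (2 * s * e₀) := ⟨_, rfl⟩
  have hN0 : 0 < N := by rw [hN]; positivity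
  have hρs : ∀ᶠ z in 𝓝[P.T] P.p, -(1 / (2 * N)) < P.ρ z :=
    eventually_const_lt P.smooth_rho (by rw [P.zero, neg_lt_zero]; positivity)
  refine ⟨s, N, min 1 (ε₁ / 4), Cd + s, lt_min one_pos (by positivity), by positivity, ?_, ?_⟩
  · filter_upwards [hle, hρs, self_mem_nhdsWithin] with z hz hρ hzT w K hw
    obtain ⟨h1, h2⟩ := hz w K hw
    have h3 := P.defining.nonpos hzT
    have h4 : N * (-P.ρ z) ≤ 1 := by
      calc N * (-P.ρ z) ≤ N * (1 / (2 * N)) :=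
            mul_le_mul_of_nonneg_left (by linarith) hN0.le
        _ = 1 / 2 := by field_simp
        _ ≤ 1 := by norm_num
    have h5 : 0 ≤ -P.ρ z - N * P.ρ z ^ 2 := by nlinarith
    have h6 : -P.ρ z - N * P.ρ z ^ 2 ≤ -P.ρ z := by
      have : 0 ≤ N * P.ρ z ^ 2 := by positivity
      linarith
    refine ⟨by positivity, ?_⟩
    have := mul_le_mul_of_nonneg_left h6 hs0.le
    linarith
  · filter_upwards [hO.bound, eventually_inside, tendsto_inside.eventually hell,
      tendsto_inside.eventually hell', tendsto_inside.eventually hlen,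
      tendsto_inside.eventually hρs] with t ht ⟨hsol, hz, hneg, hd⟩ he1 he2 hlen' hρ
    have hT := P.reg
    have hΩ := P.posDef _ hz
    have hW := hsol.posDef _ hz hd.le
    have hT0 := hsol.invTrace_nonneg hz hd.le
    have hρ2 : ContDiffOn ℝ 2 P.ρ P.T := P.smooth_rho.of_le (by decide)
    have hb2 : ContDiffOn ℝ 2 (fun y => -P.ρ y - N * P.ρ y ^ 2) P.T :=
      hρ2.neg.sub (contDiffOn_const.mul (hρ2.pow 2))
    have hLw : (P.lin t.1 t.2.2 * complexHessian P.T t.1 t.2.2).trace.re ≤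
        n - ε₁ * P.invTrace t := by
      have h1 : (P.lin t.1 t.2.2 * P.form t.1 t.2.2).trace = n := by
        rw [lin, trace_gOp_mul]
        change ((P.W t.1 t.2.2)⁻¹ * P.W t.1 t.2.2).trace = n
        rw [Matrix.nonsing_inv_mul _ (isUnit_iff_ne_zero.2 hW.det_pos.ne')]
        simp
      have h2 : (P.lin t.1 t.2.2 * P.ref t.2.2).trace =
          ((P.W t.1 t.2.2)⁻¹ * wOp (P.Ω t.2.2) (P.ref t.2.2)).trace := trace_gOp_mul _ _ _
      have hpsd : (wOp (P.Ω t.2.2) (P.ref t.2.2) - (ε₁ : ℂ) • P.Ω t.2.2).PosSemidef := by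
        refine (posSemidef_iff_quad ?_).2 fun x => ?_
        · refine (P.posDef_ref _ hz).1.sub ?_
          rw [IsHermitian, conjTranspose_smul, hΩ.1.eq, RCLike.star_def, conj_ofReal]
        · rw [quad_sub, quad_smul]
          have q1 := he1.lower x
          have q2 := (abs_le.1 (abs_quad_le he2.upper x)).2
          have q3 : ε₁ * (n * L * ∑ i, ‖x i‖ ^ 2) = l * ∑ i, ‖x i‖ ^ 2 := by
            rw [hε₁]; field_simp
          nlinarith [mul_le_mul_of_nonneg_left q2 hε₁0.le]
      have h3 := trace_mul_re_nonneg hW.inv.posSemidef hpsd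
      rw [Matrix.mul_sub, trace_sub, Matrix.mul_smul, trace_smul, sub_re, smul_eq_mul,
        re_ofReal_mul, ← h2] at h3
      have h4 : (P.lin t.1 t.2.2 * complexHessian P.T t.1 t.2.2).trace =
          n - (P.lin t.1 t.2.2 * P.ref t.2.2).trace := by
        rw [← h1, form, Matrix.mul_add, trace_add]; ring
      rw [h4, sub_re, natCast_re]
      change _ ≤ (n : ℝ) - ε₁ * ((P.W t.1 t.2.2)⁻¹ * P.Ω t.2.2).trace.re
      linarith
    rw [complexHessian_add_real hT.1 hsol.smooth_two (contDiffOn_const.mul hb2) hz,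
      complexHessian_const_mul hT.1 hb2 _ hz, complexHessian_neg_sub_sq hT.1 hρ2 hz,
      Matrix.mul_add, trace_add, add_re, Matrix.mul_smul, trace_smul, smul_eq_mul, re_ofReal_mul,
      Matrix.mul_sub, trace_sub, sub_re, ← ofReal_neg, Matrix.mul_smul, trace_smul, smul_eq_mul,
      re_ofReal_mul, Matrix.mul_smul, trace_smul, smul_eq_mul, re_ofReal_mul,
      trace_mul_vecMulVec_star]
    have hq0 := quad_nonneg (hsol.posDef_lin hz hd.le).posSemidef (P.conormal t.2.2)
    have hLρ : |(P.lin t.1 t.2.2 * complexHessian P.T P.ρ t.2.2).trace.re| ≤ C * P.invTrace t := by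
      rw [Real.norm_eq_abs, abs_of_nonneg hT0] at ht
      exact (abs_re_le_norm _).trans ht
    have hNρ : N * (-P.ρ t.2.2) ≤ 1 / 2 := by
      calc N * (-P.ρ t.2.2) ≤ N * (1 / (2 * N)) :=
            mul_le_mul_of_nonneg_left (by linarith) hN0.le
        _ = 1 / 2 := by field_simp
    have hLd : -(1 + 2 * N * P.ρ t.2.2) *
        (P.lin t.1 t.2.2 * complexHessian P.T P.ρ t.2.2).trace.re ≤ C * P.invTrace t := by
      have u1 : 0 ≤ 1 + 2 * N * P.ρ t.2.2 := by linarith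
      have u2 : 1 + 2 * N * P.ρ t.2.2 ≤ 1 := by nlinarith
      have u3 := mul_le_mul_of_nonneg_left (abs_le.1 hLρ).1 u1
      have u4 : (1 + 2 * N * P.ρ t.2.2) * (C * P.invTrace t) ≤ 1 * (C * P.invTrace t) :=
        mul_le_mul_of_nonneg_right u2 (by positivity)
      linarith
    have hsC : s * (C * P.invTrace t) = ε₁ / 2 * P.invTrace t := by
      rw [hs]; field_simp
    have hmain : (P.lin t.1 t.2.2 * complexHessian P.T t.1 t.2.2).trace.re +
        s * (-(1 + 2 * N * P.ρ t.2.2) *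
          (P.lin t.1 t.2.2 * complexHessian P.T P.ρ t.2.2).trace.re -
          2 * N * quad (P.lin t.1 t.2.2) (P.conormal t.2.2)) ≤
        n - ε₁ / 2 * P.invTrace t - 2 * s * N * quad (P.lin t.1 t.2.2) (P.conormal t.2.2) := by
      have := mul_le_mul_of_nonneg_left hLd hs0.le
      linarith
    refine hmain.trans ?_
    have hmin : min 1 (ε₁ / 4) * (1 + P.invTrace t) ≤ 1 + ε₁ / 4 * P.invTrace t := by
      have := mul_le_mul_of_nonneg_right (min_le_right 1 (ε₁ / 4)) hT0
      linarith [min_le_left 1 (ε₁ / 4)]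
    -- The two regimes of `tr W⁻¹`.
    rcases le_or_gt T₀ (P.invTrace t) with hbig | hsmall
    · have h1 : (n : ℝ) + 1 ≤ ε₁ / 4 * P.invTrace t := by
        calc (n : ℝ) + 1 = ε₁ / 4 * T₀ := by rw [hT₀]; field_simp
          _ ≤ _ := mul_le_mul_of_nonneg_left hbig (by positivity)
      have h2 : 0 ≤ 2 * s * N * quad (P.lin t.1 t.2.2) (P.conormal t.2.2) := by positivity
      linarith
    · have h1 := quad_gOp_ge hΩ hW P.two_le (C := T₀) (D := max P.detSup 1) hsmall.le
        ((hsol.le_detSup _ hz hd.le).trans (le_max_left _ _)) (P.conormal t.2.2)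
      have h2 : e₀ ≤ quad (P.lin t.1 t.2.2) (P.conormal t.2.2) := by
        refine le_trans ?_ h1
        rw [he₀]
        have : (0 : ℝ) < max P.detSup 1 := lt_max_of_lt_right one_pos
        exact mul_le_mul_of_nonneg_left hlen'.le (by positivity)
      have h3 : (n : ℝ) + 1 ≤ 2 * s * N * quad (P.lin t.1 t.2.2) (P.conormal t.2.2) := by
        calc (n : ℝ) + 1 = 2 * s * N * e₀ := by rw [hN]; field_simp
          _ ≤ _ := mul_le_mul_of_nonneg_left h2 (by positivity)
      have h4 : 0 ≤ ε₁ / 4 * P.invTrace t := by positivity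
      linarith

theorem contDiffOn_tangent (h : P.Solution w K) (j k : Fin n) :
    ContDiffOn ℝ 2 (P.tangent w j k) P.T :=
  contDiffOn_tang (m := 3) P.reg.1 (P.smooth_rhoC.of_le (by decide))
    (contDiffOn_ofReal (h.smooth.of_le (by norm_num))) (by norm_num) j k

theorem isBigO_tangent (j k : Fin n) :
    (fun t : Config n => P.tangent t.1 j k t.2.2) =O[P.near P.inside] fun t => √t.2.1 :=
  (isBigO_one_mul (isBigO_coeff (smooth_dzbar_rho k)) (isBigO_grad j)).sub
    (isBigO_one_mul (isBigO_coeff (smooth_dz_rho j)) (isBigO_grad_bar k))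

theorem eventually_tangent_eq_zero (P : BoundaryPatch n) : ∀ᶠ q in 𝓝[P.T] P.p, P.ρ q = 0 →
    ∀ w K, P.Solution w K → ∀ j k, P.tangent w j k q = 0 := by
  obtain ⟨C, -, hb⟩ := P.exists_hessian_boundary
  filter_upwards [hb, self_mem_nhdsWithin] with q hq hqT h0 w K hw j k
  obtain ⟨-, -, -, -, hv, -⟩ := hq h0 w K hw
  exact (hv j k).self_of_nhdsWithin hqT h0

set_option maxHeartbeats 2000000 in
/-- A linear growth bound of the tangential derivatives `σ` away from boundary points, by the maximum
principle for `Re(e σ) - A √K v - B √K |z - q|² + K^{-1/2} ∑ |σ|²` with unimodular `e`. The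
quadratic term produces the energy that absorbs the error terms. -/
theorem exists_tangent_le (P : BoundaryPatch n) : ∃ C R : ℝ, 0 < R ∧ ∀ᶠ q in 𝓝[P.T] P.p,
    P.ρ q = 0 → ∀ w K, P.Solution w K → ∀ j k, ∀ y ∈ P.T, dist y q ≤ R →
      ‖P.tangent w j k y‖ ≤ C * √K * ‖y - q‖ := by
  obtain ⟨s, N, ε, Cv, hε, hCv, hv, hLv⟩ := P.exists_mixed_barrier
  obtain ⟨Cρ, -, hCρ, -, Rρ, hRρ, hRU, -, hlip⟩ :=
    exists_defining_bounds P.defining P.mem P.zero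
  choose Cσ hCσ hσ using fun jk : Fin n × Fin n =>
    (isBigO_tangent (P := P) jk.1 jk.2).exists_pos
  choose CL hCL hLσ using fun jk : Fin n × Fin n =>
    (isBigO_trace_lin_hess_tangent (P := P) jk.1 jk.2).exists_pos
  obtain ⟨CG, hCG, hG⟩ := (matO_lin (P := P)).trace.exists_pos
  obtain ⟨S, hS⟩ : ∃ x, x = ∑ jk, Cσ jk := ⟨_, rfl⟩
  obtain ⟨L, hL⟩ : ∃ x, x = ∑ jk, CL jk := ⟨_, rfl⟩
  have hS0 : 0 ≤ S := by rw [hS]; exact Finset.sum_nonneg fun i _ => (hCσ i).le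
  have hL0 : 0 ≤ L := by rw [hL]; exact Finset.sum_nonneg fun i _ => (hCL i).le
  have hσS : ∀ jk, Cσ jk ≤ S := fun jk => by
    rw [hS]; exact Finset.single_le_sum (fun i _ => (hCσ i).le) (Finset.mem_univ jk)
  have hLL : ∀ jk, CL jk ≤ L := fun jk => by
    rw [hL]; exact Finset.single_le_sum (fun i _ => (hCL i).le) (Finset.mem_univ jk)
  have hall : ∀ᶠ t in P.near P.inside, (P.Solution t.1 t.2.1 ∧ t.2.2 ∈ P.T ∧ P.ρ t.2.2 < 0 ∧
      dist t.2.2 P.p < P.radius) ∧ (∀ jk : Fin n × Fin n,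
        ‖P.tangent t.1 jk.1 jk.2 t.2.2‖ ≤ S * √t.2.1) ∧
      (∀ jk : Fin n × Fin n, ‖(P.lin t.1 t.2.2 * hess P.T (P.tangent t.1 jk.1 jk.2)
        t.2.2).trace‖ ≤ L * (√t.2.1 * (1 + P.invTrace t) + √(P.invTrace t * P.energy t))) ∧
      (P.lin t.1 t.2.2).trace.re ≤ CG * P.invTrace t ∧
      (P.lin t.1 t.2.2 * complexHessian P.T
        (fun y => t.1 y + s * (-P.ρ y - N * P.ρ y ^ 2)) t.2.2).trace.re ≤
        -ε * (1 + P.invTrace t) := by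
    filter_upwards [eventually_inside, eventually_all.2 fun jk => (hσ jk).bound,
      eventually_all.2 fun jk => (hLσ jk).bound, hG.bound, hLv] with t ht h1 h2 h3 h4
    have hT0 := ht.1.invTrace_nonneg ht.2.1 ht.2.2.2.le
    have hK := Real.sqrt_nonneg t.2.1
    have herr : 0 ≤ P.err t := by
      unfold err; positivity
    refine ⟨ht, fun jk => ?_, fun jk => ?_, ?_, h4⟩
    · have := h1 jk
      rw [Real.norm_eq_abs, abs_of_nonneg hK] at this
      exact this.trans (mul_le_mul_of_nonneg_right (hσS jk) hK)
    · have := h2 jk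
      rw [Real.norm_eq_abs, abs_of_nonneg herr] at this
      exact this.trans (mul_le_mul_of_nonneg_right (hLL jk) herr)
    · rw [Real.norm_eq_abs, abs_of_nonneg hT0] at h3
      exact (re_le_norm _).trans h3
  obtain ⟨R₁, hR₁, hball₁⟩ := Metric.mem_nhdsWithin_iff.1 (eventually_near.1 hall)
  obtain ⟨R₂, hR₂, hball₂⟩ := Metric.mem_nhdsWithin_iff.1
    ((hv.and P.eventually_tangent_eq_zero).and eventually_radius)
  obtain ⟨R, hR⟩ : ∃ R, R = min Rρ (min R₁ R₂) / 3 := ⟨_, rfl⟩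
  have hm0 : 0 < min Rρ (min R₁ R₂) := lt_min hRρ (lt_min hR₁ hR₂)
  have hR0 : 0 < R := by rw [hR]; positivity
  have hRm : 2 * R < min Rρ (min R₁ R₂) := by rw [hR]; linarith
  obtain ⟨m, hm⟩ : ∃ m : ℝ, m = Fintype.card (Fin n × Fin n) := ⟨_, rfl⟩
  have hm00 : 0 ≤ m := by rw [hm]; positivity
  -- `B` gives the sign on the sphere `|z - q| = R`, and `A` the sign of the operator inside.
  obtain ⟨B, hB⟩ : ∃ B : ℝ, B = (S + m * S ^ 2) / R ^ 2 := ⟨_, rfl⟩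
  have hB0 : 0 ≤ B := by rw [hB]; positivity
  obtain ⟨c, hc⟩ : ∃ c : ℝ, c = L + m * (2 * (S * L)) := ⟨_, rfl⟩
  have hc0 : 0 ≤ c := by rw [hc]; positivity
  obtain ⟨A, hA⟩ : ∃ A : ℝ, A = (c + B * CG + c ^ 2 + 1) / ε := ⟨_, rfl⟩
  have hA0 : 0 ≤ A := by rw [hA]; positivity
  refine ⟨A * (Cv * Cρ) + B * R, R, hR0, ?_⟩
  filter_upwards [self_mem_nhdsWithin, eventually_dist_le hR0] with q hqT hqp hq0 w K hw j k
  have hin : ∀ y, dist y q ≤ R → dist y P.p < Rρ ∧ dist y P.p < R₁ ∧ dist y P.p < R₂ := by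
    intro y hy
    have h1 : dist y P.p < min Rρ (min R₁ R₂) := by linarith [dist_triangle y q P.p]
    exact ⟨h1.trans_le (min_le_left _ _), h1.trans_le ((min_le_right _ _).trans (min_le_left _ _)),
      h1.trans_le ((min_le_right _ _).trans (min_le_right _ _))⟩
  have hT := P.reg
  have hκ := one_le_sqrt hw
  have hκ0 : 0 < √K := one_pos.trans_le hκ
  set v : Cn n → ℝ := fun y => w y + s * (-P.ρ y - N * P.ρ y ^ 2) with hvdef
  have hρ2 : ContDiffOn ℝ 2 P.ρ P.T := P.smooth_rho.of_le (by decide)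
  have hvC : ContDiffOn ℝ 2 v P.T := hw.smooth_two.add
    (contDiffOn_const.mul (hρ2.neg.sub (contDiffOn_const.mul (hρ2.pow 2))))
  have hσC := fun jk : Fin n × Fin n => contDiffOn_tangent hw jk.1 jk.2
  have hUball : Metric.closedBall q R ⊆ P.U := fun y hy => hRU (hin y hy).1.le
  have hvq : ∀ y ∈ P.T, dist y q ≤ R → 0 ≤ v y ∧ v y ≤ Cv * (-P.ρ y) := fun y hy hyq =>
    (hball₂ ⟨(hin y hyq).2.2, hy⟩).1.1 w K hw
  -- Tangential derivatives are `O(√K)` on the whole half ball.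
  have hσle : ∀ y ∈ P.T, dist y q ≤ R → ∀ jk : Fin n × Fin n,
      ‖P.tangent w jk.1 jk.2 y‖ ≤ S * √K := by
    intro y hy hyq jk
    rcases (P.defining.nonpos hy).lt_or_eq with h | h
    · exact (hball₁ ⟨(hin y hyq).2.1, hy, h⟩ w K hw).2.1 jk
    · rw [(hball₂ ⟨(hin y hyq).2.2, hy⟩).1.2 h w K hw, norm_zero]; positivity
  have main : ∀ e : ℂ, ‖e‖ ≤ 1 → ∀ y ∈ P.T ∩ Metric.closedBall q R,
      (e * P.tangent w j k y).re - A * √K * v y - B * √K * ‖y - q‖ ^ 2 +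
        (√K)⁻¹ * ∑ jk : Fin n × Fin n, ‖P.tangent w jk.1 jk.2 y‖ ^ 2 ≤ 0 := by
    intro e he
    have hf1 : ContDiffOn ℝ 2 (fun y => (e * P.tangent w j k y).re) P.T :=
      contDiffOn_re (contDiffOn_const.mul (hσC (j, k)))
    have hf2 : ContDiffOn ℝ 2 (fun y => A * √K * v y) P.T := contDiffOn_const.mul hvC
    have hf3 : ContDiffOn ℝ 2 (fun y => B * √K * ‖y - q‖ ^ 2) P.T :=
      contDiffOn_const.mul (contDiff_normSq q).contDiffOn
    have hf4' : ∀ jk : Fin n × Fin n, ContDiffOn ℝ 2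
        (fun y => ‖P.tangent w jk.1 jk.2 y‖ ^ 2) P.T := fun jk => (hσC jk).norm_sq ℝ
    have hf4'' : ContDiffOn ℝ 2
        (fun y => ∑ jk : Fin n × Fin n, ‖P.tangent w jk.1 jk.2 y‖ ^ 2) P.T :=
      ContDiffOn.sum fun jk _ => hf4' jk
    have hf4 : ContDiffOn ℝ 2
        (fun y => (√K)⁻¹ * ∑ jk : Fin n × Fin n, ‖P.tangent w jk.1 jk.2 y‖ ^ 2) P.T :=
      contDiffOn_const.mul hf4''
    have hf : ContDiffOn ℝ 2 (fun y => (e * P.tangent w j k y).re - A * √K * v y -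
        B * √K * ‖y - q‖ ^ 2 + (√K)⁻¹ * ∑ jk : Fin n × Fin n, ‖P.tangent w jk.1 jk.2 y‖ ^ 2)
        P.T := ((hf1.sub hf2).sub hf3).add hf4
    set O := {y ∈ P.U | P.ρ y < 0} ∩ Metric.ball q R with hO
    have hOopen : IsOpen O := (P.defining.smooth.continuousOn.isOpen_inter_preimage
      P.defining.isOpen isOpen_Iio).inter Metric.isOpen_ball
    have hOT : O ⊆ P.T ∩ Metric.closedBall q R := fun y hy =>
      ⟨(P.defining.mem_iff hy.1.1).2 hy.1.2.le, Metric.ball_subset_closedBall hy.2⟩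
    refine nonpos_of_no_interior_max (isCompact_inter_closedBall P.defining hUball) hOopen hOT
      (hf.continuousOn.mono inter_subset_left) ?_ ?_
    · rintro y ⟨hyT, hyR⟩ hyO
      rcases (P.defining.nonpos hyT).lt_or_eq with h1 | h1
      · have hyd : ‖y - q‖ = R := by
          rw [← dist_eq_norm]
          by_contra hne
          exact hyO ⟨⟨P.defining.subset hyT, h1⟩, lt_of_le_of_ne hyR hne⟩
        have e1 : (e * P.tangent w j k y).re ≤ S * √K := by
          refine (re_le_norm _).trans ?_
          rw [norm_mul]
          exact (mul_le_of_le_one_left (norm_nonneg _) he).trans (hσle y hyT hyR (j, k))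
        have e2 : ∑ jk : Fin n × Fin n, ‖P.tangent w jk.1 jk.2 y‖ ^ 2 ≤ m * (S * √K) ^ 2 := by
          rw [hm]
          refine (Finset.sum_le_sum fun jk _ =>
            pow_le_pow_left₀ (norm_nonneg _) (hσle y hyT hyR jk) 2).trans_eq ?_
          simp
        have e3 : (√K)⁻¹ * ∑ jk : Fin n × Fin n, ‖P.tangent w jk.1 jk.2 y‖ ^ 2 ≤
            m * S ^ 2 * √K := by
          calc _ ≤ (√K)⁻¹ * (m * (S * √K) ^ 2) :=
                mul_le_mul_of_nonneg_left e2 (by positivity)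
            _ = m * S ^ 2 * √K := by field_simp
        have e4 : B * √K * ‖y - q‖ ^ 2 = (S + m * S ^ 2) * √K := by
          rw [hyd, hB]; field_simp
        have e5 : 0 ≤ A * √K * v y := by
          have := (hvq y hyT hyR).1
          positivity
        linarith
      · have e1 := (hball₂ ⟨(hin y hyR).2.2, hyT⟩).1.2 h1 w K hw
        have e2 : 0 ≤ B * √K * ‖y - q‖ ^ 2 := by positivity
        have e3 : 0 ≤ A * √K * v y := by
          have := (hvq y hyT hyR).1
          positivity
        simp only [e1, mul_zero, zero_re, norm_zero, ne_eq, OfNat.ofNat_ne_zero, not_false_eq_true,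
          zero_pow, Finset.sum_const_zero]
        linarith
    · intro y hyO _ hmax
      have hyT := (hOT hyO).1
      have hyR : dist y q ≤ R := (hOT hyO).2
      obtain ⟨⟨-, -, -, hrad⟩, b1, b2, b3, b4⟩ :=
        hball₁ ⟨(hin y hyR).2.1, hyT, hyO.1.2⟩ w K hw
      simp only at b1 b2 b3 b4 hrad
      have hGp := (hw.posDef_lin hyT hrad.le).posSemidef
      have h1 := trace_mul_complexHessian_nonpos hT hf
        (P.defining.mem_nhds_of_neg hyO.1.1 hyO.1.2) hmax hGp
      have hcre : ∀ {f : Cn n → ℂ}, ContDiffOn ℝ 2 f P.T →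
          (P.lin w y * complexHessian P.T (fun y => (f y).re) y).trace.re =
          (P.lin w y * hess P.T f y).trace.re := by
        intro f hf
        have e1 : EqOn (fun y => (((f y).re : ℝ) : ℂ))
            (fun y => (1 / 2 : ℂ) * (f y + (starRingEnd ℂ) (f y))) P.T := fun y _ => by
          simp only [add_conj]; push_cast; ring
        have hfc := contDiffOn_conj hf
        rw [complexHessian_eq, hess_congr e1 hyT, hess_const_mul hT.1 (hf.add hfc) _ hyT,
          hess_add hT.1 hf hfc hyT, hess_conj hT hf hyT, Matrix.mul_smul, trace_smul,
          Matrix.mul_add, trace_add]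
        have e2 : (P.lin w y * (hess P.T f y)ᴴ).trace =
            (starRingEnd ℂ) (P.lin w y * hess P.T f y).trace := by
          rw [← RCLike.star_def, ← trace_conjTranspose, conjTranspose_mul, hGp.1.eq,
            trace_mul_comm]
        rw [e2, add_conj, smul_eq_mul, show (1 / 2 : ℂ) = ((1 / 2 : ℝ) : ℂ) by push_cast; rfl,
          ← ofReal_mul, ofReal_re]
        ring
      have hsq : ∀ jk : Fin n × Fin n, quad (P.lin w y) (dzv P.T (P.tangent w jk.1 jk.2) y) -
          2 * (S * √K * (L * (√K * (1 + P.invTrace (w, K, y)) +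
            √(P.invTrace (w, K, y) * P.energy (w, K, y))))) ≤
          (P.lin w y * complexHessian P.T (fun y => ‖P.tangent w jk.1 jk.2 y‖ ^ 2) y).trace.re := by
        intro jk
        have e1 := trace_mul_hess_normSq_ge hT (hσC jk) hyT hGp
        have e2 : EqOn (fun y => ((‖P.tangent w jk.1 jk.2 y‖ ^ 2 : ℝ) : ℂ)) (fun y =>
            P.tangent w jk.1 jk.2 y * (starRingEnd ℂ) (P.tangent w jk.1 jk.2 y)) P.T :=
          fun y _ => by simp only [mul_conj']; push_cast; rfl
        rw [complexHessian_eq, hess_congr e2 hyT]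
        have e3 := mul_le_mul (b1 jk) (b2 jk) (norm_nonneg _) (by positivity)
        linarith
      have hsum : P.energy (w, K, y) - m * (2 * (S * √K * (L * (√K * (1 + P.invTrace (w, K, y)) +
            √(P.invTrace (w, K, y) * P.energy (w, K, y)))))) ≤
          (P.lin w y * complexHessian P.T
            (fun y => ∑ jk : Fin n × Fin n, ‖P.tangent w jk.1 jk.2 y‖ ^ 2) y).trace.re := by
        have e1 : complexHessian P.T
            (fun y => ∑ jk : Fin n × Fin n, ‖P.tangent w jk.1 jk.2 y‖ ^ 2) y =
            ∑ jk : Fin n × Fin n, complexHessian P.T (fun y => ‖P.tangent w jk.1 jk.2 y‖ ^ 2) y := by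
          simp only [complexHessian_eq]
          rw [← hess_sum hT.1 _ (fun jk _ => contDiffOn_ofReal (hf4' jk)) hyT]
          simp only [ofReal_sum]
        rw [e1, Matrix.mul_sum, trace_sum, re_sum]
        have e2 : P.energy (w, K, y) = ∑ jk : Fin n × Fin n,
            quad (P.lin w y) (dzv P.T (P.tangent w jk.1 jk.2) y) := by
          rw [energy, Fintype.sum_prod_type]
        refine le_trans (le_of_eq ?_) (Finset.sum_le_sum fun jk _ => hsq jk)
        rw [Finset.sum_sub_distrib, ← e2, Finset.sum_const, Finset.card_univ, hm, nsmul_eq_mul]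
      have hLe : -(L * (√K * (1 + P.invTrace (w, K, y)) +
          √(P.invTrace (w, K, y) * P.energy (w, K, y)))) ≤
          (P.lin w y * hess P.T (fun y => e * P.tangent w j k y) y).trace.re := by
        rw [hess_const_mul hT.1 (hσC (j, k)) _ hyT, Matrix.mul_smul, trace_smul, smul_eq_mul]
        have e1 := (abs_le.1 (abs_re_le_norm
          (e * (P.lin w y * hess P.T (P.tangent w j k) y).trace))).1
        rw [norm_mul] at e1
        have e2 := (mul_le_of_le_one_left (norm_nonneg _) he).trans (b2 (j, k))
        linarith
      rw [complexHessian_add_real hT.1 ((hf1.sub hf2).sub hf3) hf4 hyT,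
        complexHessian_sub_real hT.1 (hf1.sub hf2) hf3 hyT,
        complexHessian_sub_real hT.1 hf1 hf2 hyT, complexHessian_const_mul hT.1 hvC _ hyT,
        complexHessian_const_mul hT.1 (contDiff_normSq q).contDiffOn _ hyT,
        complexHessian_const_mul hT.1 hf4'' _ hyT, complexHessian_eq (fun y => ‖y - q‖ ^ 2),
        hess_normSq hT.1 hyT] at h1
      simp only [Matrix.mul_add, Matrix.mul_sub, Matrix.mul_smul, trace_add, trace_sub, trace_smul,
        add_re, sub_re, smul_eq_mul, re_ofReal_mul, Matrix.mul_one] at h1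
      rw [hcre (contDiffOn_const.mul (hσC (j, k)))] at h1
      simp only at h1
      have hT0 := hw.invTrace_nonneg hyT hrad.le
      have hE0 := hw.energy_nonneg hyT hrad.le
      have hX := Real.sq_sqrt (mul_nonneg hT0 hE0)
      have hX0 := Real.sqrt_nonneg (P.invTrace (w, K, y) * P.energy (w, K, y))
      have hsum' := mul_le_mul_of_nonneg_left hsum (inv_pos.2 hκ0).le
      have hsum'' : (√K)⁻¹ * (P.energy (w, K, y) - m * (2 * (S * √K * (L * (√K *
          (1 + P.invTrace (w, K, y)) + √(P.invTrace (w, K, y) * P.energy (w, K, y))))))) =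
          (√K)⁻¹ * P.energy (w, K, y) - m * (2 * (S * L)) * (√K *
          (1 + P.invTrace (w, K, y)) + √(P.invTrace (w, K, y) * P.energy (w, K, y))) := by
        field_simp
      rw [hsum''] at hsum'
      have b4' : (P.lin w y * complexHessian P.T v y).trace.re ≤
          -ε * (1 + P.invTrace (w, K, y)) := b4
      have hAε : A * ε = c + B * CG + c ^ 2 + 1 := by rw [hA, div_mul_cancel₀ _ hε.ne']
      have hBS : 0 ≤ B * CG := mul_nonneg hB0 hCG.le
      exact mixed_barrier_conclusion hκ hT0 hE0 hX hLe hsum' b3 hB0 rfl hBS b4' hA0 hAε hc h1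
  intro y hyT hyR
  rcases eq_or_ne (P.tangent w j k y) 0 with h0 | h0
  · have := (hvq q hqT (by simpa using hR0.le)).1
    rw [h0, norm_zero]; positivity
  have hn : ‖P.tangent w j k y‖ ≠ 0 := norm_ne_zero_iff.2 h0
  -- The phase that turns `Re(e σ)` into `|σ|` at `y`.
  have h1 := main ((starRingEnd ℂ) (P.tangent w j k y) / ‖P.tangent w j k y‖) (by
    rw [norm_div, RCLike.norm_conj, norm_real, norm_norm, div_self hn]) y ⟨hyT, hyR⟩
  have h2 : ((starRingEnd ℂ) (P.tangent w j k y) / ‖P.tangent w j k y‖ * P.tangent w j k y).re =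
      ‖P.tangent w j k y‖ := by
    rw [div_mul_eq_mul_div, conj_mul', ← ofReal_pow, ← ofReal_div, ofReal_re, sq,
      mul_div_cancel_right₀ _ hn]
  rw [h2] at h1
  have h3 : 0 ≤ (√K)⁻¹ * ∑ jk : Fin n × Fin n, ‖P.tangent w jk.1 jk.2 y‖ ^ 2 :=
    mul_nonneg (inv_nonneg.2 hκ0.le) (Finset.sum_nonneg fun _ _ => sq_nonneg _)
  have h4 : -P.ρ y ≤ Cρ * ‖y - q‖ := by
    have := hlip y (hin y hyR).1.le q (hin q (by simpa using hR0.le)).1.le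
    rw [hq0, sub_zero] at this
    exact (neg_le_abs _).trans this
  have h5 : v y ≤ Cv * Cρ * ‖y - q‖ := by
    have := mul_le_mul_of_nonneg_left h4 hCv.le
    linarith [(hvq y hyT hyR).2]
  have h6 : ‖y - q‖ ^ 2 ≤ R * ‖y - q‖ := by
    rw [sq]
    exact mul_le_mul_of_nonneg_right (by rwa [← dist_eq_norm]) (norm_nonneg _)
  have h7 := mul_le_mul_of_nonneg_left h5 (by positivity : 0 ≤ A * √K)
  have h8 := mul_le_mul_of_nonneg_left h6 (by positivity : 0 ≤ B * √K)
  calc ‖P.tangent w j k y‖ ≤ A * √K * v y + B * √K * ‖y - q‖ ^ 2 := by linarith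
    _ ≤ A * √K * (Cv * Cρ * ‖y - q‖) + B * √K * (R * ‖y - q‖) := add_le_add h7 h8
    _ = _ := by ring

/-- The mixed derivative bound, in terms of the tangential derivatives. -/
theorem exists_dzbar_tangent_le (P : BoundaryPatch n) : ∃ C : ℝ, ∀ᶠ q in 𝓝[P.T] P.p,
    P.ρ q = 0 → ∀ w K, P.Solution w K → ∀ j k l,
      ‖dzbar P.T l (P.tangent w j k) q‖ ≤ C * √K := by
  obtain ⟨C, R, hR, hC⟩ := P.exists_tangent_le
  refine ⟨C, ?_⟩
  filter_upwards [hC, P.eventually_tangent_eq_zero, self_mem_nhdsWithin] with q hq h0 hqT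
    hq0 w K hw j k l
  refine norm_dzbar_le (fun v => P.defining.norm_fderivWithin_le hqT hq0
    ((contDiffOn_tangent hw j k).differentiableOn two_ne_zero q hqT) (h0 hq0 w K hw j k) ?_ v) l
  filter_upwards [self_mem_nhdsWithin,
    mem_nhdsWithin_of_mem_nhds (Metric.closedBall_mem_nhds q hR)] with y hyT hyR
  exact hq hq0 w K hw j k y hyT hyR

end BoundaryPatch

end Mixed

/-! ### The complex Hessian at boundary points -/

section DoubleNormal

variable {n : ℕ} {z : Cn n}

/-- If `W ≥ c Ω`, a bound of the relative determinant bounds the relative trace. -/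
theorem trace_le_of_quad_ge {Ω W : Matrix (Fin n) (Fin n) ℂ} (hΩ : Ω.PosDef) (hW : W.PosDef)
    {c : ℝ} (hc : 0 ≤ c) (h : ∀ x, c * quad Ω x ≤ quad W x) :
    c ^ (n - 1) * (Ω⁻¹ * W).trace.re ≤ n * (Ω⁻¹ * W).det.re := by
  obtain ⟨P, Q, w, hPQ, hQP, hΩQ, hWQ, hinv⟩ := exists_simul_diag hΩ hW.1
  have hw : ∀ i, c ≤ w i := fun i => by
    have h1 := h (P *ᵥ Pi.single i 1)
    have h2 : quad Ω (P *ᵥ Pi.single i 1) = 1 := by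
      have : Ω = Qᴴ * 1 * Q := by rw [Matrix.mul_one, hΩQ]
      rw [this, quad_conj, mulVec_mulVec, hQP, one_mulVec, quad_single]
      simp
    rw [h2, hWQ, quad_conj, mulVec_mulVec, hQP, one_mulVec, quad_single, diagonal_apply_eq,
      ofReal_re, mul_one] at h1
    exact h1
  rw [hWQ, det_inv_mul_conj_diagonal hPQ hQP hinv, trace_inv_mul_conj_diagonal hQP hinv,
    ofReal_re, ofReal_re, Finset.mul_sum]
  have h1 : ∀ i ∈ Finset.univ, c ^ (n - 1) * w i ≤ ∏ j, w j := fun i _ => by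
    rw [← Finset.mul_prod_erase _ _ (Finset.mem_univ i), mul_comm]
    refine mul_le_mul_of_nonneg_left ?_ (hc.trans (hw i))
    have := Finset.prod_le_prod (s := Finset.univ.erase i) (f := fun _ => c) (g := w)
      (fun _ _ => hc) fun j _ => hw j
    rwa [Finset.prod_const, Finset.card_erase_of_mem (Finset.mem_univ i), Finset.card_univ,
      Fintype.card_fin] at this
  refine (Finset.sum_le_sum h1).trans_eq ?_
  simp

theorem dotProduct_mulVec_comm {A : Matrix (Fin n) (Fin n) ℂ} (hA : A.IsHermitian)
    (x y : Fin n → ℂ) : star x ⬝ᵥ A *ᵥ y = (starRingEnd ℂ) (star y ⬝ᵥ A *ᵥ x) := by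
  rw [← RCLike.star_def, star_dotProduct, star_mulVec, hA.eq, ← dotProduct_mulVec]

theorem ofReal_quad {A : Matrix (Fin n) (Fin n) ℂ} (hA : A.IsHermitian) (x : Fin n → ℂ) :
    (quad A x : ℂ) = star x ⬝ᵥ A *ᵥ x :=
  conj_eq_iff_re.1 (dotProduct_mulVec_comm hA x x).symm

theorem quad_add_vec {A : Matrix (Fin n) (Fin n) ℂ} (hA : A.IsHermitian) (x y : Fin n → ℂ) :
    quad A (x + y) = quad A x + quad A y + 2 * (star y ⬝ᵥ A *ᵥ x).re := by
  simp only [quad, star_add, mulVec_add, add_dotProduct, dotProduct_add, add_re,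
    dotProduct_mulVec_comm hA x y, conj_re]
  ring

theorem norm_dotProduct_mulVec_le {A : Matrix (Fin n) (Fin n) ℂ} {a b : ℝ}
    (hA : ∀ i j, ‖A i j‖ ≤ a) {x : Fin n → ℂ} (hx : ∀ i, ‖x i‖ ≤ b) (y : Fin n → ℂ) :
    ‖star y ⬝ᵥ A *ᵥ x‖ ≤ n * a * b * ∑ i, ‖y i‖ := by
  rw [dotProduct, Finset.mul_sum]
  refine (norm_sum_le _ _).trans (Finset.sum_le_sum fun i _ => ?_)
  rw [norm_mul, Pi.star_apply, norm_star, mul_comm]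
  refine mul_le_mul_of_nonneg_right ?_ (norm_nonneg _)
  rw [mulVec, dotProduct]
  refine (norm_sum_le _ _).trans ((Finset.sum_le_sum fun j _ => ?_).trans_eq
    (b := ∑ _j : Fin n, a * b) (by simp [mul_assoc]))
  rw [norm_mul]
  exact mul_le_mul (hA i j) (hx j) (norm_nonneg _) ((norm_nonneg _).trans (hA i j))

theorem cross_term_arith {n a κ c s t Y : ℝ} (hc : 0 < c) (ht : t ^ 2 ≤ n * Y) :
    2 * (n * (a * κ) * a * t * s) ≤ c / 2 * s ^ 2 + 2 * n ^ 3 * a ^ 4 / c * κ ^ 2 * Y := by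
  have h1 : 0 ≤ c / 2 * (s - 2 * n * a ^ 2 * κ * t / c) ^ 2 := by positivity
  have h2 : c / 2 * (s - 2 * n * a ^ 2 * κ * t / c) ^ 2 =
      c / 2 * s ^ 2 - 2 * (n * (a * κ) * a * t * s) + 2 * n ^ 2 * a ^ 4 / c * κ ^ 2 * t ^ 2 := by
    field_simp
    ring
  have h3 : 2 * n ^ 2 * a ^ 4 / c * κ ^ 2 * t ^ 2 ≤ 2 * n ^ 2 * a ^ 4 / c * κ ^ 2 * (n * Y) :=
    mul_le_mul_of_nonneg_left ht (by positivity)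
  have h4 : 2 * n ^ 2 * a ^ 4 / c * κ ^ 2 * (n * Y) = 2 * n ^ 3 * a ^ 4 / c * κ ^ 2 * Y := by
    ring
  linarith

/-- The double normal estimate at a point: when `W` is the image of a Hermitian matrix that is
`α r r*` up to `O(κ)`, and `W` is bounded below in the normal direction, the bound of the
determinant implies `α = O(κ²)`. On `x = Ω⁻¹ r` the leading part of `W` vanishes and `W ≥ c`, on the
orthogonal complement of `x` it is `α N Ω` with `N = rᴴ Ω⁻¹ r`, and mixed terms are `O(κ)`. So if
`α ≥ A κ²`, then `W ≥ e Ω`, the trace of `Ω⁻¹ W` is bounded by its determinant, and it is at least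
`α N (n - 1) - O(κ)`. -/
theorem exists_rank_one_coeff_le (hn : 2 ≤ n) {l L b a c : ℝ} (D : ℝ) (hl : 0 < l) (hL : 0 < L)
    (hb : 0 < b) (ha : 0 < a) (hc : 0 < c) : ∃ C : ℝ, ∀ (Ω F W : Matrix (Fin n) (Fin n) ℂ)
      (r : Fin n → ℂ) (κ α : ℝ), Ω.PosDef → W.PosDef → 1 ≤ κ →
      (∀ x, l * ∑ i, ‖x i‖ ^ 2 ≤ quad Ω x) → (∀ x, quad Ω x ≤ L * ∑ i, ‖x i‖ ^ 2) →
      b ≤ quad Ω⁻¹ r → quad Ω⁻¹ r ≤ a → (∀ i j, ‖Ω⁻¹ i j‖ ≤ a) → (∀ i, ‖(Ω⁻¹ *ᵥ r) i‖ ≤ a) →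
      (∀ i j, ‖F i j‖ ≤ a * κ) →
      W = (α : ℂ) • ((quad Ω⁻¹ r : ℂ) • Ω - vecMulVec r (star r)) + F →
      c ≤ quad W (Ω⁻¹ *ᵥ r) → (Ω⁻¹ * W).det.re ≤ D → α ≤ C * κ ^ 2 := by
  have hn0 : (0 : ℝ) < n := by exact_mod_cast (by omega : 0 < n)
  have hn1 : (1 : ℝ) ≤ n - 1 := by
    have : (2 : ℝ) ≤ n := by exact_mod_cast hn
    linarith
  obtain ⟨A, hA⟩ : ∃ A : ℝ, A = (n * a + 2 * n ^ 3 * a ^ 4 / c + 1) / (b * l) := ⟨_, rfl⟩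
  have hA0 : 0 < A := by rw [hA]; positivity
  obtain ⟨e, he⟩ : ∃ e : ℝ, e = min (c / 2) 1 / (a + L) := ⟨_, rfl⟩
  have he0 : 0 < e := by
    have : 0 < min (c / 2) 1 := lt_min (by positivity) one_pos
    rw [he]; positivity
  refine ⟨max A ((n * |D| / e ^ (n - 1) + n ^ 2 * a ^ 2) / b), ?_⟩
  intro Ω F W r κ α hΩ hW hκ hlΩ hLΩ hbr hra hΩi hx hF hWeq hcx hdet
  have hκ0 : 0 < κ := one_pos.trans_le hκ
  have hκ2 : κ ≤ κ ^ 2 := by nlinarith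
  have hκ1 : 1 ≤ κ ^ 2 := hκ.trans hκ2
  rcases le_or_gt α (A * κ ^ 2) with hα | hα
  · exact hα.trans (mul_le_mul_of_nonneg_right (le_max_left _ _) (by positivity))
  have hα0 : 0 < α := lt_trans (by positivity) hα
  obtain ⟨N, hN⟩ : ∃ N : ℝ, N = quad Ω⁻¹ r := ⟨_, rfl⟩
  rw [← hN] at hbr hra hWeq
  have hN0 : 0 < N := hb.trans_le hbr
  obtain ⟨x, hxdef⟩ : ∃ x, x = Ω⁻¹ *ᵥ r := ⟨_, rfl⟩
  rw [← hxdef] at hx hcx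
  have hΩx : Ω *ᵥ x = r := by
    rw [hxdef, mulVec_mulVec, mul_nonsing_inv _ hΩ.det_pos.ne'.isUnit, one_mulVec]
  have hrx : star r ⬝ᵥ x = N := by
    rw [hN, ofReal_quad hΩ.1.inv, hxdef]
  have hWx : W *ᵥ x = F *ᵥ x := by
    rw [hWeq, add_mulVec, smul_mulVec, sub_mulVec, smul_mulVec, hΩx, vecMulVec_mulVec, hrx,
      op_smul_eq_smul, sub_self, smul_zero, zero_add]
  have hqΩx : quad Ω x = N := by
    rw [quad, hΩx]
    have : star x ⬝ᵥ r = (starRingEnd ℂ) (star r ⬝ᵥ x) := by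
      rw [← RCLike.star_def, star_dotProduct, dotProduct_comm, dotProduct_comm]
    rw [this, hrx, conj_ofReal, ofReal_re]
  have key : ∀ y, e * quad Ω y ≤ quad W y := by
    intro y
    -- Decompose `y = s x + v` with `v` orthogonal to `x` for `Ω`.
    obtain ⟨s, hs⟩ : ∃ s : ℂ, s = (star r ⬝ᵥ y) / N := ⟨_, rfl⟩
    obtain ⟨v, hv⟩ : ∃ v, v = y - s • x := ⟨_, rfl⟩
    have hyv : y = s • x + v := by rw [hv]; abel
    have hrv : star r ⬝ᵥ v = 0 := by
      rw [hv, dotProduct_sub, dotProduct_smul, hrx, hs, smul_eq_mul,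
        div_mul_cancel₀ _ (ofReal_ne_zero.2 hN0.ne'), sub_self]
    have hquads : ∀ B : Matrix (Fin n) (Fin n) ℂ, quad B (s • x) = ‖s‖ ^ 2 * quad B x := by
      intro B
      rw [quad, mulVec_smul, star_smul, smul_dotProduct, dotProduct_smul, smul_eq_mul, smul_eq_mul,
        ← mul_assoc, RCLike.star_def, conj_mul', ← ofReal_pow, re_ofReal_mul, quad]
    have hΩy : quad Ω y = ‖s‖ ^ 2 * N + quad Ω v := by
      rw [hyv, quad_add_vec hΩ.1, hquads, hqΩx, mulVec_smul, hΩx, dotProduct_smul]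
      have : star v ⬝ᵥ r = (starRingEnd ℂ) (star r ⬝ᵥ v) := by
        rw [← RCLike.star_def, star_dotProduct, dotProduct_comm, dotProduct_comm]
      rw [this, hrv]
      simp
    obtain ⟨Y, hY⟩ : ∃ Y : ℝ, Y = ∑ i, ‖v i‖ ^ 2 := ⟨_, rfl⟩
    have hY0 : 0 ≤ Y := by rw [hY]; positivity
    have hWv : α * (N * (l * Y)) - n * (a * κ) * Y ≤ quad W v := by
      have h1 := (abs_le.1 (abs_quad_le hF v)).1
      have h2 : quad W v = α * (N * quad Ω v) + quad F v := by
        rw [hWeq, quad_add, quad_smul, quad_sub, quad_smul, quad_vecMulVec, hrv]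
        simp
      have h3 : α * (N * (l * Y)) ≤ α * (N * quad Ω v) :=
        mul_le_mul_of_nonneg_left (mul_le_mul_of_nonneg_left (hY ▸ hlΩ v) hN0.le) hα0.le
      rw [← hY] at h1
      linarith
    have hcross : -(n * (a * κ) * a * (∑ i, ‖v i‖) * ‖s‖) ≤ (star v ⬝ᵥ W *ᵥ (s • x)).re := by
      have h1 : star v ⬝ᵥ W *ᵥ (s • x) = s * (star v ⬝ᵥ F *ᵥ x) := by
        rw [mulVec_smul, hWx, dotProduct_smul, smul_eq_mul]
      have h2 := (abs_le.1 (abs_re_le_norm (s * (star v ⬝ᵥ F *ᵥ x)))).1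
      rw [norm_mul] at h2
      have h3 := mul_le_mul_of_nonneg_left (norm_dotProduct_mulVec_le hF hx v) (norm_nonneg s)
      rw [h1]
      linarith
    have hCS : (∑ i, ‖v i‖) ^ 2 ≤ n * Y := by
      have := sq_sum_le_card_mul_sum_sq (s := Finset.univ) (f := fun i => ‖v i‖)
      rwa [Finset.card_univ, Fintype.card_fin, ← hY] at this
    have hca := cross_term_arith (a := a) (κ := κ) (s := ‖s‖) hc hCS
    have hbig : n * a * κ + 2 * n ^ 3 * a ^ 4 / c * κ ^ 2 + 1 ≤ α * (N * l) := by
      have h1 : A * κ ^ 2 * (b * l) ≤ α * (N * l) :=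
        mul_le_mul hα.le (mul_le_mul_of_nonneg_right hbr hl.le) (by positivity) hα0.le
      have h2 : A * κ ^ 2 * (b * l) = (n * a + 2 * n ^ 3 * a ^ 4 / c + 1) * κ ^ 2 := by
        rw [hA]; field_simp
      have h3 : n * a * κ ≤ n * a * κ ^ 2 := mul_le_mul_of_nonneg_left hκ2 (by positivity)
      linarith
    have hfin : c / 2 * ‖s‖ ^ 2 + Y ≤ quad W y := by
      have h1 : quad W y = ‖s‖ ^ 2 * quad W x + quad W v +
          2 * (star v ⬝ᵥ W *ᵥ (s • x)).re := by
        rw [hyv, quad_add_vec hW.1, hquads]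
      have h2 := mul_le_mul_of_nonneg_left hcx (sq_nonneg ‖s‖)
      have h3 := mul_le_mul_of_nonneg_right hbig hY0
      linarith
    refine le_trans ?_ hfin
    have h1 := hLΩ v
    rw [← hY] at h1
    have h2 : quad Ω y ≤ (a + L) * (‖s‖ ^ 2 + Y) := by
      rw [hΩy]
      nlinarith [mul_le_mul_of_nonneg_left hra (sq_nonneg ‖s‖), mul_nonneg ha.le hY0,
        mul_nonneg hL.le (sq_nonneg ‖s‖)]
    calc e * quad Ω y ≤ e * ((a + L) * (‖s‖ ^ 2 + Y)) := mul_le_mul_of_nonneg_left h2 he0.le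
      _ = min (c / 2) 1 * ‖s‖ ^ 2 + min (c / 2) 1 * Y := by rw [he]; field_simp
      _ ≤ c / 2 * ‖s‖ ^ 2 + 1 * Y := add_le_add
          (mul_le_mul_of_nonneg_right (min_le_left _ _) (sq_nonneg _))
          (mul_le_mul_of_nonneg_right (min_le_right _ _) hY0)
      _ = _ := by rw [one_mul]
  have htr := trace_le_of_quad_ge hΩ hW he0.le key
  have htr1 : (Ω⁻¹ * W).trace.re ≤ n * |D| / e ^ (n - 1) := by
    rw [le_div_iff₀ (by positivity), mul_comm]
    exact htr.trans (mul_le_mul_of_nonneg_left (hdet.trans (le_abs_self D)) hn0.le)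
  have htr2 : (Ω⁻¹ * W).trace.re = α * (N * (n - 1)) + (Ω⁻¹ * F).trace.re := by
    have h1 : (Ω⁻¹ * vecMulVec r (star r)).trace = N := by
      rw [trace_mul_vecMulVec, ← hxdef, hrx]
    rw [hWeq, Matrix.mul_add, trace_add, add_re, Matrix.mul_smul, trace_smul, smul_eq_mul,
      re_ofReal_mul, Matrix.mul_sub, trace_sub, Matrix.mul_smul, h1, trace_smul, smul_eq_mul,
      nonsing_inv_mul _ hΩ.det_pos.ne'.isUnit, trace_one, Fintype.card_fin, sub_re, re_ofReal_mul,
      ofReal_re, natCast_re]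
    ring
  have htr3 := (abs_le.1 (abs_trace_mul_le hΩi hF)).1
  have h1 : α * b ≤ α * (N * (n - 1)) := by
    refine mul_le_mul_of_nonneg_left ?_ hα0.le
    nlinarith
  have h2 : α * b ≤ (n * |D| / e ^ (n - 1) + n ^ 2 * a ^ 2) * κ ^ 2 := by
    have h3 : n * |D| / e ^ (n - 1) ≤ n * |D| / e ^ (n - 1) * κ ^ 2 :=
      le_mul_of_one_le_right (by positivity) hκ1
    have h4 : (n : ℝ) ^ 2 * (a * (a * κ)) ≤ n ^ 2 * a ^ 2 * κ ^ 2 := by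
      have := mul_le_mul_of_nonneg_left hκ2 (by positivity : 0 ≤ (n : ℝ) ^ 2 * a ^ 2)
      linarith
    linarith
  calc α = α * b / b := by field_simp
    _ ≤ (n * |D| / e ^ (n - 1) + n ^ 2 * a ^ 2) * κ ^ 2 / b :=
        div_le_div_of_nonneg_right h2 hb.le
    _ = (n * |D| / e ^ (n - 1) + n ^ 2 * a ^ 2) / b * κ ^ 2 := by ring
    _ ≤ _ := mul_le_mul_of_nonneg_right (le_max_right _ _) (by positivity)

/-- A Hermitian matrix whose rows are multiples of one covector up to an error is, up to a similar
error, a real multiple of `r r*`. -/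
theorem exists_rank_one_approx {H : Matrix (Fin n) (Fin n) ℂ} (hH : H.IsHermitian)
    {r m : Fin n → ℂ} {k : Fin n} {δ a κ : ℝ} (hδ : 0 < δ) (ha : 0 ≤ a) (hk : δ ≤ ‖r k‖)
    (hr : ∀ i, ‖r i‖ ≤ a) (h : ∀ j l, ‖star (r k) * H j l - r j * m l‖ ≤ κ) :
    ∃ α : ℝ, ∀ i j, ‖H i j - α * (r i * star (r j))‖ ≤ 4 * a ^ 3 / δ ^ 4 * κ := by
  have hκ : 0 ≤ κ := (norm_nonneg _).trans (h k k)
  have hr2 : star (r k) * r k = ((‖r k‖ ^ 2 : ℝ) : ℂ) := by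
    rw [RCLike.star_def, conj_mul', ofReal_pow]
  have h1 : ∀ j l, ‖star (r k) * r k * H j l - r j * star (r k) * H k l‖ ≤ 2 * a * κ := by
    intro j l
    have e1 : star (r k) * r k * H j l - r j * star (r k) * H k l =
        r k * (star (r k) * H j l - r j * m l) - r j * (star (r k) * H k l - r k * m l) := by ring
    rw [e1]
    refine (norm_sub_le _ _).trans ?_
    rw [norm_mul, norm_mul]
    have := mul_le_mul (hr k) (h j l) (norm_nonneg _) ha
    have := mul_le_mul (hr j) (h k l) (norm_nonneg _) ha
    linarith
  have h2 : ∀ l, ‖star (r k) * r k * H k l - star (r l) * r k * H k k‖ ≤ 2 * a * κ := by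
    intro l
    have e1 := h1 l k
    rw [← norm_star] at e1
    have e2 : star (H l k) = H k l := by rw [← conjTranspose_apply, hH.eq]
    have e3 : star (H k k) = H k k := by rw [← conjTranspose_apply, hH.eq]
    simp only [star_sub, star_mul', star_star, e2, e3] at e1
    rwa [mul_comm (r k)] at e1
  have hkk : H k k = ((H k k).re : ℂ) := by
    have e3 : star (H k k) = H k k := by rw [← conjTranspose_apply, hH.eq]
    exact (conj_eq_iff_re.1 e3).symm
  refine ⟨(H k k).re / ‖r k‖ ^ 2, fun i j => ?_⟩
  have hk0 : 0 < ‖r k‖ := hδ.trans_le hk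
  have hk0' : (‖r k‖ : ℂ) ≠ 0 := ofReal_ne_zero.2 hk0.ne'
  have e1 : ((‖r k‖ ^ 4 : ℝ) : ℂ) * (H i j - ((H k k).re / ‖r k‖ ^ 2 : ℝ) * (r i * star (r j))) =
      star (r k) * r k * (star (r k) * r k * H i j - r i * star (r k) * H k j) +
      r i * star (r k) * (star (r k) * r k * H k j - star (r j) * r k * H k k) := by
    have e2 : ((‖r k‖ ^ 4 : ℝ) : ℂ) * (((H k k).re / ‖r k‖ ^ 2 : ℝ) : ℂ) =
        star (r k) * r k * H k k := by
      rw [hr2, hkk]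
      push_cast
      field_simp
      simp
    have e3 : ((‖r k‖ ^ 4 : ℝ) : ℂ) = star (r k) * r k * (star (r k) * r k) := by
      rw [hr2]; push_cast; ring
    rw [mul_sub, ← mul_assoc, e2, e3]
    ring
  have e4 : ‖r k‖ ^ 4 * ‖H i j - ((H k k).re / ‖r k‖ ^ 2 : ℝ) * (r i * star (r j))‖ ≤
      4 * a ^ 3 * κ := by
    have := congrArg norm e1
    rw [norm_mul, norm_real, Real.norm_of_nonneg (by positivity)] at this
    rw [this]
    refine (norm_add_le _ _).trans ?_
    rw [norm_mul, norm_mul _ (star (r k) * r k * H k j - star (r j) * r k * H k k), norm_mul,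
      norm_mul, norm_star]
    have f1 := mul_le_mul (mul_le_mul (hr k) (hr k) (norm_nonneg _) ha) (h1 i j) (norm_nonneg _)
      (by positivity)
    have f2 := mul_le_mul (mul_le_mul (hr i) (hr k) (norm_nonneg _) ha) (h2 j) (norm_nonneg _)
      (by positivity)
    linarith
  have e5 : δ ^ 4 * ‖H i j - ((H k k).re / ‖r k‖ ^ 2 : ℝ) * (r i * star (r j))‖ ≤ 4 * a ^ 3 * κ :=
    (mul_le_mul_of_nonneg_right (pow_le_pow_left₀ hδ.le hk 4) (norm_nonneg _)).trans e4
  rw [div_mul_eq_mul_div, le_div_iff₀ (by positivity), mul_comm]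
  exact e5

namespace BoundaryPatch

variable {P : BoundaryPatch n} {w : Cn n → ℝ} {K : ℝ}

/-- The mixed estimate determines the complex Hessian up to a multiple of `r r*`. -/
theorem exists_hessian_approx (P : BoundaryPatch n) : ∃ C : ℝ, 0 ≤ C ∧ ∀ᶠ q in 𝓝[P.T] P.p,
    P.ρ q = 0 → ∀ w K, P.Solution w K → ∃ α : ℝ, ∀ i j,
      ‖complexHessian P.T w q i j - α * (P.conormal q i * star (P.conormal q j))‖ ≤ C * √K := by
  obtain ⟨Cm, hCm⟩ := P.exists_dzbar_tangent_le
  obtain ⟨k, hk⟩ : ∃ k, P.conormal P.p k ≠ 0 := by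
    by_contra! hcon
    exact P.conormal_ne_zero (funext hcon)
  obtain ⟨a, ha0, ha⟩ := exists_eventually_bound (S := P.T) (x := P.p)
    (f := fun i z => P.conormal z i) fun i => (P.smooth_conormal i).continuousOn P.p P.mem
  obtain ⟨b, hb0, hb⟩ := exists_eventually_bound (S := P.T) (x := P.p)
    (f := fun (i : Fin n × Fin n) z => complexHessian P.T P.ρ z i.1 i.2) fun i =>
      (P.smooth_hessian_rho i.1 i.2).continuousOn P.p P.mem
  obtain ⟨d, hd0, hd⟩ := exists_eventually_bound (S := P.T) (x := P.p)
    (f := fun (i : Fin n × Fin n) z => dzbar P.T i.1 (dzbar P.T i.2 fun y => (P.ρ y : ℂ)) z)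
      fun i => (contDiffOn_dzbar (k := ∞) P.reg.1 (smooth_dzbar_rho i.2) le_rfl i.1).continuousOn
        P.p P.mem
  have hδ : 0 < ‖P.conormal P.p k‖ / 2 := half_pos (norm_pos_iff.2 hk)
  have hkev : ∀ᶠ z in 𝓝[P.T] P.p, ‖P.conormal P.p k‖ / 2 < ‖P.conormal z k‖ :=
    (((P.smooth_conormal k).continuousOn P.p P.mem).norm).eventually_const_lt
      (half_lt_self (norm_pos_iff.2 hk))
  refine ⟨4 * a ^ 3 / (‖P.conormal P.p k‖ / 2) ^ 4 * (|Cm| + |P.grad| * (b + d)), by positivity, ?_⟩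
  filter_upwards [hCm, ha, hb, hd, hkev, self_mem_nhdsWithin, eventually_radius] with q hCm ha hb hd
    hkq hqT hqr hq0 w K hw
  have hT := P.reg
  have hH : (complexHessian P.T w q).IsHermitian := isHermitian_hess_ofReal hT hw.smooth_two hqT
  have hK := Real.sqrt_nonneg K
  have hgr : ∀ j, ‖dz P.T j (fun y => (w y : ℂ)) q‖ ≤ |P.grad| * √K := fun j =>
    (hw.grad_le q hqT hqr j).trans (mul_le_mul_of_nonneg_right (le_abs_self _) hK)
  rw [show ∀ x y : ℝ, x * (|Cm| + |P.grad| * (b + d)) * y =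
    x * ((|Cm| + |P.grad| * (b + d)) * y) from fun x y => mul_assoc x _ y]
  refine exists_rank_one_approx hH
    (m := fun l => dzbar P.T l (dzbar P.T k fun y => (w y : ℂ)) q) hδ ha0.le hkq.le
    ha fun j l => ?_
  have h1 := hCm hq0 w K hw j k l
  have h2 : P.tangent w j k = tang P.T (fun y => (P.ρ y : ℂ)) (fun y => (w y : ℂ)) j k := rfl
  rw [h2, dzbar_tang hT (P.smooth_rhoC.of_le (by decide)) (contDiffOn_ofReal hw.smooth_two) hqT]
    at h1
  have h3 : dzbar P.T k (fun y => (P.ρ y : ℂ)) q = star (P.conormal q k) := dzbar_rho hqT k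
  rw [h3] at h1
  have h4 : ‖dzbar P.T k (fun y => (w y : ℂ)) q‖ ≤ |P.grad| * √K := by
    rw [dzbar_ofReal (hT.1 q hqT) (hw.diffAt hqT), RCLike.norm_conj]
    exact hgr k
  have h5 := mul_le_mul (hd (l, k)) (hgr j) (norm_nonneg _) hd0.le
  have h6 := mul_le_mul (hb (j, l)) h4 (norm_nonneg _) hb0.le
  have e1 : star (P.conormal q k) * complexHessian P.T w q j l - P.conormal q j *
      dzbar P.T l (dzbar P.T k fun y => (w y : ℂ)) q =
      ((dzbar P.T l (dzbar P.T k fun y => (P.ρ y : ℂ)) q * dz P.T j (fun y => (w y : ℂ)) q +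
        star (P.conormal q k) * hess P.T (fun y => (w y : ℂ)) q j l) -
      (hess P.T (fun y => (P.ρ y : ℂ)) q j l * dzbar P.T k (fun y => (w y : ℂ)) q +
        dz P.T j (fun y => (P.ρ y : ℂ)) q * dzbar P.T l (dzbar P.T k fun y => (w y : ℂ)) q)) -
      dzbar P.T l (dzbar P.T k fun y => (P.ρ y : ℂ)) q * dz P.T j (fun y => (w y : ℂ)) q +
      complexHessian P.T P.ρ q j l * dzbar P.T k (fun y => (w y : ℂ)) q := by
    simp only [complexHessian_eq, show dz P.T j (fun y => (P.ρ y : ℂ)) q = P.conormal q j from rfl]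
    ring
  rw [e1]
  refine (norm_add_le _ _).trans ?_
  refine (add_le_add_left (norm_sub_le _ _) _).trans ?_
  rw [norm_mul (complexHessian _ _ _ _ _),
    norm_mul (dzbar P.T l (dzbar P.T k fun y => (P.ρ y : ℂ)) q)]
  have h7 := mul_le_mul_of_nonneg_right (le_abs_self Cm) hK
  simp only at h5 h6
  linarith

/-- The local form of the theorem: a bound of the complex Hessian at boundary points near the
centre of the patch. -/
theorem exists_hessian_le (P : BoundaryPatch n) : ∃ C : ℝ, ∀ᶠ q in 𝓝[P.T] P.p,
    P.ρ q = 0 → ∀ w K, P.Solution w K → ∀ i j, ‖complexHessian P.T w q i j‖ ≤ C * K := by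
  obtain ⟨Ce, hCe0, hCe⟩ := P.exists_hessian_approx
  obtain ⟨c, hc0, hc⟩ := P.exists_le_normalForm
  obtain ⟨l, L₀, hl, _, hell⟩ := exists_elliptic (G := P.Ω) P.mem P.posDef fun i j =>
    (P.smooth_metric i j).continuousOn P.p P.mem
  obtain ⟨a₁, ha₁0, ha₁⟩ := exists_eventually_bound (S := P.T) (x := P.p)
    (f := fun i z => P.conormal z i) fun i => (P.smooth_conormal i).continuousOn P.p P.mem
  obtain ⟨a₂, ha₂0, ha₂⟩ := exists_eventually_bound (S := P.T) (x := P.p)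
    (f := fun (i : Fin n × Fin n) z => (P.Ω z)⁻¹ i.1 i.2) fun i =>
      (P.smooth_inv i.1 i.2).continuousOn P.p P.mem
  obtain ⟨a₃, ha₃0, ha₃⟩ := exists_eventually_bound (S := P.T) (x := P.p)
    (f := fun i z => ((P.Ω z)⁻¹ *ᵥ P.conormal z) i) fun i =>
      (contDiffOn_mulVec_apply P.smooth_inv P.smooth_conormal i).continuousOn P.p P.mem
  obtain ⟨a₄, ha₄0, ha₄⟩ := exists_eventually_bound (S := P.T) (x := P.p)
    (f := fun (i : Fin n × Fin n) z => P.ref z i.1 i.2) fun i =>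
      (P.smooth_ref i.1 i.2).continuousOn P.p P.mem
  obtain ⟨a₅, ha₅0, ha₅⟩ := exists_eventually_bound (S := P.T) (x := P.p)
    (f := fun (_ : Unit) z => quad (P.Ω z)⁻¹ (P.conormal z)) fun _ =>
      (contDiffOn_quad P.smooth_inv P.smooth_conormal).continuousOn P.p P.mem
  obtain ⟨a₆, ha₆0, ha₆⟩ := exists_eventually_bound (S := P.T) (x := P.p)
    (f := fun (i : Fin n × Fin n) z => P.Ω z i.1 i.2) fun i =>
      (P.smooth_metric i.1 i.2).continuousOn P.p P.mem
  have hquad := quad_pos (P.posDef _ P.mem).inv P.conormal_ne_zero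
  have hlen : ∀ᶠ z in 𝓝[P.T] P.p, quad (P.Ω P.p)⁻¹ (P.conormal P.p) / 2 <
      quad (P.Ω z)⁻¹ (P.conormal z) :=
    eventually_const_lt (contDiffOn_quad P.smooth_inv P.smooth_conormal) (half_lt_self hquad)
  obtain ⟨b, hb⟩ : ∃ b : ℝ, b = quad (P.Ω P.p)⁻¹ (P.conormal P.p) / 2 := ⟨_, rfl⟩
  rw [← hb] at hlen
  have hb0 : 0 < b := by rw [hb]; exact half_pos hquad
  -- A bound of the entries of the part of the form that is not normal.
  obtain ⟨e, he⟩ : ∃ e : ℝ, e = a₄ + Ce := ⟨_, rfl⟩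
  have he0 : 0 ≤ e := by rw [he]; positivity
  obtain ⟨f, hf⟩ : ∃ f : ℝ, f = n ^ 2 * (a₂ * e) * a₆ + e := ⟨_, rfl⟩
  have hf0 : 0 ≤ f := by rw [hf]; positivity
  obtain ⟨Cα, hCα⟩ := exists_rank_one_coeff_le P.two_le (l := l) (L := n * |L₀| + 1) (b := b)
    (a := a₂ + a₃ + a₅ + f + 1) (c := c) P.detSup hl (by positivity) hb0 (by positivity) hc0
  refine ⟨max Cα (n ^ 2 * (a₂ * e) / b) * a₁ ^ 2 + Ce, ?_⟩
  filter_upwards [hCe, hc, hell, ha₁, ha₂, ha₃, ha₄, ha₅, ha₆, hlen, self_mem_nhdsWithin,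
    eventually_radius] with q hCe hc hell ha₁ ha₂ ha₃ ha₄ ha₅ ha₆ hlen hqT hqr hq0 w K hw i j
  obtain ⟨α, hα⟩ := hCe hq0 w K hw
  have hK1 := hw.one_le
  have hκ : 1 ≤ √K := Real.one_le_sqrt.2 hK1
  have hκK : √K ^ 2 = K := Real.sq_sqrt (zero_le_one.trans hK1)
  have hκK' : √K ≤ K := by nlinarith
  have hΩ := P.posDef q hqT
  obtain ⟨E, hE⟩ : ∃ E, E = P.form w q - (α : ℂ) • vecMulVec (P.conormal q) (star (P.conormal q)) :=
    ⟨_, rfl⟩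
  have hform : P.form w q = (α : ℂ) • vecMulVec (P.conormal q) (star (P.conormal q)) + E := by
    rw [hE]; abel
  have hEb : ∀ i j, ‖E i j‖ ≤ e * √K := fun i j => by
    have h1 : E i j = P.ref q i j + (complexHessian P.T w q i j -
        α * (P.conormal q i * star (P.conormal q j))) := by
      rw [hE, form, Matrix.sub_apply, Matrix.add_apply, Matrix.smul_apply, vecMulVec_apply,
        smul_eq_mul, Pi.star_apply]
      ring
    rw [h1]
    refine (norm_add_le _ _).trans ((add_le_add (ha₄ (i, j)) (hα i j)).trans ?_)
    have := le_mul_of_one_le_right ha₄0.le hκ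
    rw [he]
    linarith
  have htrE : ‖((P.Ω q)⁻¹ * E).trace‖ ≤ n ^ 2 * (a₂ * e) * √K := by
    have := norm_trace_mul_le (fun i j => ha₂ (i, j)) hEb
    linarith
  have hN : ((P.Ω q)⁻¹ * vecMulVec (P.conormal q) (star (P.conormal q))).trace =
      (quad (P.Ω q)⁻¹ (P.conormal q) : ℂ) := by
    rw [trace_mul_vecMulVec, ofReal_quad hΩ.1.inv]
  have hupper : α ≤ Cα * √K ^ 2 := by
    refine hCα (P.Ω q) (wOp (P.Ω q) E) (P.W w q) (P.conormal q) (√K) α hΩ (hw.posDef q hqT hqr) hκ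
      hell.lower (fun x => ?_) hlen.le ?_ (fun i j => ?_) (fun i => ?_) (fun i j => ?_) ?_
      (hc hq0 w K hw) (hw.le_detSup q hqT hqr)
    · refine (le_abs_self _).trans ((abs_quad_le hell.upper x).trans ?_)
      refine mul_le_mul_of_nonneg_right ?_ (by positivity)
      have := mul_le_mul_of_nonneg_left (le_abs_self L₀) (Nat.cast_nonneg (α := ℝ) n)
      linarith
    · exact ((le_abs_self _).trans (ha₅ ())).trans (by linarith)
    · exact (ha₂ (i, j)).trans (by linarith)
    · exact (ha₃ i).trans (by linarith)
    · rw [wOp, Matrix.sub_apply, Matrix.smul_apply, smul_eq_mul]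
      refine (norm_sub_le _ _).trans ?_
      rw [norm_mul]
      have h1 := mul_le_mul htrE (ha₆ (i, j)) (norm_nonneg _) (by positivity)
      have h2 : f * √K ≤ (a₂ + a₃ + a₅ + f + 1) * √K :=
        mul_le_mul_of_nonneg_right (by linarith) (by positivity)
      rw [hf] at h2 ⊢
      have h3 := hEb i j
      simp only at h1
      linarith
    · rw [W, hform, wOp_add, wOp_smul, wOp, hN]
  have hlower : -(n ^ 2 * (a₂ * e) / b * K) ≤ α := by
    by_contra! hlt
    have h1 := hw.trace_form_nonneg hqT hqr
    rw [hform, Matrix.mul_add, trace_add, add_re, Matrix.mul_smul, trace_smul, smul_eq_mul,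
      re_ofReal_mul, hN, ofReal_re] at h1
    have h2 := (re_le_norm _).trans htrE
    have h3 : 0 ≤ n ^ 2 * (a₂ * e) / b * K := by positivity
    have h4 : -α * b ≤ -α * quad (P.Ω q)⁻¹ (P.conormal q) :=
      mul_le_mul_of_nonneg_left hlen.le (by linarith)
    have h5 : n ^ 2 * (a₂ * e) / b * K * b < -α * b :=
      mul_lt_mul_of_pos_right (by linarith) hb0
    have h6 : n ^ 2 * (a₂ * e) / b * K * b = n ^ 2 * (a₂ * e) * K := by field_simp
    have h7 : n ^ 2 * (a₂ * e) * √K ≤ n ^ 2 * (a₂ * e) * K :=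
      mul_le_mul_of_nonneg_left hκK' (by positivity)
    linarith
  have habs : |α| ≤ max Cα (n ^ 2 * (a₂ * e) / b) * K := by
    rw [hκK] at hupper
    have hK0 : 0 ≤ K := zero_le_one.trans hK1
    refine abs_le.2 ⟨?_, hupper.trans (mul_le_mul_of_nonneg_right (le_max_left _ _) hK0)⟩
    have := mul_le_mul_of_nonneg_right (le_max_right Cα (n ^ 2 * (a₂ * e) / b)) hK0
    linarith
  have h1 : complexHessian P.T w q i j = α * (P.conormal q i * star (P.conormal q j)) +
      (complexHessian P.T w q i j - α * (P.conormal q i * star (P.conormal q j))) := by ring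
  rw [h1]
  refine (norm_add_le _ _).trans ?_
  rw [norm_mul, norm_mul, norm_star, norm_real, Real.norm_eq_abs]
  have h2 : ‖P.conormal q i‖ * ‖P.conormal q j‖ ≤ a₁ ^ 2 := by
    rw [sq]; exact mul_le_mul (ha₁ i) (ha₁ j) (norm_nonneg _) ha₁0.le
  have h3 := mul_le_mul habs h2 (by positivity) ((abs_nonneg _).trans habs)
  have h4 := mul_le_mul_of_nonneg_left hκK' hCe0
  have h5 := hα i j
  linarith

end BoundaryPatch

end DoubleNormal

/-! ### Holomorphic changes of coordinates -/

section ChangeOfCoordinates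

variable {n : ℕ} {A S : Set (Cn n)} {τ : Cn n → Cn n} {z : Cn n}

/-- `τ` maps `A` to `S`, is smooth up to the boundary and satisfies the Cauchy–Riemann equations. -/
structure HolomorphicMap (A S : Set (Cn n)) (τ : Cn n → Cn n) : Prop where
  regular : Regular A
  regular_target : Regular S
  mapsTo : MapsTo τ A S
  smooth : ContDiffOn ℝ ∞ τ A
  dzbar_eq : ∀ z ∈ A, ∀ i j, dzbar A j (fun y => τ y i) z = 0

/-- The holomorphic Jacobian matrix of `τ`. -/
def jac (A : Set (Cn n)) (τ : Cn n → Cn n) (z : Cn n) : Matrix (Fin n) (Fin n) ℂ :=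
  Matrix.of fun i j => dz A j (fun y => τ y i) z

namespace HolomorphicMap

theorem contDiffOn_apply (h : HolomorphicMap A S τ) (i : Fin n) :
    ContDiffOn ℝ ∞ (fun y => τ y i) A :=
  ((EuclideanSpace.proj (𝕜 := ℂ) i).restrictScalars ℝ).contDiff.comp_contDiffOn h.smooth

theorem differentiableWithinAt (h : HolomorphicMap A S τ) (hz : z ∈ A) :
    DifferentiableWithinAt ℝ τ A z := h.smooth.differentiableOn (by simp) z hz

theorem fderivWithin_apply (h : HolomorphicMap A S τ) (hz : z ∈ A) (v : Cn n) (i : Fin n) :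
    fderivWithin ℝ τ A z v i = ∑ j, v j * jac A τ z i j := by
  have h1 : fderivWithin ℝ (fun y => τ y i) A z v = fderivWithin ℝ τ A z v i := by
    have h2 := ((((EuclideanSpace.proj (𝕜 := ℂ) i).restrictScalars ℝ).hasFDerivAt
      (x := τ z)).comp_hasFDerivWithinAt z
        (h.differentiableWithinAt hz).hasFDerivWithinAt).fderivWithin (h.regular.1 z hz)
    exact DFunLike.congr_fun h2 v
  rw [← h1, fderivWithin_apply_eq]
  exact Finset.sum_congr rfl fun j _ => by rw [h.dzbar_eq z hz, mul_zero, add_zero]; rfl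

theorem fderivWithin_comp_apply (h : HolomorphicMap A S τ) (hz : z ∈ A) {F : Cn n → ℂ}
    (hF : DifferentiableWithinAt ℝ F S (τ z)) (j : Fin n) (c : ℂ) :
    fderivWithin ℝ (fun y => F (τ y)) A z (EuclideanSpace.single j c) =
      ∑ i, (c * jac A τ z i j * dz S i F (τ z) +
        (starRingEnd ℂ) (c * jac A τ z i j) * dzbar S i F (τ z)) := by
  have h1 := fderivWithin_comp (f := τ) z hF (h.differentiableWithinAt hz) h.mapsTo
    (h.regular.1 z hz)
  have h2 : ∀ i, fderivWithin ℝ τ A z (EuclideanSpace.single j c) i = c * jac A τ z i j := by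
    intro i
    rw [h.fderivWithin_apply hz, Finset.sum_eq_single j]
    · simp
    · intro k _ hk
      simp [hk]
    · simp
  change fderivWithin ℝ (F ∘ τ) A z _ = _
  rw [h1, ContinuousLinearMap.comp_apply, fderivWithin_apply_eq]
  simp only [h2]

theorem dz_comp (h : HolomorphicMap A S τ) (hz : z ∈ A) {F : Cn n → ℂ}
    (hF : DifferentiableWithinAt ℝ F S (τ z)) (j : Fin n) :
    dz A j (fun y => F (τ y)) z = ∑ i, jac A τ z i j * dz S i F (τ z) := by
  rw [dz, h.fderivWithin_comp_apply hz hF, h.fderivWithin_comp_apply hz hF, Finset.mul_sum,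
    ← Finset.sum_sub_distrib, Finset.sum_div]
  refine Finset.sum_congr rfl fun i _ => ?_
  simp only [map_mul, map_one, conj_I]
  linear_combination (-(1 / 2) * jac A τ z i j * dz S i F (τ z) +
    1 / 2 * (starRingEnd ℂ) (jac A τ z i j) * dzbar S i F (τ z)) * I_mul_I

theorem dzbar_comp (h : HolomorphicMap A S τ) (hz : z ∈ A) {F : Cn n → ℂ}
    (hF : DifferentiableWithinAt ℝ F S (τ z)) (j : Fin n) :
    dzbar A j (fun y => F (τ y)) z =
      ∑ i, (starRingEnd ℂ) (jac A τ z i j) * dzbar S i F (τ z) := by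
  rw [dzbar, h.fderivWithin_comp_apply hz hF, h.fderivWithin_comp_apply hz hF, Finset.mul_sum,
    ← Finset.sum_add_distrib, Finset.sum_div]
  refine Finset.sum_congr rfl fun i _ => ?_
  simp only [map_mul, map_one, conj_I]
  linear_combination (1 / 2 * jac A τ z i j * dz S i F (τ z) -
    1 / 2 * (starRingEnd ℂ) (jac A τ z i j) * dzbar S i F (τ z)) * I_mul_I

theorem contDiffOn_jac (h : HolomorphicMap A S τ) (i j : Fin n) :
    ContDiffOn ℝ ∞ (fun y => jac A τ y i j) A :=
  contDiffOn_dz h.regular.1 (h.contDiffOn_apply i) le_rfl j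

/-- The Jacobian is holomorphic. -/
theorem dzbar_jac (h : HolomorphicMap A S τ) (hz : z ∈ A) (i j k : Fin n) :
    dzbar A k (fun y => jac A τ y i j) z = 0 := by
  have h1 : dzbar A k (dz A j fun y => τ y i) z = dz A j (dzbar A k fun y => τ y i) z :=
    (dz_dzbar_comm h.regular ((h.contDiffOn_apply i).of_le (by decide)) hz j k).symm
  change dzbar A k (dz A j fun y => τ y i) z = 0
  rw [h1, dz_congr (g := fun _ => 0) (fun y hy => h.dzbar_eq y hy i k) hz, dz_const]

/-- The complex Hessian is a tensor under holomorphic changes of coordinates. -/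
theorem hess_comp (h : HolomorphicMap A S τ) (hz : z ∈ A) {F : Cn n → ℂ}
    (hF : ContDiffOn ℝ 2 F S) : hess A (fun y => F (τ y)) z =
      (jac A τ z)ᵀ * hess S F (τ z) * (jac A τ z).map (starRingEnd ℂ) := by
  have hu := h.regular.1 z hz
  have hd : ∀ i, DifferentiableWithinAt ℝ (dzbar S i F) S (τ z) := fun i =>
    diffAt_dzbar h.regular_target.1 hF (h.mapsTo hz) i
  have hd' : ∀ i, DifferentiableWithinAt ℝ (fun y => dzbar S i F (τ y)) A z := fun i =>
    (hd i).comp z (h.differentiableWithinAt hz) h.mapsTo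
  have hJ : ∀ i k, DifferentiableWithinAt ℝ (fun y => jac A τ y i k) A z := fun i k =>
    (h.contDiffOn_jac i k).differentiableOn (by simp) z hz
  have hJc : ∀ i k, DifferentiableWithinAt ℝ
      (fun y => (starRingEnd ℂ) (jac A τ y i k)) A z := fun i k =>
    (contDiffOn_conj (h.contDiffOn_jac i k)).differentiableOn (by simp) z hz
  ext j k
  have h1 : EqOn (dzbar A k fun y => F (τ y))
      (fun y => ∑ i, (starRingEnd ℂ) (jac A τ y i k) * dzbar S i F (τ y)) A := fun y hy =>
    h.dzbar_comp hy (hF.differentiableOn two_ne_zero _ (h.mapsTo hy)) k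
  change dz A j (dzbar A k fun y => F (τ y)) z = _
  rw [dz_congr h1 hz, dz_sum _ hu fun i _ => (hJc i k).fun_mul (hd' i)]
  have h2 : ∀ i, dz A j (fun y => (starRingEnd ℂ) (jac A τ y i k) * dzbar S i F (τ y)) z =
      (starRingEnd ℂ) (jac A τ z i k) * ∑ l, jac A τ z l j * hess S F (τ z) l i := fun i => by
    rw [dz_mul hu (hJc i k) (hd' i), dz_conj hu (hJ i k), h.dzbar_jac hz, map_zero,
      h.dz_comp hz (hd i)]
    simp [hess]
  simp only [h2, mul_apply, transpose_apply, map_apply]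
  exact Finset.sum_congr rfl fun i _ => mul_comm _ _

theorem dzv_comp (h : HolomorphicMap A S τ) (hz : z ∈ A) {F : Cn n → ℂ}
    (hF : DifferentiableWithinAt ℝ F S (τ z)) :
    dzv A (fun y => F (τ y)) z = (jac A τ z)ᵀ *ᵥ dzv S F (τ z) :=
  funext fun j => h.dz_comp hz hF j

end HolomorphicMap

theorem dzbar_eq_zero_of_differentiableAt {f : Cn n → ℂ} (hf : DifferentiableAt ℂ f z)
    (hA : A ∈ 𝓝 z) (j : Fin n) : dzbar A j f z = 0 := by
  have h1 : fderivWithin ℝ f A z = (fderiv ℂ f z).restrictScalars ℝ :=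
    (hf.hasFDerivAt.restrictScalars ℝ).hasFDerivWithinAt.fderivWithin
      (uniqueDiffWithinAt_of_mem_nhds hA)
  have h2 : (EuclideanSpace.single j I : Cn n) = I • EuclideanSpace.single j (1 : ℂ) := by
    ext i; simp
  rw [dzbar, h1, ContinuousLinearMap.coe_restrictScalars', h2, map_smul, smul_eq_mul, ← mul_assoc,
    I_mul_I]
  ring

namespace ComplexManifoldWithBoundary

variable {M : Type*} [TopologicalSpace M] {X : ComplexManifoldWithBoundary n M}
  {e e' : PartialEquiv M (Cn n)} {x : M}

/-- The domain, in the coordinates `e`, of the change to the coordinates `e'`. -/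
def overlap (e e' : PartialEquiv M (Cn n)) : Set (Cn n) := e.target ∩ e.symm ⁻¹' e'.source

theorem exists_overlap_eq (he : e ∈ X.atlas) (he' : e' ∈ X.atlas) :
    ∃ V, IsOpen V ∧ overlap e e' = e.target ∩ V := by
  obtain ⟨V, hV, h⟩ := continuousOn_iff'.1 (X.continuousOn_symm e he) _ (X.isOpen_source e' he')
  exact ⟨V, hV, by rw [overlap, inter_comm, h, inter_comm]⟩

theorem mem_overlap {N : Type*} {e e' : PartialEquiv N (Cn n)} {x : N} (hx : x ∈ e.source)
    (hx' : x ∈ e'.source) : e x ∈ overlap e e' :=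
  ⟨e.map_source hx, by rw [mem_preimage, e.left_inv hx]; exact hx'⟩

theorem regular_target (he : e ∈ X.atlas) : Regular e.target := (X.smoothDomain e he).isRegular

theorem holomorphicMap (he : e ∈ X.atlas) (he' : e' ∈ X.atlas) :
    HolomorphicMap (overlap e e') e'.target (e' ∘ e.symm) := by
  obtain ⟨V, hV, hA⟩ := exists_overlap_eq he he'
  have hreg : Regular (overlap e e') := by rw [hA]; exact (regular_target he).inter hV
  have hsm := X.contDiffOn_transition e he e' he'
  have hi : ∀ i, ContDiffOn ℝ ∞ (fun y => (e' ∘ e.symm) y i) (overlap e e') := fun i =>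
    ((EuclideanSpace.proj (𝕜 := ℂ) i).restrictScalars ℝ).contDiff.comp_contDiffOn hsm
  refine ⟨hreg, regular_target he', fun z hz => e'.map_source hz.2, hsm, fun z hz i j => ?_⟩
  have h1 : EqOn (dzbar (overlap e e') j fun y => (e' ∘ e.symm) y i) (fun _ => 0)
      (interior (overlap e e')) := fun y hy => by
    refine dzbar_eq_zero_of_differentiableAt ?_ (mem_interior_iff_mem_nhds.1 hy) j
    exact (EuclideanSpace.proj (𝕜 := ℂ) i).differentiableAt.comp y
      ((X.holomorphic_transition e he e' he').differentiableAt (isOpen_interior.mem_nhds hy))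
  exact h1.of_subset_closure (contDiffOn_dzbar (k := ∞) hreg.1 (hi i) le_rfl j).continuousOn
    continuousOn_const interior_subset hreg.2 hz

theorem jac_eq_jacobian (he : e ∈ X.atlas) (he' : e' ∈ X.atlas) (hx : x ∈ e.source)
    (hx' : x ∈ e'.source) : jac (overlap e e') (e' ∘ e.symm) (e x) = jacobian e e' x := by
  obtain ⟨V, hV, hA⟩ := exists_overlap_eq he he'
  have h := mem_overlap hx hx'
  ext i j
  rw [hA] at h ⊢
  exact dz_inter hV h.2 j _

/-- The complex Hessian of `u` at `x` in the coordinates `e`. -/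
def hessAt (e : PartialEquiv M (Cn n)) (u : M → ℝ) (x : M) : Matrix (Fin n) (Fin n) ℂ :=
  complexHessian e.target (u ∘ e.symm) (e x)

/-- The components of `∂u` at `x` in the coordinates `e`. -/
def delAt (e : PartialEquiv M (Cn n)) (u : M → ℝ) (x : M) : Fin n → ℂ :=
  dzv e.target (fun z => (u (e.symm z) : ℂ)) (e x)

theorem eqOn_overlap {N : Type*} {e e' : PartialEquiv N (Cn n)} (u : N → ℝ) :
    EqOn (fun z => (u (e.symm z) : ℂ))
    (fun z => (fun y => (u (e'.symm y) : ℂ)) ((e' ∘ e.symm) z)) (overlap e e') := fun z hz => by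
  simp only [Function.comp_apply]
  rw [e'.left_inv hz.2]

theorem hessAt_eq (he : e ∈ X.atlas) (he' : e' ∈ X.atlas) (hx : x ∈ e.source)
    (hx' : x ∈ e'.source) {u : M → ℝ} (hu : X.IsCk 2 u) : hessAt e u x =
      (jacobian e e' x)ᵀ * hessAt e' u x * (jacobian e e' x).map (starRingEnd ℂ) := by
  obtain ⟨V, hV, hA⟩ := exists_overlap_eq he he'
  have h := mem_overlap hx hx'
  have h1 := (holomorphicMap he he').hess_comp h (contDiffOn_ofReal (hu e' he'))
  have h2 : hessAt e u x = hess (overlap e e') (fun z => (u (e.symm z) : ℂ)) (e x) := by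
    rw [hA] at h ⊢
    exact (hess_inter hV h.1 h.2 _).symm
  rw [h2, hess_congr (eqOn_overlap u) h, ← jac_eq_jacobian he he' hx hx']
  refine h1.trans ?_
  rw [hessAt, Function.comp_apply, e.left_inv hx]
  rfl

theorem delAt_eq (he : e ∈ X.atlas) (he' : e' ∈ X.atlas) (hx : x ∈ e.source)
    (hx' : x ∈ e'.source) {u : M → ℝ} (hu : X.IsCk 1 u) :
    delAt e u x = (jacobian e e' x)ᵀ *ᵥ delAt e' u x := by
  obtain ⟨V, hV, hA⟩ := exists_overlap_eq he he'
  have h := mem_overlap hx hx'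
  have h1 := (holomorphicMap he he').dzv_comp h ((contDiffOn_ofReal (hu e' he')).differentiableOn
    one_ne_zero _ ((holomorphicMap he he').mapsTo h))
  have h2 : delAt e u x = dzv (overlap e e') (fun z => (u (e.symm z) : ℂ)) (e x) := by
    rw [hA] at h ⊢
    exact funext fun j => (dz_inter hV h.2 j _).symm
  have h3 : dzv (overlap e e') (fun z => (u (e.symm z) : ℂ)) (e x) =
      dzv (overlap e e') (fun z => (fun y => (u (e'.symm y) : ℂ)) ((e' ∘ e.symm) z)) (e x) :=
    funext fun j => dz_congr (eqOn_overlap u) h j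
  rw [h2, h3, ← jac_eq_jacobian he he' hx hx']
  refine h1.trans ?_
  rw [delAt, Function.comp_apply, e.left_inv hx]
  rfl

theorem transpose_eq (J : Matrix (Fin n) (Fin n) ℂ) : Jᵀ = (J.map (starRingEnd ℂ))ᴴ := by
  ext i j; simp

variable {Ω : X.HermitianMetric} {χ : X.RealForm11}

theorem isUnit_det_jacobian (Ω : X.HermitianMetric) (he : e ∈ X.atlas) (he' : e' ∈ X.atlas)
    (hx : x ∈ e.source) (hx' : x ∈ e'.source) : IsUnit (jacobian e e' x).det := by
  have h1 := (Ω.posDef e he x hx).det_pos.ne'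
  rw [Ω.transform e he e' he' x ⟨hx, hx'⟩, det_mul, det_mul, det_transpose] at h1
  exact isUnit_iff_ne_zero.2 (left_ne_zero_of_mul (left_ne_zero_of_mul h1))

theorem isUnit_det_map {J : Matrix (Fin n) (Fin n) ℂ} (hJ : IsUnit J.det) :
    IsUnit (J.map (starRingEnd ℂ)).det := by
  have : (J.map (starRingEnd ℂ)).det = (starRingEnd ℂ) J.det :=
    ((starRingEnd ℂ).map_det J).symm
  rw [this]
  exact hJ.map _

theorem inv_conj_mul_conj {B Ω₀ : Matrix (Fin n) (Fin n) ℂ} (hB : IsUnit B.det)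
    (H : Matrix (Fin n) (Fin n) ℂ) :
    (Bᴴ * Ω₀ * B)⁻¹ * (Bᴴ * H * B) = B⁻¹ * (Ω₀⁻¹ * H) * B := by
  have hB' : IsUnit Bᴴ.det := by rw [det_conjTranspose]; exact hB.star
  rw [Matrix.mul_inv_rev, Matrix.mul_inv_rev]
  calc _ = B⁻¹ * (Ω₀⁻¹ * ((Bᴴ⁻¹ * Bᴴ) * H)) * B := by simp only [Matrix.mul_assoc]
    _ = _ := by rw [nonsing_inv_mul _ hB', Matrix.one_mul]

theorem relEigenvalues_conj {B : Matrix (Fin n) (Fin n) ℂ} (hB : IsUnit B.det)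
    (Ω₀ H : Matrix (Fin n) (Fin n) ℂ) :
    relEigenvalues (Bᴴ * Ω₀ * B) (Bᴴ * H * B) = relEigenvalues Ω₀ H := by
  rw [relEigenvalues, inv_conj_mul_conj hB, Matrix.mul_assoc, charpoly_mul_comm, Matrix.mul_assoc,
    mul_nonsing_inv _ hB, Matrix.mul_one, relEigenvalues]

/-- The eigenvalues of `χ + √-1 ∂∂̄u` may be computed in any chart. -/
theorem relEigenvalues_eq (he : e ∈ X.atlas) (hx : x ∈ e.source) {u : M → ℝ} (hu : X.IsCk 2 u) :
    relEigenvalues (Ω.mat x) (χ.plusDdbar u x) =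
      relEigenvalues (Ω.coeff e x) (χ.coeff e x + hessAt e u x) := by
  have h0 := X.mem_source x
  have h1 : χ.plusDdbar u x =
      χ.coeff (X.chartAt x) x + hessAt (X.chartAt x) u x := rfl
  rw [h1, hessAt_eq (X.chartAt_mem x) he h0 hx hu, HermitianMetric.mat,
    Ω.transform _ (X.chartAt_mem x) _ he x ⟨h0, hx⟩, χ.transform _ (X.chartAt_mem x) _ he x ⟨h0, hx⟩,
    ← Matrix.add_mul, ← Matrix.mul_add, transpose_eq,
    relEigenvalues_conj (isUnit_det_map (isUnit_det_jacobian Ω (X.chartAt_mem x) he h0 hx))]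

theorem normDdbar_eq (he : e ∈ X.atlas) (hx : x ∈ e.source) {u : M → ℝ} (hu : X.IsCk 2 u) :
    Ω.normDdbar u x = √ (Matrix.trace (((Ω.coeff e x)⁻¹ * hessAt e u x) *
      ((Ω.coeff e x)⁻¹ * hessAt e u x))).re := by
  have h0 := X.mem_source x
  have hB := isUnit_det_map (isUnit_det_jacobian Ω (X.chartAt_mem x) he h0 hx)
  have h1 : X.ddbar u x = hessAt (X.chartAt x) u x := rfl
  rw [HermitianMetric.normDdbar, h1, hessAt_eq (X.chartAt_mem x) he h0 hx hu, HermitianMetric.mat,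
    Ω.transform _ (X.chartAt_mem x) _ he x ⟨h0, hx⟩, transpose_eq, inv_conj_mul_conj hB]
  congr 2
  generalize (jacobian (X.chartAt x) e x).map (starRingEnd ℂ) = B at hB ⊢
  generalize (Ω.coeff e x)⁻¹ * hessAt e u x = Y
  calc (B⁻¹ * Y * B * (B⁻¹ * Y * B)).trace = (B⁻¹ * (Y * (B * B⁻¹) * Y * B)).trace := by
        simp only [Matrix.mul_assoc]
    _ = (Y * Y).trace := by
        rw [mul_nonsing_inv _ hB, Matrix.mul_one, trace_mul_comm, Matrix.mul_assoc,
          mul_nonsing_inv _ hB, Matrix.mul_one]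

theorem gradSq_eq (he : e ∈ X.atlas) (hx : x ∈ e.source) {u : M → ℝ} (hu : X.IsCk 1 u) :
    Ω.gradSq u x = quad (Ω.coeff e x)⁻¹ (delAt e u x) := by
  have h0 := X.mem_source x
  have hB := isUnit_det_map (isUnit_det_jacobian Ω (X.chartAt_mem x) he h0 hx)
  have h1 : X.del u x = delAt (X.chartAt x) u x := rfl
  rw [HermitianMetric.gradSq, h1, delAt_eq (X.chartAt_mem x) he h0 hx hu, HermitianMetric.mat,
    Ω.transform _ (X.chartAt_mem x) _ he x ⟨h0, hx⟩, transpose_eq]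
  generalize (jacobian (X.chartAt x) e x).map (starRingEnd ℂ) = B at hB ⊢
  have hB' : IsUnit Bᴴ.det := by rw [det_conjTranspose]; exact hB.star
  change quad _ _ = _
  rw [← quad_conj, conjTranspose_conjTranspose, Matrix.mul_inv_rev, Matrix.mul_inv_rev]
  congr 1
  calc B * (B⁻¹ * ((Ω.coeff e x)⁻¹ * Bᴴ⁻¹)) * Bᴴ =
        (B * B⁻¹) * (Ω.coeff e x)⁻¹ * (Bᴴ⁻¹ * Bᴴ) := by simp only [Matrix.mul_assoc]
    _ = _ := by rw [mul_nonsing_inv _ hB, nonsing_inv_mul _ hB', Matrix.one_mul, Matrix.mul_one]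

/-- Interior points of one chart are interior points of every other chart: changes of coordinates
are open maps at such points. -/
theorem mem_interior_target (Ω : X.HermitianMetric) (he : e ∈ X.atlas) (he' : e' ∈ X.atlas)
    (hx : x ∈ e.source) (hx' : x ∈ e'.source) (h : e x ∈ interior e.target) :
    e' x ∈ interior e'.target := by
  obtain ⟨V, hV, hA⟩ := exists_overlap_eq he he'
  have hmem := mem_overlap hx hx'
  have hτ := holomorphicMap he he'
  have hnhds : overlap e e' ∈ 𝓝 (e x) := by
    rw [hA] at hmem ⊢
    exact inter_mem (mem_interior_iff_mem_nhds.1 h) (hV.mem_nhds hmem.2)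
  have hJ := isUnit_det_jacobian Ω he he' hx hx'
  rw [← jac_eq_jacobian he he' hx hx'] at hJ
  have hstrict := ((hτ.smooth.contDiffAt hnhds).hasStrictFDerivAt (by simp))
  have hsurj : (fderiv ℝ (e' ∘ e.symm) (e x)).range = ⊤ := by
    refine LinearMap.range_eq_top.2 fun y => ?_
    refine ⟨WithLp.toLp 2 ((jac (overlap e e') (e' ∘ e.symm) (e x))⁻¹ *ᵥ fun i => y i), ?_⟩
    ext i
    have h1 := hτ.fderivWithin_apply hmem
      (WithLp.toLp 2 ((jac (overlap e e') (e' ∘ e.symm) (e x))⁻¹ *ᵥ fun i => y i)) i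
    rw [fderivWithin_of_mem_nhds hnhds] at h1
    refine h1.trans ?_
    have h2 : ((jac (overlap e e') (e' ∘ e.symm) (e x)) *ᵥ
        ((jac (overlap e e') (e' ∘ e.symm) (e x))⁻¹ *ᵥ fun i => y i)) i = y i := by
      rw [mulVec_mulVec, mul_nonsing_inv _ hJ, one_mulVec]
    rw [← h2, mulVec, dotProduct]
    exact Finset.sum_congr rfl fun j _ => mul_comm _ _
  have hmap := hstrict.map_nhds_eq_of_surj hsurj
  rw [mem_interior_iff_mem_nhds]
  have hx2 : (e' ∘ e.symm) (e x) = e' x := by rw [Function.comp_apply, e.left_inv hx]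
  rw [hx2] at hmap
  rw [← hmap, mem_map]
  exact mem_of_superset hnhds hτ.mapsTo

theorem mem_boundary_iff (Ω : X.HermitianMetric) (he : e ∈ X.atlas) (hx : x ∈ e.source) :
    x ∈ X.boundary ↔ e x ∉ interior e.target :=
  not_congr ⟨mem_interior_target Ω (X.chartAt_mem x) he (X.mem_source x) hx,
    mem_interior_target Ω he (X.chartAt_mem x) hx (X.mem_source x)⟩

end ComplexManifoldWithBoundary

end ChangeOfCoordinates

/-! ### A maximum principle on components that meet the boundary -/

section MaximumPrinciple

namespace ComplexManifoldWithBoundary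

variable {n : ℕ} {M : Type*} [TopologicalSpace M] {X : ComplexManifoldWithBoundary n M} {x : M}

theorem continuousAt_chart (X : ComplexManifoldWithBoundary n M) {e : PartialEquiv M (Cn n)}
    (he : e ∈ X.atlas) (hx : x ∈ e.source) : ContinuousAt e x :=
  (X.continuousOn e he).continuousAt ((X.isOpen_source e he).mem_nhds hx)

theorem tendsto_chart (X : ComplexManifoldWithBoundary n M) {e : PartialEquiv M (Cn n)}
    (he : e ∈ X.atlas) (hx : x ∈ e.source) : Tendsto e (𝓝 x) (𝓝[e.target] (e x)) :=
  tendsto_nhdsWithin_iff.2 ⟨X.continuousAt_chart he hx,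
    mem_of_superset ((X.isOpen_source e he).mem_nhds hx) fun _ hy => e.map_source hy⟩

theorem tendsto_chart_symm (X : ComplexManifoldWithBoundary n M) {e : PartialEquiv M (Cn n)}
    (he : e ∈ X.atlas) (hx : x ∈ e.source) : Tendsto e.symm (𝓝[e.target] (e x)) (𝓝 x) := by
  have h := X.continuousOn_symm e he (e x) (e.map_source hx)
  rwa [ContinuousWithinAt, e.left_inv hx] at h

theorem IsCk.continuous {k : WithTop ℕ∞} {f : M → ℝ} (hf : X.IsCk k f) : Continuous f := by
  refine continuous_iff_continuousAt.2 fun x => ?_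
  have he := X.chartAt_mem x
  have hx := X.mem_source x
  have h1 : Tendsto (f ∘ (X.chartAt x).symm) (𝓝[(X.chartAt x).target] (X.chartAt x x))
      (𝓝 (f x)) := by
    have := (hf _ he).continuousOn (X.chartAt x x) ((X.chartAt x).map_source hx)
    rwa [ContinuousWithinAt, Function.comp_apply, (X.chartAt x).left_inv hx] at this
  refine (h1.comp (X.tendsto_chart he hx)).congr' ?_
  filter_upwards [(X.isOpen_source _ he).mem_nhds hx] with y hy
  simp only [Function.comp_apply]
  rw [(X.chartAt x).left_inv hy]

/-- Second order operators `Re tr(G ∂∂̄f)`, given in the chart around each point `x` on a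
neighbourhood `nhd x` of its image, together with zeroth order bounds `β`. -/
structure EllipticFamily (X : ComplexManifoldWithBoundary n M) where
  G : M → Cn n → Matrix (Fin n) (Fin n) ℂ
  nhd : M → Set (Cn n)
  β : M → ℝ
  nhd_mem : ∀ x, nhd x ∈ 𝓝 (X.chartAt x x)
  β_pos : ∀ x, 0 < β x
  elliptic : ∀ x, ∃ l L, 0 < l ∧ ∀ z ∈ nhd x, z ∈ (X.chartAt x).target → Elliptic l L (G x z)

namespace EllipticFamily

variable {A : EllipticFamily X} {f : M → ℝ} {b : ℝ}

/-- `f` is nonpositive on the boundary and `Re tr(G ∂∂̄f) ≥ -β b`. -/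
structure Sub (A : EllipticFamily X) (f : M → ℝ) (b : ℝ) : Prop where
  smooth : X.IsCk 2 f
  boundary : ∀ x ∈ X.boundary, f x ≤ 0
  pos : 0 < b
  le : ∀ x, ∀ z ∈ A.nhd x, z ∈ (X.chartAt x).target → -(A.β x * b) ≤
    (A.G x z * complexHessian (X.chartAt x).target (f ∘ (X.chartAt x).symm) z).trace.re

/-- Cutting off along a clopen set preserves subsolutions. -/
theorem Sub.indicator (h : A.Sub f b) {D : Set M} (hD : IsClopen D) : A.Sub (D.indicator f) b := by
  have hloc : ∀ e ∈ X.atlas, ∀ z ∈ e.target, ∃ V, IsOpen V ∧ z ∈ V ∧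
      ((∀ y ∈ e.target ∩ V, (D.indicator f ∘ e.symm) y = (f ∘ e.symm) y) ∨
        ∀ y ∈ e.target ∩ V, (D.indicator f ∘ e.symm) y = 0) := by
    intro e he z hz
    by_cases hzD : e.symm z ∈ D
    · obtain ⟨V, hV, hVe⟩ := continuousOn_iff'.1 (X.continuousOn_symm e he) D hD.isOpen
      refine ⟨V, hV, (hVe ▸ ⟨hzD, hz⟩ : z ∈ V ∩ e.target).1, Or.inl fun y hy => ?_⟩
      have : y ∈ e.symm ⁻¹' D ∩ e.target := hVe.symm ▸ ⟨hy.2, hy.1⟩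
      exact indicator_of_mem (s := D) this.1 f
    · obtain ⟨V, hV, hVe⟩ := continuousOn_iff'.1 (X.continuousOn_symm e he) Dᶜ
        hD.compl.isOpen
      refine ⟨V, hV, (hVe ▸ ⟨hzD, hz⟩ : z ∈ V ∩ e.target).1, Or.inr fun y hy => ?_⟩
      have : y ∈ e.symm ⁻¹' Dᶜ ∩ e.target := hVe.symm ▸ ⟨hy.2, hy.1⟩
      exact indicator_of_notMem (s := D) this.1 f
  refine ⟨fun e he => fun z hz => ?_, fun x hx => ?_, h.pos, fun x z hz hzT => ?_⟩
  · obtain ⟨V, hV, hzV, h1 | h1⟩ := hloc e he z hz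
    · refine (contDiffWithinAt_inter (hV.mem_nhds hzV)).1 ?_
      exact ((h.smooth e he z hz).mono inter_subset_left).congr h1 (h1 z ⟨hz, hzV⟩)
    · refine (contDiffWithinAt_inter (hV.mem_nhds hzV)).1 ?_
      exact contDiffWithinAt_const.congr h1 (h1 z ⟨hz, hzV⟩)
  · by_cases hxD : x ∈ D
    · rw [indicator_of_mem hxD]; exact h.boundary x hx
    · rw [indicator_of_notMem hxD]
  · have hβ := mul_pos (A.β_pos x) h.pos
    obtain ⟨V, hV, hzV, h1 | h1⟩ := hloc _ (X.chartAt_mem x) z hzT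
    · have h2 : complexHessian (X.chartAt x).target (D.indicator f ∘ (X.chartAt x).symm) z =
          complexHessian (X.chartAt x).target (f ∘ (X.chartAt x).symm) z := by
        rw [complexHessian_eq, complexHessian_eq, ← hess_inter hV hzT hzV,
          hess_congr (fun y hy => congrArg ofReal (h1 y hy)) ⟨hzT, hzV⟩, hess_inter hV hzT hzV]
      rw [h2]
      exact h.le x z hz hzT
    · have h2 : complexHessian (X.chartAt x).target (D.indicator f ∘ (X.chartAt x).symm) z =
          0 := by
        rw [complexHessian_eq, ← hess_inter hV hzT hzV,
          hess_congr (g := fun _ => ((0 : ℝ) : ℂ))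
            (fun y hy => congrArg ofReal (h1 y hy)) ⟨hzT, hzV⟩, hess_const]
      rw [h2, Matrix.mul_zero, trace_zero, zero_re]
      exact (neg_neg_of_pos hβ).le

/-- Upper bounds `S` of subsolutions improve to `(1 - c) S + C b` on `U`, uniformly. -/
def Grows (A : EllipticFamily X) (U : Set M) : Prop :=
  ∃ c C : ℝ, 0 < c ∧ c ≤ 1 ∧ 0 ≤ C ∧ ∀ f b, A.Sub f b → ∀ S, 0 ≤ S → (∀ y, f y ≤ S) →
    ∀ y ∈ U, f y ≤ (1 - c) * S + C * b

theorem Grows.mono {U V : Set M} (h : A.Grows V) (hUV : U ⊆ V) : A.Grows U := by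
  obtain ⟨c, C, hc, hc1, hC, h⟩ := h
  exact ⟨c, C, hc, hc1, hC, fun f b hf S hS hle y hy => h f b hf S hS hle y (hUV hy)⟩

theorem Grows.union {U V : Set M} (hU : A.Grows U) (hV : A.Grows V) : A.Grows (U ∪ V) := by
  obtain ⟨c, C, hc, hc1, hC, h⟩ := hU
  obtain ⟨c', C', hc', hc1', hC', h'⟩ := hV
  refine ⟨min c c', max C C', lt_min hc hc', (min_le_left _ _).trans hc1,
    hC.trans (le_max_left _ _), fun f b hf S hS hle y hy => ?_⟩
  have hb := hf.pos.le
  have h1 := mul_le_mul_of_nonneg_right (min_le_left c c') hS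
  have h2 := mul_le_mul_of_nonneg_right (min_le_right c c') hS
  have h3 := mul_le_mul_of_nonneg_right (le_max_left C C') hb
  have h4 := mul_le_mul_of_nonneg_right (le_max_right C C') hb
  rcases hy with hy | hy
  · linarith [h f b hf S hS hle y hy]
  · linarith [h' f b hf S hS hle y hy]

/-- The set of points near which subsolutions grow. -/
def growthSet (A : EllipticFamily X) : Set M := {x | ∃ U ∈ 𝓝 x, A.Grows U}

theorem isOpen_growthSet : IsOpen A.growthSet := by
  refine isOpen_iff_mem_nhds.2 fun x ⟨U, hU, h⟩ => ?_
  filter_upwards [eventually_mem_nhds_iff.2 hU] with y hy using ⟨U, hy, h⟩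

/-- Subsolutions are nonpositive on the boundary, and the barrier propagates this inside. -/
theorem boundary_subset_growthSet (Ω : X.HermitianMetric) : X.boundary ⊆ A.growthSet := by
  intro x hx
  have he := X.chartAt_mem x
  have hxe := X.mem_source x
  obtain ⟨l, L, hl, hell⟩ := A.elliptic x
  obtain ⟨U, ρ, hpU, hdef⟩ := (X.smoothDomain _ he).exists_isDefining
    ((X.chartAt x).map_source hxe)
  have hint : ∀ z ∈ (X.chartAt x).target ∩ U, ρ z = 0 → (X.chartAt x).symm z ∈ X.boundary := by
    intro z hz h0
    rw [mem_boundary_iff Ω he ((X.chartAt x).map_target hz.1), (X.chartAt x).right_inv hz.1]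
    intro hcon
    have : z ∈ interior ((X.chartAt x).target ∩ U) := by
      rw [interior_inter, hdef.isOpen.interior_eq]; exact ⟨hcon, hz.2⟩
    exact ((hdef.mem_interior_iff hz.2).1 this).ne h0
  have h0 : ρ (X.chartAt x x) = 0 := by
    refine le_antisymm (hdef.nonpos ⟨(X.chartAt x).map_source hxe, hpU⟩) (not_lt.1 fun hlt => ?_)
    exact hx (interior_mono inter_subset_left ((hdef.mem_interior_iff hpU).2 hlt))
  obtain ⟨R₂, hR₂, hball⟩ := Metric.mem_nhds_iff.1 (A.nhd_mem x)
  obtain ⟨C, R, hC, hR, hRR, hRU, hbar⟩ := exists_boundary_barrier hdef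
    ⟨(X.chartAt x).map_source hxe, hpU⟩ h0 hl L hR₂
  obtain ⟨b₀, hb₀, hb⟩ := hbar _ ⟨(X.chartAt x).map_source hxe, hpU⟩ h0 (by simpa using hR.le)
  obtain ⟨r, hr⟩ : ∃ r : ℝ, r = min R (1 / (2 * C)) := ⟨_, rfl⟩
  have hr0 : 0 < r := by rw [hr]; exact lt_min hR (by positivity)
  refine ⟨(X.chartAt x) ⁻¹' Metric.closedBall (X.chartAt x x) r ∩ (X.chartAt x).source,
    inter_mem (X.continuousAt_chart he hxe (Metric.closedBall_mem_nhds _ hr0))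
      ((X.isOpen_source _ he).mem_nhds hxe), 1 / 2, A.β x, by norm_num, by norm_num,
    (A.β_pos x).le, ?_⟩
  rintro f b hf S hS hle y ⟨hy, hys⟩
  have hball' : Metric.closedBall (X.chartAt x x) R ⊆ U :=
    (Metric.closedBall_subset_closedBall (by linarith)).trans hRU
  have hyR : dist (X.chartAt x y) (X.chartAt x x) ≤ r := hy
  have hyR' : dist (X.chartAt x y) (X.chartAt x x) ≤ R := hyR.trans (hr ▸ min_le_left _ _)
  have hyT : X.chartAt x y ∈ (X.chartAt x).target ∩ U :=
    ⟨(X.chartAt x).map_source hys, hball' hyR'⟩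
  have key := le_mul_boundary_barrier hdef (f := f ∘ (X.chartAt x).symm) (S := S)
    (β := A.β x * b) hball' hb₀ (fun y hy hyR => ⟨(hb y hy hyR).1, (hb y hy hyR).2.2⟩)
    ((hf.smooth _ he).mono inter_subset_left) hS (mul_pos (A.β_pos x) hf.pos)
    (fun z _ _ => hle _) (fun z hz _ hz0 => hf.boundary _ (hint z hz hz0))
    (fun z hz hzR _ => ?_) _ hyT hyR'
  · have h1 := (hb _ hyT hyR').2.1
    rw [Function.comp_apply, (X.chartAt x).left_inv hys] at key
    have h2 : 0 ≤ S + 2 * (A.β x * b) := by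
      have := mul_pos (A.β_pos x) hf.pos
      positivity
    rw [dist_eq_norm] at hyR
    have h3 : b₀ (X.chartAt x y) ≤ 1 / 2 := by
      calc b₀ (X.chartAt x y) ≤ C * (1 / (2 * C)) :=
            h1.trans (mul_le_mul_of_nonneg_left (hyR.trans (hr ▸ min_le_right _ _)) hC.le)
        _ = 1 / 2 := by field_simp
    have h4 := mul_le_mul_of_nonneg_left h3 h2
    linarith
  · have hzn : z ∈ A.nhd x := hball (hzR.trans_le (by linarith))
    refine ⟨_, hell z hzn hz.1, ?_⟩
    have h1 := hf.le x z hzn hz.1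
    have h2 : complexHessian ((X.chartAt x).target ∩ U) (f ∘ (X.chartAt x).symm) z =
        complexHessian (X.chartAt x).target (f ∘ (X.chartAt x).symm) z :=
      hess_inter hdef.isOpen hz.1 hz.2 _
    rwa [h2]

/-- Growth on a small ball around a nearby point spreads to a neighbourhood of an interior point. -/
theorem mem_growthSet_of_mem_closure (hx : x ∈ closure A.growthSet)
    (hxb : x ∉ X.boundary) : x ∈ A.growthSet := by
  have he := X.chartAt_mem x
  have hxe := X.mem_source x
  obtain ⟨l, L, hl, hell⟩ := A.elliptic x
  obtain ⟨R, hR, hball⟩ := Metric.mem_nhds_iff.1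
    (inter_mem (A.nhd_mem x) (interior_mem_nhds.2 (mem_interior_iff_mem_nhds.1 (not_not.1 hxb))))
  obtain ⟨x', ⟨hx'd, hx's⟩, U, hU, c, C, hc, hc1, hC, hgrow⟩ := mem_closure_iff_nhds.1 hx
    ((X.chartAt x) ⁻¹' Metric.ball (X.chartAt x x) (R / 8) ∩ (X.chartAt x).source)
    (inter_mem (X.continuousAt_chart he hxe (Metric.ball_mem_nhds _ (by positivity)))
      ((X.isOpen_source _ he).mem_nhds hxe))
  have hx'd' : dist (X.chartAt x x') (X.chartAt x x) < R / 8 := hx'd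
  have hin : ∀ z, dist z (X.chartAt x x') ≤ 2 * (R / 4) →
      z ∈ A.nhd x ∧ z ∈ interior (X.chartAt x).target := fun z hz =>
    hball (Metric.mem_ball.2 (by linarith [dist_triangle z (X.chartAt x x') (X.chartAt x x)]))
  obtain ⟨ε₀, hε₀, hεU⟩ := Metric.mem_nhdsWithin_iff.1 (X.tendsto_chart_symm he hx's hU)
  obtain ⟨ε, hε⟩ : ∃ ε : ℝ, ε = min (ε₀ / 2) (R / 8) := ⟨_, rfl⟩
  have hε0 : 0 < ε := by rw [hε]; exact lt_min (by positivity) (by positivity)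
  have hεR : ε < R / 4 := by rw [hε]; exact (min_le_right _ _).trans_lt (by linarith)
  have hεε : ε < ε₀ := by rw [hε]; exact (min_le_left _ _).trans_lt (by linarith)
  obtain ⟨c', C', hc', hc1', hC', key⟩ := exists_growth_inside (regular_target he) hε0 hεR
    (y := X.chartAt x x') (fun z hz => (hin z hz).2) hl (L := L) hc hc1
    (mul_nonneg hC (inv_nonneg.2 (A.β_pos x).le))
  refine ⟨(X.chartAt x) ⁻¹' Metric.ball (X.chartAt x x) (R / 8) ∩ (X.chartAt x).source,
    (inter_mem (X.continuousAt_chart he hxe (Metric.ball_mem_nhds _ (by positivity)))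
      ((X.isOpen_source _ he).mem_nhds hxe)), c', C' * A.β x, hc', hc1',
    mul_nonneg hC' (A.β_pos x).le, ?_⟩
  rintro f b hf S hS hle y ⟨hy, hys⟩
  have hy' : dist (X.chartAt x y) (X.chartAt x x) < R / 8 := hy
  have h1 := key (f ∘ (X.chartAt x).symm) S (A.β x * b) hS (mul_pos (A.β_pos x) hf.pos)
    (hf.smooth _ he) (fun _ _ => hle _) (fun z hz => ?_) (fun z hz => ?_) (X.chartAt x y)
    (Metric.mem_closedBall.2 (by
      linarith [dist_triangle_right (X.chartAt x y) (X.chartAt x x') (X.chartAt x x)]))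
  · rw [Function.comp_apply, (X.chartAt x).left_inv hys] at h1
    linarith
  · have hz1 : dist z (X.chartAt x x') ≤ ε := hz
    have hzT := interior_subset (hin z (by linarith)).2
    have h2 := hgrow f b hf S hS hle ((X.chartAt x).symm z)
      (hεU ⟨Metric.mem_ball.2 (hz1.trans_lt hεε), hzT⟩)
    have h3 : C * (A.β x)⁻¹ * (A.β x * b) = C * b := by
      have := (A.β_pos x).ne'
      field_simp
    rw [h3]
    exact h2
  · have hzn := hin z (Metric.mem_ball.1 hz).le
    exact ⟨_, hell z hzn.1 (interior_subset hzn.2), hf.le x z hzn.1 (interior_subset hzn.2)⟩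

theorem isClopen_growthSet (Ω : X.HermitianMetric) : IsClopen A.growthSet := by
  refine ⟨isClosed_of_closure_subset fun x hx => ?_, isOpen_growthSet⟩
  by_cases hxb : x ∈ X.boundary
  · exact boundary_subset_growthSet Ω hxb
  · exact mem_growthSet_of_mem_closure hx hxb

/-- The maximum principle: subsolutions are bounded on a clopen set `D` that contains the boundary,
namely the growth set. Components without boundary carry no such bound. -/
theorem exists_le [CompactSpace M] (Ω : X.HermitianMetric) (A : EllipticFamily X) :
    ∃ C : ℝ, 0 ≤ C ∧ ∃ D : Set M, IsClopen D ∧ X.boundary ⊆ D ∧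
      ∀ f b, A.Sub f b → ∀ x ∈ D, f x ≤ C * b := by
  have hD := A.isClopen_growthSet Ω
  obtain ⟨c, C, hc, hc1, hC, h⟩ : A.Grows A.growthSet :=
    hD.isClosed.isCompact.induction_on
      ⟨1, 0, one_pos, le_rfl, le_rfl, fun _ _ _ _ _ _ y hy => hy.elim⟩ (fun _ _ hst h => h.mono hst)
      (fun _ _ hs ht => hs.union ht) fun x ⟨U, hU, h⟩ => ⟨U, mem_nhdsWithin_of_mem_nhds hU, h⟩
  refine ⟨C / c, by positivity, A.growthSet, hD, boundary_subset_growthSet Ω, fun f b hf x hx => ?_⟩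
  obtain ⟨x₀, hx₀, hmax⟩ := hD.isClosed.isCompact.exists_isMaxOn ⟨x, hx⟩
    hf.smooth.continuous.continuousOn
  have hb := hf.pos
  rcases le_or_gt (f x₀) 0 with h0 | h0
  · exact (hmax hx).trans (h0.trans (by positivity))
  -- The cut-off subsolution has the global bound `f x₀`, attained at `x₀`: `f x₀` is at most
  -- `(1 - c) f x₀ + C b`.
  have h1 := h _ b (hf.indicator hD) (f x₀) h0.le (fun y => ?_) x₀ hx₀
  · rw [indicator_of_mem hx₀] at h1
    refine (hmax hx).trans ?_
    rw [div_mul_eq_mul_div, le_div_iff₀ hc]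
    linarith
  · by_cases hy : y ∈ A.growthSet
    · rw [indicator_of_mem hy]; exact hmax hy
    · rw [indicator_of_notMem hy]; exact h0.le

end EllipticFamily

end ComplexManifoldWithBoundary

end MaximumPrinciple

/-! ### The equation in charts and bounds of the solution -/

section Global

namespace ComplexManifoldWithBoundary

variable {n : ℕ} {M : Type*} [TopologicalSpace M] {X : ComplexManifoldWithBoundary n M}
  {Ω : X.HermitianMetric} {χ : X.RealForm11} {e : PartialEquiv M (Cn n)} {u usub ψ : M → ℝ}
  {x : M} {z : Cn n}

/-- The components of the metric as functions of the coordinates `e`. -/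
def HermitianMetric.inChart (Ω : X.HermitianMetric) (e : PartialEquiv M (Cn n)) (z : Cn n) :
    Matrix (Fin n) (Fin n) ℂ := Ω.coeff e (e.symm z)

/-- The components of `χ + √-1 ∂∂̄u` as functions of the coordinates `e`. -/
def RealForm11.inChart (χ : X.RealForm11) (e : PartialEquiv M (Cn n)) (u : M → ℝ) (z : Cn n) :
    Matrix (Fin n) (Fin n) ℂ := χ.coeff e (e.symm z) + complexHessian e.target (u ∘ e.symm) z

theorem posDef_inChart (he : e ∈ X.atlas) (hz : z ∈ e.target) : (Ω.inChart e z).PosDef :=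
  Ω.posDef e he _ (e.map_target hz)

theorem contDiffOn_metric (he : e ∈ X.atlas) {k : WithTop ℕ∞} (hk : k ≤ (∞ : WithTop ℕ∞))
    (i j : Fin n) : ContDiffOn ℝ k (fun z => Ω.inChart e z i j) e.target :=
  (Ω.smooth e he i j).of_le hk

theorem contDiffOn_metric_inv (he : e ∈ X.atlas) {k : WithTop ℕ∞} (hk : k ≤ (∞ : WithTop ℕ∞))
    (i j : Fin n) : ContDiffOn ℝ k (fun z => (Ω.inChart e z)⁻¹ i j) e.target :=
  contDiffOn_inv_apply (contDiffOn_metric he hk)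
    (fun _ hz => (posDef_inChart he hz).det_pos.ne') i j

theorem contDiffOn_form (he : e ∈ X.atlas) {k m : WithTop ℕ∞} (hk : k ≤ (∞ : WithTop ℕ∞))
    (hu : X.IsCk m u) (hm : k + 1 + 1 ≤ m) (i j : Fin n) :
    ContDiffOn ℝ k (fun z => χ.inChart e u z i j) e.target :=
  ((χ.smooth e he i j).of_le hk).add
    (BoundaryPatch.contDiffOn_complexHessian (regular_target he).1 (hu e he) hm i j)

theorem isHermitian_form (he : e ∈ X.atlas) (hu : X.IsCk 2 u) (hz : z ∈ e.target) :
    (χ.inChart e u z).IsHermitian :=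
  (χ.isHermitian e he _ (e.map_target hz)).add
    (isHermitian_hess_ofReal (regular_target he) (hu e he) hz)

theorem hessAt_symm {N : Type*} {e : PartialEquiv N (Cn n)} {u : N → ℝ} (hz : z ∈ e.target) :
    hessAt e u (e.symm z) = complexHessian e.target (u ∘ e.symm) z := by
  rw [hessAt, e.right_inv hz]

theorem relEigenvalues_symm (he : e ∈ X.atlas) (hu : X.IsCk 2 u) (hz : z ∈ e.target) :
    relEigenvalues (Ω.mat (e.symm z)) (χ.plusDdbar u (e.symm z)) =
      relEigenvalues (Ω.inChart e z) (χ.inChart e u z) := by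
  rw [relEigenvalues_eq he (e.map_target hz) hu, hessAt_symm hz]
  rfl

theorem Admissible.posDef (hn : 1 ≤ n) (h : Admissible (n - 1) Ω χ u) (he : e ∈ X.atlas)
    (hu : X.IsCk 2 u) (hz : z ∈ e.target) : (wOp (Ω.inChart e z) (χ.inChart e u z)).PosDef := by
  have h1 := h (e.symm z)
  rwa [relEigenvalues_symm he hu hz,
    inCone_iff_posDef (posDef_inChart he hz) (isHermitian_form he hu hz) hn] at h1

theorem maOperator_symm (hn : 1 ≤ n) (he : e ∈ X.atlas) (hu : X.IsCk 2 u) (hz : z ∈ e.target) :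
    maOperator (n - 1) Ω χ u (e.symm z) =
      ((Ω.inChart e z)⁻¹ * wOp (Ω.inChart e z) (χ.inChart e u z)).det.re := by
  rw [← prodSums_eq_det (posDef_inChart he hz) (isHermitian_form he hu hz) hn, ofReal_re,
    maOperator, relEigenvalues_symm he hu hz]

theorem complexHessian_sub_symm {v : M → ℝ} (he : e ∈ X.atlas) (hu : X.IsCk 2 u) (hv : X.IsCk 2 v)
    (hz : z ∈ e.target) : complexHessian e.target ((fun y => u y - v y) ∘ e.symm) z =
      χ.inChart e u z - χ.inChart e v z := by
  rw [RealForm11.inChart, RealForm11.inChart, add_sub_add_left_eq_sub]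
  exact complexHessian_sub_real (regular_target he).1 (hu e he) (hv e he) hz

/-- Elliptic families from continuous positive coefficients. -/
theorem exists_ellipticFamily (G : M → Cn n → Matrix (Fin n) (Fin n) ℂ) (b : M → Cn n → ℝ)
    (hG : ∀ x, ∀ z ∈ (X.chartAt x).target, (G x z).PosDef)
    (hc : ∀ x i j, ContDiffOn ℝ 0 (fun z => G x z i j) (X.chartAt x).target)
    (hb : ∀ x, ContDiffOn ℝ 0 (b x) (X.chartAt x).target) :
    ∃ A : EllipticFamily X, A.G = G ∧
      ∀ x, ∀ z ∈ A.nhd x, z ∈ (X.chartAt x).target → |b x z| ≤ A.β x := by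
  have hmem : ∀ x, X.chartAt x x ∈ (X.chartAt x).target := fun x =>
    (X.chartAt x).map_source (X.mem_source x)
  choose l L hl hL hell using fun x => exists_elliptic (hmem x) (hG x) fun i j =>
    (hc x i j).continuousOn _ (hmem x)
  choose β hβ hbd using fun x => exists_eventually_bound (S := (X.chartAt x).target)
    (x := X.chartAt x x) (f := fun _ : Unit => b x) fun _ => (hb x).continuousOn _ (hmem x)
  choose V hV hVs using fun x =>
    mem_nhdsWithin_iff_exists_mem_nhds_inter.1 ((hell x).and (hbd x))
  exact ⟨⟨G, V, β, hV, hβ, fun x => ⟨l x, L x, hl x, fun z hz hzT => (hVs x ⟨hz, hzT⟩).1⟩⟩, rfl,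
    fun x z hz hzT => (hVs x ⟨hz, hzT⟩).2 ()⟩

/-- `u` is an admissible solution with right hand side `ψ` and the boundary values of `usub`; the
constant `N` controls `ψ` and the gradient of `ψ ^ γ`. -/
structure IsSolution (Ω : X.HermitianMetric) (χ : X.RealForm11) (usub : M → ℝ) (m γ N : ℝ)
    (ψ u : M → ℝ) : Prop where
  smooth_rhs : X.IsCk ∞ ψ
  le_rhs : ∀ x, m ≤ ψ x
  rhs_le : ∀ x, ψ x ≤ N
  gradSq_le : ∀ x, Ω.gradSq (fun x => ψ x ^ γ) x ≤ N
  rhs_le_sub : ∀ x, ψ x ≤ maOperator (n - 1) Ω χ usub x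
  smooth : X.IsCk 4 u
  admissible : Admissible (n - 1) Ω χ u
  eq : ∀ x, maOperator (n - 1) Ω χ u x = ψ x
  boundary : ∀ x ∈ X.boundary, u x = usub x

variable {m γ N : ℝ}

theorem IsCk.of_le {k l : WithTop ℕ∞} (hu : X.IsCk l u) (h : k ≤ l) : X.IsCk k u :=
  fun e he => (hu e he).of_le h

theorem IsSolution.smooth_two (h : IsSolution Ω χ usub m γ N ψ u) : X.IsCk 2 u :=
  h.smooth.of_le (by norm_num)

theorem trace_inv_mul_nonneg {Ω₀ H : Matrix (Fin n) (Fin n) ℂ} (hn : 2 ≤ n) (hΩ : Ω₀.PosDef)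
    (hW : (wOp Ω₀ H).PosDef) : 0 ≤ (Ω₀⁻¹ * H).trace.re := by
  have h1 := trace_mul_re_nonneg hΩ.inv.posSemidef hW.posSemidef
  rw [trace_inv_mul_wOp hΩ, show ((n : ℂ) - 1) = ((n - 1 : ℝ) : ℂ) by push_cast; rfl,
    re_ofReal_mul] at h1
  have hn : (2 : ℝ) ≤ n := by exact_mod_cast hn
  exact (mul_nonneg_iff_of_pos_left (by linarith)).1 h1

/-- Solutions are bounded above near the boundary, since `tr(Ω⁻¹ g) ≥ 0`. -/
theorem exists_sub_le [CompactSpace M] (hn : 2 ≤ n) (hs : X.IsCk 2 usub) (m γ N : ℝ) :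
    ∃ S : ℝ, ∃ D : Set M, IsClopen D ∧ X.boundary ⊆ D ∧
      ∀ ψ u, IsSolution Ω χ usub m γ N ψ u → ∀ x ∈ D, u x - usub x ≤ S := by
  obtain ⟨A, hA, hβ⟩ := exists_ellipticFamily (X := X)
    (fun x z => (Ω.inChart (X.chartAt x) z)⁻¹)
    (fun x z => ((Ω.inChart (X.chartAt x) z)⁻¹ * χ.inChart (X.chartAt x) usub z).trace.re)
    (fun x z hz => (posDef_inChart (X.chartAt_mem x) hz).inv)
    (fun x => contDiffOn_metric_inv (X.chartAt_mem x) (by simp))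
    (fun x => contDiffOn_re (contDiffOn_trace (contDiffOn_mul_apply
      (contDiffOn_metric_inv (X.chartAt_mem x) (by simp))
      (contDiffOn_form (X.chartAt_mem x) (by simp) hs (by norm_num)))))
  obtain ⟨C, -, D, hD, hbD, h⟩ := A.exists_le Ω
  refine ⟨C * 1, D, hD, hbD, fun ψ u hu x hx => h (fun y => u y - usub y) 1 ?_ x hx⟩
  refine ⟨fun e he => (hu.smooth_two e he).sub (hs e he), fun x hx => ?_, one_pos,
    fun x z hz hzT => ?_⟩
  · rw [hu.boundary x hx, sub_self]
  · have he := X.chartAt_mem x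
    have h1 := trace_inv_mul_nonneg hn (posDef_inChart he hzT)
      (Admissible.posDef (by omega) hu.admissible he hu.smooth_two hzT)
    have h2 := (abs_le.1 (hβ x z hz hzT)).2
    rw [hA, complexHessian_sub_symm (χ := χ) he hu.smooth_two hs hzT, Matrix.mul_sub, trace_sub,
      sub_re]
    linarith

theorem contDiffOn_gOp {T : Set (Cn n)} {k : WithTop ℕ∞} {A B : Cn n → Matrix (Fin n) (Fin n) ℂ}
    (hA : ∀ i j, ContDiffOn ℝ k (fun z => A z i j) T) (hdA : ∀ z ∈ T, (A z).det ≠ 0)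
    (hB : ∀ i j, ContDiffOn ℝ k (fun z => B z i j) T) (hdB : ∀ z ∈ T, (B z).det ≠ 0)
    (i j : Fin n) : ContDiffOn ℝ k (fun z => gOp (A z) (B z) i j) T := by
  simp only [gOp, Matrix.sub_apply, Matrix.smul_apply, smul_eq_mul]
  exact ((contDiffOn_trace (contDiffOn_mul_apply (contDiffOn_inv_apply hB hdB) hA)).mul
    (contDiffOn_inv_apply hA hdA i j)).sub (contDiffOn_inv_apply hB hdB i j)

/-- Monotonicity of the relative determinant controls the relative trace. -/
theorem card_le_trace_inv_mul {Ω₀ W W' : Matrix (Fin n) (Fin n) ℂ} (hΩ : Ω₀.PosDef)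
    (hW : W.PosDef) (hW' : W'.PosDef) (h : (Ω₀⁻¹ * W).det.re ≤ (Ω₀⁻¹ * W').det.re) :
    (n : ℝ) ≤ (W⁻¹ * W').trace.re := by
  have hdet : ∀ B : Matrix (Fin n) (Fin n) ℂ, B.det = Ω₀.det * (Ω₀⁻¹ * B).det := fun B => by
    rw [← det_mul, ← Matrix.mul_assoc, mul_nonsing_inv _ hΩ.det_pos.ne'.isUnit, Matrix.one_mul]
  have hre : ∀ B : Matrix (Fin n) (Fin n) ℂ, B.det.re = Ω₀.det.re * (Ω₀⁻¹ * B).det.re := fun B => by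
    have h1 := hdet B
    have h2 : Ω₀.det = (Ω₀.det.re : ℂ) := 
      Complex.ext rfl (by simpa using (Complex.pos_iff.1 hΩ.det_pos).2.symm)
    rw [h1]
    conv_lhs => rw [h2]
    rw [re_ofReal_mul]
  have h0 := (Complex.pos_iff.1 hΩ.det_pos).1
  have h1 := log_det_le hW hW'
  have h2 : Real.log W.det.re ≤ Real.log W'.det.re := by
    refine Real.log_le_log (Complex.pos_iff.1 hW.det_pos).1 ?_
    rw [hre W, hre W']
    exact mul_le_mul_of_nonneg_left h h0.le
  linarith

/-- Solutions lie above the subsolution near the boundary, by concavity of the equation. -/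
theorem IsSolution.exists_nonneg [CompactSpace M] (hn : 2 ≤ n) (hs : X.IsCk 2 usub)
    (hadm : Admissible (n - 1) Ω χ usub) (h : IsSolution Ω χ usub m γ N ψ u) :
    ∃ D : Set M, IsClopen D ∧ X.boundary ⊆ D ∧ ∀ x ∈ D, 0 ≤ u x - usub x := by
  have hW : ∀ {v : M → ℝ}, X.IsCk 2 v → ∀ x i j, ContDiffOn ℝ 0
      (fun z => wOp (Ω.inChart (X.chartAt x) z) (χ.inChart (X.chartAt x) v z) i j)
      (X.chartAt x).target := fun hv x => contDiffOn_wOp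
    (contDiffOn_metric (X.chartAt_mem x) (by simp))
    (fun z hz => (posDef_inChart (X.chartAt_mem x) hz).det_pos.ne')
    (contDiffOn_form (X.chartAt_mem x) (by simp) hv (by norm_num))
  have hWp : ∀ x, ∀ z ∈ (X.chartAt x).target,
      (wOp (Ω.inChart (X.chartAt x) z) (χ.inChart (X.chartAt x) u z)).PosDef := fun x z hz =>
    Admissible.posDef (by omega) h.admissible (X.chartAt_mem x) h.smooth_two hz
  obtain ⟨A, hA, hβ⟩ := exists_ellipticFamily (X := X)
    (fun x z => gOp (Ω.inChart (X.chartAt x) z)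
      (wOp (Ω.inChart (X.chartAt x) z) (χ.inChart (X.chartAt x) u z))) (fun _ _ => 0)
    (fun x z hz => posDef_gOp (posDef_inChart (X.chartAt_mem x) hz) (hWp x z hz) hn)
    (fun x => contDiffOn_gOp (contDiffOn_metric (X.chartAt_mem x) (by simp))
      (fun z hz => (posDef_inChart (X.chartAt_mem x) hz).det_pos.ne') (hW h.smooth_two x)
      fun z hz => (hWp x z hz).det_pos.ne')
    (fun x => contDiffOn_const)
  obtain ⟨C, hC, D, hD, hbD, hle⟩ := A.exists_le Ω
  refine ⟨D, hD, hbD, fun x hx => ?_⟩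
  have key : ∀ b : ℝ, 0 < b → usub x - u x ≤ C * b := by
    refine fun b hb => hle (fun y => usub y - u y) b ?_ x hx
    refine ⟨fun e he => (hs e he).sub (h.smooth_two e he), fun x hx => ?_, hb, fun x z hz hzT => ?_⟩
    · rw [h.boundary x hx, sub_self]
    · have he := X.chartAt_mem x
      have h1 : (n : ℝ) ≤ _ := card_le_trace_inv_mul (posDef_inChart he hzT) (hWp x z hzT)
        (Admissible.posDef (by omega) hadm he hs hzT) (by
          rw [← maOperator_symm (by omega) he h.smooth_two hzT,
            ← maOperator_symm (by omega) he hs hzT, h.eq]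
          exact h.rhs_le_sub _)
      have h2 : 0 < A.β x * b := mul_pos (A.β_pos x) hb
      rw [hA, complexHessian_sub_symm (χ := χ) he hs h.smooth_two hzT, trace_gOp_mul, wOp_sub,
        Matrix.mul_sub, trace_sub, nonsing_inv_mul _ (hWp x z hzT).det_pos.ne'.isUnit, trace_one,
        Fintype.card_fin, sub_re, natCast_re]
      linarith
  by_contra! hneg
  have h1 : 0 < usub x - u x := by linarith
  have h2 := key ((usub x - u x) / (C + 1) / 2) (by positivity)
  have h3 : C * ((usub x - u x) / (C + 1) / 2) ≤ (usub x - u x) / 2 := by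
    have h4 : C / (C + 1) ≤ 1 := (div_le_one (by positivity)).2 (by linarith)
    calc C * ((usub x - u x) / (C + 1) / 2) = C / (C + 1) * ((usub x - u x) / 2) := by ring
      _ ≤ 1 * ((usub x - u x) / 2) := mul_le_mul_of_nonneg_right h4 (by positivity)
      _ = _ := one_mul _
  linarith

/-- The squared gradient norm in a chart. -/
theorem gradSq_symm (he : e ∈ X.atlas) (hu : X.IsCk 1 u) (hz : z ∈ e.target) :
    Ω.gradSq u (e.symm z) =
      quad (Ω.inChart e z)⁻¹ (dzv e.target (fun y => (u (e.symm y) : ℂ)) z) := by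
  rw [gradSq_eq he (e.map_target hz) hu, delAt, e.right_inv hz]
  rfl

theorem continuous_gradSq (hu : X.IsCk 1 u) : Continuous (Ω.gradSq u) := by
  refine continuous_iff_continuousAt.2 fun x => ?_
  have he := X.chartAt_mem x
  have hx := X.mem_source x
  have h1 : ContDiffOn ℝ 0 (fun z => quad (Ω.inChart (X.chartAt x) z)⁻¹
      (dzv (X.chartAt x).target (fun y => (u ((X.chartAt x).symm y) : ℂ)) z))
      (X.chartAt x).target := contDiffOn_quad (contDiffOn_metric_inv he (by simp)) fun i =>
    contDiffOn_dz (regular_target he).1 (contDiffOn_ofReal (hu _ he)) (by norm_num) i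
  have h2 := (h1.continuousOn _ ((X.chartAt x).map_source hx)).tendsto.comp
    (X.tendsto_chart he hx)
  have h3 : ∀ y ∈ (X.chartAt x).source, Ω.gradSq u y = quad (Ω.inChart (X.chartAt x)
      (X.chartAt x y))⁻¹ (dzv (X.chartAt x).target
        (fun y => (u ((X.chartAt x).symm y) : ℂ)) (X.chartAt x y)) := fun y hy => by
    rw [← gradSq_symm he hu ((X.chartAt x).map_source hy), (X.chartAt x).left_inv hy]
  rw [ContinuousAt, h3 x hx]
  refine h2.congr' ?_
  filter_upwards [(X.isOpen_source _ he).mem_nhds hx] with y hy using (h3 y hy).symm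

theorem gradSq_nonneg (hu : X.IsCk 1 u) : 0 ≤ Ω.gradSq u x := by
  rw [gradSq_eq (X.chartAt_mem x) (X.mem_source x) hu]
  exact quad_nonneg (Ω.posDef _ (X.chartAt_mem x) x (X.mem_source x)).inv.posSemidef _

theorem gradSq_le_gradConst [CompactSpace M] (hu : X.IsCk 1 u) :
    Ω.gradSq u x ≤ Ω.gradConst u ∧ 1 ≤ Ω.gradConst u := by
  have h1 := le_ciSup (isCompact_range (continuous_gradSq (Ω := Ω) hu)).bddAbove x
  have h2 := gradSq_nonneg (Ω := Ω) (x := x) hu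
  rw [HermitianMetric.gradConst]
  constructor <;> linarith

/-- Near a point the components of the gradient are bounded by its norm. -/
theorem exists_norm_dz_le (Ω : X.HermitianMetric) (he : e ∈ X.atlas) (hz : z ∈ e.target) :
    ∃ C : ℝ, 0 ≤ C ∧ ∀ᶠ y in 𝓝[e.target] z, ∀ u, X.IsCk 1 u → ∀ j,
      ‖dz e.target j (fun y => (u (e.symm y) : ℂ)) y‖ ≤ C * √(Ω.gradSq u (e.symm y)) := by
  obtain ⟨l, L, hl, -, hell⟩ := exists_elliptic (G := fun z => (Ω.inChart e z)⁻¹) hz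
    (fun z hz => (posDef_inChart he hz).inv) fun i j =>
      (contDiffOn_metric_inv (k := 0) he (by simp) i j).continuousOn z hz
  refine ⟨√(1 / l), Real.sqrt_nonneg _, ?_⟩
  filter_upwards [hell, self_mem_nhdsWithin] with y hy hyT u hu j
  rw [gradSq_symm he hu hyT, ← Real.sqrt_mul (by positivity)]
  refine Real.le_sqrt_of_sq_le ?_
  have h1 := hy.lower (dzv e.target (fun y => (u (e.symm y) : ℂ)) y)
  have h2 : ‖dz e.target j (fun y => (u (e.symm y) : ℂ)) y‖ ^ 2 ≤
      ∑ i, ‖dzv e.target (fun y => (u (e.symm y) : ℂ)) y i‖ ^ 2 :=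
    Finset.single_le_sum (f := fun i => ‖dzv e.target (fun y => (u (e.symm y) : ℂ)) y i‖ ^ 2)
      (fun _ _ => sq_nonneg _) (Finset.mem_univ j)
  rw [one_div, ← div_eq_inv_mul, le_div_iff₀ hl, mul_comm]
  exact (mul_le_mul_of_nonneg_left h2 hl.le).trans h1

theorem norm_dz_ofReal_le {T : Set (Cn n)} {f : Cn n → ℝ} (hT : UniqueDiffWithinAt ℝ T z)
    (hf : DifferentiableWithinAt ℝ f T z) (j : Fin n) :
    ‖dz T j (fun y => (f y : ℂ)) z‖ ≤ ‖fderivWithin ℝ f T z‖ := by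
  have h : ∀ c : ℂ, ‖c‖ = 1 → ‖fderivWithin ℝ (fun y => (f y : ℂ)) T z
      (EuclideanSpace.single j c)‖ ≤ ‖fderivWithin ℝ f T z‖ := fun c hc => by
    rw [fderivWithin_ofReal hT hf, norm_real]
    refine (ContinuousLinearMap.le_opNorm _ _).trans_eq ?_
    rw [PiLp.norm_single, hc, mul_one]
  rw [dz, norm_div, Complex.norm_ofNat, div_le_iff₀ two_pos]
  refine (norm_sub_le _ _).trans ?_
  rw [norm_mul, norm_I, one_mul]
  linarith [h 1 norm_one, h I norm_I]

theorem ChartCover.norm_le_of_c2Norm_le {𝒦 : X.ChartCover} {f : M → ℝ} {B : ℝ≥0}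
    (h : 𝒦.c2Norm f ≤ B) {i : Fin 𝒦.size} (hx : x ∈ 𝒦.piece i) {k : ℕ} (hk : k < 3) :
    ‖iteratedFDerivWithin ℝ k (f ∘ (𝒦.chart i).symm) (𝒦.chart i).target (𝒦.chart i x)‖ ≤ B := by
  have h1 := (Finset.single_le_sum (s := Finset.range 3) (f := fun k => ‖iteratedFDerivWithin ℝ k
    (f ∘ (𝒦.chart i).symm) (𝒦.chart i).target (𝒦.chart i x)‖ₑ) (fun _ _ => zero_le)
    (Finset.mem_range.2 hk)).trans (((le_iSup₂ (f := fun x (_ : x ∈ 𝒦.piece i) =>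
      ∑ k ∈ Finset.range 3, ‖iteratedFDerivWithin ℝ k (f ∘ (𝒦.chart i).symm) (𝒦.chart i).target
        (𝒦.chart i x)‖ₑ) x hx).trans (le_iSup (fun i => ⨆ x ∈ 𝒦.piece i, ∑ k ∈ Finset.range 3,
          ‖iteratedFDerivWithin ℝ k (f ∘ (𝒦.chart i).symm) (𝒦.chart i).target
            (𝒦.chart i x)‖ₑ) i)).trans h)
  have h2 : ((‖iteratedFDerivWithin ℝ k (f ∘ (𝒦.chart i).symm) (𝒦.chart i).target
      (𝒦.chart i x)‖₊ : ℝ≥0) : ℝ≥0∞) ≤ B := h1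
  exact_mod_cast ENNReal.coe_le_coe.1 h2

/-- The `C²` norm bounds the function and its gradient norm. -/
theorem ChartCover.exists_gradSq_le (𝒦 : X.ChartCover) (Ω : X.HermitianMetric) (B : ℝ≥0) :
    ∃ C : ℝ, ∀ f, X.IsCk 1 f → 𝒦.c2Norm f ≤ B → ∀ x, |f x| ≤ B ∧ Ω.gradSq f x ≤ C := by
  have hbd : ∀ i, ∃ a : ℝ, ∀ x ∈ 𝒦.piece i, ∀ j k, ‖(Ω.coeff (𝒦.chart i) x)⁻¹ j k‖ ≤ a := by
    intro i
    have he := 𝒦.chart_mem i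
    have h1 : ∀ jk : Fin n × Fin n, ∃ a : ℝ, ∀ x ∈ 𝒦.piece i,
        ‖(Ω.coeff (𝒦.chart i) x)⁻¹ jk.1 jk.2‖ ≤ a := by
      intro jk
      refine (𝒦.isCompact_piece i).exists_bound_of_continuousOn ?_
      have h2 : ContinuousOn (fun x => (Ω.inChart (𝒦.chart i) (𝒦.chart i x))⁻¹ jk.1 jk.2)
          (𝒦.chart i).source :=
        (contDiffOn_metric_inv (k := 0) he (by simp) jk.1 jk.2).continuousOn.comp
          (X.continuousOn _ he) fun x hx => (𝒦.chart i).map_source hx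
      refine (h2.congr fun x hx => ?_).mono (𝒦.piece_subset i)
      simp only [HermitianMetric.inChart]
      rw [(𝒦.chart i).left_inv hx]
    choose a ha using h1
    exact ⟨∑ jk, |a jk|, fun x hx j k => (ha (j, k) x hx).trans ((le_abs_self _).trans
      (Finset.single_le_sum (f := fun jk => |a jk|) (fun _ _ => abs_nonneg _)
        (Finset.mem_univ (j, k))))⟩
  choose a ha using hbd
  refine ⟨∑ i, n * |a i| * (n * (B : ℝ) ^ 2), fun f hf hB x => ?_⟩
  obtain ⟨i, hi⟩ := 𝒦.cover x
  have he := 𝒦.chart_mem i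
  have hxs := 𝒦.piece_subset i hi
  constructor
  · have h1 := 𝒦.norm_le_of_c2Norm_le hB hi (k := 0) (by norm_num)
    rwa [norm_iteratedFDerivWithin_zero, Function.comp_apply, (𝒦.chart i).left_inv hxs,
      Real.norm_eq_abs] at h1
  · have hu := (regular_target he).1 _ ((𝒦.chart i).map_source hxs)
    have h1 := 𝒦.norm_le_of_c2Norm_le hB hi (k := 1) (by norm_num)
    rw [norm_iteratedFDerivWithin_one _ hu] at h1
    have h2 : ∀ j, ‖delAt (𝒦.chart i) f x j‖ ≤ B := fun j =>
      (norm_dz_ofReal_le hu ((hf _ he).differentiableOn one_ne_zero _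
        ((𝒦.chart i).map_source hxs)) j).trans h1
    rw [gradSq_eq he hxs hf]
    refine (le_abs_self _).trans ((abs_quad_le (ha i x hi) _).trans ?_)
    have h3 : ∑ j, ‖delAt (𝒦.chart i) f x j‖ ^ 2 ≤ n * (B : ℝ) ^ 2 := by
      refine (Finset.sum_le_sum fun j _ => pow_le_pow_left₀ (norm_nonneg _) (h2 j) 2).trans_eq ?_
      simp
    calc n * a i * ∑ j, ‖delAt (𝒦.chart i) f x j‖ ^ 2 ≤ n * |a i| * (n * (B : ℝ) ^ 2) :=
          mul_le_mul (mul_le_mul_of_nonneg_left (le_abs_self _) n.cast_nonneg) h3 (by positivity)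
            (by positivity)
      _ ≤ _ := Finset.single_le_sum (f := fun i => n * |a i| * (n * (B : ℝ) ^ 2))
          (fun _ _ => by positivity) (Finset.mem_univ i)

end ComplexManifoldWithBoundary

end Global

/-! ### Boundary patches of the manifold -/

section Assembly

namespace ComplexManifoldWithBoundary

variable {n : ℕ} {M : Type*} [TopologicalSpace M] {X : ComplexManifoldWithBoundary n M}
  {Ω : X.HermitianMetric} {χ : X.RealForm11} {e : PartialEquiv M (Cn n)} {u usub ψ : M → ℝ}
  {x : M} {p z : Cn n} {U : Set (Cn n)} {ρ : Cn n → ℝ} {m γ N : ℝ}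

/-- The boundary patch in the chart `e` around the boundary point with coordinates `p`. -/
def patch (hn : 2 ≤ n) (Ω : X.HermitianMetric) (χ : X.RealForm11) (hs : X.IsCk ∞ usub)
    (hadm : Admissible (n - 1) Ω χ usub) (he : e ∈ X.atlas) (hU : IsDefining U ρ (e.target ∩ U))
    (hp : p ∈ e.target ∩ U) (h0 : ρ p = 0) {radius inf : ℝ} (hr : 0 < radius) (hi : 0 < inf)
    (sup detSup dlog grad : ℝ) : BoundaryPatch n where
  U := U
  T := e.target ∩ U
  ρ := ρ
  p := p
  two_le := hn
  defining := hU
  mem := hp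
  zero := h0
  Ω := Ω.inChart e
  ref := χ.inChart e usub
  smooth_metric i j := (contDiffOn_metric he le_rfl i j).mono inter_subset_left
  smooth_ref i j := (contDiffOn_form he le_rfl hs le_rfl i j).mono inter_subset_left
  posDef z hz := posDef_inChart he hz.1
  isHermitian_ref z hz := isHermitian_form he (hs.of_le (by decide)) hz.1
  posDef_ref z hz := Admissible.posDef (by omega) hadm he (hs.of_le (by decide)) hz.1
  radius := radius
  radius_pos := hr
  sup := sup
  inf := inf
  inf_pos := hi
  detSup := detSup
  dlog := dlog
  grad := grad

theorem contDiffOn_log_rhs (h : IsSolution Ω χ usub m γ N ψ u) (hm : 0 < m) (he : e ∈ X.atlas) :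
    ContDiffOn ℝ 1 (fun z => Real.log (ψ (e.symm z))) e.target :=
  ((h.smooth_rhs e he).of_le (by decide)).log fun z _ => (hm.trans_le (h.le_rhs (e.symm z))).ne'

theorem isCk_rpow (hψ : X.IsCk 1 ψ) (hm : 0 < m) (hle : ∀ x, m ≤ ψ x) (γ : ℝ) :
    X.IsCk 1 fun x => ψ x ^ γ := fun e he =>
  (hψ e he).rpow_const_of_ne fun z _ => (hm.trans_le (hle (e.symm z))).ne'

theorem dz_const_mul_log {T : Set (Cn n)} {f : Cn n → ℝ} (hT : UniqueDiffWithinAt ℝ T z)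
    (hf : DifferentiableWithinAt ℝ f T z) (h0 : f z ≠ 0) (c : ℝ) (j : Fin n) :
    dz T j (fun y => ((c * Real.log (f y) : ℝ) : ℂ)) z =
      (c * (f z)⁻¹ : ℝ) * dz T j (fun y => (f y : ℂ)) z := by
  have h1 := (hf.hasFDerivWithinAt.log h0).const_mul c
  simp only [dz, fderivWithin_ofReal hT h1.differentiableWithinAt, fderivWithin_ofReal hT hf,
    h1.fderivWithin hT]
  simp only [_root_.smul_apply, smul_eq_mul]
  push_cast
  ring

/-- The logarithmic derivative of the right hand side is bounded by the gradient of its root. -/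
theorem norm_dz_log_le (h : IsSolution Ω χ usub m γ N ψ u) (hm : 0 < m) (hγ : 0 < γ)
    (he : e ∈ X.atlas) (hz : z ∈ e.target) {C : ℝ} (j : Fin n)
    (hC : ‖dz e.target j (fun y => (((ψ (e.symm y) ^ γ : ℝ)) : ℂ)) z‖ ≤ C * √N) :
    ‖dz e.target j (fun y => ((Real.log (ψ (e.symm y)) : ℝ) : ℂ)) z‖ ≤
      γ⁻¹ * (m ^ γ)⁻¹ * (C * √N) := by
  have hpos : ∀ x, 0 < ψ x := fun x => hm.trans_le (h.le_rhs x)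
  have h1 : (fun y => ((Real.log (ψ (e.symm y)) : ℝ) : ℂ)) =
      fun y => ((γ⁻¹ * Real.log (ψ (e.symm y) ^ γ) : ℝ) : ℂ) := by
    funext y
    rw [Real.log_rpow (hpos _), inv_mul_cancel_left₀ hγ.ne']
  have hd : DifferentiableWithinAt ℝ (fun y => ψ (e.symm y) ^ γ) e.target z :=
    (isCk_rpow (h.smooth_rhs.of_le (by decide)) hm h.le_rhs γ e he).differentiableOn one_ne_zero z hz
  have hp := Real.rpow_pos_of_pos (hpos (e.symm z)) γ
  rw [h1, dz_const_mul_log ((regular_target he).1 z hz) hd hp.ne', norm_mul, norm_real,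
    Real.norm_of_nonneg (by positivity)]
  have h2 : (ψ (e.symm z) ^ γ)⁻¹ ≤ (m ^ γ)⁻¹ := inv_anti₀ (Real.rpow_pos_of_pos hm γ)
    (Real.rpow_le_rpow hm.le (h.le_rhs _) hγ.le)
  exact mul_le_mul (mul_le_mul_of_nonneg_left h2 (inv_nonneg.2 hγ.le)) hC (norm_nonneg _)
    (mul_nonneg (inv_nonneg.2 hγ.le) (inv_nonneg.2 (Real.rpow_nonneg hm.le γ)))

/-- Boundary points in a chart are the zeros of a local defining function. -/
theorem symm_mem_boundary_iff (Ω : X.HermitianMetric) (he : e ∈ X.atlas)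
    (hU : IsDefining U ρ (e.target ∩ U)) (hz : z ∈ e.target ∩ U) :
    e.symm z ∈ X.boundary ↔ ρ z = 0 := by
  rw [mem_boundary_iff Ω he (e.map_target hz.1), e.right_inv hz.1]
  have h1 : z ∈ interior e.target ↔ ρ z < 0 := by
    rw [← hU.mem_interior_iff hz.2, interior_inter, hU.isOpen.interior_eq]
    exact ⟨fun h => ⟨h, hz.2⟩, fun h => h.1⟩
  rw [h1, not_lt]
  exact ⟨fun h => le_antisymm (hU.nonpos hz) h, fun h => h.ge⟩

/-- A clopen set containing the boundary contains a neighbourhood of each boundary point which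
does not depend on it. -/
theorem eventually_mem_clopen (Ω : X.HermitianMetric) (he : e ∈ X.atlas)
    (hU : IsDefining U ρ (e.target ∩ U)) (hp : p ∈ e.target ∩ U) (h0 : ρ p = 0) :
    ∀ᶠ z in 𝓝[e.target ∩ U] p, ∀ D : Set M, IsClopen D → X.boundary ⊆ D → e.symm z ∈ D := by
  obtain ⟨C, -, hC⟩ := hU.exists_segment hp.2 h0
  obtain ⟨δ, hδ, hs⟩ := hC 1 one_pos
  filter_upwards [self_mem_nhdsWithin, mem_nhdsWithin_of_mem_nhds (Metric.ball_mem_nhds p hδ)]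
    with z hz hzδ D hD hbD
  obtain ⟨q, hq, hq0, -, -, hseg⟩ := hs z hz hzδ
  have h1 : IsPreconnected (e.symm '' segment ℝ z q) :=
    (convex_segment z q).isPreconnected.image _
      ((X.continuousOn_symm e he).mono (hseg.trans inter_subset_left))
  exact h1.subset_isClopen hD ⟨e.symm q, mem_image_of_mem _ (right_mem_segment ℝ z q),
    hbD ((symm_mem_boundary_iff Ω he hU hq).2 hq0)⟩ (mem_image_of_mem _ (left_mem_segment ℝ z q))

theorem form_patch {P : BoundaryPatch n} (he : e ∈ X.atlas) (hT : P.T = e.target ∩ P.U)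
    (href : P.ref = χ.inChart e usub) (hu : X.IsCk 2 u) (hs : X.IsCk 2 usub) (hz : z ∈ P.T) :
    P.form ((fun y => u y - usub y) ∘ e.symm) z = χ.inChart e u z := by
  rw [hT] at hz
  have h1 : complexHessian (e.target ∩ P.U) ((fun y => u y - usub y) ∘ e.symm) z =
      complexHessian e.target ((fun y => u y - usub y) ∘ e.symm) z :=
    hess_inter P.defining.isOpen hz.1 hz.2 _
  rw [BoundaryPatch.form, hT, h1, href, complexHessian_sub_symm (χ := χ) he hu hs hz.1,
    add_sub_cancel]

set_option maxHeartbeats 800000 in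
/-- The local data at a boundary point: differences of solutions and the subsolution are solutions
on a patch. -/
theorem exists_patch [CompactSpace M] (hn : 2 ≤ n) (hs : X.IsCk ∞ usub)
    (hadm : Admissible (n - 1) Ω χ usub) (hm : 0 < m) (hγ : 0 < γ) (N : ℝ) (hx : x ∈ X.boundary) :
    ∃ P : BoundaryPatch n, P.p = X.chartAt x x ∧ P.T = (X.chartAt x).target ∩ P.U ∧
      IsDefining P.U P.ρ ((X.chartAt x).target ∩ P.U) ∧
      ∀ ψ u, IsSolution Ω χ usub m γ N ψ u →
        P.Solution ((fun y => u y - usub y) ∘ (X.chartAt x).symm) (Ω.gradConst u) := by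
  have he := X.chartAt_mem x
  have hxs := X.mem_source x
  generalize X.chartAt x = e at he hxs ⊢
  have hs2 : X.IsCk 2 usub := hs.of_le (by decide)
  have hs1 : X.IsCk 1 usub := hs.of_le (by decide)
  obtain ⟨U, ρ, hpU, hU⟩ := (X.smoothDomain e he).exists_isDefining (e.map_source hxs)
  have hp : e x ∈ e.target ∩ U := ⟨e.map_source hxs, hpU⟩
  have h0 : ρ (e x) = 0 :=
    (symm_mem_boundary_iff Ω he hU hp).1 (by rwa [e.left_inv hxs])
  obtain ⟨S, D, hD, hbD, hsup⟩ := exists_sub_le (Ω := Ω) (χ := χ) hn hs2 m γ N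
  obtain ⟨C, hC0, hC⟩ := exists_norm_dz_le Ω he hp.1
  have hC' : ∀ᶠ y in 𝓝[e.target ∩ U] (e x), ∀ u, X.IsCk 1 u → ∀ j,
      ‖dz e.target j (fun y => (u (e.symm y) : ℂ)) y‖ ≤ C * √(Ω.gradSq u (e.symm y)) :=
    nhdsWithin_mono _ inter_subset_left hC
  obtain ⟨R, hR, hball⟩ := Metric.mem_nhdsWithin_iff.1
    (hC'.and (eventually_mem_clopen Ω he hU hp h0))
  obtain ⟨P, hP⟩ : ∃ P, P = patch hn Ω χ hs hadm he hU hp h0 (half_pos hR) hm S N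
      (γ⁻¹ * (m ^ γ)⁻¹ * (C * √N)) (C + C * √(Ω.gradConst usub)) := ⟨_, rfl⟩
  have hin : ∀ {z}, z ∈ e.target ∩ U → dist z (e x) ≤ R / 2 →
      z ∈ Metric.ball (e x) R ∩ (e.target ∩ U) := fun hz hzd =>
    ⟨Metric.mem_ball.2 (hzd.trans_lt (half_lt_self hR)), hz⟩
  refine ⟨P, by rw [hP]; rfl, by rw [hP]; rfl, by rw [hP]; exact hU, fun ψ u hu => ?_⟩
  have hu2 := hu.smooth_two
  have hu1 : X.IsCk 1 u := hu.smooth.of_le (by norm_num)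
  have hform : ∀ z ∈ e.target ∩ U, P.W ((fun y => u y - usub y) ∘ e.symm) z =
      wOp (Ω.inChart e z) (χ.inChart e u z) := fun z hz => by
    rw [BoundaryPatch.W, form_patch (χ := χ) he (by rw [hP]; rfl) (by rw [hP]; rfl) hu2 hs2
      (by rw [hP]; exact hz), hP]
    rfl
  have hdet : ∀ z ∈ e.target ∩ U,
      ((P.Ω z)⁻¹ * P.W ((fun y => u y - usub y) ∘ e.symm) z).det.re = ψ (e.symm z) := by
    intro z hz
    rw [hform z hz, ← hu.eq, maOperator_symm (by omega) he hu2 hz.1, hP]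
    rfl
  have hlog : EqOn (P.logDet ((fun y => u y - usub y) ∘ e.symm))
      (fun z => Real.log (ψ (e.symm z))) (e.target ∩ U) := fun z hz => by
    rw [BoundaryPatch.logDet, hdet z hz]
  have hT : P.T = e.target ∩ U := by rw [hP]; rfl
  have hPp : P.p = e x := by rw [hP]; rfl
  have hPr : P.radius = R / 2 := by rw [hP]; rfl
  have hPρ : P.ρ = ρ := by rw [hP]; rfl
  have hPs : P.sup = S := by rw [hP]; rfl
  have hPi : P.inf = m := by rw [hP]; rfl
  have hPd : P.detSup = N := by rw [hP]; rfl
  have hPl : P.dlog = γ⁻¹ * (m ^ γ)⁻¹ * (C * √N) := by rw [hP]; rfl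
  have hPg : P.grad = C + C * √(Ω.gradConst usub) := by rw [hP]; rfl
  clear hP
  constructor
  · rw [hT]
    exact ((hu.smooth e he).sub ((hs e he).of_le (by decide))).mono inter_subset_left
  · rw [hT, hPρ]
    intro z hz _ hz0
    exact sub_eq_zero.2 (hu.boundary _ ((symm_mem_boundary_iff Ω he hU hz).2 hz0))
  · rw [hT, hPp, hPr]
    intro z hz hzd
    obtain ⟨D', hD', hbD', hnn⟩ := hu.exists_nonneg hn hs2 hadm
    exact hnn _ ((hball (hin hz hzd)).2 D' hD' hbD')
  · rw [hT, hPp, hPr, hPs]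
    intro z hz hzd
    exact hsup ψ u hu _ ((hball (hin hz hzd)).2 D hD hbD)
  · rw [hT]
    intro z hz _
    rw [hform z hz]
    exact Admissible.posDef (by omega) hu.admissible he hu2 hz.1
  · rw [hT, hPi]
    intro z hz _
    rw [hdet z hz]
    exact hu.le_rhs _
  · rw [hT, hPd]
    intro z hz _
    rw [hdet z hz]
    exact hu.rhs_le _
  · rw [hT]
    exact ((contDiffOn_log_rhs hu hm he).mono inter_subset_left).congr hlog
  · rw [hT, hPp, hPr, hPl]
    intro z hz hzd j
    rw [dz_congr (fun y hy => congrArg ofReal (hlog hy)) hz, dz_inter hU.isOpen hz.2]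
    refine norm_dz_log_le hu hm hγ he hz.1 j ?_
    exact ((hball (hin hz hzd)).1 _ (isCk_rpow (hu.smooth_rhs.of_le (by decide)) hm hu.le_rhs γ)
      j).trans (mul_le_mul_of_nonneg_left (Real.sqrt_le_sqrt (hu.gradSq_le _)) hC0)
  · rw [hT, hPp, hPr, hPg]
    intro z hz hzd j
    have hd : ∀ {v : M → ℝ}, X.IsCk 1 v → DifferentiableWithinAt ℝ
        (fun y => (v (e.symm y) : ℂ)) e.target z := fun hv =>
      (contDiffOn_ofReal (hv e he)).differentiableOn one_ne_zero z hz.1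
    have h1 : dz (e.target ∩ U) j
        (fun y => ((((fun y => u y - usub y) ∘ e.symm) y : ℝ) : ℂ)) z =
        dz e.target j (fun y => (u (e.symm y) : ℂ)) z -
          dz e.target j (fun y => (usub (e.symm y) : ℂ)) z := by
      rw [dz_inter hU.isOpen hz.2, ← dz_sub ((regular_target he).1 z hz.1) (hd hu1) (hd hs1)]
      simp only [Function.comp_apply, ofReal_sub]
    rw [h1]
    refine (norm_sub_le _ _).trans ?_
    have hK := (gradSq_le_gradConst (Ω := Ω) (x := e.symm z) hu1)
    have h2 := ((hball (hin hz hzd)).1 _ hu1 j).trans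
      (mul_le_mul_of_nonneg_left (Real.sqrt_le_sqrt hK.1) hC0)
    have h3 := ((hball (hin hz hzd)).1 _ hs1 j).trans (mul_le_mul_of_nonneg_left
      (Real.sqrt_le_sqrt (gradSq_le_gradConst (Ω := Ω) (x := e.symm z) hs1).1) hC0)
    have h4 : C * √(Ω.gradConst usub) ≤ C * √(Ω.gradConst usub) * √(Ω.gradConst u) :=
      le_mul_of_one_le_right (by positivity) (Real.one_le_sqrt.2 hK.2)
    linarith
  · exact (gradSq_le_gradConst (Ω := Ω) (x := x) hu1).2

theorem sqrt_trace_le {A H : Matrix (Fin n) (Fin n) ℂ} {a h : ℝ} (hA : ∀ i j, ‖A i j‖ ≤ a)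
    (hH : ∀ i j, ‖H i j‖ ≤ h) (ha : 0 ≤ a) (hh : 0 ≤ h) :
    √((A * H * (A * H)).trace.re) ≤ n * (n * (a * h)) := by
  have h1 : ∀ i j, ‖(A * H) i j‖ ≤ n * (a * h) := fun i j => by
    rw [mul_apply]
    refine (norm_sum_le _ _).trans ((Finset.sum_le_sum fun k _ => ?_).trans_eq
      (b := ∑ _k : Fin n, a * h) (by simp))
    rw [norm_mul]
    exact mul_le_mul (hA i k) (hH k j) (norm_nonneg _) ha
  refine Real.sqrt_le_iff.2 ⟨by positivity, ?_⟩
  refine (re_le_norm _).trans ((norm_trace_mul_le h1 h1).trans_eq ?_)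
  ring

/-- The estimate near a boundary point. -/
theorem exists_normDdbar_le [CompactSpace M] (hn : 2 ≤ n) (hs : X.IsCk ∞ usub)
    (hadm : Admissible (n - 1) Ω χ usub) (hm : 0 < m) (hγ : 0 < γ) (N : ℝ) (hx : x ∈ X.boundary) :
    ∃ C : ℝ, ∀ᶠ y in 𝓝 x, y ∈ X.boundary → ∀ ψ u, IsSolution Ω χ usub m γ N ψ u →
      Ω.normDdbar u y ≤ C * Ω.gradConst u := by
  obtain ⟨P, hPp, hPT, hPU, hP⟩ := exists_patch (Ω := Ω) (χ := χ) hn hs hadm hm hγ N hx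
  obtain ⟨C, hC⟩ := P.exists_hessian_le
  have he := X.chartAt_mem x
  have hxs := X.mem_source x
  rw [hPT, hPp] at hC
  have hpU : X.chartAt x x ∈ P.U := by
    have := P.mem
    rw [hPp] at this
    exact P.defining.subset this
  generalize X.chartAt x = e at he hxs hP hC hPT hPU hpU
  have hs2 : X.IsCk 2 usub := hs.of_le (by decide)
  have htend : Tendsto e (𝓝 x) (𝓝[e.target ∩ P.U] (e x)) := by
    rw [inter_comm, nhdsWithin_inter_of_mem (mem_nhdsWithin_of_mem_nhds (hPU.isOpen.mem_nhds hpU))]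
    exact X.tendsto_chart he hxs
  obtain ⟨a, ha0, ha⟩ := exists_eventually_bound (S := e.target) (x := e x)
    (f := fun (i : Fin n × Fin n) z => (Ω.inChart e z)⁻¹ i.1 i.2) fun i =>
      (contDiffOn_metric_inv (k := 0) he (by simp) i.1 i.2).continuousOn _ (e.map_source hxs)
  obtain ⟨b, hb0, hb⟩ := exists_eventually_bound (S := e.target) (x := e x)
    (f := fun (i : Fin n × Fin n) z => complexHessian e.target (usub ∘ e.symm) z i.1 i.2) fun i =>
      (BoundaryPatch.contDiffOn_complexHessian (k := 0) (regular_target he).1 (hs2 e he)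
        (by norm_num) i.1 i.2).continuousOn _ (e.map_source hxs)
  refine ⟨n * (n * (a * (b + |C|))), ?_⟩
  filter_upwards [htend.eventually hC, htend.eventually self_mem_nhdsWithin,
    (X.tendsto_chart he hxs).eventually ha, (X.tendsto_chart he hxs).eventually hb,
    (X.isOpen_source e he).mem_nhds hxs] with y hC hyT ha hb hys hyb ψ u hu
  have hu2 := hu.smooth_two
  have hK := (gradSq_le_gradConst (Ω := Ω) (x := x)
    (hu.smooth.of_le (by norm_num) : X.IsCk 1 u)).2
  have hy0 : P.ρ (e y) = 0 :=
    (symm_mem_boundary_iff Ω he hPU hyT).1 (by rwa [e.left_inv hys])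
  have h1 := hC hy0 _ _ (hP ψ u hu)
  have h2 : complexHessian (e.target ∩ P.U) ((fun y => u y - usub y) ∘ e.symm) (e y) =
      hessAt e u y - complexHessian e.target (usub ∘ e.symm) (e y) := by
    rw [hessAt, ← complexHessian_sub_real (regular_target he).1 (hu2 e he) (hs2 e he) hyT.1]
    exact hess_inter hPU.isOpen hyT.1 hyT.2 _
  have h3 : ∀ i j, ‖hessAt e u y i j‖ ≤ (b + |C|) * Ω.gradConst u := fun i j => by
    have h4 : hessAt e u y i j = complexHessian e.target (usub ∘ e.symm) (e y) i j +
        complexHessian (e.target ∩ P.U) ((fun y => u y - usub y) ∘ e.symm) (e y) i j := by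
      rw [h2, Matrix.sub_apply]; ring
    rw [h4]
    refine (norm_add_le _ _).trans ((add_le_add (hb (i, j)) (h1 i j)).trans ?_)
    rw [add_mul]
    exact add_le_add (le_mul_of_one_le_right hb0.le hK)
      (mul_le_mul_of_nonneg_right (le_abs_self C) (by linarith))
  have h5 : ∀ i j, ‖(Ω.coeff e y)⁻¹ i j‖ ≤ a := fun i j => by
    have := ha (i, j)
    rwa [HermitianMetric.inChart, e.left_inv hys] at this
  rw [normDdbar_eq he hys hu2]
  refine (sqrt_trace_le h5 h3 ha0.le (by positivity)).trans_eq ?_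
  ring

theorem isClosed_boundary (Ω : X.HermitianMetric) : IsClosed X.boundary := by
  refine isOpen_compl_iff.1 (isOpen_iff_mem_nhds.2 fun x hx => ?_)
  have he := X.chartAt_mem x
  have hxs := X.mem_source x
  filter_upwards [X.continuousAt_chart he hxs (isOpen_interior.mem_nhds (not_not.1 hx)),
    (X.isOpen_source _ he).mem_nhds hxs] with y hy hys
  exact fun hyb => (mem_boundary_iff Ω he hys).1 hyb hy

/-- The boundary estimate for the complex Hessian, by compactness of the boundary. -/
theorem exists_forall_normDdbar_le [CompactSpace M] (hn : 2 ≤ n) (hs : X.IsCk ∞ usub)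
    (hadm : Admissible (n - 1) Ω χ usub) (hm : 0 < m) (hγ : 0 < γ) (N : ℝ) :
    ∃ C : ℝ, ∀ x ∈ X.boundary, ∀ ψ u, IsSolution Ω χ usub m γ N ψ u →
      Ω.normDdbar u x ≤ C * Ω.gradConst u := by
  have h : ∃ C : ℝ, ∀ x ∈ X.boundary, x ∈ X.boundary → ∀ ψ u, IsSolution Ω χ usub m γ N ψ u →
      Ω.normDdbar u x ≤ C * Ω.gradConst u := by
    refine (isClosed_boundary Ω).isCompact.induction_on
      (p := fun s => ∃ C : ℝ, ∀ x ∈ s, x ∈ X.boundary → ∀ ψ u, IsSolution Ω χ usub m γ N ψ u →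
        Ω.normDdbar u x ≤ C * Ω.gradConst u) ⟨0, fun x hx => hx.elim⟩
      (fun s t hst ⟨C, hC⟩ => ⟨C, fun x hx => hC x (hst hx)⟩) ?_ fun x hx => ?_
    · rintro s t ⟨C, hC⟩ ⟨C', hC'⟩
      refine ⟨max C C', fun x hx hxb ψ u hu => ?_⟩
      have hK := (gradSq_le_gradConst (Ω := Ω) (x := x)
        (hu.smooth.of_le (by norm_num) : X.IsCk 1 u)).2
      rcases hx with hx | hx
      · exact (hC x hx hxb ψ u hu).trans
          (mul_le_mul_of_nonneg_right (le_max_left _ _) (by linarith))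
      · exact (hC' x hx hxb ψ u hu).trans
          (mul_le_mul_of_nonneg_right (le_max_right _ _) (by linarith))
    · obtain ⟨C, hC⟩ := exists_normDdbar_le (Ω := Ω) (χ := χ) hn hs hadm hm hγ N hx
      exact ⟨_, mem_nhdsWithin_of_mem_nhds hC, C, fun y hy hyb => hy hyb⟩
  obtain ⟨C, hC⟩ := h
  exact ⟨C, fun x hx => hC x hx hx⟩

end ComplexManifoldWithBoundary

end Assembly

end HermitianDirichlet

end

open HermitianDirichlet in
theorem mainTheorem2 {n : ℕ} (hn : 2 ≤ n)
    {M : Type*} [TopologicalSpace M] [CompactSpace M] [T2Space M]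
    (X : ComplexManifoldWithBoundary n M) (Ω : X.HermitianMetric) (χ : X.RealForm11)
    (usub : M → ℝ) (husub : X.IsCk ∞ usub) (hadm : Admissible (n - 1) Ω χ usub)
    (φ : X.boundary → ℝ) (hφ : ∀ x : X.boundary, usub x = φ x)
    (𝒦 : X.ChartCover) (B : ℝ≥0) (m : ℝ) (hm : 0 < m) :
    ∃ C : ℝ, ∀ ψ : M → ℝ, X.IsCk ∞ ψ → (∀ x, m ≤ ψ x) →
      𝒦.c2Norm (fun x => ψ x ^ (1 / (n.choose (n - 1) : ℝ))) ≤ B →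
      (∀ x, ψ x ≤ maOperator (n - 1) Ω χ usub x) →
      ∀ u : M → ℝ, X.IsCk 4 u → Admissible (n - 1) Ω χ u →
        (∀ x, maOperator (n - 1) Ω χ u x = ψ x) →
        (∀ x : X.boundary, u x = φ x) →
        ∀ x ∈ X.boundary, Ω.normDdbar u x ≤ C * Ω.gradConst u := by
  have hn0 : 0 < (n.choose (n - 1) : ℝ) := by exact_mod_cast Nat.choose_pos (Nat.sub_le n 1)
  have hγ : 0 < 1 / (n.choose (n - 1) : ℝ) := one_div_pos.2 hn0
  obtain ⟨C₀, hC₀⟩ := 𝒦.exists_gradSq_le Ω B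
  obtain ⟨C, hC⟩ := ComplexManifoldWithBoundary.exists_forall_normDdbar_le (Ω := Ω) (χ := χ) hn
    husub hadm hm hγ (max C₀ ((B : ℝ) ^ (n.choose (n - 1) : ℝ)))
  refine ⟨C, fun ψ hψ hψm hψB hψs u hu hua hue hub x hx => hC x hx ψ u ?_⟩
  -- The function `ψ ^ (1 / n)` and its gradient are controlled by the `C²` norm.
  have hv := hC₀ _ (ComplexManifoldWithBoundary.isCk_rpow
    (hψ.of_le (by decide)) hm hψm (1 / (n.choose (n - 1) : ℝ))) hψB
  refine ⟨hψ, hψm, fun y => le_max_of_le_right ?_, fun y => le_max_of_le_left (hv y).2, hψs, hu,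
    hua, hue, fun y hy => (hub ⟨y, hy⟩).trans (hφ ⟨y, hy⟩).symm⟩
  have hψ0 : 0 ≤ ψ y := hm.le.trans (hψm y)
  have h1 := (le_abs_self _).trans (hv y).1
  have h2 := Real.rpow_le_rpow (Real.rpow_nonneg hψ0 _) h1 hn0.le
  rwa [← Real.rpow_mul hψ0, one_div, inv_mul_cancel₀ hn0.ne', Real.rpow_one] at h2
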